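/- **Theorem 3.1.** Let $W=(a_1,a_2,a_3;h)$ and $W^*=(a_1^*,a_2^*,a_3^*;h^*)$ be reduced regular weight systems in three variables. Then $W^*$ is P-dual to $W$ if and only if $W^*$ is M-dual to $W$. *Weight systems.* A weight system $W=(a_1,a_2,a_3;h)$ consists of positive integers with $a_i\le h/2$. It is reduced if $\gcd(a_1,a_2,a_3,h)=1$, and regular if $\chi_W(T):=T^{\epsilon_W}\prod_{i=1}^3\frac{1-T^{h-a_i}}{1-T^{a_i}}$, where $\epsilon_W:=a_1+a_2+a_3-h$, has poles at most at $T=0$. Then $\chi_W(T)=\sum_{j}T^{m_j}$ for a finite multiset of integers $m_j$, the exponents of $W$. The order of the weights is immaterial. Write $\mathbf e[x]=e^{2\pi\sqrt{-1}x}$, $\omega_i=a_i/h$, and $\hat c_W=1-2\epsilon_W/h$. *P-duality.* Let $G$ be $\{\mathrm{id}\}$ or the group $G_0$ generated by $\mathrm{diag}(\mathbf e[\omega_1],\mathbf e[\omega_2],\mathbf e[\omega_3])$. Write its elements as $\alpha=\mathrm{diag}(\mathbf e[\omega_1\alpha_1],\mathbf e[\omega_2\alpha_2],\mathbf e[\omega_3\alpha_3])$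 with $\alpha_i\in\mathbb Z$, and put $$\chi(W,G)(y,\bar y):=\frac{(-1)^3}{|G|}\sum_{\alpha,\beta\in G}\ \prod_{\omega_i\alpha_i\notin\mathbb Z}(y\bar y)^{\frac{1-2\omega_i}{2}}\Big(\frac y{\bar y}\Big)^{-\omega_i\alpha_i+\lfloor\omega_i\alpha_i\rfloor+\frac12}\prod_{\omega_i\alpha_i\in\mathbb Z}\mathbf e\big[\omega_i\beta_i+\tfrac12\big]\frac{1-\mathbf e[1-\omega_i\beta_i](y\bar y)^{1-\omega_i}}{1-\mathbf e[\omega_i\beta_i](y\bar y)^{\omega_i}},$$ and $\chi(W):=\chi(W,\{\mathrm{id}\})$. Let $G_0^*$ be the group $G_0$ of $W^*$. Then $W^*$ is P-dual to $W$ if $$\chi(W)(y,\bar y)=(-1)^3\,\bar y^{\,\hat c_{W^*}}\chi(W^*,G_0^*)(y,\bar y^{-1})\quad\text{and}\quad \chi(W^*)(y,\bar y)=(-1)^3\,\bar y^{\,\hat c_{W}}\chi(W,G_0)(y,\bar y^{-1})$$ for all real $y,\bar y>0$ with $y\bar y\ne1$ and $y\neq\bar y$ (equivalently, as finite sums of monomials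 with fractional exponents). *M-duality.* Let $p_i=h/\gcd(h,a_i)$, $p_{ij}=\operatorname{lcm}(p_i,p_j)$ and $M(W)=\{1,p_1,p_2,p_3,p_{12},p_{23},p_{31},h\}$. The characteristic polynomial $\varphi_W(\lambda)=\prod_j(\lambda-\mathbf e[m_j/h])$ has a unique expression $\prod_{i\in M(W)}(\lambda^i-1)^{e_W(i)}$ with $e_W(i)\in\mathbb Z$; put $e_W(i)=0$ for $i\notin M(W)$. Say that $W$ is of type III if, after renumbering the weights, $p_2=p_3$, $p_1\nmid p_2$ and $p_2\nmid p_1$, and of type V if $p_1=p_2=p_3$. Then $W^*$ is M-dual to $W$ if $$\prod_{i\in M(W^*)}(\lambda^i-1)^{e_{W^*}(i)}=\prod_{i\mid h}(\lambda^i-1)^{-e_W(h/i)}$$ and, in the two types where this identity does not determine $W^*$, moreover: - if $W$ or $W^*$ is of type III, then $W^*=W$ up to the order of the weights; - if $W$ or $W^*$ is of type V, then both are, and there are integers $k,l,m\ge0$ such that, up to the order of the weights, $W=(lm-m+1,\,mk-k+1,\,kl-l+1;\,klm+1)$ and $W^*=(lm-l+1,\,mk-m+1,\,kl-k+1;\,klm+1)$.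 -/

import Mathlib

/-- A weight system `(a₁, a₂, a₃; h)` in three variables: positive integers with `aᵢ ≤ h / 2`
(so in particular `max aᵢ < h`). -/
structure WeightSystem where
  a : Fin 3 → ℕ
  h : ℕ
  a_pos : ∀ i, 0 < a i
  h_pos : 0 < h
  two_mul_a_le : ∀ i, 2 * a i ≤ h

namespace WeightSystem

/-- `gcd(a₁, a₂, a₃, h) = 1`. -/
def IsReduced (W : WeightSystem) : Prop :=
  Nat.gcd (Finset.univ.gcd W.a) W.h = 1

/-- `ε_W = a₁ + a₂ + a₃ - h`. -/
def eps (W : WeightSystem) : ℤ := (∑ i, (W.a i : ℤ)) - W.h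

/-- The rational function `χ_W(T) = T ^ ε_W * ∏ (1 - T ^ (h - aᵢ)) / (1 - T ^ aᵢ)`. -/
noncomputable def chiRat (W : WeightSystem) : RatFunc ℂ :=
  RatFunc.X ^ W.eps *
    ∏ i, (1 - RatFunc.X ^ (W.h - W.a i)) / (1 - RatFunc.X ^ (W.a i))

/-- `χ_W(T)` has poles at most at `T = 0`. -/
def IsRegular (W : WeightSystem) : Prop :=
  ∀ z : ℂ, z ≠ 0 → W.chiRat.denom.eval z ≠ 0

/-- `e[x] = exp(2π√-1 x)`. -/
noncomputable def expTwoPi (x : ℝ) : ℂ := Complex.exp (2 * Real.pi * Complex.I * x)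

/-- `ωᵢ = aᵢ / h`. -/
noncomputable def omega (W : WeightSystem) (i : Fin 3) : ℝ := (W.a i : ℝ) / W.h

/-- The diagonal entries of `diag(e[ω₁α₁], e[ω₂α₂], e[ω₃α₃])`. -/
noncomputable def diagElement (W : WeightSystem) (α : Fin 3 → ℤ) : Fin 3 → ℂ :=
  fun i => expTwoPi (W.omega i * α i)

/-- Exponent vectors for the principal discrete group `G₀` generated by
`diag(e[ω₁], e[ω₂], e[ω₃])`: the `k`-th power of the generator, for `0 ≤ k < h`, is given by
`(k, k, k)`. For a reduced weight system every element of `G₀` is listed exactly once, see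
`injOn_diagElement_principalGroup` and `image_diagElement_principalGroup`. -/
def principalGroup (W : WeightSystem) : Finset (Fin 3 → ℤ) :=
  (Finset.range W.h).image fun k : ℕ => fun _ => (k : ℤ)

/-- The exponent vector of the identity, for the trivial group `{id}`. -/
def trivialGroup : Finset (Fin 3 → ℤ) := {0}

open Classical in
/-- The contribution `χ_α(W, G)(y, ȳ)` of the `α`-sector in Vafa's formula. The finite abelian
group `G` of diagonal matrices is given by one exponent vector for each of its elements.
`y` and `ȳ` are positive real variables, so that the fractional powers are the usual ones; the
formula has no poles for `yȳ ≠ 1`. -/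
noncomputable def sectorPoincare (W : WeightSystem) (G : Finset (Fin 3 → ℤ)) (α : Fin 3 → ℤ)
    (y ybar : ℝ) : ℂ :=
  ∑ β ∈ G,
    (∏ i ∈ Finset.univ.filter (fun i => ¬ ∃ n : ℤ, W.omega i * α i = n),
      (((y * ybar) ^ ((1 - 2 * W.omega i) / 2) *
        (y / ybar) ^ (-(W.omega i * α i) + ⌊W.omega i * α i⌋ + 1 / 2) : ℝ) : ℂ)) *
    ∏ i ∈ Finset.univ.filter (fun i => ∃ n : ℤ, W.omega i * α i = n),
      expTwoPi (W.omega i * β i + 1 / 2) *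
        ((1 - expTwoPi (1 - W.omega i * β i) * (((y * ybar) ^ (1 - W.omega i) : ℝ) : ℂ)) /
          (1 - expTwoPi (W.omega i * β i) * (((y * ybar) ^ W.omega i : ℝ) : ℂ)))

/-- The orbifoldized Poincaré polynomial `χ(W, G)(y, ȳ)`. -/
noncomputable def orbifoldPoincare (W : WeightSystem) (G : Finset (Fin 3 → ℤ))
    (y ybar : ℝ) : ℂ :=
  (-1) ^ 3 / (G.card : ℂ) * ∑ α ∈ G, W.sectorPoincare G α y ybar

/-- `χ(W)(y, ȳ) = χ(W, {id})(y, ȳ)`. -/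
noncomputable def poincare (W : WeightSystem) (y ybar : ℝ) : ℂ :=
  W.orbifoldPoincare trivialGroup y ybar

/-- `ĉ_W = 1 - 2 ε_W / h`. -/
noncomputable def cHat (W : WeightSystem) : ℝ := 1 - 2 * ((W.eps : ℝ) / W.h)

/-- `W'` is P-dual to `W`. Both sides are finite sums of monomials `y ^ r * ȳ ^ s` with real
exponents; they are compared for all positive `y, ȳ` where the defining formulas have no
poles (`yȳ ≠ 1` for the left sides and `y ȳ⁻¹ ≠ 1` for the right sides). -/
def IsPDual (W' W : WeightSystem) : Prop :=
  ∀ y ybar : ℝ, 0 < y → 0 < ybar → y * ybar ≠ 1 → y ≠ ybar →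
    W.poincare y ybar =
        (-1) ^ 3 * ((ybar ^ W'.cHat : ℝ) : ℂ) *
          W'.orbifoldPoincare W'.principalGroup y ybar⁻¹ ∧
    W'.poincare y ybar =
        (-1) ^ 3 * ((ybar ^ W.cHat : ℝ) : ℂ) *
          W.orbifoldPoincare W.principalGroup y ybar⁻¹

/-- `m` is the multiset of exponents of `W`: `χ_W(T) = ∑ T ^ mᵢ`. -/
def IsExponents (W : WeightSystem) (m : Multiset ℤ) : Prop :=
  W.chiRat = (m.map fun k => (RatFunc.X : RatFunc ℂ) ^ k).sum

/-- The characteristic polynomial `∏ (λ - e[mᵢ / h])` formed with the exponents `m`. -/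
noncomputable def charPoly (W : WeightSystem) (m : Multiset ℤ) : Polynomial ℂ :=
  (m.map fun k => Polynomial.X - Polynomial.C (expTwoPi ((k : ℝ) / W.h))).prod

/-- `pᵢ = h / gcd(h, aᵢ)`. -/
def p (W : WeightSystem) (i : Fin 3) : ℕ := W.h / Nat.gcd W.h (W.a i)

/-- `M(W) = {1, p₁, p₂, p₃, p₁₂, p₂₃, p₃₁, h}` where `pᵢⱼ = lcm(pᵢ, pⱼ)`. -/
def M (W : WeightSystem) : Finset ℕ :=
  {1, W.p 0, W.p 1, W.p 2, Nat.lcm (W.p 0) (W.p 1), Nat.lcm (W.p 1) (W.p 2),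
    Nat.lcm (W.p 2) (W.p 0), W.h}

/-- `e` is the function of cyclotomic exponents of `W`: it vanishes off `M(W)` and
`φ_W(λ) = ∏_{i ∈ M(W)} (λ ^ i - 1) ^ e(i)`. -/
def IsCyclotomicExponents (W : WeightSystem) (e : ℕ → ℤ) : Prop :=
  (∀ i, i ∉ W.M → e i = 0) ∧
  ∃ m : Multiset ℤ, W.IsExponents m ∧
    algebraMap (Polynomial ℂ) (RatFunc ℂ) (W.charPoly m) =
      ∏ i ∈ W.M, ((RatFunc.X : RatFunc ℂ) ^ i - 1) ^ e i

/-- Saito's duality of characteristic polynomials,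
`∏ (λ ^ i - 1) ^ e_{W'}(i) = ∏ (λ ^ i - 1) ^ (-e_W(h / i))`. On the right, `i` runs over the
divisors of `h`; a divisor with `h / i ∉ M(W)` contributes the factor `1`. -/
def IsCharPolyDual (W' W : WeightSystem) : Prop :=
  ∃ e e' : ℕ → ℤ, W.IsCyclotomicExponents e ∧ W'.IsCyclotomicExponents e' ∧
    ∏ i ∈ W'.M, ((RatFunc.X : RatFunc ℂ) ^ i - 1) ^ e' i =
      ∏ i ∈ W.h.divisors, ((RatFunc.X : RatFunc ℂ) ^ i - 1) ^ (-e (W.h / i))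

/-- The leveled poset `M(W)` is of type III: in some numbering of the weights it consists of
`1`, `p₁`, `p₂ = p₃ = p₂₃` and `p₁₂ = p₁₃ = h`, on the levels `0, 1, 2, 3`, where `p₁` and `p₂`
are incomparable for the division relation. -/
def IsTypeIII (W : WeightSystem) : Prop :=
  ∃ σ : Equiv.Perm (Fin 3),
    W.p (σ 1) = W.p (σ 2) ∧ ¬ W.p (σ 0) ∣ W.p (σ 1) ∧ ¬ W.p (σ 1) ∣ W.p (σ 0)

/-- The leveled poset `M(W)` is of type V: `p₁ = p₂ = p₃ (= h)`. -/
def IsTypeV (W : WeightSystem) : Prop :=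
  W.p 0 = W.p 1 ∧ W.p 1 = W.p 2

/-- Equality of weight systems up to the order of the weights. -/
def IsSame (W' W : WeightSystem) : Prop :=
  W'.h = W.h ∧ ∃ σ : Equiv.Perm (Fin 3), ∀ i, W'.a (σ i) = W.a i

/-- Up to the order of the weights,
`W = (lm - m + 1, mk - k + 1, kl - l + 1; klm + 1)` and
`W' = (lm - l + 1, mk - m + 1, kl - k + 1; klm + 1)`. -/
def IsLoopPair (W' W : WeightSystem) : Prop :=
  ∃ k l m : ℕ, W.h = k * l * m + 1 ∧ W'.h = k * l * m + 1 ∧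
    (∃ σ : Equiv.Perm (Fin 3), ∀ i, (W.a (σ i) : ℤ) =
      ![(l : ℤ) * m - m + 1, (m : ℤ) * k - k + 1, (k : ℤ) * l - l + 1] i) ∧
    (∃ σ : Equiv.Perm (Fin 3), ∀ i, (W'.a (σ i) : ℤ) =
      ![(l : ℤ) * m - l + 1, (m : ℤ) * k - m + 1, (k : ℤ) * l - k + 1] i)

/-- `W'` is M-dual to `W`: the duality of characteristic polynomials, refined in the two types
where the characteristic polynomial does not determine the weight system. A weight system of
type III is dual only to itself, and one of type V only to the weight system of type V with
the weights of the transposed loop. -/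
def IsMDual (W' W : WeightSystem) : Prop :=
  IsCharPolyDual W' W ∧
  (W.IsTypeIII ∨ W'.IsTypeIII → IsSame W' W) ∧
  (W.IsTypeV ∨ W'.IsTypeV → W.IsTypeV ∧ W'.IsTypeV ∧ IsLoopPair W' W)

theorem expTwoPi_eq_iff (x y : ℝ) : expTwoPi x = expTwoPi y ↔ ∃ n : ℤ, x = y + n := by
  unfold expTwoPi
  rw [Complex.exp_eq_exp_iff_exists_int]
  have hpi : (2 * Real.pi * Complex.I : ℂ) ≠ 0 := by
    simp [Real.pi_ne_zero]
  refine exists_congr fun n => ?_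
  constructor
  · intro h
    have h2 : (2 * Real.pi * Complex.I : ℂ) * x = (2 * Real.pi * Complex.I) * (y + n) := by
      rw [h]; ring
    have h3 := mul_left_cancel₀ hpi h2
    exact_mod_cast h3
  · intro h
    rw [h]; push_cast; ring

/-- The listed exponent vectors give pairwise different matrices. -/
theorem injOn_diagElement_principalGroup (W : WeightSystem) (hW : W.IsReduced) :
    Set.InjOn W.diagElement (W.principalGroup : Set (Fin 3 → ℤ)) := by
  intro α hα β hβ hab
  simp only [principalGroup, Finset.coe_image, Set.mem_image, Finset.coe_range,
    Set.mem_Iio] at hα hβ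
  obtain ⟨k, hk, rfl⟩ := hα
  obtain ⟨l, hl, rfl⟩ := hβ
  have hh : (W.h : ℝ) ≠ 0 := by exact_mod_cast W.h_pos.ne'
  have key : ∀ i, (W.h : ℤ) ∣ (W.a i : ℤ) * ((k : ℤ) - l) := by
    intro i
    have h1 := congrFun hab i
    simp only [diagElement, expTwoPi_eq_iff, omega] at h1
    obtain ⟨n, hn⟩ := h1
    refine ⟨n, ?_⟩
    have : (W.a i : ℝ) * ((k : ℝ) - l) = W.h * n := by
      field_simp at hn
      push_cast at hn
      linarith
    exact_mod_cast this
  have key2 : ∀ i, W.h ∣ W.a i * ((k : ℤ) - l).natAbs := by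
    intro i
    have := Int.natAbs_dvd_natAbs.mpr (key i)
    simpa [Int.natAbs_mul] using this
  have h3 : W.h ∣ (Finset.univ.gcd W.a) * ((k : ℤ) - l).natAbs := by
    have : W.h ∣ Finset.univ.gcd (fun i => W.a i * ((k : ℤ) - l).natAbs) :=
      Finset.dvd_gcd fun i _ => key2 i
    rwa [Finset.gcd_mul_right, normalize_eq] at this
  have h4 : W.h ∣ ((k : ℤ) - l).natAbs :=
    (Nat.Coprime.symm (show Nat.Coprime _ _ from hW)).dvd_of_dvd_mul_left h3
  have h5 : ((k : ℤ) - l).natAbs < W.h := by omega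
  have h6 := Nat.eq_zero_of_dvd_of_lt h4 h5
  have : (k : ℤ) = l := by omega
  simp [this]

/-- The listed exponent vectors give all powers of the generator of `G₀`. -/
theorem image_diagElement_principalGroup (W : WeightSystem) :
    W.diagElement '' (W.principalGroup : Set (Fin 3 → ℤ)) =
      Set.range fun k : ℤ => fun i => expTwoPi (W.omega i) ^ k := by
  have hh : (W.h : ℝ) ≠ 0 := by exact_mod_cast W.h_pos.ne'
  have hpow : ∀ (k : ℤ) (i : Fin 3),
      expTwoPi (W.omega i) ^ k = expTwoPi (W.omega i * k) := by
    intro k i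
    unfold expTwoPi
    rw [← Complex.exp_int_mul]
    congr 1
    push_cast
    ring
  ext g
  simp only [principalGroup, Finset.coe_image, Set.mem_image, Finset.coe_range,
    Set.mem_Iio, Set.mem_range, exists_exists_and_eq_and]
  constructor
  · rintro ⟨k, -, rfl⟩
    exact ⟨k, by funext i; rw [hpow]; rfl⟩
  · rintro ⟨k, rfl⟩
    have hpos : (0 : ℤ) < W.h := by exact_mod_cast W.h_pos
    have h1 := Int.emod_nonneg k hpos.ne'
    have h2 := Int.emod_lt_of_pos k hpos
    refine ⟨(k % W.h).toNat, by omega, ?_⟩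
    funext i
    rw [hpow]
    simp only [diagElement, expTwoPi_eq_iff, Int.toNat_of_nonneg h1]
    refine ⟨-(W.a i * (k / W.h)), ?_⟩
    have h3 : ((k % W.h : ℤ) : ℝ) = k - W.h * ((k / W.h : ℤ) : ℝ) := by
      have := Int.emod_add_mul_ediv k W.h
      have h4 : ((k % W.h : ℤ) : ℝ) + W.h * ((k / W.h : ℤ) : ℝ) = k := by exact_mod_cast this
      linarith
    rw [h3]
    simp only [omega]
    push_cast
    field_simp
    ring

end WeightSystem

/-! ### Regularity as a divisor count, and Poincaré polynomials of fixed loci -/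

namespace WeightSystem
open Polynomial

/-! Everything is read off from one function on the divisors of `h`, namely `cyc j`, the exponent of
`λ ^ j - 1` in the characteristic polynomial. Fourier inversion over the `h`-th roots of unity gives
its divisor sums two meanings. The sum over the `j` with `h ∣ j * r` counts the exponents of `W`
congruent to `r` modulo `h` (`CountRegular.res_univ_eq`), and the sum over the `j ∣ k` is minus the
multiplicity of the `k`-th sector of the orbifold (`CountRegular.sectorMult_eq`). So, when `ε` and
`h` are coprime and `h` is common to both systems, Saito's duality says that the exponents of `W`,
counted modulo `h`, match the sectors of `W'` (`cycDual_iff`).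

Vafa's formula can be evaluated sector by sector. A nontrivial group element fixes at most two
variables, and the invariants of its fixed locus lie in the middle degree, so the sector gives one
monomial in `y * ybar` after the change of sign of charge. Only the untwisted sector depends on `y /
ybar`, with coefficient `spec 0`. Hence P-duality means that `spec 0` vanishes on both sides and
that the exponents of each system are the positions of the twisted sectors of the other
(`isPDual_iff`).

From P to M: comparing extreme degrees gives `ε / h = ε' / h'`, a trivially acting subgroup would
exist unless `gcd(ε, h) = 1`, so `h` and `ε` agree; as sector `k` sits at `-ε * k` modulo `h`,
reduction modulo `h` gives Saito's duality (`SpecDual.cycDual`).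

From M to P the congruences must be lifted to equalities. Exponents lie strictly between `-h` and `2
* h` and are symmetric about `h / 2`, so it is enough to match the negative ones
(`CycDual.spec_eq_dspec`). These count monomials of small weight on one side and group elements of
small age on the other. If the systems belong to an invertible polynomial with matrix `M` and to its
transpose, then `k ↦ adjugate M * k` matches the two (`IsTransposeBy.repCount_eq`).

That the systems do arise in this way is arithmetic. The conditions `cyc h = 1` and `∑ cyc = 0`,
examined for every divisibility pattern of `p 0, p 1, p 2`, leave a short list of types
(`Balanced.cases`), and duality forces transposed parameters (`Balanced.classify`). The function
`cyc` loses information in two cases: for type III, where `ε` supplies it, and for type V, where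
`cyc` only remembers `h`. In the latter the full spectrum recovers the weights and so the transposed
loop (`Balanced.isLoopPair`). The family `(h / 2, h / 2, 1; h)` has no negative exponents to match.
-/

theorem a_lt_h (W : WeightSystem) (i : Fin 3) : W.a i < W.h := by
  have := W.two_mul_a_le i
  have := W.a_pos i
  omega

theorem rootMultiplicity_X_pow_sub_one {n : ℕ} (hn : n ≠ 0) (z : ℂ) :
    rootMultiplicity z (X ^ n - 1 : ℂ[X]) = if z ^ n = 1 then 1 else 0 := by
  classical
  have hsep : (X ^ n - 1 : ℂ[X]).Separable := by
    simpa using separable_X_pow_sub_C (1 : ℂ) (n := n) (by exact_mod_cast hn) one_ne_zero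
  have hne : (X ^ n - 1 : ℂ[X]) ≠ 0 := by
    simpa using X_pow_sub_C_ne_zero (Nat.pos_of_ne_zero hn) (1 : ℂ)
  rw [← count_roots]
  split_ifs with h
  · apply Multiset.count_eq_one_of_mem (nodup_roots hsep)
    rw [mem_roots hne]
    simp [h]
  · apply Multiset.count_eq_zero_of_notMem
    rw [mem_roots hne]
    simpa [sub_eq_zero] using h

theorem X_pow_sub_one_ne_zero {R : Type*} [CommRing R] [Nontrivial R] {n : ℕ} (hn : n ≠ 0) :
    (X ^ n - 1 : R[X]) ≠ 0 := by
  simpa using X_pow_sub_C_ne_zero (Nat.pos_of_ne_zero hn) (1 : R)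

theorem rootMultiplicity_prod_X_pow_sub_one {ι : Type*} (s : Finset ι) (n m : ι → ℕ)
    (hn : ∀ i ∈ s, n i ≠ 0) (z : ℂ) :
    rootMultiplicity z (∏ i ∈ s, (X ^ n i - 1 : ℂ[X]) ^ m i) =
      ∑ i ∈ s, if z ^ n i = 1 then m i else 0 := by
  classical
  have hne : ∏ i ∈ s, (X ^ n i - 1 : ℂ[X]) ^ m i ≠ 0 :=
    Finset.prod_ne_zero_iff.mpr fun i hi => pow_ne_zero _ (X_pow_sub_one_ne_zero (hn i hi))
  rw [← count_roots, roots_prod _ _ hne, Multiset.count_bind, ← Finset.sum]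
  refine Finset.sum_congr rfl fun i hi => ?_
  rw [roots_pow, Multiset.count_nsmul, count_roots, rootMultiplicity_X_pow_sub_one (hn i hi)]
  split_ifs <;> simp

theorem zpow_mul_prod_div_mul {K : Type*} [Field K] {x : K} (hx : x ≠ 0) (u v : ℕ)
    (A B : Fin 3 → K) (hA : ∀ i, 1 - A i ≠ 0) :
    x ^ ((u : ℤ) - v) * (∏ i, (1 - B i) / (1 - A i)) * (x ^ v * ∏ i, (A i - 1)) =
      x ^ u * ∏ i, (B i - 1) := by
  rw [zpow_sub₀ hx, zpow_natCast, zpow_natCast]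
  have h : (∏ i, (1 - B i) / (1 - A i)) * ∏ i, (A i - 1) = ∏ i, (B i - 1) := by
    rw [← Finset.prod_mul_distrib]
    refine Finset.prod_congr rfl fun i _ => ?_
    have := hA i
    field_simp
    ring
  rw [← h]
  field_simp

/-- The arithmetic form of regularity. -/
def CountRegular (W : WeightSystem) : Prop :=
  ∀ d, 1 < d → (Finset.univ.filter fun i => d ∣ W.a i).card ≤
    (Finset.univ.filter fun i => d ∣ W.h - W.a i).card

/-- Denominators are cleared so that poles can be tested by root multiplicities in `ℂ[X]`; `u` and
`v` are the positive and negative parts of `ε`. The exponents `1` fit the shape of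
`rootMultiplicity_prod_X_pow_sub_one`. -/
theorem exists_num_mul_eq (W : WeightSystem) : ∃ u v : ℕ,
    W.chiRat.num * (X ^ v * ∏ i, (X ^ W.a i - 1 : ℂ[X]) ^ 1) =
      W.chiRat.denom * (X ^ u * ∏ i, (X ^ (W.h - W.a i) - 1 : ℂ[X]) ^ 1) := by
  obtain ⟨u, v, huv⟩ : ∃ u v : ℕ, W.eps = (u : ℤ) - v :=
    ⟨W.eps.toNat, (-W.eps).toNat, by omega⟩
  refine ⟨u, v, ?_⟩
  have hq : ∀ n : ℕ, n ≠ 0 → (1 - RatFunc.X ^ n : RatFunc ℂ) ≠ 0 := by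
    intro n hn h0
    have h2 : algebraMap ℂ[X] (RatFunc ℂ) (1 - X ^ n) = 0 := by
      simpa only [map_sub, map_pow, RatFunc.algebraMap_X, map_one] using h0
    rw [map_eq_zero_iff _ (RatFunc.algebraMap_injective ℂ)] at h2
    exact X_pow_sub_one_ne_zero hn (sub_eq_zero.mpr (sub_eq_zero.mp h2).symm)
  apply RatFunc.algebraMap_injective ℂ
  have h1 := RatFunc.num_div_denom W.chiRat
  have hden : algebraMap ℂ[X] (RatFunc ℂ) W.chiRat.denom ≠ 0 :=
    RatFunc.algebraMap_ne_zero (RatFunc.denom_ne_zero _)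
  rw [div_eq_iff hden] at h1
  rw [map_mul, h1]
  simp only [map_mul, map_prod, map_sub, map_pow, RatFunc.algebraMap_X, map_one, pow_one]
  rw [mul_comm _ (algebraMap ℂ[X] (RatFunc ℂ) W.chiRat.denom), mul_assoc]
  congr 1
  rw [chiRat, huv]
  exact zpow_mul_prod_div_mul RatFunc.X_ne_zero _ _ _ _ fun i => hq _ (W.a_pos i).ne'

theorem rootMultiplicity_mul_X_pow_mul {z : ℂ} (hz0 : z ≠ 0) {p : ℂ[X]} (hp : p ≠ 0) (u : ℕ)
    (n : Fin 3 → ℕ) (hn : ∀ i, n i ≠ 0) :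
    rootMultiplicity z (p * (X ^ u * ∏ i, (X ^ n i - 1 : ℂ[X]) ^ 1)) =
      rootMultiplicity z p + ∑ i, if z ^ n i = 1 then 1 else 0 := by
  have hA : (∏ i, (X ^ n i - 1 : ℂ[X]) ^ 1) ≠ 0 :=
    Finset.prod_ne_zero_iff.mpr fun i _ => pow_ne_zero _ (X_pow_sub_one_ne_zero (hn i))
  have hX : (X ^ u : ℂ[X]) ≠ 0 := pow_ne_zero _ X_ne_zero
  have hXz : rootMultiplicity z (X ^ u : ℂ[X]) = 0 := by
    apply rootMultiplicity_eq_zero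
    simp [hz0]
  rw [rootMultiplicity_mul (mul_ne_zero hp (mul_ne_zero hX hA)),
    rootMultiplicity_mul (mul_ne_zero hX hA), hXz, zero_add,
    rootMultiplicity_prod_X_pow_sub_one _ _ _ fun i _ => hn i]

/-- At a primitive `d`-th root of unity `X ^ n - 1` has a simple zero if `d ∣ n` and none otherwise.
Absence of a pole there bounds the zeros of the denominator by those of the numerator. -/
theorem IsRegular.countRegular {W : WeightSystem} (hW : W.IsRegular) : W.CountRegular := by
  intro d hd
  have hd0 : d ≠ 0 := by omega
  obtain ⟨z, hz⟩ : ∃ z : ℂ, IsPrimitiveRoot z d := ⟨_, Complex.isPrimitiveRoot_exp d hd0⟩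
  have hz0 : z ≠ 0 := hz.ne_zero hd0
  obtain ⟨u, v, key⟩ := W.exists_num_mul_eq
  have hdne : W.chiRat.denom ≠ 0 := RatFunc.denom_ne_zero _
  have hdz : rootMultiplicity z W.chiRat.denom = 0 := rootMultiplicity_eq_zero (hW z hz0)
  have hne : ∀ i, W.h - W.a i ≠ 0 := fun i => by have := W.a_lt_h i; omega
  have hR : ∏ i, (X ^ (W.h - W.a i) - 1 : ℂ[X]) ^ 1 ≠ 0 :=
    Finset.prod_ne_zero_iff.mpr fun i _ => pow_ne_zero _ (X_pow_sub_one_ne_zero (hne i))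
  have hnum : W.chiRat.num ≠ 0 := by
    intro h0
    rw [h0, zero_mul] at key
    exact mul_ne_zero hdne (mul_ne_zero (pow_ne_zero _ X_ne_zero) hR) key.symm
  have e1 := congrArg (rootMultiplicity z) key
  rw [rootMultiplicity_mul_X_pow_mul hz0 hnum _ _ fun i => (W.a_pos i).ne',
    rootMultiplicity_mul_X_pow_mul hz0 hdne _ _ hne, hdz] at e1
  simp only [hz.pow_eq_one_iff_dvd] at e1
  rw [Finset.card_filter, Finset.card_filter]
  omega

/-- Each product factors into cyclotomic polynomials, in which `cyclotomic d` occurs as often as `d`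
divides an exponent. -/
theorem prod_X_pow_sub_one_dvd {ι : Type*} (s : Finset ι) (b c : ι → ℕ)
    (hb : ∀ i ∈ s, b i ≠ 0) (hc : ∀ i ∈ s, c i ≠ 0)
    (H : ∀ d, 1 < d → (s.filter fun i => d ∣ b i).card ≤ (s.filter fun i => d ∣ c i).card) :
    ∏ i ∈ s, (X ^ b i - 1 : ℤ[X]) ∣ ∏ i ∈ s, (X ^ c i - 1 : ℤ[X]) := by
  classical
  obtain ⟨N, hN⟩ : ∃ N, ∀ i ∈ s, b i < N ∧ c i < N := by
    refine ⟨(∑ i ∈ s, (b i + c i)) + 1, fun i hi => ?_⟩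
    have := Finset.single_le_sum (f := fun i => b i + c i) (fun _ _ => Nat.zero_le _) hi
    omega
  have key : ∀ f : ι → ℕ, (∀ i ∈ s, f i ≠ 0 ∧ f i < N) →
      ∏ i ∈ s, (X ^ f i - 1 : ℤ[X]) =
        ∏ d ∈ Finset.Ico 1 N, cyclotomic d ℤ ^ (s.filter fun i => d ∣ f i).card := by
    intro f hf
    have h1 : ∀ i ∈ s, (X ^ f i - 1 : ℤ[X]) =
        ∏ d ∈ Finset.Ico 1 N, if d ∣ f i then cyclotomic d ℤ else 1 := by
      intro i hi
      rw [← prod_cyclotomic_eq_X_pow_sub_one (Nat.pos_of_ne_zero (hf i hi).1), Finset.prod_ite,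
        Finset.prod_const_one, mul_one]
      refine Finset.prod_congr ?_ fun _ _ => rfl
      ext d
      simp only [Nat.mem_divisors, Finset.mem_filter, Finset.mem_Ico]
      constructor
      · rintro ⟨h, h0⟩
        have := Nat.le_of_dvd (Nat.pos_of_ne_zero h0) h
        have := Nat.pos_of_dvd_of_pos h (Nat.pos_of_ne_zero h0)
        have := (hf i hi).2
        exact ⟨⟨by omega, by omega⟩, h⟩
      · rintro ⟨-, h⟩
        exact ⟨h, (hf i hi).1⟩
    rw [Finset.prod_congr rfl h1, Finset.prod_comm]
    refine Finset.prod_congr rfl fun d _ => ?_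
    rw [Finset.prod_ite, Finset.prod_const_one, mul_one, Finset.prod_const]
  rw [key b fun i hi => ⟨hb i hi, (hN i hi).1⟩, key c fun i hi => ⟨hc i hi, (hN i hi).2⟩]
  refine Finset.prod_dvd_prod_of_dvd _ _ fun d hd => pow_dvd_pow _ ?_
  rw [Finset.mem_Ico] at hd
  rcases Nat.lt_or_ge 1 d with h | h
  · exact H d h
  -- The hypothesis leaves out `d = 1`, but there both multiplicities are the size of `s`.
  · obtain rfl : d = 1 := by omega
    simp

/-- The indices of the variables fixed by the `k`-th power of the generator of `G₀`. -/
def fixed (W : WeightSystem) (k : ℕ) : Finset (Fin 3) :=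
  Finset.univ.filter fun i => W.h ∣ W.a i * k

theorem mem_fixed {W : WeightSystem} {k : ℕ} {i : Fin 3} : i ∈ W.fixed k ↔ W.h ∣ W.a i * k := by
  simp [fixed]

theorem fixed_of_dvd {W : WeightSystem} {k : ℕ} (h : W.h ∣ k) : W.fixed k = Finset.univ := by
  ext i
  simp [mem_fixed, Dvd.dvd.mul_left h (W.a i)]

/-- Being fixed by the `k`-th power becomes a divisibility condition on the weight itself, which is
what the counts in `CountRegular` can absorb. -/
theorem h_dvd_mul_iff (W : WeightSystem) (k x : ℕ) :
    W.h ∣ x * k ↔ W.h / Nat.gcd W.h k ∣ x := by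
  have hg : 0 < Nat.gcd W.h k := Nat.gcd_pos_of_pos_left _ W.h_pos
  constructor
  · intro h
    have h1 : W.h / Nat.gcd W.h k ∣ x * (k / Nat.gcd W.h k) := by
      rw [← Nat.mul_div_assoc _ (Nat.gcd_dvd_right _ _)]
      exact Nat.div_dvd_div (Nat.gcd_dvd_left _ _) h
    exact (Nat.coprime_div_gcd_div_gcd hg).dvd_of_dvd_mul_right h1
  · intro h
    calc W.h = W.h / Nat.gcd W.h k * Nat.gcd W.h k :=
          (Nat.div_mul_cancel (Nat.gcd_dvd_left _ _)).symm
      _ ∣ x * k := Nat.mul_dvd_mul h (Nat.gcd_dvd_right _ _)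

theorem mem_fixed_iff_p_dvd {W : WeightSystem} {k : ℕ} {i : Fin 3} :
    i ∈ W.fixed k ↔ W.p i ∣ k := by
  rw [mem_fixed, mul_comm, h_dvd_mul_iff]
  rfl

/-- The fixed variables are those whose weight is divisible by `q = h / gcd(h, k)`, so this is the
global count for `lcm d q`. As `q ∣ h`, the same holds for `h - a i`. -/
theorem CountRegular.fixed {W : WeightSystem} (hW : W.CountRegular) (k : ℕ) {d : ℕ} (hd : 1 < d) :
    ((W.fixed k).filter fun i => d ∣ W.a i).card ≤
      ((W.fixed k).filter fun i => d ∣ W.h - W.a i).card := by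
  set q := W.h / Nat.gcd W.h k with hq
  have hqh : q ∣ W.h := Nat.div_dvd_of_dvd (Nat.gcd_dvd_left _ _)
  have hq0 : 0 < q := Nat.pos_of_dvd_of_pos hqh W.h_pos
  have h1 : 1 < Nat.lcm d q := by
    have := Nat.le_of_dvd (Nat.lcm_pos (by omega) hq0) (Nat.dvd_lcm_left d q)
    omega
  have := hW _ h1
  convert this using 2
  · ext i
    simp only [Finset.mem_filter, mem_fixed, h_dvd_mul_iff, Finset.mem_univ, true_and,
      Nat.lcm_dvd_iff, ← hq]
    tauto
  · ext i
    simp only [Finset.mem_filter, mem_fixed, h_dvd_mul_iff, Finset.mem_univ, true_and,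
      Nat.lcm_dvd_iff, ← hq]
    rw [Nat.dvd_sub_iff_right (W.a_lt_h i).le hqh]
    tauto

/-- The Poincaré polynomial of the Jacobi ring in the variables with index in `J`, with degrees
in units of `1 / h`. -/
noncomputable def jac (W : WeightSystem) (J : Finset (Fin 3)) : ℤ[X] :=
  (∏ i ∈ J, (X ^ (W.h - W.a i) - 1)) /ₘ ∏ i ∈ J, (X ^ W.a i - 1)

theorem monic_prod_a (W : WeightSystem) (J : Finset (Fin 3)) :
    (∏ i ∈ J, (X ^ W.a i - 1 : ℤ[X])).Monic :=
  monic_prod_of_monic _ _ fun i _ => by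
    simpa using monic_X_pow_sub_C (1 : ℤ) (W.a_pos i).ne'

theorem monic_prod_h_sub_a (W : WeightSystem) (J : Finset (Fin 3)) :
    (∏ i ∈ J, (X ^ (W.h - W.a i) - 1 : ℤ[X])).Monic :=
  monic_prod_of_monic _ _ fun i _ => by
    have := W.a_lt_h i
    simpa using monic_X_pow_sub_C (1 : ℤ) (n := W.h - W.a i) (by omega)

/-- The Jacobi ring in the variables with index in `J` has a Poincaré polynomial. -/
def HasJac (W : WeightSystem) (J : Finset (Fin 3)) : Prop :=
  (∏ i ∈ J, (X ^ W.a i - 1 : ℤ[X])) ∣ ∏ i ∈ J, (X ^ (W.h - W.a i) - 1 : ℤ[X])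

theorem HasJac.mul_jac {W : WeightSystem} {J : Finset (Fin 3)} (hJ : W.HasJac J) :
    (∏ i ∈ J, (X ^ W.a i - 1 : ℤ[X])) * W.jac J = ∏ i ∈ J, (X ^ (W.h - W.a i) - 1 : ℤ[X]) := by
  have h1 := modByMonic_add_div (∏ i ∈ J, (X ^ (W.h - W.a i) - 1 : ℤ[X]))
    (∏ i ∈ J, (X ^ W.a i - 1 : ℤ[X]))
  rw [(modByMonic_eq_zero_iff_dvd (W.monic_prod_a J)).mpr hJ, zero_add] at h1
  exact h1

theorem CountRegular.hasJac {W : WeightSystem} (hW : W.CountRegular) (k : ℕ) :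
    W.HasJac (W.fixed k) :=
  prod_X_pow_sub_one_dvd _ _ _ (fun i _ => (W.a_pos i).ne')
    (fun i _ => by have := W.a_lt_h i; omega) fun _ hd => hW.fixed k hd

theorem CountRegular.hasJac_univ {W : WeightSystem} (hW : W.CountRegular) :
    W.HasJac Finset.univ := by
  have := hW.hasJac 0
  rwa [fixed_of_dvd (dvd_zero _)] at this

theorem natDegree_prod_X_pow_sub_one {ι : Type*} (s : Finset ι) (n : ι → ℕ)
    (hn : ∀ i ∈ s, n i ≠ 0) :
    (∏ i ∈ s, (X ^ n i - 1 : ℤ[X])).natDegree = ∑ i ∈ s, n i := by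
  rw [natDegree_prod _ _ fun i hi => X_pow_sub_one_ne_zero (hn i hi)]
  refine Finset.sum_congr rfl fun i _ => ?_
  simpa using natDegree_X_pow_sub_C (R := ℤ) (n := n i) (r := 1)

theorem HasJac.ne_zero {W : WeightSystem} {J : Finset (Fin 3)} (hJ : W.HasJac J) :
    W.jac J ≠ 0 := by
  intro h0
  have h1 := hJ.mul_jac
  rw [h0, mul_zero] at h1
  exact (W.monic_prod_h_sub_a J).ne_zero h1.symm

theorem HasJac.natDegree_jac {W : WeightSystem} {J : Finset (Fin 3)} (hJ : W.HasJac J) :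
    (W.jac J).natDegree = ∑ i ∈ J, (W.h - 2 * W.a i) := by
  have h1 := congrArg natDegree hJ.mul_jac
  rw [natDegree_mul (W.monic_prod_a J).ne_zero hJ.ne_zero,
    natDegree_prod_X_pow_sub_one _ _ fun i _ => (W.a_pos i).ne',
    natDegree_prod_X_pow_sub_one _ _ fun i _ => by have := W.a_lt_h i; omega] at h1
  have h2 : ∑ i ∈ J, (W.h - W.a i) = ∑ i ∈ J, W.a i + ∑ i ∈ J, (W.h - 2 * W.a i) := by
    rw [← Finset.sum_add_distrib]
    refine Finset.sum_congr rfl fun i _ => ?_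
    have := W.two_mul_a_le i
    omega
  omega

theorem reverse_X_pow_sub_one {n : ℕ} (hn : n ≠ 0) :
    (X ^ n - 1 : ℤ[X]).reverse = -(X ^ n - 1) := by
  have h : (X ^ n - 1 : ℤ[X]).natDegree = n := by
    simpa using natDegree_X_pow_sub_C (R := ℤ) (n := n) (r := 1)
  ext m
  rw [coeff_reverse, h]
  simp only [coeff_sub, coeff_X_pow, coeff_one, coeff_neg]
  rcases le_or_gt m n with hm | hm
  · rw [revAt_le hm]
    split_ifs <;> omega
  · rw [revAt_eq_self_of_lt hm]
    split_ifs <;> omega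

theorem reverse_prod_X_pow_sub_one {ι : Type*} (s : Finset ι) (n : ι → ℕ)
    (hn : ∀ i ∈ s, n i ≠ 0) :
    (∏ i ∈ s, (X ^ n i - 1 : ℤ[X])).reverse = (-1) ^ s.card * ∏ i ∈ s, (X ^ n i - 1) := by
  classical
  induction s using Finset.induction_on with
  | empty => simpa using reverse_C (1 : ℤ)
  | insert i s hi ih =>
    rw [Finset.prod_insert hi, reverse_mul_of_domain, ih fun j hj => hn j (by simp [hj]),
      reverse_X_pow_sub_one (hn i (by simp)), Finset.card_insert_of_notMem hi]
    ring

/-- Numerator and denominator have the same number of factors, and each factor is antipalindromic,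
so the signs cancel in the quotient. -/
theorem HasJac.reverse_jac {W : WeightSystem} {J : Finset (Fin 3)} (hJ : W.HasJac J) :
    (W.jac J).reverse = W.jac J := by
  have h1 := congrArg Polynomial.reverse hJ.mul_jac
  rw [reverse_mul_of_domain, reverse_prod_X_pow_sub_one _ _ fun i _ => (W.a_pos i).ne',
    reverse_prod_X_pow_sub_one _ _ fun i _ => by have := W.a_lt_h i; omega, ← hJ.mul_jac,
    mul_assoc] at h1
  have h2 : ((-1 : ℤ[X]) ^ J.card) ≠ 0 := pow_ne_zero _ (by simp)
  exact mul_left_cancel₀ (W.monic_prod_a J).ne_zero (mul_left_cancel₀ h2 h1)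

theorem HasJac.coeff_symm {W : WeightSystem} {J : Finset (Fin 3)} (hJ : W.HasJac J) {m n : ℕ}
    (hmn : m + n = (W.jac J).natDegree) : (W.jac J).coeff m = (W.jac J).coeff n := by
  conv_lhs => rw [← hJ.reverse_jac]
  rw [coeff_reverse, revAt_le (by omega)]
  congr 1
  omega

/-- In low degrees the Poincaré polynomial counts monomials. -/
theorem HasJac.coeff_eq {W : WeightSystem} {J : Finset (Fin 3)} (hJ : W.HasJac J) {n : ℕ}
    (hn : ∀ i ∈ J, n < W.h - W.a i) (hh : n < W.h) :
    (W.jac J).coeff n = (∏ i ∈ J, ∑ l ∈ Finset.range W.h, (X ^ (W.a i * l) : ℤ[X])).coeff n := by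
  set Q := ∏ i ∈ J, ∑ l ∈ Finset.range W.h, (X ^ (W.a i * l) : ℤ[X]) with hQ
  set A := ∏ i ∈ J, (X ^ W.a i - 1 : ℤ[X]) with hA
  have hQA : A * Q = ∏ i ∈ J, (X ^ (W.a i * W.h) - 1) := by
    rw [hA, hQ, ← Finset.prod_mul_distrib]
    refine Finset.prod_congr rfl fun i _ => ?_
    simp only [pow_mul]
    exact mul_geom_sum _ _
  -- Modulo `X ^ (n + 1)` such a product is only the sign `(-1) ^ J.card`. This applies to the
  -- numerator of `jac` and to `A * Q`, and `A` is invertible modulo a power of `X`.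
  have hlow : ∀ f : Fin 3 → ℕ, (∀ i ∈ J, n < f i) →
      (X ^ (n + 1) : ℤ[X]) ∣ ∏ i ∈ J, (X ^ f i - 1) - (-1) ^ J.card := by
    intro f hf
    have h1 := Finset.prod_add (fun i => (X : ℤ[X]) ^ f i) (fun _ => -1) J
    simp only [Finset.prod_const, ← sub_eq_add_neg] at h1
    rw [h1, ← Finset.add_sum_erase _ _ (Finset.empty_mem_powerset J)]
    simp only [Finset.prod_empty, Finset.sdiff_empty, one_mul, add_sub_cancel_left]
    refine Finset.dvd_sum fun t ht => Dvd.dvd.mul_right ?_ _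
    rw [Finset.mem_erase, Finset.mem_powerset] at ht
    obtain ⟨i, hi⟩ := Finset.nonempty_iff_ne_empty.mpr ht.1
    exact (pow_dvd_pow _ (hf i (ht.2 hi))).trans (Finset.dvd_prod_of_mem _ hi)
  have h1 : (X ^ (n + 1) : ℤ[X]) ∣ A * (W.jac J - Q) := by
    rw [mul_sub, hA, hJ.mul_jac, ← hA, hQA]
    have := dvd_sub (hlow _ hn) (hlow (fun i => W.a i * W.h) fun i _ =>
      hh.trans_le (Nat.le_mul_of_pos_left _ (W.a_pos i)))
    simpa using this
  have h2 : IsCoprime (X ^ (n + 1) : ℤ[X]) A := by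
    refine IsCoprime.prod_right fun i _ => IsCoprime.pow_left ?_
    obtain ⟨m, hm⟩ := Nat.exists_eq_succ_of_ne_zero (W.a_pos i).ne'
    exact ⟨X ^ m, -1, by rw [hm, pow_succ]; ring⟩
  have h3 := X_pow_dvd_iff.mp (h2.dvd_of_dvd_mul_left h1) n (Nat.lt_succ_self n)
  rw [coeff_sub] at h3
  omega

theorem HasJac.coeff_nonneg {W : WeightSystem} {J : Finset (Fin 3)} (hJ : W.HasJac J) {n : ℕ}
    (hn : ∀ i ∈ J, n < W.h - W.a i) (hh : n < W.h) : 0 ≤ (W.jac J).coeff n := by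
  rw [hJ.coeff_eq hn hh, Finset.prod_sum, finsetSum_coeff]
  refine Finset.sum_nonneg fun t _ => ?_
  rw [Finset.prod_pow_eq_pow_sum, coeff_X_pow]
  split_ifs <;> simp

theorem HasJac.coeff_univ {W : WeightSystem} (hJ : W.HasJac Finset.univ) {n : ℕ}
    (hn : ∀ i, n < W.h - W.a i) :
    (W.jac Finset.univ).coeff n =
      ((Fintype.piFinset fun _ : Fin 3 => Finset.range W.h).filter
        fun l => n = ∑ i, W.a i * l i).card := by
  have hh : n < W.h := (hn 0).trans_le (Nat.sub_le _ _)
  rw [hJ.coeff_eq (fun i _ => hn i) hh, Finset.prod_univ_sum, finsetSum_coeff]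
  simp only [Finset.prod_pow_eq_pow_sum, coeff_X_pow, Finset.card_filter, Nat.cast_sum,
    Nat.cast_ite, Nat.cast_one, Nat.cast_zero]

end WeightSystem

/-! ### Fourier inversion and the function `cyc` -/

namespace WeightSystem
open Polynomial

/-- The standard primitive `h`-th root of unity. -/
noncomputable def zeta (W : WeightSystem) : ℂ := Complex.exp (2 * Real.pi * Complex.I / W.h)

theorem isPrimitiveRoot_zeta (W : WeightSystem) : IsPrimitiveRoot W.zeta W.h :=
  Complex.isPrimitiveRoot_exp _ W.h_pos.ne'

/-- `X ^ n - 1` at `z * X`, divided by `X - 1` if it vanishes at `1`. -/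
noncomputable def strictFactor (z : ℂ) (n : ℕ) : ℂ[X] :=
  if z ^ n = 1 then ∑ l ∈ Finset.range n, X ^ l else C (z ^ n) * X ^ n - 1

theorem X_pow_sub_one_comp (z : ℂ) (n : ℕ) :
    (X ^ n - 1 : ℂ[X]).comp (C z * X) = (if z ^ n = 1 then X - 1 else 1) * strictFactor z n := by
  rw [strictFactor]
  split_ifs with h
  · rw [mul_geom_sum]
    simp [mul_pow, ← C_pow, h]
  · simp [mul_pow]

theorem eval_one_strictFactor (z : ℂ) (n : ℕ) :
    (strictFactor z n).eval 1 = if z ^ n = 1 then (n : ℂ) else z ^ n - 1 := by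
  rw [strictFactor]
  split_ifs with h
  · simp [eval_finsetSum]
  · simp

/-- Since `z ^ (h - a) = z ^ (-a)`, a factor with `z ^ a ≠ 1` equals `-z ^ (-a)` and is cancelled up
to sign by the weight of the volume form. A factor of the form `0 / 0` has the limit `(h - a) / a`.
-/
theorem HasJac.aeval_mul {W : WeightSystem} {J : Finset (Fin 3)} (hJ : W.HasJac J) {z : ℂ}
    (hz : z ^ W.h = 1) :
    aeval z (W.jac J) * z ^ (∑ i ∈ J, W.a i) =
      (-1) ^ J.card * ∏ i ∈ J, if z ^ W.a i = 1 then 1 - (W.h : ℂ) / W.a i else 1 := by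
  have hz0 : z ≠ 0 := by
    rintro rfl
    rw [zero_pow W.h_pos.ne'] at hz
    exact zero_ne_one hz
  have hsplit : ∀ i, z ^ (W.h - W.a i) * z ^ W.a i = 1 := fun i => by
    rw [← pow_add, Nat.sub_add_cancel (W.a_lt_h i).le, hz]
  have hiff : ∀ i, z ^ (W.h - W.a i) = 1 ↔ z ^ W.a i = 1 := by
    intro i
    constructor
    · intro h
      simpa [h] using hsplit i
    · intro h
      simpa [h] using hsplit i
  -- Substituting `z * X` moves the point to `1`, where the common zeros of both sides are powers of
  -- `X - 1` and can be cancelled before evaluation.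
  have e1 := congrArg (fun P : ℤ[X] => (P.map (Int.castRingHom ℂ)).comp (C z * X)) hJ.mul_jac
  simp only [Polynomial.map_mul, Polynomial.map_prod, Polynomial.map_sub, Polynomial.map_pow,
    map_X, Polynomial.map_one, mul_comp, prod_comp] at e1
  simp only [X_pow_sub_one_comp, hiff, Finset.prod_mul_distrib] at e1
  have hne : (∏ i ∈ J, if z ^ W.a i = 1 then (X - 1 : ℂ[X]) else 1) ≠ 0 := by
    refine Finset.prod_ne_zero_iff.mpr fun i _ => ?_
    split_ifs
    · simpa using X_sub_C_ne_zero (1 : ℂ)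
    · exact one_ne_zero
  rw [mul_assoc] at e1
  have e2 := congrArg (eval 1) (mul_left_cancel₀ hne e1)
  simp only [eval_mul, eval_prod, eval_one_strictFactor, eval_comp, eval_C, eval_X, mul_one,
    hiff, eval_map] at e2
  have e3 : eval₂ (Int.castRingHom ℂ) z (W.jac J) = aeval z (W.jac J) := rfl
  rw [e3] at e2
  have hA : (∏ i ∈ J, if z ^ W.a i = 1 then (W.a i : ℂ) else z ^ W.a i - 1) ≠ 0 := by
    refine Finset.prod_ne_zero_iff.mpr fun i _ => ?_
    split_ifs with h
    · exact_mod_cast (W.a_pos i).ne'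
    · exact sub_ne_zero.mpr h
  apply mul_left_cancel₀ hA
  rw [← mul_assoc, e2, ← Finset.prod_pow_eq_pow_sum, ← Finset.prod_mul_distrib,
    ← Finset.prod_const, ← Finset.prod_mul_distrib, ← Finset.prod_mul_distrib]
  refine Finset.prod_congr rfl fun i _ => ?_
  have ha : (W.a i : ℂ) ≠ 0 := by exact_mod_cast (W.a_pos i).ne'
  split_ifs with h
  · rw [h, Nat.cast_sub (W.a_lt_h i).le]
    field_simp
    ring
  · have := hsplit i
    linear_combination this

theorem zeta_zpow_eq_one_iff (W : WeightSystem) (m : ℤ) : W.zeta ^ m = 1 ↔ (W.h : ℤ) ∣ m :=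
  W.isPrimitiveRoot_zeta.zpow_eq_one_iff_dvd m

theorem zeta_pow_eq_one_iff (W : WeightSystem) (m : ℕ) : W.zeta ^ m = 1 ↔ W.h ∣ m :=
  W.isPrimitiveRoot_zeta.pow_eq_one_iff_dvd m

theorem zeta_ne_zero (W : WeightSystem) : W.zeta ≠ 0 := Complex.exp_ne_zero _

theorem geom_sum_of_pow_eq_one {x : ℂ} {n : ℕ} (hx : x ^ n = 1) :
    ∑ k ∈ Finset.range n, x ^ k = if x = 1 then (n : ℂ) else 0 := by
  split_ifs with h
  · simp [h]
  · have := mul_geom_sum x n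
    rw [hx, sub_self] at this
    exact (mul_eq_zero.mp this).resolve_left (sub_ne_zero.mpr h)

theorem sum_zeta_zpow_pow (W : WeightSystem) (m : ℤ) :
    ∑ k ∈ Finset.range W.h, (W.zeta ^ m) ^ k = if (W.h : ℤ) ∣ m then (W.h : ℂ) else 0 := by
  rw [geom_sum_of_pow_eq_one]
  · simp only [zeta_zpow_eq_one_iff]
  · rw [← zpow_natCast, zpow_comm, zpow_natCast, W.isPrimitiveRoot_zeta.pow_eq_one, one_zpow]

theorem sum_range_mul_ite_dvd (L N : ℕ) (hL : 0 < L) (f : ℕ → ℂ) :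
    ∑ k ∈ Finset.range (L * N), (if L ∣ k then f k else 0) =
      ∑ l ∈ Finset.range N, f (L * l) := by
  rw [← Finset.sum_filter]
  symm
  refine Finset.sum_nbij (fun l => L * l) ?_ ?_ ?_ ?_
  · intro l hl
    rw [Finset.mem_range] at hl
    simp only [Finset.mem_filter, Finset.mem_range, dvd_mul_right, and_true]
    exact Nat.mul_lt_mul_of_pos_left hl hL
  · intro x _ y _ hxy
    exact Nat.eq_of_mul_eq_mul_left hL hxy
  · intro k hk
    simp only [Finset.coe_filter, Finset.mem_range, Set.mem_ofPred_eq] at hk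
    obtain ⟨hk, l, rfl⟩ := hk
    exact ⟨l, by simpa using Nat.lt_of_mul_lt_mul_left hk, rfl⟩
  · intro _ _
    rfl

theorem sum_ite_dvd_zeta_zpow (W : WeightSystem) {L : ℕ} (hL : L ∣ W.h) (r : ℤ) :
    ∑ k ∈ Finset.range W.h, (if L ∣ k then (W.zeta ^ (-r)) ^ k else 0) =
      if (W.h : ℤ) ∣ L * r then (W.h : ℂ) / L else 0 := by
  obtain ⟨N, hN⟩ := hL
  have hL0 : 0 < L := Nat.pos_of_ne_zero fun h0 => by
    have := W.h_pos
    simp [hN, h0] at this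
  have hLc : (L : ℂ) ≠ 0 := by exact_mod_cast hL0.ne'
  have h1 := sum_range_mul_ite_dvd L N hL0 fun k => (W.zeta ^ (-r)) ^ k
  rw [← hN] at h1
  rw [h1]
  simp only [pow_mul]
  rw [geom_sum_of_pow_eq_one]
  · have h2 : (W.zeta ^ (-r)) ^ L = 1 ↔ (W.h : ℤ) ∣ L * r := by
      rw [← zpow_natCast, ← zpow_mul, zeta_zpow_eq_one_iff, ← dvd_neg]
      rw [show -(-r * (L : ℤ)) = L * r by ring]
    have h3 : (N : ℂ) = W.h / L := by
      rw [hN]; push_cast; field_simp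
    simp only [h2, h3]
  · rw [← pow_mul, ← hN, ← zpow_natCast, zpow_comm, zpow_natCast,
      W.isPrimitiveRoot_zeta.pow_eq_one, one_zpow]

/-- The sum of the coefficients of the Poincaré polynomial in the variables in `J`, over the
degrees which are congruent to `r` modulo `h` after the shift by the degree of the volume form. -/
noncomputable def res (W : WeightSystem) (J : Finset (Fin 3)) (r : ℤ) : ℤ :=
  ∑ n ∈ (W.jac J).support,
    if (W.h : ℤ) ∣ n + (∑ i ∈ J, (W.a i : ℤ)) - r then (W.jac J).coeff n else 0

theorem p_dvd_h (W : WeightSystem) (i : Fin 3) : W.p i ∣ W.h :=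
  Nat.div_dvd_of_dvd (Nat.gcd_dvd_left _ _)

theorem p_pos (W : WeightSystem) (i : Fin 3) : 0 < W.p i := Nat.pos_of_dvd_of_pos (W.p_dvd_h i) W.h_pos

theorem lcm_p_dvd_h (W : WeightSystem) (I : Finset (Fin 3)) : I.lcm W.p ∣ W.h :=
  Finset.lcm_dvd fun i _ => W.p_dvd_h i

theorem lcm_p_pos (W : WeightSystem) (I : Finset (Fin 3)) : 0 < I.lcm W.p :=
  Nat.pos_of_dvd_of_pos (W.lcm_p_dvd_h I) W.h_pos

/-- Summing over the `h`-th roots of unity selects one residue class of degrees. -/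
theorem h_mul_res {W : WeightSystem} {J : Finset (Fin 3)} (r : ℤ) :
    (W.h : ℂ) * W.res J r = ∑ k ∈ Finset.range W.h,
      aeval (W.zeta ^ k) (W.jac J) * (W.zeta ^ k) ^ (∑ i ∈ J, W.a i) * (W.zeta ^ (-r)) ^ k := by
  have h1 : ∀ k ∈ Finset.range W.h,
      aeval (W.zeta ^ k) (W.jac J) * (W.zeta ^ k) ^ (∑ i ∈ J, W.a i) * (W.zeta ^ (-r)) ^ k =
      ∑ n ∈ (W.jac J).support, ((W.jac J).coeff n : ℂ) *
        (W.zeta ^ ((n : ℤ) + (∑ i ∈ J, (W.a i : ℤ)) - r)) ^ k := by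
    intro k _
    rw [aeval_def, eval₂_eq_sum, Polynomial.sum, Finset.sum_mul, Finset.sum_mul]
    refine Finset.sum_congr rfl fun n _ => ?_
    have hz := W.zeta_ne_zero
    rw [eq_intCast, sub_eq_add_neg, zpow_add₀ hz, zpow_add₀ hz, mul_pow, mul_pow,
      ← Nat.cast_sum, zpow_natCast, zpow_natCast, ← pow_mul, ← pow_mul, ← pow_mul, ← pow_mul,
      mul_comm k n, mul_comm k (∑ i ∈ J, W.a i)]
    ring
  rw [Finset.sum_congr rfl h1, Finset.sum_comm, res, Int.cast_sum, Finset.mul_sum]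
  refine Finset.sum_congr rfl fun n _ => ?_
  rw [← Finset.mul_sum, sum_zeta_zpow_pow]
  split_ifs <;> simp [mul_comm]

/-- In the values from `aeval_mul` the product over `J` expands over subsets `I`. The term of `I`
survives at `zeta ^ k` exactly when the lcm `L` of the `p i` divides `k`, and the geometric sum over
these `k` is `h / L` or `0`. -/
theorem HasJac.res_eq {W : WeightSystem} {J : Finset (Fin 3)} (hJ : W.HasJac J) (r : ℤ) :
    (W.res J r : ℚ) = (-1) ^ J.card * ∑ I ∈ J.powerset, (-1) ^ I.card *
      (∏ i ∈ I, (W.h : ℚ) / W.a i) *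
        (if (W.h : ℤ) ∣ (I.lcm W.p : ℕ) * r then 1 / ((I.lcm W.p : ℕ) : ℚ) else 0) := by
  have hh : (W.h : ℂ) ≠ 0 := by exact_mod_cast W.h_pos.ne'
  have key : (W.h : ℂ) * W.res J r = (W.h : ℂ) * ((-1) ^ J.card * ∑ I ∈ J.powerset,
      (-1) ^ I.card * (∏ i ∈ I, (W.h : ℂ) / W.a i) *
        (if (W.h : ℤ) ∣ (I.lcm W.p : ℕ) * r then 1 / ((I.lcm W.p : ℕ) : ℂ) else 0)) := by
    rw [h_mul_res]
    have h1 : ∀ k ∈ Finset.range W.h,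
        aeval (W.zeta ^ k) (W.jac J) * (W.zeta ^ k) ^ (∑ i ∈ J, W.a i) * (W.zeta ^ (-r)) ^ k =
        ∑ I ∈ J.powerset, (-1) ^ J.card * ((-1) ^ I.card * (∏ i ∈ I, (W.h : ℂ) / W.a i)) *
          (if I.lcm W.p ∣ k then (W.zeta ^ (-r)) ^ k else 0) := by
      intro k _
      have hzk : (W.zeta ^ k) ^ W.h = 1 := by
        rw [← pow_mul, mul_comm, pow_mul, W.isPrimitiveRoot_zeta.pow_eq_one, one_pow]
      rw [hJ.aeval_mul hzk]
      have h2 : ∀ i ∈ J, (if (W.zeta ^ k) ^ W.a i = 1 then 1 - (W.h : ℂ) / W.a i else 1) =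
          (if W.p i ∣ k then -((W.h : ℂ) / W.a i) else 0) + 1 := by
        intro i _
        have h3 : (W.zeta ^ k) ^ W.a i = 1 ↔ W.p i ∣ k := by
          rw [← pow_mul, zeta_pow_eq_one_iff, mul_comm k, ← mem_fixed, mem_fixed_iff_p_dvd]
        simp only [h3]
        split_ifs <;> ring
      rw [Finset.prod_congr rfl h2, Finset.prod_add, Finset.mul_sum, Finset.sum_mul]
      refine Finset.sum_congr rfl fun I _ => ?_
      simp only [Finset.prod_const_one, mul_one, Finset.lcm_dvd_iff]
      rw [Finset.prod_ite_zero]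
      split_ifs with h
      · rw [Finset.prod_neg]
      · ring
    rw [Finset.sum_congr rfl h1, Finset.sum_comm, Finset.mul_sum, Finset.mul_sum]
    refine Finset.sum_congr rfl fun I _ => ?_
    rw [← Finset.mul_sum, sum_ite_dvd_zeta_zpow W (W.lcm_p_dvd_h I)]
    split_ifs <;> ring
  apply Rat.cast_injective (α := ℂ)
  rw [Rat.cast_intCast, mul_left_cancel₀ hh key]
  push_cast
  congr 1
  refine Finset.sum_congr rfl fun I _ => ?_
  congr 1
  split_ifs <;> simp

/-- The rational exponent of `λ ^ j - 1` in the characteristic polynomial. -/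
noncomputable def cyc (W : WeightSystem) (j : ℕ) : ℚ :=
  ∑ I : Finset (Fin 3), if I.lcm W.p = j then
    (-1) ^ (I.card + 1) * (∏ i ∈ I, (W.h : ℚ) / W.a i) / j else 0

theorem sum_divisors_mul_cyc (W : WeightSystem) (f : ℕ → ℚ) :
    ∑ j ∈ W.h.divisors, f j * W.cyc j = ∑ I : Finset (Fin 3),
      (-1) ^ (I.card + 1) * (∏ i ∈ I, (W.h : ℚ) / W.a i) / (I.lcm W.p : ℕ) * f (I.lcm W.p) := by
  simp only [cyc, Finset.mul_sum]
  rw [Finset.sum_comm]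
  refine Finset.sum_congr rfl fun I _ => ?_
  rw [Finset.sum_eq_single (I.lcm W.p)]
  · rw [if_pos rfl, mul_comm]
  · intro j _ hj
    rw [if_neg hj.symm, mul_zero]
  · intro h
    exact absurd (Nat.mem_divisors.mpr ⟨W.lcm_p_dvd_h I, W.h_pos.ne'⟩) h

theorem cyc_eq_zero_of_not_dvd {W : WeightSystem} {j : ℕ} (hj : ¬ j ∣ W.h) : W.cyc j = 0 :=
  Finset.sum_eq_zero fun I _ => if_neg fun h : I.lcm W.p = j => hj (h ▸ W.lcm_p_dvd_h I)

theorem IsReduced.dvd_of_forall {W : WeightSystem} (hW : W.IsReduced) {k : ℕ}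
    (hk : ∀ i, W.h ∣ W.a i * k) : W.h ∣ k := by
  have h3 : W.h ∣ (Finset.univ.gcd W.a) * k := by
    have : W.h ∣ Finset.univ.gcd (fun i => W.a i * k) := Finset.dvd_gcd fun i _ => hk i
    rwa [Finset.gcd_mul_right, normalize_eq] at this
  exact (Nat.Coprime.symm (show Nat.Coprime _ _ from hW)).dvd_of_dvd_mul_left h3

theorem IsReduced.lcm_p_univ {W : WeightSystem} (hW : W.IsReduced) :
    Finset.univ.lcm W.p = W.h := by
  refine Nat.dvd_antisymm (W.lcm_p_dvd_h _) (hW.dvd_of_forall fun i => ?_)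
  rw [← mem_fixed, mem_fixed_iff_p_dvd]
  exact Finset.dvd_lcm (Finset.mem_univ i)

theorem univ_powerset_three : (Finset.univ : Finset (Finset (Fin 3))) =
    {∅, {0}, {1}, {2}, {0, 1}, {1, 2}, {2, 0}, Finset.univ} := by decide

theorem IsReduced.cyc_eq {W : WeightSystem} (hW : W.IsReduced) (j : ℕ) :
    W.cyc j = (if j = 1 then -1 else 0) +
      (if W.p 0 = j then (W.h : ℚ) / W.a 0 / j else 0) +
      (if W.p 1 = j then (W.h : ℚ) / W.a 1 / j else 0) +
      (if W.p 2 = j then (W.h : ℚ) / W.a 2 / j else 0) -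
      (if Nat.lcm (W.p 0) (W.p 1) = j then (W.h : ℚ) / W.a 0 * (W.h / W.a 1) / j else 0) -
      (if Nat.lcm (W.p 1) (W.p 2) = j then (W.h : ℚ) / W.a 1 * (W.h / W.a 2) / j else 0) -
      (if Nat.lcm (W.p 2) (W.p 0) = j then (W.h : ℚ) / W.a 2 * (W.h / W.a 0) / j else 0) +
      (if W.h = j then (W.h : ℚ) / W.a 0 * (W.h / W.a 1) * (W.h / W.a 2) / j else 0) := by
  rw [cyc, univ_powerset_three]
  rw [Finset.sum_insert (by decide), Finset.sum_insert (by decide), Finset.sum_insert (by decide),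
    Finset.sum_insert (by decide), Finset.sum_insert (by decide), Finset.sum_insert (by decide),
    Finset.sum_insert (by decide), Finset.sum_singleton, hW.lcm_p_univ]
  have h01 : (0 : Fin 3) ∉ ({1} : Finset (Fin 3)) := by decide
  have h12 : (1 : Fin 3) ∉ ({2} : Finset (Fin 3)) := by decide
  have h20 : (2 : Fin 3) ∉ ({0} : Finset (Fin 3)) := by decide
  have hlcm : ∀ x y : ℕ, GCDMonoid.lcm x y = Nat.lcm x y := fun _ _ => rfl
  simp only [Finset.lcm_empty, Finset.lcm_insert, Finset.lcm_singleton, Finset.card_empty,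
    Finset.card_singleton, Finset.prod_empty, Finset.prod_singleton, Finset.prod_insert h01,
    Finset.prod_insert h12, Finset.prod_insert h20, Finset.card_insert_of_notMem h01,
    Finset.card_insert_of_notMem h12, Finset.card_insert_of_notMem h20, Finset.card_univ,
    Fintype.card_fin, normalize_eq, hlcm, Fin.prod_univ_three, eq_comm (a := (1 : ℕ))]
  have : ∀ (P : Prop) [Decidable P] (x : ℚ), -(if P then x else 0) = if P then -x else 0 := by
    intro P _ x
    split_ifs <;> simp
  simp only [sub_eq_add_neg, this]
  have hj1 : (if j = 1 then (-1 : ℚ) ^ (0 + 1) * 1 / j else 0) = if j = 1 then -1 else 0 := by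
    split_ifs with h
    · simp [h]
    · rfl
  rw [hj1]
  ring_nf

theorem IsReduced.cyc_eq_zero {W : WeightSystem} (hW : W.IsReduced) {j : ℕ} (hj : j ∉ W.M) :
    W.cyc j = 0 := by
  simp only [M, Finset.mem_insert, Finset.mem_singleton, not_or] at hj
  obtain ⟨h1, h2, h3, h4, h5, h6, h7, h8⟩ := hj
  rw [hW.cyc_eq, if_neg h1, if_neg (Ne.symm h2), if_neg (Ne.symm h3), if_neg (Ne.symm h4),
    if_neg (Ne.symm h5), if_neg (Ne.symm h6), if_neg (Ne.symm h7), if_neg (Ne.symm h8)]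
  ring

theorem M_subset_divisors (W : WeightSystem) : W.M ⊆ W.h.divisors := by
  intro j hj
  rw [Nat.mem_divisors]
  refine ⟨?_, W.h_pos.ne'⟩
  simp only [M, Finset.mem_insert, Finset.mem_singleton] at hj
  rcases hj with rfl | rfl | rfl | rfl | rfl | rfl | rfl | rfl
  · exact one_dvd _
  · exact W.p_dvd_h 0
  · exact W.p_dvd_h 1
  · exact W.p_dvd_h 2
  · exact Nat.lcm_dvd (W.p_dvd_h 0) (W.p_dvd_h 1)
  · exact Nat.lcm_dvd (W.p_dvd_h 1) (W.p_dvd_h 2)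
  · exact Nat.lcm_dvd (W.p_dvd_h 2) (W.p_dvd_h 0)
  · exact dvd_rfl

/-- The multiplicity of the `k`-th twisted sector. -/
noncomputable def sectorMult (W : WeightSystem) (k : ℕ) : ℤ :=
  (-1) ^ (W.fixed k).card * W.res (W.fixed k) 0

/-- This is `res_eq` for `r = 0`: the subsets of the fixed locus are those whose lcm divides `k`,
and the two signs from its cardinality cancel. -/
theorem CountRegular.sectorMult_eq {W : WeightSystem} (hW : W.CountRegular) (k : ℕ) :
    (W.sectorMult k : ℚ) = -∑ j ∈ W.h.divisors, if j ∣ k then W.cyc j else 0 := by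
  have h1 : ∀ j ∈ W.h.divisors, (if j ∣ k then W.cyc j else 0) =
      (if j ∣ k then 1 else 0) * W.cyc j := by
    intro j _
    split_ifs <;> simp
  rw [Finset.sum_congr rfl h1, sum_divisors_mul_cyc, sectorMult, Int.cast_mul, (hW.hasJac k).res_eq,
    ← mul_assoc]
  push_cast
  rw [← mul_pow, neg_one_mul, neg_neg, one_pow, one_mul, ← Finset.sum_neg_distrib]
  have h2 : (W.fixed k).powerset = Finset.univ.filter fun I => I.lcm W.p ∣ k := by
    ext I
    simp only [Finset.mem_powerset, Finset.mem_filter, Finset.mem_univ, true_and,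
      Finset.lcm_dvd_iff, Finset.subset_iff, mem_fixed_iff_p_dvd]
  rw [h2, Finset.sum_filter]
  refine Finset.sum_congr rfl fun I _ => ?_
  simp only [mul_zero, dvd_zero, if_true]
  split_ifs <;> ring

theorem CountRegular.res_univ_eq {W : WeightSystem} (hW : W.CountRegular) (r : ℤ) :
    (W.res Finset.univ r : ℚ) =
      ∑ j ∈ W.h.divisors, if (W.h : ℤ) ∣ j * r then W.cyc j else 0 := by
  have h1 : ∀ j ∈ W.h.divisors, (if (W.h : ℤ) ∣ j * r then W.cyc j else 0) =
      (if (W.h : ℤ) ∣ j * r then 1 else 0) * W.cyc j := by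
    intro j _
    split_ifs <;> simp
  rw [Finset.sum_congr rfl h1, sum_divisors_mul_cyc W fun j => if (W.h : ℤ) ∣ j * r then 1 else 0,
    hW.hasJac_univ.res_eq, Finset.mul_sum, Finset.powerset_univ]
  refine Finset.sum_congr rfl fun I _ => ?_
  rw [Finset.card_univ, Fintype.card_fin]
  split_ifs <;> ring

/-- A function on the divisors of `h` is determined by its divisor sums. -/
theorem eq_of_sum_divisors_eq {h : ℕ} (hh : h ≠ 0) (f g : ℕ → ℚ)
    (H : ∀ k, k ∣ h → ∑ j ∈ h.divisors, (if j ∣ k then f j else 0) =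
      ∑ j ∈ h.divisors, if j ∣ k then g j else 0) {j : ℕ} (hj : j ∣ h) : f j = g j := by
  induction j using Nat.strong_induction_on with
  | _ j ih =>
    have hmem : j ∈ h.divisors := Nat.mem_divisors.mpr ⟨hj, hh⟩
    have hj0 : 0 < j := Nat.pos_of_dvd_of_pos hj (Nat.pos_of_ne_zero hh)
    have h1 := H j hj
    rw [← Finset.add_sum_erase _ _ hmem, ← Finset.add_sum_erase _ (fun i => if i ∣ j then g i else 0)
      hmem, if_pos dvd_rfl, if_pos dvd_rfl] at h1
    have h2 : ∑ i ∈ h.divisors.erase j, (if i ∣ j then f i else 0) =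
        ∑ i ∈ h.divisors.erase j, if i ∣ j then g i else 0 := by
      refine Finset.sum_congr rfl fun i hi => ?_
      rw [Finset.mem_erase, Nat.mem_divisors] at hi
      split_ifs with hij
      · exact ih i (lt_of_le_of_ne (Nat.le_of_dvd hj0 hij) hi.1) hi.2.1
      · rfl
    linarith

/-- The divisor sums of `cyc` are integers, being minus sector multiplicities, so integrality
follows by induction along divisors. -/
theorem CountRegular.exists_cyc_eq_int {W : WeightSystem} (hW : W.CountRegular) :
    ∃ e : ℕ → ℤ, ∀ j, (e j : ℚ) = W.cyc j := by
  have key : ∀ j, ∃ z : ℤ, (z : ℚ) = W.cyc j := by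
    intro j
    induction j using Nat.strong_induction_on with
    | _ j ih =>
      by_cases hj : j ∣ W.h
      · have hmem : j ∈ W.h.divisors := Nat.mem_divisors.mpr ⟨hj, W.h_pos.ne'⟩
        have hj0 : 0 < j := Nat.pos_of_dvd_of_pos hj W.h_pos
        have h1 := hW.sectorMult_eq j
        rw [← Finset.add_sum_erase _ _ hmem, if_pos dvd_rfl] at h1
        choose! e he using ih
        refine ⟨-W.sectorMult j - ∑ i ∈ W.h.divisors.erase j, if i ∣ j then e i else 0, ?_⟩
        have h2 : ∑ i ∈ W.h.divisors.erase j, (if i ∣ j then (e i : ℚ) else 0) =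
            ∑ i ∈ W.h.divisors.erase j, if i ∣ j then W.cyc i else 0 := by
          refine Finset.sum_congr rfl fun i hi => ?_
          rw [Finset.mem_erase, Nat.mem_divisors] at hi
          split_ifs with hij
          · exact he i (lt_of_le_of_ne (Nat.le_of_dvd hj0 hij) hi.1)
          · rfl
        push_cast
        rw [h2, h1]
        ring
      · exact ⟨0, by rw [cyc_eq_zero_of_not_dvd hj]; simp⟩
  choose e he using key
  exact ⟨e, he⟩

end WeightSystem

/-! ### Exponents, characteristic polynomials and Saito's duality -/

namespace WeightSystem
open Polynomial

/-- The coefficient of `T ^ m` in `χ_W(T)`. -/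
noncomputable def spec (W : WeightSystem) (m : ℤ) : ℤ :=
  if W.eps ≤ m then (W.jac Finset.univ).coeff (m - W.eps).toNat else 0

/-- The multiset of exponents, provided the coefficients of `χ_W` are nonnegative. -/
noncomputable def expMultiset (W : WeightSystem) : Multiset ℤ :=
  ∑ n ∈ (W.jac Finset.univ).support,
    Multiset.replicate ((W.jac Finset.univ).coeff n).toNat (n + W.eps)

theorem count_expMultiset (W : WeightSystem) (m : ℤ) :
    W.expMultiset.count m = (W.spec m).toNat := by
  rw [expMultiset, Multiset.count_sum', spec]
  simp only [Multiset.count_replicate]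
  split_ifs with h
  · rw [Finset.sum_eq_single (m - W.eps).toNat]
    · rw [if_pos (by omega)]
    · intro n _ hn
      rw [if_neg (by omega)]
    · intro hn
      rw [if_pos (by omega), notMem_support_iff.mp hn, Int.toNat_zero]
  · refine Finset.sum_eq_zero fun n _ => if_neg (by omega)

theorem jac_map_algebraMap {W : WeightSystem} (hW : W.HasJac Finset.univ) :
    W.chiRat = RatFunc.X ^ W.eps * algebraMap ℂ[X] (RatFunc ℂ)
      ((W.jac Finset.univ).map (Int.castRingHom ℂ)) := by
  have e1 := congrArg (fun P : ℤ[X] => algebraMap ℂ[X] (RatFunc ℂ) (P.map (Int.castRingHom ℂ)))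
    hW.mul_jac
  simp only [Polynomial.map_mul, Polynomial.map_prod, Polynomial.map_sub, Polynomial.map_pow,
    map_X, Polynomial.map_one, map_mul, map_prod, map_sub, map_pow, RatFunc.algebraMap_X,
    map_one] at e1
  have hA : ∏ i, ((RatFunc.X : RatFunc ℂ) ^ W.a i - 1) ≠ 0 := by
    refine Finset.prod_ne_zero_iff.mpr fun i _ h0 => ?_
    have h2 : algebraMap ℂ[X] (RatFunc ℂ) (X ^ W.a i - 1) = 0 := by
      simpa only [map_sub, map_pow, RatFunc.algebraMap_X, map_one] using h0
    rw [map_eq_zero_iff _ (RatFunc.algebraMap_injective ℂ)] at h2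
    exact X_pow_sub_one_ne_zero (W.a_pos i).ne' h2
  rw [chiRat]
  congr 1
  have e2 : ∏ i, (1 - (RatFunc.X : RatFunc ℂ) ^ (W.h - W.a i)) / (1 - RatFunc.X ^ W.a i) =
      (∏ i, ((RatFunc.X : RatFunc ℂ) ^ (W.h - W.a i) - 1)) / ∏ i, (RatFunc.X ^ W.a i - 1) := by
    rw [← Finset.prod_div_distrib]
    refine Finset.prod_congr rfl fun i _ => ?_
    rw [← neg_sub, ← neg_sub ((RatFunc.X : RatFunc ℂ) ^ W.a i)]
    exact neg_div_neg_eq _ _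
  rw [e2, div_eq_iff hA, mul_comm, e1]

theorem coeff_sum_map_X_pow (m : Multiset ℤ) (f : ℤ → ℕ) (j : ℕ) :
    ((m.map fun k => (X : ℂ[X]) ^ f k).sum).coeff j = (m.countP fun k => f k = j : ℕ) := by
  induction m using Multiset.induction_on with
  | empty => simp
  | cons k m ih =>
    rw [Multiset.map_cons, Multiset.sum_cons, coeff_add, ih, coeff_X_pow, Multiset.countP_cons]
    simp only [eq_comm (a := j)]
    split_ifs <;> push_cast <;> ring

/-- Both sides are Laurent polynomials; a common factor `X ^ N` turns the identity into one of
polynomial coefficients. -/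
theorem isExponents_iff {W : WeightSystem} (hW : W.HasJac Finset.univ) (m : Multiset ℤ) :
    W.IsExponents m ↔ ∀ k, (m.count k : ℤ) = W.spec k := by
  obtain ⟨N, hN, hNε⟩ : ∃ N : ℕ, (∀ k ∈ m, 0 ≤ k + N) ∧ 0 ≤ W.eps + N := by
    refine ⟨(m.map Int.natAbs).sum + W.eps.natAbs, fun k hk => ?_, by omega⟩
    have := Multiset.single_le_sum (fun _ _ => Nat.zero_le _) _
      (Multiset.mem_map_of_mem Int.natAbs hk)
    omega
  have hX : (RatFunc.X : RatFunc ℂ) ≠ 0 := RatFunc.X_ne_zero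
  have hXz : ∀ k : ℤ, 0 ≤ k + N → (RatFunc.X : RatFunc ℂ) ^ k * RatFunc.X ^ N =
      algebraMap ℂ[X] (RatFunc ℂ) (X ^ (k + N).toNat) := by
    intro k hk
    rw [map_pow, RatFunc.algebraMap_X, ← zpow_natCast _ N, ← zpow_add₀ hX, ← zpow_natCast,
      Int.toNat_of_nonneg hk]
  have e1 : W.chiRat * RatFunc.X ^ N = algebraMap ℂ[X] (RatFunc ℂ)
      (X ^ (W.eps + N).toNat * (W.jac Finset.univ).map (Int.castRingHom ℂ)) := by
    rw [jac_map_algebraMap hW, map_mul, ← hXz _ hNε]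
    ring
  have e2 : (m.map fun k => (RatFunc.X : RatFunc ℂ) ^ k).sum * RatFunc.X ^ N =
      algebraMap ℂ[X] (RatFunc ℂ) (m.map fun k : ℤ => (X : ℂ[X]) ^ (k + N).toNat).sum := by
    rw [map_multiset_sum, Multiset.map_map, ← Multiset.sum_map_mul_right]
    congr 1
    exact Multiset.map_congr rfl fun k hk => hXz k (hN k hk)
  have e3 : ∀ j : ℕ, m.countP (fun k : ℤ => (k + N).toNat = j) = m.count ((j : ℤ) - N) := by
    intro j
    rw [Multiset.count]
    refine Multiset.countP_congr rfl fun k hk => ?_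
    have := hN k hk
    rw [eq_iff_iff]
    omega
  have e4 : W.IsExponents m ↔ X ^ (W.eps + N).toNat *
      (W.jac Finset.univ).map (Int.castRingHom ℂ) =
        (m.map fun k : ℤ => (X : ℂ[X]) ^ (k + N).toNat).sum := by
    rw [← (RatFunc.algebraMap_injective ℂ).eq_iff, ← e1, ← e2,
      mul_left_inj' (pow_ne_zero N hX)]
    rfl
  rw [e4, Polynomial.ext_iff]
  have e5 : ∀ j : ℕ, (X ^ (W.eps + N).toNat *
      (W.jac Finset.univ).map (Int.castRingHom ℂ)).coeff j = (W.spec ((j : ℤ) - N) : ℂ) := by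
    intro j
    rw [coeff_X_pow_mul', spec, coeff_map]
    by_cases h : (W.eps + N).toNat ≤ j
    · rw [if_pos h, if_pos (by omega)]
      have : j - (W.eps + N).toNat = ((j : ℤ) - N - W.eps).toNat := by omega
      rw [this]
      simp
    · rw [if_neg h, if_neg (by omega)]
      simp
  simp only [e5, coeff_sum_map_X_pow, e3]
  constructor
  · intro H k
    by_cases hk : 0 ≤ k + N
    · have := H (k + N).toNat
      rw [show (((k + N).toNat : ℤ) - N) = k by omega] at this
      exact_mod_cast this.symm
    · rw [Multiset.count_eq_zero_of_notMem fun h => hk (hN k h), spec, if_neg (by omega)]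
      rfl
  · intro H j
    exact_mod_cast (H _).symm

theorem spec_nonneg_iff (W : WeightSystem) :
    (∀ m, 0 ≤ W.spec m) ↔ ∀ n, 0 ≤ (W.jac Finset.univ).coeff n := by
  constructor
  · intro H n
    have := H (n + W.eps)
    rw [spec, if_pos (by omega)] at this
    simpa using this
  · intro H m
    rw [spec]
    split_ifs
    · exact H _
    · exact le_rfl

theorem isExponents_expMultiset {W : WeightSystem} (hW : W.HasJac Finset.univ)
    (h0 : ∀ m, 0 ≤ W.spec m) : W.IsExponents W.expMultiset := by
  rw [isExponents_iff hW]
  intro k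
  rw [count_expMultiset, Int.toNat_of_nonneg (h0 k)]

theorem IsExponents.spec_nonneg {W : WeightSystem} (hW : W.HasJac Finset.univ) {m : Multiset ℤ}
    (hm : W.IsExponents m) (k : ℤ) : 0 ≤ W.spec k := by
  rw [← (isExponents_iff hW m).mp hm k]
  positivity

theorem IsExponents.eq_expMultiset {W : WeightSystem} (hW : W.HasJac Finset.univ) {m : Multiset ℤ}
    (hm : W.IsExponents m) : m = W.expMultiset := by
  ext k
  rw [count_expMultiset, ← (isExponents_iff hW m).mp hm k, Int.toNat_natCast]

theorem sum_a_eq (W : WeightSystem) : (∑ i, (W.a i : ℤ)) = W.eps + W.h := by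
  rw [eps]; ring

theorem countP_expMultiset {W : WeightSystem} (h0 : ∀ m, 0 ≤ W.spec m) (r : ℤ) :
    (W.expMultiset.countP (fun k => (W.h : ℤ) ∣ k - r) : ℤ) = W.res Finset.univ r := by
  rw [expMultiset, Multiset.countP_eq_card_filter, res]
  have h1 : (∑ n ∈ (W.jac Finset.univ).support,
      Multiset.replicate ((W.jac Finset.univ).coeff n).toNat ((n : ℤ) + W.eps)).filter
        (fun k => (W.h : ℤ) ∣ k - r) = ∑ n ∈ (W.jac Finset.univ).support,
      (Multiset.replicate ((W.jac Finset.univ).coeff n).toNat ((n : ℤ) + W.eps)).filter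
        (fun k => (W.h : ℤ) ∣ k - r) := by
    induction (W.jac Finset.univ).support using Finset.induction_on with
    | empty => simp
    | insert i s hi ih => rw [Finset.sum_insert hi, Finset.sum_insert hi, Multiset.filter_add, ih]
  rw [h1, Multiset.card_sum, Nat.cast_sum]
  refine Finset.sum_congr rfl fun n _ => ?_
  have h2 : (W.h : ℤ) ∣ n + (∑ i, (W.a i : ℤ)) - r ↔ (W.h : ℤ) ∣ (n : ℤ) + W.eps - r := by
    rw [sum_a_eq, show (n : ℤ) + (W.eps + W.h) - r = n + W.eps - r + W.h by ring,
      dvd_add_self_right]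
  simp only [h2]
  split_ifs with h
  · rw [Multiset.filter_eq_self.mpr fun k hk => by rw [Multiset.eq_of_mem_replicate hk]; exact h,
      Multiset.card_replicate, Int.toNat_of_nonneg ((spec_nonneg_iff W).mp h0 n)]
  · rw [Multiset.filter_eq_nil.mpr fun k hk => by rw [Multiset.eq_of_mem_replicate hk]; exact h]
    rfl

theorem expTwoPi_div_h (W : WeightSystem) (k : ℤ) : expTwoPi ((k : ℝ) / W.h) = W.zeta ^ k := by
  rw [expTwoPi, zeta, ← Complex.exp_int_mul]
  congr 1
  push_cast
  ring

theorem charPoly_eq (W : WeightSystem) (m : Multiset ℤ) :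
    W.charPoly m = (m.map fun k => X - C (W.zeta ^ k)).prod := by
  simp only [charPoly, Multiset.bind_def, Multiset.pure_def, Multiset.bind_singleton,
    Multiset.map_map, Function.comp_def, expTwoPi_div_h]

theorem rootMultiplicity_charPoly (W : WeightSystem) (m : Multiset ℤ) (r : ℤ) :
    rootMultiplicity (W.zeta ^ r) (W.charPoly m) = m.countP fun k => (W.h : ℤ) ∣ k - r := by
  classical
  have h1 : W.charPoly m = ((m.map fun k => W.zeta ^ k).map fun a => X - C a).prod := by
    rw [charPoly_eq, Multiset.map_map]
    rfl
  rw [← count_roots, h1, roots_multiset_prod_X_sub_C, Multiset.count_map,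
    Multiset.countP_eq_card_filter]
  congr 1
  refine Multiset.filter_congr fun k _ => ?_
  rw [← zeta_zpow_eq_one_iff, zpow_sub₀ W.zeta_ne_zero,
    div_eq_one_iff_eq (zpow_ne_zero _ W.zeta_ne_zero), eq_comm]

/-- The numerator of `∏ (λ ^ i - 1) ^ f i`. -/
noncomputable def posPart (S : Finset ℕ) (f : ℕ → ℤ) : ℂ[X] :=
  ∏ i ∈ S, (X ^ i - 1) ^ (f i).toNat

theorem posPart_ne_zero {S : Finset ℕ} (hS : ∀ i ∈ S, i ≠ 0) (f : ℕ → ℤ) : posPart S f ≠ 0 :=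
  Finset.prod_ne_zero_iff.mpr fun i hi => pow_ne_zero _ (X_pow_sub_one_ne_zero (hS i hi))

theorem monic_posPart {S : Finset ℕ} (hS : ∀ i ∈ S, i ≠ 0) (f : ℕ → ℤ) : (posPart S f).Monic :=
  monic_prod_of_monic _ _ fun i hi => by
    refine Monic.pow ?_ _
    simpa using monic_X_pow_sub_C (1 : ℂ) (hS i hi)

theorem prod_zpow_eq_div {S : Finset ℕ} (hS : ∀ i ∈ S, i ≠ 0) (f : ℕ → ℤ) :
    ∏ i ∈ S, ((RatFunc.X : RatFunc ℂ) ^ i - 1) ^ f i =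
      algebraMap ℂ[X] (RatFunc ℂ) (posPart S f) /
        algebraMap ℂ[X] (RatFunc ℂ) (posPart S (-f)) := by
  simp only [posPart, map_prod, map_pow, map_sub, RatFunc.algebraMap_X, map_one]
  rw [← Finset.prod_div_distrib]
  refine Finset.prod_congr rfl fun i hi => ?_
  have h0 : (RatFunc.X : RatFunc ℂ) ^ i - 1 ≠ 0 := by
    intro h0
    have h2 : algebraMap ℂ[X] (RatFunc ℂ) (X ^ i - 1) = 0 := by
      simpa only [map_sub, map_pow, RatFunc.algebraMap_X, map_one] using h0
    rw [map_eq_zero_iff _ (RatFunc.algebraMap_injective ℂ)] at h2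
    exact X_pow_sub_one_ne_zero (hS i hi) h2
  rw [← zpow_natCast (_ - 1), ← zpow_natCast (_ - 1), ← zpow_sub₀ h0]
  congr 1
  simp only [Pi.neg_apply]
  omega

theorem rootMultiplicity_posPart {S : Finset ℕ} (hS : ∀ i ∈ S, i ≠ 0) (f : ℕ → ℤ) (z : ℂ) :
    (rootMultiplicity z (posPart S f) : ℤ) - rootMultiplicity z (posPart S (-f)) =
      ∑ i ∈ S, if z ^ i = 1 then f i else 0 := by
  rw [posPart, posPart, rootMultiplicity_prod_X_pow_sub_one S (fun i => i) _ hS,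
    rootMultiplicity_prod_X_pow_sub_one S (fun i => i) _ hS, Nat.cast_sum, Nat.cast_sum,
    ← Finset.sum_sub_distrib]
  refine Finset.sum_congr rfl fun i _ => ?_
  simp only [Pi.neg_apply]
  split_ifs <;> omega

theorem eq_of_forall_rootMultiplicity_eq {p q : ℂ[X]} (hp : p.Monic) (hq : q.Monic)
    (H : ∀ z, rootMultiplicity z p = rootMultiplicity z q) : p = q := by
  classical
  rw [(IsAlgClosed.splits p).eq_prod_roots_of_monic hp,
    (IsAlgClosed.splits q).eq_prod_roots_of_monic hq]
  congr 2
  ext z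
  rw [count_roots, count_roots, H]

/-- Monic polynomials over `ℂ` agree when their root multiplicities do. All elements of `M` divide
`h`, so only the points `zeta ^ r` matter. -/
theorem charPoly_eq_iff (W : WeightSystem) (m : Multiset ℤ) (e : ℕ → ℤ) :
    algebraMap ℂ[X] (RatFunc ℂ) (W.charPoly m) =
      ∏ i ∈ W.M, ((RatFunc.X : RatFunc ℂ) ^ i - 1) ^ e i ↔
    ∀ r : ℤ, (m.countP (fun k => (W.h : ℤ) ∣ k - r) : ℤ) =
      ∑ i ∈ W.M, if (W.h : ℤ) ∣ i * r then e i else 0 := by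
  classical
  have hS : ∀ i ∈ W.M, i ≠ 0 := fun i hi =>
    (Nat.pos_of_mem_divisors (W.M_subset_divisors hi)).ne'
  have hmon : (W.charPoly m).Monic := by
    rw [charPoly_eq]
    exact monic_multiset_prod_of_monic _ _ fun _ _ => monic_X_sub_C _
  rw [prod_zpow_eq_div hS, eq_div_iff (RatFunc.algebraMap_ne_zero (posPart_ne_zero hS _)),
    ← map_mul, (RatFunc.algebraMap_injective ℂ).eq_iff]
  have hmul : ∀ z, rootMultiplicity z (W.charPoly m * posPart W.M (-e)) =
      rootMultiplicity z (W.charPoly m) + rootMultiplicity z (posPart W.M (-e)) := fun z =>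
    rootMultiplicity_mul (mul_ne_zero hmon.ne_zero (posPart_ne_zero hS _))
  have hif : ∀ (r : ℤ) (i : ℕ), (W.zeta ^ r) ^ i = 1 ↔ (W.h : ℤ) ∣ i * r := by
    intro r i
    rw [← zpow_natCast, ← zpow_mul, zeta_zpow_eq_one_iff, mul_comm]
  constructor
  · intro H r
    have h1 := congrArg (rootMultiplicity (W.zeta ^ r)) H
    rw [hmul, rootMultiplicity_charPoly] at h1
    have h2 := rootMultiplicity_posPart hS e (W.zeta ^ r)
    simp only [hif] at h2
    rw [← h2]
    omega
  · intro H
    refine eq_of_forall_rootMultiplicity_eq (hmon.mul (monic_posPart hS _)) (monic_posPart hS _)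
      fun z => ?_
    rw [hmul]
    have h2 := rootMultiplicity_posPart hS e z
    by_cases hz : z ^ W.h = 1
    · have : NeZero W.h := ⟨W.h_pos.ne'⟩
      obtain ⟨r, -, hr⟩ := W.isPrimitiveRoot_zeta.eq_pow_of_pow_eq_one hz
      rw [← zpow_natCast] at hr
      subst hr
      rw [rootMultiplicity_charPoly]
      simp only [hif] at h2
      rw [← H] at h2
      omega
    · have h3 : ∑ i ∈ W.M, (if z ^ i = 1 then e i else 0) = 0 := by
        refine Finset.sum_eq_zero fun i hi => if_neg fun h => hz ?_
        obtain ⟨c, hc⟩ := Nat.dvd_of_mem_divisors (W.M_subset_divisors hi)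
        rw [hc, pow_mul, h, one_pow]
      have h4 : rootMultiplicity z (W.charPoly m) = 0 := by
        apply rootMultiplicity_eq_zero
        rw [IsRoot, charPoly_eq, eval_multiset_prod, Multiset.prod_eq_zero_iff, Multiset.map_map,
          Multiset.mem_map]
        rintro ⟨k, -, hk⟩
        simp only [Function.comp, eval_sub, eval_X, eval_C] at hk
        rw [sub_eq_zero] at hk
        apply hz
        rw [hk, ← zpow_natCast, zpow_comm, zpow_natCast, W.isPrimitiveRoot_zeta.pow_eq_one,
          one_zpow]
      rw [h3] at h2
      omega

theorem sum_M_eq_sum_divisors (W : WeightSystem) (P : ℕ → Prop) [DecidablePred P] {f : ℕ → ℚ}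
    (hf : ∀ i, i ∉ W.M → f i = 0) :
    ∑ i ∈ W.M, (if P i then f i else 0) = ∑ i ∈ W.h.divisors, if P i then f i else 0 :=
  Finset.sum_subset W.M_subset_divisors fun i _ hi => by simp [hf i hi]

/-- Root multiplicities give the sums of `e` over the `i` with `h ∣ i * r`, and `cyc` has the same
sums by `res_univ_eq`. These sums determine a function on the divisors of `h`. Nonnegativity of
`spec` is what the existence of a multiset of exponents requires. -/
theorem isCyclotomicExponents_iff {W : WeightSystem} (hred : W.IsReduced) (hW : W.CountRegular)
    (e : ℕ → ℤ) : W.IsCyclotomicExponents e ↔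
      (∀ m, 0 ≤ W.spec m) ∧ ∀ j, (e j : ℚ) = W.cyc j := by
  have hJ := hW.hasJac_univ
  have hcast : ∀ r : ℤ, ((∑ i ∈ W.M, if (W.h : ℤ) ∣ i * r then e i else 0 : ℤ) : ℚ) =
      ∑ i ∈ W.M, if (W.h : ℤ) ∣ i * r then (e i : ℚ) else 0 := by
    intro r
    rw [Int.cast_sum]
    refine Finset.sum_congr rfl fun i _ => ?_
    split_ifs <;> simp
  constructor
  · rintro ⟨h0, m, hm, hc⟩
    have hnn := hm.spec_nonneg hJ
    refine ⟨hnn, ?_⟩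
    obtain rfl := hm.eq_expMultiset hJ
    rw [charPoly_eq_iff] at hc
    have h1 : ∀ r : ℤ, ∑ i ∈ W.h.divisors, (if (W.h : ℤ) ∣ i * r then (e i : ℚ) else 0) =
        ∑ i ∈ W.h.divisors, if (W.h : ℤ) ∣ i * r then W.cyc i else 0 := by
      intro r
      rw [← hW.res_univ_eq, ← countP_expMultiset hnn, hc, hcast,
        sum_M_eq_sum_divisors W _ fun i hi => by rw [h0 i hi]; rfl]
    -- Under `j ↦ h / j` the condition `h ∣ i * k` becomes `j ∣ k`, so that divisor sums can be
    -- inverted.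
    have h2 : ∀ j, j ∣ W.h → (e (W.h / j) : ℚ) = W.cyc (W.h / j) := by
      intro j hj
      refine eq_of_sum_divisors_eq W.h_pos.ne' (fun j => (e (W.h / j) : ℚ))
        (fun j => W.cyc (W.h / j)) (fun k _ => ?_) hj
      have h3 : ∀ f : ℕ → ℚ, ∑ j ∈ W.h.divisors, (if j ∣ k then f (W.h / j) else 0) =
          ∑ i ∈ W.h.divisors, if (W.h : ℤ) ∣ i * (k : ℤ) then f i else 0 := by
        intro f
        rw [← Nat.sum_div_divisors]
        refine Finset.sum_congr rfl fun i hi => ?_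
        have hi' := Nat.dvd_of_mem_divisors hi
        rw [Nat.div_div_self hi' W.h_pos.ne']
        have : W.h / i ∣ k ↔ (W.h : ℤ) ∣ i * (k : ℤ) := by
          rw [← Nat.cast_mul, Int.natCast_dvd_natCast]
          exact Nat.div_dvd_iff_dvd_mul hi' (Nat.pos_of_mem_divisors hi)
        simp only [this]
      rw [h3 fun i => (e i : ℚ), h3 W.cyc, h1]
    intro j
    by_cases hj : j ∣ W.h
    · have := h2 (W.h / j) (Nat.div_dvd_of_dvd hj)
      rwa [Nat.div_div_self hj W.h_pos.ne'] at this
    · rw [cyc_eq_zero_of_not_dvd hj, h0 j fun h => hj (Nat.dvd_of_mem_divisors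
        (W.M_subset_divisors h))]
      rfl
  · rintro ⟨hnn, he⟩
    refine ⟨fun i hi => ?_, W.expMultiset, isExponents_expMultiset hJ hnn, ?_⟩
    · have := he i
      rw [hred.cyc_eq_zero hi] at this
      exact_mod_cast this
    · rw [charPoly_eq_iff]
      intro r
      rw [countP_expMultiset hnn]
      have h1 := hW.res_univ_eq r
      have h2 := hcast r
      rw [sum_M_eq_sum_divisors W _ fun i hi => by rw [he, hred.cyc_eq_zero hi]] at h2
      simp only [he] at h2
      rw [← h2] at h1
      exact_mod_cast h1

/-- The order of vanishing at a primitive `d`-th root of unity is the sum of the exponents over the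
multiples of `d`. These sums determine the exponents from the largest index downwards. -/
theorem prod_zpow_eq_iff {S S' : Finset ℕ} (hS : ∀ i ∈ S, i ≠ 0) (hS' : ∀ i ∈ S', i ≠ 0)
    (f f' : ℕ → ℤ) :
    ∏ i ∈ S, ((RatFunc.X : RatFunc ℂ) ^ i - 1) ^ f i =
      ∏ i ∈ S', ((RatFunc.X : RatFunc ℂ) ^ i - 1) ^ f' i ↔
    ∀ i, (if i ∈ S then f i else 0) = if i ∈ S' then f' i else 0 := by
  constructor
  · intro H
    rw [prod_zpow_eq_div hS, prod_zpow_eq_div hS',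
      div_eq_div_iff (RatFunc.algebraMap_ne_zero (posPart_ne_zero hS _))
        (RatFunc.algebraMap_ne_zero (posPart_ne_zero hS' _)), ← map_mul, ← map_mul,
      (RatFunc.algebraMap_injective ℂ).eq_iff] at H
    have h1 : ∀ d, d ≠ 0 → ∑ i ∈ S, (if d ∣ i then f i else 0) =
        ∑ i ∈ S', if d ∣ i then f' i else 0 := by
      intro d hd
      obtain ⟨z, hz⟩ : ∃ z : ℂ, IsPrimitiveRoot z d := ⟨_, Complex.isPrimitiveRoot_exp d hd⟩
      have h2 := congrArg (rootMultiplicity z) H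
      rw [rootMultiplicity_mul (mul_ne_zero (posPart_ne_zero hS _) (posPart_ne_zero hS' _)),
        rootMultiplicity_mul (mul_ne_zero (posPart_ne_zero hS' _) (posPart_ne_zero hS _))] at h2
      have h3 := rootMultiplicity_posPart hS f z
      have h4 := rootMultiplicity_posPart hS' f' z
      simp only [hz.pow_eq_one_iff_dvd] at h3 h4
      omega
    obtain ⟨N, hN⟩ : ∃ N, ∀ i, i ∈ S ∪ S' → i < N := by
      refine ⟨(S ∪ S').sup id + 1, fun i hi => Nat.lt_succ_of_le (Finset.le_sup (f := id) hi)⟩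
    have h2 : ∀ (T : Finset ℕ) (g : ℕ → ℤ), (∀ i ∈ T, i ≠ 0) → T ⊆ S ∪ S' → ∀ d,
        ∑ i ∈ T, (if d ∣ i then g i else 0) =
          ∑ i ∈ (Finset.Ico 1 N).filter (d ∣ ·), if i ∈ T then g i else 0 := by
      intro T g hT hTS d
      rw [← Finset.sum_filter, ← Finset.sum_filter]
      refine Finset.sum_congr ?_ fun _ _ => rfl
      ext i
      simp only [Finset.mem_filter, Finset.mem_Ico]
      constructor
      · rintro ⟨hi, hd⟩
        have := hN i (hTS hi)
        have := hT i hi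
        exact ⟨⟨⟨by omega, by omega⟩, hd⟩, hi⟩
      · rintro ⟨⟨-, hd⟩, hi⟩
        exact ⟨hi, hd⟩
    -- Downward induction on `d`, measured by `N - d`: the proper multiples of `d` are already known
    -- and are subtracted.
    have h3 : ∀ k d, N - d ≤ k → d ≠ 0 →
        (if d ∈ S then f d else 0) = if d ∈ S' then f' d else 0 := by
      intro k
      induction k with
      | zero =>
        intro d hd _
        have h4 : ∀ i, i ∈ S ∪ S' → i ≠ d := fun i hi => by have := hN i hi; omega
        rw [if_neg fun h => h4 d (Finset.mem_union_left _ h) rfl,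
          if_neg fun h => h4 d (Finset.mem_union_right _ h) rfl]
      | succ k ih =>
        intro d hd hd0
        by_cases hdN : N ≤ d
        · exact ih d (by omega) hd0
        · have h4 := h1 d hd0
          rw [h2 S f hS Finset.subset_union_left, h2 S' f' hS' Finset.subset_union_right] at h4
          have hmem : d ∈ (Finset.Ico 1 N).filter (d ∣ ·) := by
            simp only [Finset.mem_filter, Finset.mem_Ico, dvd_refl, and_true]
            omega
          rw [← Finset.add_sum_erase _ _ hmem,
            ← Finset.add_sum_erase _ (fun i => if i ∈ S' then f' i else 0) hmem] at h4
          have h5 : ∑ i ∈ ((Finset.Ico 1 N).filter (d ∣ ·)).erase d, (if i ∈ S then f i else 0) =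
              ∑ i ∈ ((Finset.Ico 1 N).filter (d ∣ ·)).erase d, if i ∈ S' then f' i else 0 := by
            refine Finset.sum_congr rfl fun i hi => ?_
            simp only [Finset.mem_erase, Finset.mem_filter, Finset.mem_Ico] at hi
            have := Nat.le_of_dvd (by omega) hi.2.2
            exact ih i (by omega) (by omega)
          omega
    intro d
    by_cases hd : d = 0
    · rw [if_neg fun h => hS d h hd, if_neg fun h => hS' d h hd]
    · exact h3 _ d le_rfl hd
  · intro H
    have h1 : ∀ (T : Finset ℕ) (g : ℕ → ℤ), T ⊆ S ∪ S' →
        ∏ i ∈ T, ((RatFunc.X : RatFunc ℂ) ^ i - 1) ^ g i =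
          ∏ i ∈ S ∪ S', ((RatFunc.X : RatFunc ℂ) ^ i - 1) ^ (if i ∈ T then g i else 0) := by
      intro T g hT
      rw [← Finset.prod_subset hT fun i _ hi => by rw [if_neg hi, zpow_zero]]
      exact Finset.prod_congr rfl fun i hi => by rw [if_pos hi]
    rw [h1 S f Finset.subset_union_left, h1 S' f' Finset.subset_union_right]
    simp only [H]

/-- Saito's duality for the exponents of the characteristic polynomials. -/
def CycDual (W' W : WeightSystem) : Prop :=
  ∀ i, W'.cyc i = if i ∣ W.h then -W.cyc (W.h / i) else 0

/-- Exponents of `λ ^ i - 1` in a product are unique, so the polynomial identity is one between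
values of `cyc`. -/
theorem isCharPolyDual_iff {W W' : WeightSystem} (hred : W.IsReduced) (hW : W.CountRegular)
    (hred' : W'.IsReduced) (hW' : W'.CountRegular) : IsCharPolyDual W' W ↔
      (∀ m, 0 ≤ W.spec m) ∧ (∀ m, 0 ≤ W'.spec m) ∧ CycDual W' W := by
  have hS : ∀ i ∈ W'.M, i ≠ 0 := fun i hi =>
    (Nat.pos_of_mem_divisors (W'.M_subset_divisors hi)).ne'
  have hS' : ∀ i ∈ W.h.divisors, i ≠ 0 := fun i hi => (Nat.pos_of_mem_divisors hi).ne'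
  have key : ∀ e e' : ℕ → ℤ, (∀ j, (e j : ℚ) = W.cyc j) → (∀ j, (e' j : ℚ) = W'.cyc j) →
      (∏ i ∈ W'.M, ((RatFunc.X : RatFunc ℂ) ^ i - 1) ^ e' i =
        ∏ i ∈ W.h.divisors, ((RatFunc.X : RatFunc ℂ) ^ i - 1) ^ (-e (W.h / i)) ↔
      CycDual W' W) := by
    intro e e' he he'
    rw [prod_zpow_eq_iff hS hS' e' fun i => -e (W.h / i)]
    refine forall_congr' fun i => ?_
    rw [← he', ← he, ← Int.cast_neg, ← Int.cast_zero (R := ℚ), ← apply_ite Int.cast,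
      Int.cast_inj]
    have h1 : (if i ∈ W'.M then e' i else 0) = e' i := by
      split_ifs with h
      · rfl
      · have := he' i
        rw [hred'.cyc_eq_zero h] at this
        exact_mod_cast this.symm
    rw [h1]
    simp only [Nat.mem_divisors, W.h_pos.ne', ne_eq, not_false_eq_true, and_true]
  constructor
  · rintro ⟨e, e', h, h', H⟩
    rw [isCyclotomicExponents_iff hred hW] at h
    rw [isCyclotomicExponents_iff hred' hW'] at h'
    exact ⟨h.1, h'.1, (key e e' h.2 h'.2).mp H⟩
  · rintro ⟨h0, h0', H⟩
    obtain ⟨e, he⟩ := hW.exists_cyc_eq_int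
    obtain ⟨e', he'⟩ := hW'.exists_cyc_eq_int
    exact ⟨e, e', (isCyclotomicExponents_iff hred hW e).mpr ⟨h0, he⟩,
      (isCyclotomicExponents_iff hred' hW' e').mpr ⟨h0', he'⟩, (key e e' he he').mpr H⟩

end WeightSystem

/-! ### Invariant parts of the fixed loci -/

namespace WeightSystem
open Polynomial

theorem spec_symm {W : WeightSystem} (hJ : W.HasJac Finset.univ) (m : ℤ) :
    W.spec (W.h - m) = W.spec m := by
  have hdeg : ((W.jac Finset.univ).natDegree : ℤ) = W.h - 2 * W.eps := by
    rw [hJ.natDegree_jac, Nat.cast_sum, eps]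
    have : ∀ i ∈ Finset.univ, ((W.h - 2 * W.a i : ℕ) : ℤ) = W.h - 2 * W.a i := by
      intro i _
      have := W.two_mul_a_le i
      omega
    rw [Finset.sum_congr rfl this, Finset.sum_sub_distrib, ← Finset.mul_sum]
    simp
    ring
  rw [spec, spec]
  by_cases h1 : W.eps ≤ W.h - m <;> by_cases h2 : W.eps ≤ m
  · rw [if_pos h1, if_pos h2]
    apply hJ.coeff_symm
    omega
  · rw [if_pos h1, if_neg h2]
    apply coeff_eq_zero_of_natDegree_lt
    omega
  · rw [if_neg h1, if_pos h2]
    symm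
    apply coeff_eq_zero_of_natDegree_lt
    omega
  · rw [if_neg h1, if_neg h2]

/-- The part of the Poincaré polynomial in the variables in `J` which is invariant under `G₀`. -/
noncomputable def invPart (W : WeightSystem) (J : Finset (Fin 3)) (S : ℂ) : ℂ :=
  ∑ n ∈ (W.jac J).support,
    if (W.h : ℤ) ∣ n + (∑ i ∈ J, (W.a i : ℤ)) - 0 then ((W.jac J).coeff n : ℂ) * S ^ n else 0

theorem invPart_empty (W : WeightSystem) (S : ℂ) : W.invPart ∅ S = 1 := by
  have h1 : W.jac ∅ = 1 := by simp [jac]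
  rw [invPart, h1, ← C_1, support_C one_ne_zero, Finset.sum_singleton]
  simp

theorem res_empty (W : WeightSystem) : W.res ∅ 0 = 1 := by
  have h1 : W.jac ∅ = 1 := by simp [jac]
  rw [res, h1, ← C_1, support_C one_ne_zero, Finset.sum_singleton]
  simp

/-- The degree of `jac {i}` is `h - 2 * a i`, so the shifted degrees lie between `a i` and `h - a
i`. -/
theorem HasJac.not_dvd_of_card_one {W : WeightSystem} {i : Fin 3} (hJ : W.HasJac {i}) {n : ℕ}
    (hn : n ∈ (W.jac {i}).support) : ¬ (W.h : ℤ) ∣ n + (∑ i ∈ {i}, (W.a i : ℤ)) - 0 := by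
  have h1 := le_natDegree_of_mem_supp _ hn
  rw [hJ.natDegree_jac, Finset.sum_singleton] at h1
  rw [Finset.sum_singleton, sub_zero]
  have := W.a_pos i
  have := W.two_mul_a_le i
  intro h
  have := Int.le_of_dvd (by omega) h
  omega

theorem HasJac.invPart_singleton {W : WeightSystem} {i : Fin 3} (hJ : W.HasJac {i}) (S : ℂ) :
    W.invPart {i} S = 0 :=
  Finset.sum_eq_zero fun _ hn => if_neg (hJ.not_dvd_of_card_one hn)

theorem HasJac.res_singleton {W : WeightSystem} {i : Fin 3} (hJ : W.HasJac {i}) :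
    W.res {i} 0 = 0 :=
  Finset.sum_eq_zero fun _ hn => if_neg (hJ.not_dvd_of_card_one hn)

/-- The shifted degrees are positive and less than `2 * h`, so the only available multiple of `h` is
`h`, the middle degree. -/
theorem HasJac.dvd_iff_of_card_two {W : WeightSystem} {i j : Fin 3} (hij : i ≠ j)
    (hJ : W.HasJac {i, j}) {n : ℕ} (hn : n ∈ (W.jac {i, j}).support) :
    (W.h : ℤ) ∣ n + (∑ i ∈ {i, j}, (W.a i : ℤ)) - 0 ↔ n = W.h - W.a i - W.a j := by
  have h1 := le_natDegree_of_mem_supp _ hn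
  rw [hJ.natDegree_jac, Finset.sum_pair hij] at h1
  rw [Finset.sum_pair hij, sub_zero]
  have := W.a_pos i
  have := W.two_mul_a_le i
  have := W.a_pos j
  have := W.two_mul_a_le j
  constructor
  · rintro ⟨c, hc⟩
    have hc1 : c = 1 := by
      have h2 : 0 < c := by
        by_contra! h
        nlinarith
      have h3 : c < 2 := by
        by_contra! h
        have := mul_le_mul_of_nonneg_left h (Int.natCast_nonneg W.h)
        omega
      omega
    subst hc1
    omega
  · intro h
    exact ⟨1, by omega⟩

theorem HasJac.res_pair {W : WeightSystem} {i j : Fin 3} (hij : i ≠ j)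
    (hJ : W.HasJac {i, j}) :
    W.res {i, j} 0 = (W.jac {i, j}).coeff (W.h - W.a i - W.a j) := by
  rw [res, Finset.sum_congr rfl fun n hn => by simp only [hJ.dvd_iff_of_card_two hij hn]; rfl,
    Finset.sum_ite_eq']
  split_ifs with h
  · rfl
  · exact (notMem_support_iff.mp h).symm

theorem HasJac.invPart_pair {W : WeightSystem} {i j : Fin 3} (hij : i ≠ j)
    (hJ : W.HasJac {i, j}) (S : ℂ) :
    W.invPart {i, j} S = W.res {i, j} 0 * S ^ (W.h - W.a i - W.a j) := by
  rw [hJ.res_pair hij, invPart,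
    Finset.sum_congr rfl fun n hn => by simp only [hJ.dvd_iff_of_card_two hij hn]; rfl,
    Finset.sum_ite_eq']
  split_ifs with h
  · rfl
  · rw [notMem_support_iff.mp h]
    simp

/-- Here the shifted degrees lie strictly between `0` and `3 * h`, so `h` and `2 * h` are possible.
They correspond to the exponents `0` and `h` and have the same multiplicity by `spec_symm`. -/
theorem HasJac.invPart_univ {W : WeightSystem} (hJ : W.HasJac Finset.univ) (S : ℂ) :
    W.invPart Finset.univ S = W.spec 0 * (S ^ (-W.eps) + S ^ (W.h - W.eps)) := by
  have hh := W.h_pos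
  have h2a := W.two_mul_a_le
  have hε : W.eps < W.h := by
    rw [eps, Fin.sum_univ_three]
    have := h2a 0
    have := h2a 1
    have := h2a 2
    omega
  have hε' : -(W.h : ℤ) < W.eps := by
    rw [eps, Fin.sum_univ_three]
    have := W.a_pos 0
    have := W.a_pos 1
    have := W.a_pos 2
    omega
  have hdeg : ((W.jac Finset.univ).natDegree : ℤ) = W.h - 2 * W.eps := by
    rw [hJ.natDegree_jac, Nat.cast_sum, eps]
    have : ∀ i ∈ Finset.univ, ((W.h - 2 * W.a i : ℕ) : ℤ) = W.h - 2 * W.a i := by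
      intro i _
      have := W.two_mul_a_le i
      omega
    rw [Finset.sum_congr rfl this, Finset.sum_sub_distrib, ← Finset.mul_sum]
    simp
    ring
  have h1 : ∀ n ∈ (W.jac Finset.univ).support,
      (if (W.h : ℤ) ∣ n + (∑ i, (W.a i : ℤ)) - 0 then
        ((W.jac Finset.univ).coeff n : ℂ) * S ^ n else 0) =
      (if (n : ℤ) = -W.eps then (W.spec 0 : ℂ) * S ^ (-W.eps) else 0) +
      (if (n : ℤ) = W.h - W.eps then (W.spec 0 : ℂ) * S ^ (W.h - W.eps) else 0) := by
    intro n hn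
    have h3 := le_natDegree_of_mem_supp _ hn
    by_cases e1 : (n : ℤ) = -W.eps
    · have hd : (W.h : ℤ) ∣ n + (∑ i, (W.a i : ℤ)) - 0 := by
        rw [sum_a_eq]
        exact ⟨1, by omega⟩
      have e2 : ¬ (n : ℤ) = W.h - W.eps := by omega
      rw [if_pos e1, if_neg e2, if_pos hd, add_zero, spec, if_pos (by omega), ← e1, zpow_natCast]
      congr 3
      omega
    · by_cases e2 : (n : ℤ) = W.h - W.eps
      · have hd : (W.h : ℤ) ∣ n + (∑ i, (W.a i : ℤ)) - 0 := by
          rw [sum_a_eq]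
          exact ⟨2, by omega⟩
        rw [if_neg e1, if_pos e2, if_pos hd, zero_add, ← spec_symm hJ, spec, if_pos (by omega), ← e2, zpow_natCast]
        congr 3
        omega
      · rw [if_neg e1, if_neg e2, add_zero, if_neg]
        rw [sum_a_eq]
        rintro ⟨c, hc⟩
        have h4 : 0 < c := by
          by_contra! h
          nlinarith
        have h5 : c < 3 := by
          by_contra! h
          nlinarith
        obtain rfl | rfl : c = 1 ∨ c = 2 := by omega
        · omega
        · omega
  have h6 : ∀ m : ℤ, 0 ≤ m → W.spec 0 = (W.jac Finset.univ).coeff m.toNat → ∀ x : ℂ,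
      ∑ n ∈ (W.jac Finset.univ).support, (if (n : ℤ) = m then (W.spec 0 : ℂ) * x else 0) =
        W.spec 0 * x := by
    intro m hm hs x
    have : ∀ n ∈ (W.jac Finset.univ).support, (if (n : ℤ) = m then (W.spec 0 : ℂ) * x else 0) =
        if n = m.toNat then (W.spec 0 : ℂ) * x else 0 := by
      intro n _
      exact if_congr (by omega) rfl rfl
    rw [Finset.sum_congr rfl this, Finset.sum_ite_eq']
    split_ifs with h
    · rfl
    · rw [hs, notMem_support_iff.mp h]
      simp
  rw [invPart, Finset.sum_congr rfl h1, Finset.sum_add_distrib, mul_add]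
  congr 1
  -- If `ε > 0` the degree `-ε` does not occur, in agreement with `spec 0 = 0`.
  · by_cases e : W.eps ≤ 0
    · refine h6 _ (by omega) ?_ _
      rw [spec, if_pos e]
      congr 1
      omega
    · rw [spec, if_neg e]
      simp
  · refine h6 _ (by omega) ?_ _
    rw [← spec_symm hJ, spec, if_pos (by omega), sub_zero]

theorem HasJac.res_univ_zero {W : WeightSystem} (hJ : W.HasJac Finset.univ) :
    W.res Finset.univ 0 = 2 * W.spec 0 := by
  have h1 := hJ.invPart_univ 1
  have h2 : W.invPart Finset.univ 1 = (W.res Finset.univ 0 : ℂ) := by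
    rw [invPart, res, Int.cast_sum]
    refine Finset.sum_congr rfl fun n _ => ?_
    split_ifs <;> simp
  rw [h2, one_zpow, one_zpow] at h1
  have h3 : (W.res Finset.univ 0 : ℂ) = ((2 * W.spec 0 : ℤ) : ℂ) := by
    rw [h1]; push_cast; ring
  exact_mod_cast h3

theorem card_cases (J : Finset (Fin 3)) :
    J = ∅ ∨ (∃ i, J = {i}) ∨ (∃ i j, i ≠ j ∧ J = {i, j}) ∨ J = Finset.univ := by
  revert J
  decide

/-- The invariant part of a twisted sector is concentrated in the middle degree. -/
theorem HasJac.invPart_eq {W : WeightSystem} {J : Finset (Fin 3)} (hJ : W.HasJac J)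
    (hne : J ≠ Finset.univ) (S : ℂ) :
    W.invPart J S = W.res J 0 * S ^ (((J.card / 2 : ℕ) : ℤ) * W.h - ∑ i ∈ J, (W.a i : ℤ)) := by
  rcases card_cases J with rfl | ⟨i, rfl⟩ | ⟨i, j, hij, rfl⟩ | rfl
  · rw [invPart_empty, res_empty]
    simp
  -- The rounding in `card / 2` is harmless for one variable, since the multiplicity is `0`.
  · rw [hJ.invPart_singleton, hJ.res_singleton]
    simp
  · rw [hJ.invPart_pair hij, Finset.card_pair hij, Finset.sum_pair hij, ← zpow_natCast]
    congr 2
    have := W.two_mul_a_le i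
    have := W.two_mul_a_le j
    push_cast
    omega
  · exact absurd rfl hne

/-! ### Evaluation of a sector in Vafa's formula -/

theorem omega_mul_eq_int_iff (W : WeightSystem) (k : ℕ) (i : Fin 3) :
    (∃ n : ℤ, W.omega i * ((k : ℤ) : ℝ) = n) ↔ i ∈ W.fixed k := by
  have hh : (W.h : ℝ) ≠ 0 := by exact_mod_cast W.h_pos.ne'
  rw [mem_fixed, ← Int.natCast_dvd_natCast, dvd_def]
  refine exists_congr fun n => ?_
  rw [omega, Int.cast_natCast]
  have : (W.a i : ℝ) / W.h * k = n ↔ (W.a i : ℝ) * k = W.h * n := by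
    constructor
    · intro h
      rw [← h]
      field_simp
    · intro h
      field_simp
      linarith
  rw [this]
  norm_cast

theorem omega_mul_sub_floor (W : WeightSystem) (k : ℕ) (i : Fin 3) :
    W.omega i * ((k : ℤ) : ℝ) - ⌊W.omega i * ((k : ℤ) : ℝ)⌋ = ((W.a i * k % W.h : ℕ) : ℝ) / W.h := by
  have h1 : W.omega i * ((k : ℤ) : ℝ) = ((W.a i * k : ℕ) : ℝ) / W.h := by
    rw [omega]; push_cast; ring
  have hh : (W.h : ℝ) ≠ 0 := by exact_mod_cast W.h_pos.ne'
  have h2 : ⌊((W.a i * k : ℕ) : ℝ) / W.h⌋ = ((W.a i * k / W.h : ℕ) : ℤ) := by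
    rw [← Nat.floor_div_eq_div (K := ℝ), Int.natCast_floor_eq_floor (by positivity)]
  rw [h1, h2]
  have h3 : ((W.a i * k : ℕ) : ℝ) = W.h * ((W.a i * k / W.h : ℕ) : ℝ) + ((W.a i * k % W.h : ℕ) : ℝ) := by
    rw [← Nat.cast_mul, ← Nat.cast_add, Nat.div_add_mod]
  rw [Int.cast_natCast]
  conv_lhs => rw [h3]
  field_simp
  ring

theorem expTwoPi_omega_mul (W : WeightSystem) (i : Fin 3) (b : ℕ) :
    expTwoPi (W.omega i * ((b : ℤ) : ℝ)) = (W.zeta ^ b) ^ W.a i := by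
  have := W.expTwoPi_div_h (b * W.a i)
  rw [← pow_mul, ← zpow_natCast]
  push_cast at this ⊢
  rw [← this, omega]
  congr 1
  ring

theorem expTwoPi_add (x y : ℝ) : expTwoPi (x + y) = expTwoPi x * expTwoPi y := by
  rw [expTwoPi, expTwoPi, expTwoPi, ← Complex.exp_add]
  congr 1
  push_cast
  ring

theorem expTwoPi_half : expTwoPi (1 / 2) = -1 := by
  rw [expTwoPi, ← Complex.exp_pi_mul_I]
  congr 1
  push_cast
  ring

theorem expTwoPi_one : expTwoPi 1 = 1 := by
  rw [expTwoPi]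
  simp [Complex.exp_two_pi_mul_I]

theorem expTwoPi_one_sub_omega_mul (W : WeightSystem) (i : Fin 3) (b : ℕ) :
    expTwoPi (1 - W.omega i * ((b : ℤ) : ℝ)) = (W.zeta ^ b) ^ (W.h - W.a i) := by
  have h1 : expTwoPi (1 - W.omega i * ((b : ℤ) : ℝ)) * expTwoPi (W.omega i * ((b : ℤ) : ℝ)) = 1 := by
    rw [← expTwoPi_add, sub_add_cancel, expTwoPi_one]
  rw [expTwoPi_omega_mul] at h1
  have h2 : (W.zeta ^ b) ^ (W.h - W.a i) * (W.zeta ^ b) ^ W.a i = 1 := by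
    rw [← pow_add, Nat.sub_add_cancel (W.a_lt_h i).le, ← pow_mul, mul_comm, pow_mul,
      W.isPrimitiveRoot_zeta.pow_eq_one, one_pow]
  exact mul_right_cancel₀ (pow_ne_zero _ (pow_ne_zero _ W.zeta_ne_zero)) (h1.trans h2.symm)

theorem rpow_omega (W : WeightSystem) (i : Fin 3) {x : ℝ} (hx : 0 < x) :
    x ^ W.omega i = (x ^ (1 / (W.h : ℝ))) ^ W.a i := by
  rw [← Real.rpow_natCast, ← Real.rpow_mul hx.le, omega]
  congr 1
  ring

theorem rpow_one_sub_omega (W : WeightSystem) (i : Fin 3) {x : ℝ} (hx : 0 < x) :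
    x ^ (1 - W.omega i) = (x ^ (1 / (W.h : ℝ))) ^ (W.h - W.a i) := by
  have hh : (W.h : ℝ) ≠ 0 := by exact_mod_cast W.h_pos.ne'
  rw [← Real.rpow_natCast, ← Real.rpow_mul hx.le, omega, Nat.cast_sub (W.a_lt_h i).le]
  congr 1
  field_simp

/-- The contribution of the fixed locus to a sector, for one group element. -/
theorem HasJac.prod_fixed {W : WeightSystem} {J : Finset (Fin 3)} (hJ : W.HasJac J) (b : ℕ)
    {x : ℝ} (hx : 0 < x) (hx1 : x ≠ 1) :
    ∏ i ∈ J, expTwoPi (W.omega i * ((b : ℤ) : ℝ) + 1 / 2) *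
      ((1 - expTwoPi (1 - W.omega i * ((b : ℤ) : ℝ)) * ((x ^ (1 - W.omega i) : ℝ) : ℂ)) /
        (1 - expTwoPi (W.omega i * ((b : ℤ) : ℝ)) * ((x ^ W.omega i : ℝ) : ℂ))) =
    (-1) ^ J.card * ((W.zeta ^ b) ^ (∑ i ∈ J, W.a i) *
      aeval (W.zeta ^ b * ((x ^ (1 / (W.h : ℝ)) : ℝ) : ℂ)) (W.jac J)) := by
  set z : ℂ := W.zeta ^ b * ((x ^ (1 / (W.h : ℝ)) : ℝ) : ℂ) with hz
  have hS : 0 < x ^ (1 / (W.h : ℝ)) := Real.rpow_pos_of_pos hx _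
  have hS1 : x ^ (1 / (W.h : ℝ)) ≠ 1 := by
    intro h
    have hh : (W.h : ℝ) ≠ 0 := by exact_mod_cast W.h_pos.ne'
    have h2 := congrArg (· ^ (W.h : ℝ)) h
    simp only [Real.one_rpow] at h2
    rw [← Real.rpow_mul hx.le, one_div_mul_cancel hh, Real.rpow_one] at h2
    exact hx1 h2
  have hnorm : ‖z‖ = x ^ (1 / (W.h : ℝ)) := by
    rw [hz, norm_mul, norm_pow, Complex.norm_eq_one_of_pow_eq_one
      W.isPrimitiveRoot_zeta.pow_eq_one W.h_pos.ne', one_pow, one_mul, Complex.norm_real,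
      Real.norm_of_nonneg hS.le]
  have hza : ∀ i, z ^ W.a i - 1 ≠ 0 := by
    intro i h
    rw [sub_eq_zero] at h
    have h1 := congrArg norm h
    rw [norm_pow, hnorm, norm_one] at h1
    exact hS1 ((pow_eq_one_iff_of_nonneg hS.le (W.a_pos i).ne').mp h1)
  have e1 := congrArg (aeval z) hJ.mul_jac
  simp only [map_mul, map_prod, map_sub, map_pow, aeval_X, map_one] at e1
  have hA : ∏ i ∈ J, (z ^ W.a i - 1) ≠ 0 := Finset.prod_ne_zero_iff.mpr fun i _ => hza i
  have e2 : aeval z (W.jac J) = ∏ i ∈ J, (z ^ (W.h - W.a i) - 1) / (z ^ W.a i - 1) := by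
    rw [Finset.prod_div_distrib, eq_div_iff hA, mul_comm, e1]
  rw [e2, ← Finset.prod_pow_eq_pow_sum, ← Finset.prod_mul_distrib, ← Finset.prod_const,
    ← Finset.prod_mul_distrib]
  refine Finset.prod_congr rfl fun i _ => ?_
  have hza' := hza i
  have hza'' : 1 - z ^ W.a i ≠ 0 := by
    rw [← neg_sub]
    exact neg_ne_zero.mpr hza'
  rw [expTwoPi_add, expTwoPi_half, expTwoPi_omega_mul, expTwoPi_one_sub_omega_mul,
    rpow_omega W i hx, rpow_one_sub_omega W i hx, Complex.ofReal_pow, Complex.ofReal_pow,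
    ← mul_pow, ← mul_pow, ← hz]
  field_simp
  ring

/-- The inner sum over the group is the projection to the invariant part, times the order of the
group. -/
theorem HasJac.sum_fixed {W : WeightSystem} {J : Finset (Fin 3)} (S : ℂ) :
    ∑ b ∈ Finset.range W.h, (W.zeta ^ b) ^ (∑ i ∈ J, W.a i) * aeval (W.zeta ^ b * S) (W.jac J) =
      W.h * W.invPart J S := by
  have h1 : ∀ b ∈ Finset.range W.h,
      (W.zeta ^ b) ^ (∑ i ∈ J, W.a i) * aeval (W.zeta ^ b * S) (W.jac J) =
      ∑ n ∈ (W.jac J).support, (((W.jac J).coeff n : ℂ) * S ^ n) *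
        (W.zeta ^ ((n : ℤ) + (∑ i ∈ J, (W.a i : ℤ)) - 0)) ^ b := by
    intro b _
    rw [aeval_def, eval₂_eq_sum, Polynomial.sum, Finset.mul_sum]
    refine Finset.sum_congr rfl fun n _ => ?_
    have hz := W.zeta_ne_zero
    rw [eq_intCast, sub_zero, zpow_add₀ hz, mul_pow, mul_pow,
      ← Nat.cast_sum, zpow_natCast, zpow_natCast, ← pow_mul, ← pow_mul, ← pow_mul, ← pow_mul,
      mul_comm b n, mul_comm b (∑ i ∈ J, W.a i)]
    ring
  rw [Finset.sum_congr rfl h1, Finset.sum_comm, invPart, Finset.mul_sum]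
  refine Finset.sum_congr rfl fun n _ => ?_
  rw [← Finset.mul_sum, sum_zeta_zpow_pow]
  split_ifs <;> ring

theorem sum_principalGroup {M : Type*} [AddCommMonoid M] (W : WeightSystem)
    (f : (Fin 3 → ℤ) → M) :
    ∑ α ∈ W.principalGroup, f α = ∑ k ∈ Finset.range W.h, f fun _ => (k : ℤ) := by
  rw [principalGroup, Finset.sum_image]
  intro k _ l _ hkl
  have := congrFun hkl 0
  simpa using this

theorem card_principalGroup (W : WeightSystem) : W.principalGroup.card = W.h := by
  rw [principalGroup, Finset.card_image_of_injective, Finset.card_range]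
  intro k l hkl
  have := congrFun hkl 0
  simpa using this

theorem filter_omega (W : WeightSystem) (k : ℕ) [DecidablePred fun i => ∃ n : ℤ,
    W.omega i * (((fun _ => (k : ℤ)) : Fin 3 → ℤ) i : ℝ) = n] :
    (Finset.univ.filter fun i => ∃ n : ℤ,
      W.omega i * (((fun _ => (k : ℤ)) : Fin 3 → ℤ) i : ℝ) = n) = W.fixed k := by
  ext i
  simp only [Finset.mem_filter, Finset.mem_univ, true_and]
  exact W.omega_mul_eq_int_iff k i

theorem filter_not_omega (W : WeightSystem) (k : ℕ) [DecidablePred fun i => ¬ ∃ n : ℤ,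
    W.omega i * (((fun _ => (k : ℤ)) : Fin 3 → ℤ) i : ℝ) = n] :
    (Finset.univ.filter fun i => ¬ ∃ n : ℤ,
      W.omega i * (((fun _ => (k : ℤ)) : Fin 3 → ℤ) i : ℝ) = n) = (W.fixed k)ᶜ := by
  ext i
  simp only [Finset.mem_filter, Finset.mem_univ, true_and, Finset.mem_compl]
  exact not_congr (W.omega_mul_eq_int_iff k i)

theorem CountRegular.sectorPoincare_eq {W : WeightSystem} (hW : W.CountRegular) (k : ℕ)
    {y ybar : ℝ} (hy : 0 < y) (hyb : 0 < ybar) (h1 : y * ybar ≠ 1) :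
    W.sectorPoincare W.principalGroup (fun _ => (k : ℤ)) y ybar =
      ((∏ i ∈ (W.fixed k)ᶜ, (y * ybar) ^ ((1 - 2 * W.omega i) / 2) *
        (y / ybar) ^ (1 / 2 - ((W.a i * k % W.h : ℕ) : ℝ) / W.h) : ℝ) : ℂ) *
      ((-1) ^ (W.fixed k).card *
        (W.h * W.invPart (W.fixed k) (((y * ybar) ^ (1 / (W.h : ℝ)) : ℝ) : ℂ))) := by
  rw [sectorPoincare, sum_principalGroup]
  simp only [filter_omega, filter_not_omega]
  rw [← Finset.mul_sum]
  congr 1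
  · rw [Complex.ofReal_prod]
    refine Finset.prod_congr rfl fun i _ => ?_
    rw [← omega_mul_sub_floor]
    congr 3
    ring
  · rw [Finset.sum_congr rfl fun b _ => (hW.hasJac k).prod_fixed b (mul_pos hy hyb) h1,
      ← Finset.mul_sum, HasJac.sum_fixed]

theorem CountRegular.poincare_eq {W : WeightSystem} (hW : W.CountRegular)
    {y ybar : ℝ} (hy : 0 < y) (hyb : 0 < ybar) (h1 : y * ybar ≠ 1) :
    W.poincare y ybar =
      aeval (((y * ybar) ^ (1 / (W.h : ℝ)) : ℝ) : ℂ) (W.jac Finset.univ) := by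
  rw [poincare, orbifoldPoincare, trivialGroup, Finset.sum_singleton, sectorPoincare,
    Finset.sum_singleton]
  have h0 : (0 : Fin 3 → ℤ) = fun _ => ((0 : ℕ) : ℤ) := by
    funext i
    simp
  rw [h0]
  simp only [filter_omega, filter_not_omega]
  rw [hW.hasJac 0 |>.prod_fixed 0 (mul_pos hy hyb) h1, fixed_of_dvd (dvd_zero _)]
  simp
  norm_num

/-- The position of the `k`-th twisted sector, in units of `1 / h`. -/
def pos (W : WeightSystem) (k : ℕ) : ℤ :=
  2 * W.h - (((W.fixed k).card / 2 : ℕ) : ℤ) * W.h - ∑ i, ((W.a i * k % W.h : ℕ) : ℤ)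

theorem sum_omega (W : WeightSystem) : ∑ i, W.omega i = 1 + W.eps / W.h := by
  have hh : (W.h : ℝ) ≠ 0 := by exact_mod_cast W.h_pos.ne'
  have := W.sum_a_eq
  have h2 : (∑ i, (W.a i : ℝ)) = W.eps + W.h := by exact_mod_cast this
  simp only [omega]
  rw [← Finset.sum_div, h2]
  field_simp
  ring

theorem IsReduced.fixed_ne_univ {W : WeightSystem} (hred : W.IsReduced) {k : ℕ} (h0 : k ≠ 0)
    (hk : k < W.h) : W.fixed k ≠ Finset.univ := by
  intro h
  have h1 := hred.dvd_of_forall fun i => mem_fixed.mp (h ▸ Finset.mem_univ i)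
  exact h0 (Nat.eq_zero_of_dvd_of_lt h1 hk)

/-- After `ybar ↦ ybar⁻¹` the power of `y / ybar` is `ĉ / 2` in every sector that contributes, and
the prefactor `ybar ^ ĉ` turns it into a power of `y * ybar`. The remaining exponents are the ages,
which are already powers of `y * ybar`. -/
theorem CountRegular.twisted_sector_eq {W : WeightSystem} (hred : W.IsReduced) (hW : W.CountRegular)
    {k : ℕ} (h0 : k ≠ 0) (hk : k < W.h) {y ybar : ℝ} (hy : 0 < y) (hyb : 0 < ybar)
    (h1 : y ≠ ybar) :
    ((ybar ^ W.cHat : ℝ) : ℂ) * W.sectorPoincare W.principalGroup (fun _ => (k : ℤ)) y ybar⁻¹ =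
      W.h * (W.sectorMult k * (((y * ybar) ^ (((W.pos k : ℝ) - W.eps) / W.h) : ℝ) : ℂ)) := by
  have hh : (W.h : ℝ) ≠ 0 := by exact_mod_cast W.h_pos.ne'
  have hyb' : 0 < ybar⁻¹ := inv_pos.mpr hyb
  have hx : 0 < y * ybar⁻¹ := mul_pos hy hyb'
  have ht : 0 < y * ybar := mul_pos hy hyb
  have hne : y * ybar⁻¹ ≠ 1 := by
    intro h
    rw [mul_inv_eq_one₀ hyb.ne'] at h
    exact h1 h
  rw [hW.sectorPoincare_eq k hy hyb' hne, div_inv_eq_mul]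
  rw [(hW.hasJac k).invPart_eq (hred.fixed_ne_univ h0 hk),
    sectorMult]
  -- With one fixed variable both sides vanish. Otherwise the number of fixed variables is even,
  -- which the exponent computation needs.
  by_cases hcard : ∃ i, W.fixed k = {i}
  · obtain ⟨i, hi⟩ := hcard
    have := hW.hasJac k
    rw [hi] at this
    rw [hi, this.res_singleton]
    simp
  · have hcard2 : ((W.fixed k).card : ℝ) = 2 * ((W.fixed k).card / 2 : ℕ) := by
      rcases card_cases (W.fixed k) with h | h | ⟨i, j, hij, h⟩ | h
      · rw [h]; simp
      · exact absurd h hcard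
      · rw [h, Finset.card_pair hij]; norm_num
      · exact absurd h (hred.fixed_ne_univ h0 hk)
    have key : ybar ^ W.cHat * ((∏ i ∈ (W.fixed k)ᶜ, (y * ybar⁻¹) ^ ((1 - 2 * W.omega i) / 2) *
        (y * ybar) ^ (1 / 2 - ((W.a i * k % W.h : ℕ) : ℝ) / W.h)) *
        ((y * ybar⁻¹) ^ (1 / (W.h : ℝ))) ^
          ((((W.fixed k).card / 2 : ℕ) : ℤ) * W.h - ∑ i ∈ W.fixed k, (W.a i : ℤ))) =
        (y * ybar) ^ (((W.pos k : ℝ) - W.eps) / W.h) := by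
      rw [Finset.prod_mul_distrib, ← Real.rpow_sum_of_pos hx, ← Real.rpow_sum_of_pos ht,
        ← Real.rpow_intCast, ← Real.rpow_mul hx.le]
      have e1 : ∑ i ∈ (W.fixed k)ᶜ, (1 - 2 * W.omega i) / 2 + 1 / (W.h : ℝ) *
          (((((W.fixed k).card / 2 : ℕ) : ℤ) * W.h - ∑ i ∈ W.fixed k, (W.a i : ℤ) : ℤ) : ℝ) =
          W.cHat / 2 := by
        have e5 := Finset.sum_add_sum_compl (W.fixed k) W.omega
        rw [sum_omega] at e5
        have e6 : ∑ i ∈ W.fixed k, W.omega i = (∑ i ∈ W.fixed k, (W.a i : ℝ)) / W.h := by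
          rw [Finset.sum_div]
          rfl
        have e7 : ((W.fixed k).card : ℝ) + ((W.fixed k)ᶜ.card : ℝ) = 3 := by
          have := Finset.card_add_card_compl (W.fixed k)
          rw [Fintype.card_fin] at this
          exact_mod_cast this
        rw [← Finset.sum_div, Finset.sum_sub_distrib, ← Finset.mul_sum, cHat]
        simp only [Int.cast_sub, Int.cast_mul, Int.cast_natCast, Int.cast_sum]
        rw [mul_sub, one_div_mul_eq_div, one_div_mul_eq_div, ← e6, mul_div_cancel_right₀ _ hh,
          Finset.sum_const, nsmul_eq_mul, mul_one]
        linarith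
      have e2 : ∑ i ∈ (W.fixed k)ᶜ, (1 / 2 - ((W.a i * k % W.h : ℕ) : ℝ) / W.h) + W.cHat / 2 =
          ((W.pos k : ℝ) - W.eps) / W.h := by
        have e5 := Finset.sum_add_sum_compl (W.fixed k)
          fun i => ((W.a i * k % W.h : ℕ) : ℝ) / W.h
        have e6 : ∑ i ∈ W.fixed k, ((W.a i * k % W.h : ℕ) : ℝ) / W.h = 0 := by
          refine Finset.sum_eq_zero fun i hi => ?_
          rw [Nat.mod_eq_zero_of_dvd (mem_fixed.mp hi)]
          simp
        have e7 : ((W.fixed k).card : ℝ) + ((W.fixed k)ᶜ.card : ℝ) = 3 := by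
          have := Finset.card_add_card_compl (W.fixed k)
          rw [Fintype.card_fin] at this
          exact_mod_cast this
        rw [e6, zero_add, ← Finset.sum_div Finset.univ] at e5
        rw [Finset.sum_sub_distrib, e5, cHat, pos, Finset.sum_const,
          nsmul_eq_mul]
        simp only [Int.cast_sub, Int.cast_mul, Int.cast_natCast, Int.cast_sum, Int.cast_ofNat]
        field_simp
        linear_combination (W.h : ℝ) * e7 - (W.h : ℝ) * hcard2
      rw [mul_right_comm, ← Real.rpow_add hx, e1, ← e2, Real.rpow_add ht,
        Real.mul_rpow hy.le hyb'.le, Real.mul_rpow (z := W.cHat / 2) hy.le hyb.le,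
        Real.inv_rpow hyb.le]
      have e3 : ybar ^ W.cHat = ybar ^ (W.cHat / 2) * ybar ^ (W.cHat / 2) := by
        rw [← Real.rpow_add hyb]
        congr 1
        ring
      have e4 : ybar ^ (W.cHat / 2) ≠ 0 := (Real.rpow_pos_of_pos hyb _).ne'
      rw [e3]
      field_simp
    rw [← key]
    push_cast
    ring

end WeightSystem

/-! ### P-duality as an equality of spectra -/

namespace WeightSystem
open Polynomial

/-- The subtracted term is the sector of the identity. It carries the only dependence on `y / ybar`,
through the exponents `0` and `h` of `W`. -/
theorem CountRegular.orbifoldPoincare_eq {W : WeightSystem} (hred : W.IsReduced)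
    (hW : W.CountRegular) {y ybar : ℝ} (hy : 0 < y) (hyb : 0 < ybar) (h1 : y ≠ ybar) :
    (-1) ^ 3 * ((ybar ^ W.cHat : ℝ) : ℂ) * W.orbifoldPoincare W.principalGroup y ybar⁻¹ =
      ∑ k ∈ Finset.Ico 1 W.h,
        W.sectorMult k * (((y * ybar) ^ (((W.pos k : ℝ) - W.eps) / W.h) : ℝ) : ℂ) -
      W.spec 0 * (((y * ybar) ^ (W.cHat / 2) *
        ((y / ybar) ^ (-(1 / 2) : ℝ) + (y / ybar) ^ (1 / 2 : ℝ)) : ℝ) : ℂ) := by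
  have hh : (W.h : ℝ) ≠ 0 := by exact_mod_cast W.h_pos.ne'
  have hhc : (W.h : ℂ) ≠ 0 := by exact_mod_cast W.h_pos.ne'
  have hyb' : 0 < ybar⁻¹ := inv_pos.mpr hyb
  have hx : 0 < y * ybar⁻¹ := mul_pos hy hyb'
  have ht : 0 < y * ybar := mul_pos hy hyb
  have hne : y * ybar⁻¹ ≠ 1 := by
    intro h
    rw [mul_inv_eq_one₀ hyb.ne'] at h
    exact h1 h
  have h0 : ((ybar ^ W.cHat : ℝ) : ℂ) *
      W.sectorPoincare W.principalGroup (fun _ => ((0 : ℕ) : ℤ)) y ybar⁻¹ =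
      -(W.h * (W.spec 0 * (((y * ybar) ^ (W.cHat / 2) *
        ((y / ybar) ^ (-(1 / 2) : ℝ) + (y / ybar) ^ (1 / 2 : ℝ)) : ℝ) : ℂ))) := by
    rw [hW.sectorPoincare_eq 0 hy hyb' hne, fixed_of_dvd (dvd_zero _),
      hW.hasJac_univ.invPart_univ]
    have e1 : ((y * ybar) ^ (W.cHat / 2) *
        ((y / ybar) ^ (-(1 / 2) : ℝ) + (y / ybar) ^ (1 / 2 : ℝ)) : ℝ) =
        ybar ^ W.cHat * (((y * ybar⁻¹) ^ (1 / (W.h : ℝ))) ^ (-W.eps) +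
          ((y * ybar⁻¹) ^ (1 / (W.h : ℝ))) ^ ((W.h : ℤ) - W.eps)) := by
      have e2 : 1 / (W.h : ℝ) * ((-W.eps : ℤ) : ℝ) = W.cHat / 2 + -(1 / 2) := by
        rw [cHat]; push_cast; ring
      have e3 : 1 / (W.h : ℝ) * (((W.h : ℤ) - W.eps : ℤ) : ℝ) = W.cHat / 2 + 1 / 2 := by
        rw [cHat]; push_cast; field_simp; ring
      have e4 : ybar ^ W.cHat = ybar ^ (W.cHat / 2) * ybar ^ (W.cHat / 2) := by
        rw [← Real.rpow_add hyb]
        congr 1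
        ring
      rw [← Real.rpow_intCast, ← Real.rpow_intCast, ← Real.rpow_mul hx.le, ← Real.rpow_mul hx.le,
        e2, e3, Real.rpow_add hx, Real.rpow_add hx, div_eq_mul_inv y, e4,
        Real.mul_rpow (z := W.cHat / 2) hy.le hyb.le,
        Real.mul_rpow (z := W.cHat / 2) hy.le hyb'.le, Real.inv_rpow hyb.le]
      have e5 : ybar ^ (W.cHat / 2) ≠ 0 := (Real.rpow_pos_of_pos hyb _).ne'
      field_simp
    rw [e1]
    simp
    ring
  have h2 : ((ybar ^ W.cHat : ℝ) : ℂ) *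
      ∑ k ∈ Finset.range W.h, W.sectorPoincare W.principalGroup (fun _ => (k : ℤ)) y ybar⁻¹ =
      W.h * (∑ k ∈ Finset.Ico 1 W.h,
        W.sectorMult k * (((y * ybar) ^ (((W.pos k : ℝ) - W.eps) / W.h) : ℝ) : ℂ) -
      W.spec 0 * (((y * ybar) ^ (W.cHat / 2) *
        ((y / ybar) ^ (-(1 / 2) : ℝ) + (y / ybar) ^ (1 / 2 : ℝ)) : ℝ) : ℂ)) := by
    rw [Finset.range_eq_Ico, Finset.sum_eq_sum_Ico_succ_bot W.h_pos, mul_add, h0, zero_add,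
      Finset.mul_sum, Finset.sum_congr rfl fun k hk => hW.twisted_sector_eq hred
        (Nat.one_le_iff_ne_zero.mp (Finset.mem_Ico.mp hk).1) (Finset.mem_Ico.mp hk).2 hy hyb h1,
      ← Finset.mul_sum]
    ring
  rw [orbifoldPoincare, card_principalGroup, sum_principalGroup]
  have h3 : ∀ a b : ℂ, (-1) ^ 3 * a * ((-1) ^ 3 / (W.h : ℂ) * b) = (W.h : ℂ)⁻¹ * (a * b) := by
    intro a b
    field_simp
  rw [h3, h2, inv_mul_cancel_left₀ hhc]

/-- After multiplication by `x ^ N` both sides are polynomials that agree at infinitely many points.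
-/
theorem sum_zpow_eq_iff {ι κ : Type} (s : Finset ι) (t : Finset κ) (c : ι → ℤ) (d : κ → ℤ)
    (f : ι → ℤ) (g : κ → ℤ) :
    (∀ x : ℝ, 0 < x → x ≠ 1 →
      ∑ i ∈ s, (c i : ℂ) * (x : ℂ) ^ f i = ∑ j ∈ t, (d j : ℂ) * (x : ℂ) ^ g j) ↔
    ∀ u : ℤ, ∑ i ∈ s, (if f i = u then c i else 0) = ∑ j ∈ t, if g j = u then d j else 0 := by
  classical
  constructor
  · intro H u
    obtain ⟨N, hN⟩ : ∃ N : ℕ, (∀ i ∈ s, 0 ≤ f i + N) ∧ (∀ j ∈ t, 0 ≤ g j + N) ∧ 0 ≤ u + N := by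
      refine ⟨∑ i ∈ s, (f i).natAbs + ∑ j ∈ t, (g j).natAbs + u.natAbs, fun i hi => ?_,
        fun j hj => ?_, by omega⟩
      · have := Finset.single_le_sum (f := fun i => (f i).natAbs) (fun _ _ => Nat.zero_le _) hi
        omega
      · have := Finset.single_le_sum (f := fun i => (g i).natAbs) (fun _ _ => Nat.zero_le _) hj
        omega
    have hpoly : ∑ i ∈ s, C (c i : ℂ) * X ^ (f i + N).toNat =
        ∑ j ∈ t, C (d j : ℂ) * X ^ (g j + N).toNat := by
      apply Polynomial.eq_of_infinite_eval_eq
      have hinf : Set.Infinite ((fun x : ℝ => (x : ℂ)) '' Set.Ioi 1) :=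
        (Set.Ioi_infinite 1).image Complex.ofReal_injective.injOn
      refine hinf.mono ?_
      rintro _ ⟨x, hx, rfl⟩
      have hx0 : (0 : ℝ) < x := lt_trans one_pos hx
      have hxc : (x : ℂ) ≠ 0 := by exact_mod_cast hx0.ne'
      have h1 := H x hx0 (ne_of_gt hx)
      simp only [Set.mem_ofPred_eq, eval_finsetSum, eval_mul, eval_C, eval_pow, eval_X]
      have h2 : ∀ m : ℤ, 0 ≤ m + N → (x : ℂ) ^ (m + N).toNat = (x : ℂ) ^ N * (x : ℂ) ^ m := by
        intro m hm
        rw [← zpow_natCast, Int.toNat_of_nonneg hm, zpow_add₀ hxc, zpow_natCast, mul_comm]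
      rw [Finset.sum_congr rfl fun i hi => by rw [h2 _ (hN.1 i hi), mul_left_comm],
        ← Finset.mul_sum, h1, Finset.mul_sum]
      exact Finset.sum_congr rfl fun j hj => by rw [h2 _ (hN.2.1 j hj), mul_left_comm]
    have h3 := congrArg (fun p => p.coeff (u + N).toNat) hpoly
    simp only [finsetSum_coeff, coeff_C_mul, coeff_X_pow, mul_ite, mul_one, mul_zero] at h3
    have h4 : ∀ m : ℤ, 0 ≤ m + N → ((u + N).toNat = (m + N).toNat ↔ m = u) := by
      intro m hm
      have := hN.2.2
      omega
    rw [Finset.sum_congr rfl fun i hi => if_congr (h4 _ (hN.1 i hi)) rfl rfl,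
      Finset.sum_congr rfl fun i hi => if_congr (h4 _ (hN.2.1 i hi)) rfl rfl] at h3
    have h5 : ((∑ i ∈ s, (if f i = u then c i else 0) : ℤ) : ℂ) =
        ((∑ j ∈ t, (if g j = u then d j else 0) : ℤ) : ℂ) := by
      push_cast
      exact h3
    exact_mod_cast h5
  · intro H x _ _
    have h1 : ∀ {ι : Type} (s : Finset ι) (c : ι → ℤ) (f : ι → ℤ) (U : Finset ℤ),
        s.image f ⊆ U → ∑ i ∈ s, (c i : ℂ) * (x : ℂ) ^ f i =
          ∑ u ∈ U, ((∑ i ∈ s, (if f i = u then c i else 0) : ℤ) : ℂ) * (x : ℂ) ^ u := by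
      intro ι s c f U hU
      simp only [Int.cast_sum, Finset.sum_mul]
      rw [Finset.sum_comm]
      refine Finset.sum_congr rfl fun i hi => ?_
      rw [Finset.sum_eq_single (f i)]
      · simp
      · intro u _ hu
        rw [if_neg hu.symm]
        simp
      · intro h
        exact absurd (hU (Finset.mem_image_of_mem f hi)) h
    rw [h1 s c f (s.image f ∪ t.image g) Finset.subset_union_left,
      h1 t d g (s.image f ∪ t.image g) Finset.subset_union_right]
    simp only [H]

/-- One half of P-duality, as an equality of finite families of exponents with multiplicities. -/
def SpecDual (W W' : WeightSystem) : Prop :=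
  W'.spec 0 = 0 ∧ ∀ u : ℤ,
    ∑ n ∈ (W.jac Finset.univ).support,
      (if (n : ℤ) * W'.h = u then (W.jac Finset.univ).coeff n else 0) =
    ∑ k ∈ Finset.Ico 1 W'.h, if (W'.pos k - W'.eps) * W.h = u then W'.sectorMult k else 0

/-- The product `t = y * ybar` and the ratio `s ^ 2 = y / ybar` vary independently, so the part
depending on `s` must vanish, and this is the condition on `spec 0`. Putting `t = x ^ (h * h')`
makes all remaining exponents integral. -/
theorem half_pDual_iff {W W' : WeightSystem} (hW : W.CountRegular)
    (hred' : W'.IsReduced) (hW' : W'.CountRegular) :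
    (∀ y ybar : ℝ, 0 < y → 0 < ybar → y * ybar ≠ 1 → y ≠ ybar →
      W.poincare y ybar = (-1) ^ 3 * ((ybar ^ W'.cHat : ℝ) : ℂ) *
        W'.orbifoldPoincare W'.principalGroup y ybar⁻¹) ↔ SpecDual W W' := by
  have hh : (W.h : ℝ) ≠ 0 := by exact_mod_cast W.h_pos.ne'
  have hh' : (W'.h : ℝ) ≠ 0 := by exact_mod_cast W'.h_pos.ne'
  have hA : ∀ x : ℝ, 0 < x →
      aeval (((x ^ ((W.h : ℝ) * W'.h)) ^ (1 / (W.h : ℝ)) : ℝ) : ℂ) (W.jac Finset.univ) =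
      ∑ n ∈ (W.jac Finset.univ).support,
        ((W.jac Finset.univ).coeff n : ℂ) * (x : ℂ) ^ ((n : ℤ) * W'.h) := by
    intro x hx
    rw [aeval_def, eval₂_eq_sum, Polynomial.sum]
    refine Finset.sum_congr rfl fun n _ => ?_
    rw [eq_intCast, ← Complex.ofReal_pow, ← Real.rpow_mul hx.le, ← Real.rpow_natCast,
      ← Real.rpow_mul hx.le, ← Complex.ofReal_zpow, ← Real.rpow_intCast]
    congr 3
    push_cast
    field_simp
  have hB : ∀ x : ℝ, 0 < x → ∑ k ∈ Finset.Ico 1 W'.h, (W'.sectorMult k : ℂ) *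
        (((x ^ ((W.h : ℝ) * W'.h)) ^ (((W'.pos k : ℝ) - W'.eps) / W'.h) : ℝ) : ℂ) =
      ∑ k ∈ Finset.Ico 1 W'.h, (W'.sectorMult k : ℂ) *
        (x : ℂ) ^ ((W'.pos k - W'.eps) * W.h) := by
    intro x hx
    refine Finset.sum_congr rfl fun k _ => ?_
    rw [← Real.rpow_mul hx.le, ← Complex.ofReal_zpow, ← Real.rpow_intCast]
    congr 3
    push_cast
    field_simp
  constructor
  · intro H
    have key : ∀ t s : ℝ, 0 < t → t ≠ 1 → 0 < s → s ≠ 1 →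
        aeval ((t ^ (1 / (W.h : ℝ)) : ℝ) : ℂ) (W.jac Finset.univ) =
        ∑ k ∈ Finset.Ico 1 W'.h, (W'.sectorMult k : ℂ) *
          ((t ^ (((W'.pos k : ℝ) - W'.eps) / W'.h) : ℝ) : ℂ) -
        W'.spec 0 * ((t ^ (W'.cHat / 2) * (s⁻¹ + s) : ℝ) : ℂ) := by
      intro t s ht ht1 hs hs1
      have e0 : 0 < √t := Real.sqrt_pos.mpr ht
      have e1 : √t * s * (√t / s) = t := by
        field_simp
        exact Real.sq_sqrt ht.le
      have e2 : √t * s / (√t / s) = s ^ (2 : ℝ) := by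
        rw [Real.rpow_two]
        field_simp
      have e3 : √t * s ≠ √t / s := by
        intro h
        rw [← h, div_self (mul_pos e0 hs).ne', Real.rpow_two] at e2
        exact hs1 ((pow_eq_one_iff_of_nonneg hs.le two_ne_zero).mp e2.symm)
      have e4 := H (√t * s) (√t / s) (mul_pos e0 hs) (div_pos e0 hs) (by rwa [e1]) e3
      rw [hW.poincare_eq (mul_pos e0 hs) (div_pos e0 hs) (by rwa [e1]),
        hW'.orbifoldPoincare_eq hred' (mul_pos e0 hs) (div_pos e0 hs) e3, e1, e2,
        ← Real.rpow_mul hs.le, ← Real.rpow_mul hs.le] at e4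
      norm_num at e4
      rw [Real.rpow_neg_one] at e4
      push_cast at e4 ⊢
      simpa using e4
    have h0 : W'.spec 0 = 0 := by
      have k2 := key 2 2 (by norm_num) (by norm_num) (by norm_num) (by norm_num)
      have k3 := key 2 3 (by norm_num) (by norm_num) (by norm_num) (by norm_num)
      rw [k2] at k3
      have e1 : (((2 : ℝ) ^ (W'.cHat / 2) : ℝ) : ℂ) ≠ 0 := by
        exact_mod_cast (Real.rpow_pos_of_pos two_pos _).ne'
      have e2 : (W'.spec 0 : ℂ) * (((2 : ℝ) ^ (W'.cHat / 2) : ℝ) : ℂ) = 0 := by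
        have := sub_right_injective k3
        push_cast at this ⊢
        -- For `s = 2` and `s = 3` the values of `s⁻¹ + s` are `5 / 2` and `10 / 3`, which differ by
        -- `5 / 6`.
        linear_combination (-6 / 5 : ℂ) * this
      have := (mul_eq_zero.mp e2).resolve_right e1
      exact_mod_cast this
    refine ⟨h0, (sum_zpow_eq_iff _ _ _ _ _ _).mp fun x hx hx1 => ?_⟩
    rw [← hA x hx, ← hB x hx, key _ 2 (Real.rpow_pos_of_pos hx _) ?_ two_pos (by norm_num), h0]
    · simp
    · intro h
      have h2 := congrArg (· ^ (1 / ((W.h : ℝ) * W'.h))) h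
      simp only [Real.one_rpow] at h2
      rw [← Real.rpow_mul hx.le, mul_one_div_cancel (mul_ne_zero hh hh'), Real.rpow_one] at h2
      exact hx1 h2
  · rintro ⟨h0, H⟩ y ybar hy hyb h1 h2
    have ht : 0 < y * ybar := mul_pos hy hyb
    rw [hW.poincare_eq hy hyb h1, hW'.orbifoldPoincare_eq hred' hy hyb h2, h0]
    set x := (y * ybar) ^ (1 / ((W.h : ℝ) * W'.h)) with hxdef
    have hx : 0 < x := Real.rpow_pos_of_pos ht _
    have ht2 : y * ybar = x ^ ((W.h : ℝ) * W'.h) := by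
      rw [hxdef, ← Real.rpow_mul ht.le, one_div_mul_cancel (mul_ne_zero hh hh'), Real.rpow_one]
    have hx1 : x ≠ 1 := by
      intro h
      rw [h, Real.one_rpow] at ht2
      exact h1 ht2
    rw [ht2, hA x hx, hB x hx, (sum_zpow_eq_iff _ _ _ _ _ _).mpr H x hx hx1]
    simp

theorem isPDual_iff {W W' : WeightSystem} (hred : W.IsReduced) (hW : W.CountRegular)
    (hred' : W'.IsReduced) (hW' : W'.CountRegular) :
    IsPDual W' W ↔ SpecDual W W' ∧ SpecDual W' W := by
  rw [← half_pDual_iff hW hred' hW', ← half_pDual_iff hW' hred hW]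
  constructor
  · intro H
    exact ⟨fun y yb h1 h2 h3 h4 => (H y yb h1 h2 h3 h4).1,
      fun y yb h1 h2 h3 h4 => (H y yb h1 h2 h3 h4).2⟩
  · rintro ⟨H1, H2⟩ y yb h1 h2 h3 h4
    exact ⟨H1 y yb h1 h2 h3 h4, H2 y yb h1 h2 h3 h4⟩

end WeightSystem

/-! ### P-duality forces equal `h` and `ε` -/

namespace WeightSystem
open Polynomial

theorem HasJac.coeff_zero {W : WeightSystem} {J : Finset (Fin 3)} (hJ : W.HasJac J) :
    (W.jac J).coeff 0 = 1 := by
  have h1 := congrArg (eval 0) hJ.mul_jac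
  simp only [eval_mul, eval_prod, eval_sub, eval_pow, eval_X, eval_one] at h1
  have hA : ∏ i ∈ J, ((0 : ℤ) ^ W.a i - 1) = ∏ _i ∈ J, ((0 : ℤ) - 1) :=
    Finset.prod_congr rfl fun i _ => by rw [zero_pow (W.a_pos i).ne']
  have hB : ∏ i ∈ J, ((0 : ℤ) ^ (W.h - W.a i) - 1) = ∏ _i ∈ J, ((0 : ℤ) - 1) :=
    Finset.prod_congr rfl fun i _ => by
      rw [zero_pow (show W.h - W.a i ≠ 0 by have := W.a_lt_h i; omega)]
  rw [hA, hB] at h1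
  rw [coeff_zero_eq_eval_zero]
  have h2 : (∏ _i ∈ J, ((0 : ℤ) - 1)) ≠ 0 := Finset.prod_ne_zero_iff.mpr fun _ _ => by norm_num
  exact mul_left_cancel₀ h2 (h1.trans (mul_one _).symm)

/-- The residues may be replaced by the numbers `a i * k`, and the weights add up to `ε + h`. -/
theorem h_dvd_pos_add (W : WeightSystem) (k : ℕ) : (W.h : ℤ) ∣ W.pos k + W.eps * k := by
  have h1 : ∀ i, (W.h : ℤ) ∣ (W.a i : ℤ) * k - ((W.a i * k % W.h : ℕ) : ℤ) := by
    intro i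
    rw [Int.natCast_mod, Nat.cast_mul]
    exact Int.dvd_self_sub_emod
  have h2 : (W.h : ℤ) ∣ ∑ i, ((W.a i : ℤ) * k - ((W.a i * k % W.h : ℕ) : ℤ)) :=
    Finset.dvd_sum fun i _ => h1 i
  rw [Finset.sum_sub_distrib, ← Finset.sum_mul, sum_a_eq] at h2
  have h3 : W.pos k + W.eps * k = ((W.eps + W.h) * k - ∑ i, ((W.a i * k % W.h : ℕ) : ℤ)) +
      W.h * (2 - (((W.fixed k).card / 2 : ℕ) : ℤ) - k) := by
    rw [pos]; ring
  rw [h3]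
  exact dvd_add h2 (dvd_mul_right _ _)

theorem mem_fixed_sub {W : WeightSystem} {k : ℕ} (hk : k ≤ W.h) :
    W.fixed (W.h - k) = W.fixed k := by
  ext i
  rw [mem_fixed, mem_fixed, Nat.mul_sub, Nat.dvd_sub_iff_right (Nat.mul_le_mul_left _ hk)
    (dvd_mul_left _ _)]

theorem sectorMult_sub {W : WeightSystem} {k : ℕ} (hk : k ≤ W.h) :
    W.sectorMult (W.h - k) = W.sectorMult k := by
  rw [sectorMult, sectorMult, mem_fixed_sub hk]

/-- For two fixed variables the middle degree `h - a i - a j` lies in the range where the Poincaré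
polynomial counts monomials; hence the nonnegativity. -/
theorem CountRegular.sectorMult_cases {W : WeightSystem} (hW : W.CountRegular)
    (hred : W.IsReduced) {k : ℕ} (h0 : k ≠ 0) (hk : k < W.h) :
    (W.fixed k = ∅ ∧ W.sectorMult k = 1) ∨
    ((W.fixed k).card = 1 ∧ W.sectorMult k = 0) ∨
    (∃ i j, i ≠ j ∧ W.fixed k = {i, j} ∧ 0 ≤ W.sectorMult k ∧
      W.sectorMult k = (W.jac {i, j}).coeff (W.h - W.a i - W.a j)) := by
  have hJ := hW.hasJac k
  rcases card_cases (W.fixed k) with h | ⟨i, h⟩ | ⟨i, j, hij, h⟩ | h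
  · left
    refine ⟨h, ?_⟩
    rw [sectorMult, h, res_empty]
    simp
  · right; left
    rw [h] at hJ
    rw [sectorMult, h, hJ.res_singleton]
    simp
  · right; right
    rw [h] at hJ
    refine ⟨i, j, hij, h, ?_⟩
    rw [sectorMult, h, hJ.res_pair hij, Finset.card_pair hij, neg_one_sq, one_mul]
    refine ⟨hJ.coeff_nonneg (fun l hl => ?_) ?_, rfl⟩
    · have := W.a_pos i
      have := W.a_pos j
      have := W.two_mul_a_le i
      have := W.two_mul_a_le j
      rw [Finset.mem_insert, Finset.mem_singleton] at hl
      rcases hl with rfl | rfl <;> omega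
    · have := W.a_pos i
      have := W.h_pos
      omega
  · exact absurd h (hred.fixed_ne_univ h0 hk)

theorem CountRegular.sectorMult_nonneg {W : WeightSystem} (hW : W.CountRegular)
    (hred : W.IsReduced) {k : ℕ} (h0 : k ≠ 0) (hk : k < W.h) : 0 ≤ W.sectorMult k := by
  rcases hW.sectorMult_cases hred h0 hk with h | h | ⟨_, _, _, _, h, _⟩
  · omega
  · omega
  · exact h

theorem CountRegular.even_card_fixed {W : WeightSystem} (hW : W.CountRegular)
    (hred : W.IsReduced) {k : ℕ} (h0 : k ≠ 0) (hk : k < W.h) (hm : W.sectorMult k ≠ 0) :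
    (W.fixed k).card = 2 * ((W.fixed k).card / 2) := by
  rcases hW.sectorMult_cases hred h0 hk with h | h | ⟨i, j, hij, h, _⟩
  · rw [h.1]; simp
  · exact absurd h.2 hm
  · rw [h, Finset.card_pair hij]

theorem sum_mod_sub (W : WeightSystem) {k : ℕ} (hk : k ≤ W.h) :
    ∑ i, ((W.a i * (W.h - k) % W.h : ℕ) : ℤ) =
      (3 - (W.fixed k).card) * W.h - ∑ i, ((W.a i * k % W.h : ℕ) : ℤ) := by
  have h1 : ∀ i, ((W.a i * (W.h - k) % W.h : ℕ) : ℤ) =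
      (if i ∈ W.fixed k then 0 else (W.h : ℤ)) - ((W.a i * k % W.h : ℕ) : ℤ) := by
    intro i
    have h2 : W.h ∣ (W.a i * (W.h - k) % W.h) + (W.a i * k % W.h) := by
      rw [Nat.dvd_iff_mod_eq_zero, ← Nat.add_mod, ← mul_add, Nat.sub_add_cancel hk,
        Nat.mul_mod_left]
    have h3 := Nat.mod_lt (W.a i * (W.h - k)) W.h_pos
    have h4 := Nat.mod_lt (W.a i * k) W.h_pos
    split_ifs with h
    · rw [mem_fixed] at h
      rw [Nat.mod_eq_zero_of_dvd h, add_zero] at h2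
      rw [Nat.mod_eq_zero_of_dvd h, Nat.eq_zero_of_dvd_of_lt h2 h3]
      simp
    · rw [mem_fixed, Nat.dvd_iff_mod_eq_zero] at h
      obtain ⟨c, hc⟩ := h2
      have : c = 1 := by
        rcases c with _ | _ | c
        · omega
        · rfl
        · have : W.h * 2 ≤ W.h * (c + 1 + 1) := Nat.mul_le_mul_left _ (by omega)
          omega
      subst this
      omega
  rw [Finset.sum_congr rfl fun i _ => h1 i, Finset.sum_sub_distrib]
  congr 1
  rw [← Finset.sum_filter_add_sum_filter_not Finset.univ (· ∈ W.fixed k)]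
  rw [Finset.sum_congr rfl fun i hi => if_pos (Finset.mem_filter.mp hi).2,
    Finset.sum_congr (f := fun i => if i ∈ W.fixed k then (0 : ℤ) else W.h) rfl
      fun i hi => if_neg (Finset.mem_filter.mp hi).2]
  rw [Finset.sum_const_zero, zero_add, Finset.sum_const, nsmul_eq_mul]
  congr 1
  have h5 : Finset.univ.filter (fun i => i ∉ W.fixed k) = (W.fixed k)ᶜ := by
    ext; simp
  have h6 := Finset.card_add_card_compl (W.fixed k)
  rw [Fintype.card_fin] at h6
  rw [h5]
  omega

theorem CountRegular.pos_sub {W : WeightSystem} (hW : W.CountRegular)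
    (hred : W.IsReduced) {k : ℕ} (h0 : k ≠ 0) (hk : k < W.h) (hm : W.sectorMult k ≠ 0) :
    W.pos (W.h - k) = W.h - W.pos k := by
  rw [pos, pos, mem_fixed_sub hk.le, sum_mod_sub W hk.le]
  have h1 : ((W.fixed k).card : ℤ) = 2 * (((W.fixed k).card / 2 : ℕ) : ℤ) := by
    exact_mod_cast hW.even_card_fixed hred h0 hk hm
  linear_combination (W.h : ℤ) * h1

theorem natDegree_jac_univ {W : WeightSystem} (hJ : W.HasJac Finset.univ) :
    ((W.jac Finset.univ).natDegree : ℤ) = W.h - 2 * W.eps := by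
  rw [hJ.natDegree_jac, Nat.cast_sum, eps]
  have : ∀ i ∈ Finset.univ, ((W.h - 2 * W.a i : ℕ) : ℤ) = W.h - 2 * W.a i := by
    intro i _
    have := W.two_mul_a_le i
    omega
  rw [Finset.sum_congr rfl this, Finset.sum_sub_distrib, ← Finset.mul_sum]
  simp
  ring

theorem SpecDual.coeff_eq {W W' : WeightSystem} (H : SpecDual W W') (n : ℕ) :
    (W.jac Finset.univ).coeff n = ∑ k ∈ Finset.Ico 1 W'.h,
      if (W'.pos k - W'.eps) * W.h = n * W'.h then W'.sectorMult k else 0 := by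
  rw [← H.2]
  have hh : (W'.h : ℤ) ≠ 0 := by exact_mod_cast W'.h_pos.ne'
  have h1 : ∀ m ∈ (W.jac Finset.univ).support, (if (m : ℤ) * W'.h = n * W'.h then
      (W.jac Finset.univ).coeff m else 0) = if m = n then (W.jac Finset.univ).coeff m else 0 := by
    intro m _
    exact if_congr (by rw [mul_left_inj' hh, Nat.cast_inj]) rfl rfl
  rw [Finset.sum_congr rfl h1, Finset.sum_ite_eq']
  split_ifs with h
  · rfl
  · exact notMem_support_iff.mp h

theorem SpecDual.exists_of_ne_zero {W W' : WeightSystem} (H : SpecDual W W') {n : ℕ}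
    (hn : (W.jac Finset.univ).coeff n ≠ 0) : ∃ k, k ≠ 0 ∧ k < W'.h ∧ W'.sectorMult k ≠ 0 ∧
      (W'.pos k - W'.eps) * W.h = n * W'.h := by
  rw [H.coeff_eq] at hn
  obtain ⟨k, hk, h1⟩ := Finset.exists_ne_zero_of_sum_ne_zero hn
  rw [Finset.mem_Ico] at hk
  rw [ne_eq, ite_eq_right_iff, Classical.not_imp] at h1
  exact ⟨k, by omega, hk.2, h1.2, h1.1⟩

/-- The constant term of `jac` comes from a sector at position `ε'`. The inverse sector is at `h' -
ε'`, cannot be cancelled because multiplicities are nonnegative, and so its degree is at most that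
of `jac`. -/
theorem SpecDual.eps_mul_le {W W' : WeightSystem} (H : SpecDual W W') (hW : W.CountRegular)
    (hred' : W'.IsReduced) (hW' : W'.CountRegular) : W.eps * W'.h ≤ W'.eps * W.h := by
  have hJ := hW.hasJac_univ
  obtain ⟨k, h0, hk, hm, hpos⟩ := H.exists_of_ne_zero (n := 0) (by rw [hJ.coeff_zero]; norm_num)
  have hh : (W.h : ℤ) ≠ 0 := by exact_mod_cast W.h_pos.ne'
  have h1 : W'.pos k = W'.eps := by
    rw [Nat.cast_zero, zero_mul] at hpos
    have := (mul_eq_zero.mp hpos).resolve_right hh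
    omega
  have h2 := hW'.pos_sub hred' h0 hk hm
  have h3 : ∑ n ∈ (W.jac Finset.univ).support,
      (if (n : ℤ) * W'.h = (W'.h - 2 * W'.eps) * W.h then (W.jac Finset.univ).coeff n else 0) ≠ 0 := by
    rw [H.2]
    apply ne_of_gt
    refine Finset.sum_pos' (fun l hl => ?_) ⟨W'.h - k, ?_, ?_⟩
    · rw [Finset.mem_Ico] at hl
      split_ifs
      · exact hW'.sectorMult_nonneg hred' (by omega) hl.2
      · exact le_rfl
    · rw [Finset.mem_Ico]
      omega
    · rw [if_pos (by rw [h2, h1]; ring), sectorMult_sub hk.le]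
      exact lt_of_le_of_ne (hW'.sectorMult_nonneg hred' h0 hk) hm.symm
  obtain ⟨n, hn, h4⟩ := Finset.exists_ne_zero_of_sum_ne_zero h3
  rw [ne_eq, ite_eq_right_iff, Classical.not_imp] at h4
  have h5 := le_natDegree_of_mem_supp _ hn
  have h6 := natDegree_jac_univ hJ
  have h7 : (n : ℤ) * W'.h ≤ (W.h - 2 * W.eps) * W'.h :=
    mul_le_mul_of_nonneg_right (by omega) (Int.natCast_nonneg _)
  rw [h4.1] at h7
  linarith

theorem SpecDual.eps_mul_eq {W W' : WeightSystem} (H : SpecDual W W') (H' : SpecDual W' W)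
    (hred : W.IsReduced) (hW : W.CountRegular)
    (hred' : W'.IsReduced) (hW' : W'.CountRegular) : W.eps * W'.h = W'.eps * W.h :=
  le_antisymm (H.eps_mul_le hW hred' hW') (H'.eps_mul_le hW' hred hW)

/-- The weight `j` cancels the denominator in `cyc`, so the expansion over subsets closes up to a
product. For `k = h` it is the number of exponents; this detects how far the support of `cyc`
reaches. -/
theorem prod_one_sub_eq (W : WeightSystem) (k : ℕ) :
    -∏ i ∈ W.fixed k, (1 - (W.h : ℚ) / W.a i) =
      ∑ j ∈ W.h.divisors, if j ∣ k then j * W.cyc j else 0 := by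
  have h1 : ∀ j ∈ W.h.divisors, (if j ∣ k then j * W.cyc j else 0) =
      (if j ∣ k then (j : ℚ) else 0) * W.cyc j := by
    intro j _
    split_ifs <;> simp
  have h2 : (W.fixed k).powerset = Finset.univ.filter fun I => I.lcm W.p ∣ k := by
    ext I
    simp only [Finset.mem_powerset, Finset.mem_filter, Finset.mem_univ, true_and,
      Finset.lcm_dvd_iff, Finset.subset_iff, mem_fixed_iff_p_dvd]
  rw [Finset.sum_congr rfl h1, sum_divisors_mul_cyc W fun j => if j ∣ k then (j : ℚ) else 0,
    Finset.prod_sub, h2, Finset.sum_filter, ← Finset.sum_neg_distrib]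
  refine Finset.sum_congr rfl fun I _ => ?_
  have : ((I.lcm W.p : ℕ) : ℚ) ≠ 0 := by exact_mod_cast (W.lcm_p_pos I).ne'
  split_ifs
  · simp only [Finset.prod_const_one]
    field_simp
    ring
  · simp

/-- Regularity of the one-variable fixed locus, tested at `d = a i`, gives `a i ∣ h - a i`. -/
theorem CountRegular.dvd_h_of_fixed_eq {W : WeightSystem} (hW : W.CountRegular) {k : ℕ}
    {i : Fin 3} (h : W.fixed k = {i}) : W.a i ∣ W.h := by
  rcases Nat.lt_or_ge 1 (W.a i) with h1 | h1
  · have h2 := hW.fixed k h1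
    rw [h, Finset.filter_singleton, Finset.filter_singleton, if_pos dvd_rfl] at h2
    split_ifs at h2 with h3
    · exact (Nat.dvd_sub_iff_left (W.a_lt_h i).le dvd_rfl).mp h3
    · simp at h2
  · have := W.a_pos i
    rw [show W.a i = 1 by omega]
    exact one_dvd _

theorem one_le_div_sub_one (W : WeightSystem) (i : Fin 3) : 1 ≤ (W.h : ℚ) / W.a i - 1 := by
  have h1 : (0 : ℚ) < W.a i := by exact_mod_cast W.a_pos i
  have h2 : (2 : ℚ) * W.a i ≤ W.h := by exact_mod_cast W.two_mul_a_le i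
  rw [le_sub_iff_add_le, le_div_iff₀ h1]
  linarith

theorem two_mul_a_eq_of_mul_eq_one {W : WeightSystem} {i j : Fin 3}
    (h : ((W.h : ℚ) / W.a i - 1) * ((W.h : ℚ) / W.a j - 1) = 1) :
    2 * W.a i = W.h ∧ 2 * W.a j = W.h := by
  have hi := W.one_le_div_sub_one i
  have hj := W.one_le_div_sub_one j
  have h1 : (W.h : ℚ) / W.a i - 1 = 1 := by nlinarith
  have h2 : (W.h : ℚ) / W.a j - 1 = 1 := by nlinarith
  have h3 : (W.a i : ℚ) ≠ 0 := by exact_mod_cast (W.a_pos i).ne'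
  have h4 : (W.a j : ℚ) ≠ 0 := by exact_mod_cast (W.a_pos j).ne'
  field_simp at h1 h2
  constructor
  · have : (2 : ℚ) * W.a i = W.h := by linarith
    exact_mod_cast this
  · have : (2 : ℚ) * W.a j = W.h := by linarith
    exact_mod_cast this

/-- The weight systems `(2, d, d; 2d)` with `d` odd. -/
def IsDoubledA (W : WeightSystem) (d : ℕ) : Prop :=
  W.h = 2 * d ∧ Odd d ∧ 3 ≤ d ∧ ∃ i, W.a i = 2 ∧ ∀ j, j ≠ i → W.a j = d

theorem exists_compl_pair (i : Fin 3) : ∃ j k : Fin 3, j ≠ i ∧ k ≠ i ∧ j ≠ k ∧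
    Finset.univ = ({i, j, k} : Finset (Fin 3)) := by
  revert i
  decide

theorem IsReduced.eq_one_of_dvd {W : WeightSystem} (hred : W.IsReduced) {c : ℕ}
    (h : ∀ i, c ∣ W.a i) (hh : c ∣ W.h) : c = 1 :=
  Nat.eq_one_of_dvd_one (hred ▸ Nat.dvd_gcd (Finset.dvd_gcd fun i _ => h i) hh)

/-- The product of `1 - h / a i` over the moved variables is `1`, while every factor is at most
`-1`. Hence either none is moved, or exactly two are and both have weight `h / 2`; reducedness and
regularity of the third variable then pin down the weights. -/
theorem CountRegular.eq_h_or_isDoubledA {W : WeightSystem} (hred : W.IsReduced)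
    (hW : W.CountRegular) {d : ℕ} (hd : d ∣ W.h)
    (H : ∏ i ∈ W.fixed d, (1 - (W.h : ℚ) / W.a i) = ∏ i, (1 - (W.h : ℚ) / W.a i)) :
    d = W.h ∨ W.IsDoubledA d := by
  by_cases hdh : d = W.h
  · exact Or.inl hdh
  right
  have hd0 : 0 < d := Nat.pos_of_dvd_of_pos hd W.h_pos
  have hdlt : d < W.h := lt_of_le_of_ne (Nat.le_of_dvd W.h_pos hd) hdh
  have hne := hred.fixed_ne_univ hd0.ne' hdlt
  have h1 := W.one_le_div_sub_one
  have hprod : ∏ i ∈ (W.fixed d)ᶜ, (1 - (W.h : ℚ) / W.a i) = 1 := by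
    rw [← Finset.prod_mul_prod_compl (W.fixed d)] at H
    have h2 : ∏ i ∈ W.fixed d, (1 - (W.h : ℚ) / W.a i) ≠ 0 :=
      Finset.prod_ne_zero_iff.mpr fun i _ => by have := h1 i; linarith
    exact mul_left_cancel₀ h2 (H.symm.trans (mul_one _).symm)
  rcases card_cases (W.fixed d) with h | ⟨i, h⟩ | ⟨i, j, hij, h⟩ | h
  · exfalso
    rw [h, Finset.compl_empty, Fin.prod_univ_three] at hprod
    have h2 : 1 ≤ ((W.h : ℚ) / W.a 0 - 1) * ((W.h : ℚ) / W.a 1 - 1) :=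
      one_le_mul_of_one_le_of_one_le (h1 0) (h1 1)
    have h3 := one_le_mul_of_one_le_of_one_le h2 (h1 2)
    linarith
  · obtain ⟨j, k, hji, hki, hjk, huniv⟩ := exists_compl_pair i
    have hc : (W.fixed d)ᶜ = {j, k} := by
      rw [h]
      ext l
      have := Finset.mem_univ l
      rw [huniv] at this
      simp only [Finset.mem_insert, Finset.mem_singleton, Finset.mem_compl] at this ⊢
      constructor
      · tauto
      · rintro (rfl | rfl) <;> assumption
    rw [hc, Finset.prod_pair hjk] at hprod
    obtain ⟨haj, hak⟩ := two_mul_a_eq_of_mul_eq_one (W := W) (i := j) (j := k)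
      (by linear_combination hprod)
    have hai := hW.dvd_h_of_fixed_eq h
    have hmi : W.h ∣ W.a i * d := mem_fixed.mp (h ▸ Finset.mem_singleton_self i)
    have hmj : ¬ W.h ∣ W.a j * d := fun hm => by
      have := mem_fixed.mpr hm
      rw [h, Finset.mem_singleton] at this
      exact hji this
    -- If `d` were even, a variable of weight `h / 2` would be fixed by the `d`-th power.
    have hodd : Odd d := by
      by_contra heven
      rw [Nat.not_odd_iff_even] at heven
      obtain ⟨c, hc⟩ := heven
      apply hmj
      rw [hc, ← haj]
      exact ⟨c, by ring⟩
    obtain ⟨g, hg⟩ := hd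
    have hgeven : 2 ∣ g := by
      have h2 : 2 ∣ d * g := hg ▸ ⟨W.a j, haj.symm⟩
      rcases (Nat.Prime.dvd_mul Nat.prime_two).mp h2 with h3 | h3
      · have := Nat.odd_iff.mp hodd
        omega
      · exact h3
    obtain ⟨g', rfl⟩ := hgeven
    have haj' : W.a j = d * g' := by
      have : 2 * W.a j = 2 * (d * g') := by rw [haj, hg]; ring
      omega
    have hak' : W.a k = d * g' := by omega
    have hgi : 2 * g' ∣ W.a i := by
      rw [hg, mul_comm (W.a i)] at hmi
      exact Nat.dvd_of_mul_dvd_mul_left hd0 hmi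
    have hall : ∀ c, c ∣ W.a i → c ∣ W.a j → ∀ l, c ∣ W.a l := by
      intro c h2 h3 l
      have := Finset.mem_univ l
      rw [huniv] at this
      simp only [Finset.mem_insert, Finset.mem_singleton] at this
      rcases this with rfl | rfl | rfl
      · exact h2
      · exact h3
      · rwa [hak', ← haj']
    have hg1 : g' = 1 := hred.eq_one_of_dvd
      (hall g' ((Dvd.intro_left 2 rfl).trans hgi) (haj' ▸ Dvd.intro_left d rfl))
      (hg ▸ ⟨d * 2, by ring⟩)
    subst hg1
    obtain ⟨c, hc2⟩ := hgi
    have hc1 : c = 1 := by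
      have hcd : c ∣ d := by
        rw [hc2, hg] at hai
        exact Nat.dvd_of_mul_dvd_mul_left two_pos (by simpa [mul_comm d 2] using hai)
      refine hred.eq_one_of_dvd (hall c (hc2 ▸ Dvd.intro_left _ rfl) ?_) ?_
      · rw [haj']
        exact hcd.mul_right _
      · rw [hg]
        exact hcd.mul_right _
    refine ⟨by omega, hodd, ?_, i, by omega, fun l hl => ?_⟩
    · have := W.two_mul_a_le i
      have := Nat.odd_iff.mp hodd
      omega
    · have := Finset.mem_univ l
      rw [huniv] at this
      simp only [Finset.mem_insert, Finset.mem_singleton] at this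
      rcases this with rfl | rfl | rfl
      · exact absurd rfl hl
      · omega
      · omega
  · exfalso
    have hcard := Finset.card_add_card_compl (W.fixed d)
    rw [h, Finset.card_pair hij, Fintype.card_fin] at hcard
    obtain ⟨k, hk⟩ := Finset.card_eq_one.mp (show ({i, j} : Finset (Fin 3))ᶜ.card = 1 by omega)
    rw [h, hk, Finset.prod_singleton] at hprod
    have := h1 k
    linarith
  · exact absurd h hne

/-- If `zeta ^ d` has value `1` on every exponent, the shifted `jac` takes the same value at `zeta ^
d` and at `1`; `aeval_mul` computes both. -/
theorem CountRegular.prod_fixed_eq_of_dvd {W : WeightSystem} (hW : W.CountRegular) {d : ℕ}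
    (H : ∀ n ∈ (W.jac Finset.univ).support, (W.h : ℤ) ∣ (n + W.eps) * d) :
    ∏ i ∈ W.fixed d, (1 - (W.h : ℚ) / W.a i) = ∏ i, (1 - (W.h : ℚ) / W.a i) := by
  have hJ := hW.hasJac_univ
  have hzd : (W.zeta ^ d) ^ W.h = 1 := by
    rw [← pow_mul, mul_comm, pow_mul, W.isPrimitiveRoot_zeta.pow_eq_one, one_pow]
  have h1 := hJ.aeval_mul hzd
  have h2 := hJ.aeval_mul (one_pow W.h : (1 : ℂ) ^ W.h = 1)
  have h3 : aeval (W.zeta ^ d) (W.jac Finset.univ) * (W.zeta ^ d) ^ (∑ i, W.a i) =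
      aeval 1 (W.jac Finset.univ) * 1 ^ (∑ i, W.a i) := by
    rw [aeval_def, aeval_def, eval₂_eq_sum, eval₂_eq_sum, Polynomial.sum, Polynomial.sum,
      Finset.sum_mul, Finset.sum_mul]
    refine Finset.sum_congr rfl fun n hn => ?_
    rw [mul_assoc, ← pow_add, one_pow, one_pow, mul_one, mul_one, ← pow_mul]
    have h4 : W.zeta ^ (d * (n + ∑ i, W.a i)) = 1 := by
      rw [zeta_pow_eq_one_iff, ← Int.natCast_dvd_natCast]
      push_cast
      rw [sum_a_eq]
      have e : (d : ℤ) * (n + (W.eps + W.h)) = (n + W.eps) * d + W.h * d := by ring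
      rw [e]
      exact dvd_add (H n hn) (dvd_mul_right (W.h : ℤ) d)
    rw [h4, mul_one]
  rw [h3, h2] at h1
  have h5 : ((-1 : ℂ) ^ (Finset.univ : Finset (Fin 3)).card) ≠ 0 := pow_ne_zero _ (by norm_num)
  have h6 := mul_left_cancel₀ h5 h1
  simp only [one_pow, if_true] at h6
  have h7 : ∀ i, (W.zeta ^ d) ^ W.a i = 1 ↔ i ∈ W.fixed d := by
    intro i
    rw [← pow_mul, zeta_pow_eq_one_iff, mul_comm d, ← mem_fixed]
  simp only [h7] at h6
  have h8 : Finset.univ.filter (fun i => i ∈ W.fixed d) = W.fixed d := by ext; simp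
  rw [Finset.prod_ite, Finset.prod_const_one, mul_one, h8] at h6
  have h9 := h6.symm
  apply (algebraMap ℚ ℂ).injective
  simpa only [map_prod, map_sub, map_one, map_div₀, map_natCast] using h9

/-- For `(2, d, d; 2d)` the sectors `h - 1` and `d - 1` both lie at position `ε` with multiplicity
`1`, whereas the lowest coefficient of the other `jac` is `1`. -/
theorem SpecDual.not_isDoubledA {W W' : WeightSystem} (H : SpecDual W' W) (hred : W.IsReduced)
    (hW : W.CountRegular) (hW' : W'.CountRegular) (d : ℕ) : ¬ W.IsDoubledA d := by
  rintro ⟨hh, hodd, hd, i, hi, hj⟩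
  have hd2 := Nat.odd_iff.mp hodd
  obtain ⟨j, k, hji, hki, hjk, huniv⟩ := exists_compl_pair i
  have haj := hj j hji
  have hak := hj k hki
  have hni : i ∉ ({j, k} : Finset (Fin 3)) := by
    simp [hji.symm, hki.symm]
  have hsum : ∀ f : Fin 3 → ℤ, ∑ l, f l = f i + f j + f k := by
    intro f
    rw [huniv, Finset.sum_insert hni, Finset.sum_pair hjk, add_assoc]
  have hε : W.eps = 2 := by
    rw [eps, hsum, hi, haj, hak, hh]
    push_cast
    ring
  have h1 := H.coeff_eq 0
  rw [hW'.hasJac_univ.coeff_zero] at h1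
  have hh' : (W'.h : ℤ) ≠ 0 := by exact_mod_cast W'.h_pos.ne'
  have hodd_not : ∀ m, ¬ 2 * d ∣ d * (2 * m + 1) := by
    intro m hm
    rw [mul_comm 2 d] at hm
    have := Nat.dvd_of_mul_dvd_mul_left (by omega) hm
    omega
  obtain ⟨e, he⟩ : ∃ e, d = 2 * e + 1 := ⟨d / 2, by omega⟩
  have hf1 : W.fixed (W.h - 1) = ∅ := by
    rw [mem_fixed_sub (by omega)]
    ext l
    rw [mem_fixed, hh, mul_one]
    simp only [Finset.notMem_empty, iff_false]
    by_cases hl : l = i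
    · rw [hl, hi]
      intro h
      have := Nat.le_of_dvd two_pos h
      omega
    · rw [hj l hl]
      intro h
      have := Nat.le_of_dvd (by omega) h
      omega
  have hf2 : W.fixed (d - 1) = {j, k} := by
    ext l
    have hl := Finset.mem_univ l
    rw [huniv] at hl
    simp only [Finset.mem_insert, Finset.mem_singleton] at hl ⊢
    rw [mem_fixed, hh]
    rcases hl with rfl | rfl | rfl
    · rw [hi]
      simp only [hji.symm, hki.symm, or_self, iff_false]
      intro h
      have := Nat.le_of_dvd (by omega) h
      omega
    · simp only [true_or, iff_true, haj]
      exact ⟨e, by rw [show d - 1 = 2 * e by omega]; ring⟩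
    · simp only [or_true, iff_true, hak]
      exact ⟨e, by rw [show d - 1 = 2 * e by omega]; ring⟩
  have hp1 : W.pos (W.h - 1) = W.eps := by
    have h2 := sum_mod_sub W (k := 1) (by omega)
    have h3 : W.fixed 1 = ∅ := by rw [← mem_fixed_sub (by omega), hf1]
    rw [pos, hf1, h2, h3, hsum]
    rw [mul_one, mul_one, mul_one, Nat.mod_eq_of_lt (W.a_lt_h i), Nat.mod_eq_of_lt (W.a_lt_h j),
      Nat.mod_eq_of_lt (W.a_lt_h k), hi, haj, hak, hε, hh]
    simp
    ring
  have hp2 : W.pos (d - 1) = W.eps := by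
    have h3 : ∀ l ∈ W.fixed (d - 1), W.a l * (d - 1) % W.h = 0 := fun l hl =>
      Nat.mod_eq_zero_of_dvd (mem_fixed.mp hl)
    rw [hf2] at h3
    rw [pos, hf2, hsum, h3 j (by simp), h3 k (by simp), Finset.card_pair hjk, hi,
      Nat.mod_eq_of_lt (by omega), hε, hh]
    push_cast
    omega
  have hm1 : W.sectorMult (W.h - 1) = 1 := by
    rw [sectorMult, hf1, res_empty]
    simp
  have hJ := hW.hasJac (d - 1)
  have hm2 : W.sectorMult (d - 1) = 1 := by
    rw [hf2] at hJ
    rw [sectorMult, hf2, hJ.res_pair hjk, haj, hak, show W.h - d - d = 0 by omega, hJ.coeff_zero,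
      Finset.card_pair hjk]
    norm_num
  have h2 : ∑ l ∈ ({W.h - 1, d - 1} : Finset ℕ),
      (if (W.pos l - W.eps) * W'.h = (0 : ℕ) * W.h then W.sectorMult l else 0) ≤
      ∑ l ∈ Finset.Ico 1 W.h,
        if (W.pos l - W.eps) * W'.h = (0 : ℕ) * W.h then W.sectorMult l else 0 := by
    refine Finset.sum_le_sum_of_subset_of_nonneg ?_ fun l hl _ => ?_
    · intro l hl
      simp only [Finset.mem_insert, Finset.mem_singleton] at hl
      rw [Finset.mem_Ico]
      omega
    · rw [Finset.mem_Ico] at hl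
      split_ifs
      · exact hW.sectorMult_nonneg hred (by omega) hl.2
      · exact le_rfl
  rw [← h1, Finset.sum_pair (by omega), hp1, hp2, hm1, hm2] at h2
  simp at h2

/-- Sector positions are congruent to `-ε' * k`; transported by the common ratio `ε / h`, this makes
every exponent of `W` divisible by `g = gcd(ε, h)`. Then the power `d = h / g` acts trivially on all
exponents, which forces `d = h`. -/
theorem SpecDual.gcd_eps_h {W W' : WeightSystem} (H : SpecDual W W') (H' : SpecDual W' W)
    (hred : W.IsReduced) (hW : W.CountRegular)
    (hred' : W'.IsReduced) (hW' : W'.CountRegular) : Int.gcd W.eps W.h = 1 := by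
  have hee := H.eps_mul_eq H' hred hW hred' hW'
  have hh' : (W'.h : ℤ) ≠ 0 := by exact_mod_cast W'.h_pos.ne'
  set g := Int.gcd W.eps W.h with hg
  have hgh : g ∣ W.h := by
    rw [← Int.natCast_dvd_natCast]
    exact Int.gcd_dvd_right _ _
  have hgε : (g : ℤ) ∣ W.eps := Int.gcd_dvd_left _ _
  have hg0 : 0 < g := Nat.pos_of_dvd_of_pos hgh W.h_pos
  obtain ⟨d, hd⟩ := hgh
  have h1 : ∀ n ∈ (W.jac Finset.univ).support, (W.h : ℤ) ∣ (n + W.eps) * d := by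
    intro n hn
    obtain ⟨k, h0, hk, hm, hpos⟩ := H.exists_of_ne_zero (mem_support_iff.mp hn)
    obtain ⟨c, hc⟩ := W'.h_dvd_pos_add k
    have h2 : (n : ℤ) * W'.h = (W.h * c - W.eps * (k + 1)) * W'.h := by
      rw [← hpos]
      have : W'.pos k = W'.h * c - W'.eps * k := by linarith
      rw [this]
      linear_combination (k + 1) * hee
    have h3 := mul_right_cancel₀ hh' h2
    have h4 : (g : ℤ) ∣ n + W.eps := by
      rw [h3]
      have : (g : ℤ) ∣ W.h := by rw [hd]; push_cast; exact dvd_mul_right _ _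
      exact dvd_add (dvd_sub (this.mul_right _) (hgε.mul_right _)) hgε
    rw [hd]
    push_cast
    exact mul_dvd_mul_right h4 _
  rcases hW.eq_h_or_isDoubledA hred (d := d) (hd ▸ Dvd.intro_left _ rfl)
    (hW.prod_fixed_eq_of_dvd h1) with h | h
  · rw [h] at hd
    have := W.h_pos
    nlinarith
  · exact absurd h (H'.not_isDoubledA hred hW hW' d)

theorem SpecDual.h_eq {W W' : WeightSystem} (H : SpecDual W W') (H' : SpecDual W' W)
    (hred : W.IsReduced) (hW : W.CountRegular)
    (hred' : W'.IsReduced) (hW' : W'.CountRegular) : W'.h = W.h ∧ W'.eps = W.eps := by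
  have hee := H.eps_mul_eq H' hred hW hred' hW'
  have g1 := H.gcd_eps_h H' hred hW hred' hW'
  have g2 := H'.gcd_eps_h H hred' hW' hred hW
  have h1 : (W.h : ℤ) ∣ W'.h := by
    refine Int.dvd_of_dvd_mul_right_of_gcd_one (b := W.eps) ?_ (by rwa [Int.gcd_comm])
    exact ⟨W'.eps, by linarith⟩
  have h2 : (W'.h : ℤ) ∣ W.h := by
    refine Int.dvd_of_dvd_mul_right_of_gcd_one (b := W'.eps) ?_ (by rwa [Int.gcd_comm])
    exact ⟨W.eps, by linarith⟩
  have h3 : W'.h = W.h :=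
    Nat.dvd_antisymm (Int.natCast_dvd_natCast.mp h2) (Int.natCast_dvd_natCast.mp h1)
  refine ⟨h3, ?_⟩
  rw [h3] at hee
  exact (mul_right_cancel₀ (by exact_mod_cast W.h_pos.ne') hee).symm

end WeightSystem

/-! ### Reduction modulo `h`: sectors against exponents -/

namespace WeightSystem
open Polynomial

/-- The multiplicity of `m` among the exponents of the orbifold of `W` by its principal group. -/
noncomputable def dspec (W : WeightSystem) (m : ℤ) : ℤ :=
  ∑ k ∈ Finset.Ico 1 W.h, if W.pos k = m then W.sectorMult k else 0

theorem spec_eq_sum (W : WeightSystem) (m : ℤ) : W.spec m =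
    ∑ n ∈ (W.jac Finset.univ).support,
      if (n : ℤ) + W.eps = m then (W.jac Finset.univ).coeff n else 0 := by
  rw [spec]
  split_ifs with h
  · have h1 : ∀ n ∈ (W.jac Finset.univ).support,
        (if (n : ℤ) + W.eps = m then (W.jac Finset.univ).coeff n else 0) =
        if n = (m - W.eps).toNat then (W.jac Finset.univ).coeff n else 0 := fun n _ =>
      if_congr (by omega) rfl rfl
    rw [Finset.sum_congr rfl h1, Finset.sum_ite_eq']
    split_ifs with h2
    · rfl
    · exact notMem_support_iff.mp h2
  · refine (Finset.sum_eq_zero fun n _ => if_neg ?_).symm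
    omega

theorem specDual_iff {W W' : WeightSystem} (hh : W'.h = W.h) (hε : W'.eps = W.eps) :
    SpecDual W W' ↔ W'.spec 0 = 0 ∧ ∀ m, W.spec m = W'.dspec m := by
  have h0 : (W.h : ℤ) ≠ 0 := by exact_mod_cast W.h_pos.ne'
  have key : ∀ m : ℤ, (∑ n ∈ (W.jac Finset.univ).support,
      (if (n : ℤ) * W'.h = (m - W.eps) * W.h then (W.jac Finset.univ).coeff n else 0) =
    ∑ k ∈ Finset.Ico 1 W'.h,
      if (W'.pos k - W'.eps) * W.h = (m - W.eps) * W.h then W'.sectorMult k else 0) ↔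
      W.spec m = W'.dspec m := by
    intro m
    rw [spec_eq_sum, dspec, hh, hε]
    simp only [mul_left_inj' h0, eq_sub_iff_add_eq, sub_add_cancel]
  rw [SpecDual]
  refine and_congr_right fun _ => ⟨fun H m => (key m).mp (H _), fun H u => ?_⟩
  by_cases hu : ∃ m, u = (m - W.eps) * W.h
  · obtain ⟨m, rfl⟩ := hu
    exact (key m).mpr (H m)
  · rw [Finset.sum_eq_zero fun n _ => if_neg ?_, Finset.sum_eq_zero fun k _ => if_neg ?_]
    · rintro rfl
      exact hu ⟨W'.pos k, by rw [hε]⟩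
    · rintro rfl
      exact hu ⟨n + W.eps, by rw [hh]; ring⟩

theorem sum_mul_comp_eq {ι κ : Type} (S : Finset ι) (T : Finset κ) (w : ι → ℤ) (f : ι → ℤ)
    (w' : κ → ℤ) (f' : κ → ℤ)
    (H : ∀ u, ∑ x ∈ S, (if f x = u then w x else 0) = ∑ y ∈ T, if f' y = u then w' y else 0)
    (P : ℤ → Prop) [DecidablePred P] :
    ∑ x ∈ S, (if P (f x) then w x else 0) = ∑ y ∈ T, if P (f' y) then w' y else 0 := by
  classical
  have key : ∀ {α : Type} (A : Finset α) (v : α → ℤ) (g : α → ℤ) (U : Finset ℤ),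
      (∀ x ∈ A, g x ∈ U) → ∑ x ∈ A, (if P (g x) then v x else 0) =
        ∑ u ∈ U, if P u then ∑ x ∈ A, (if g x = u then v x else 0) else 0 := by
    intro α A v g U hU
    have h1 : ∀ u ∈ U, (if P u then ∑ x ∈ A, (if g x = u then v x else 0) else 0) =
        ∑ x ∈ A, if g x = u then (if P (g x) then v x else 0) else 0 := by
      intro u _
      split_ifs with h
      · refine Finset.sum_congr rfl fun x _ => ?_
        split_ifs with h2 h3
        · rfl
        · exact absurd (h2 ▸ h) h3
        · rfl
      · refine (Finset.sum_eq_zero fun x _ => ?_).symm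
        split_ifs with h2 h3
        · exact absurd (h2 ▸ h3) h
        · rfl
        · rfl
    rw [Finset.sum_congr rfl h1, Finset.sum_comm]
    refine Finset.sum_congr rfl fun x hx => ?_
    rw [Finset.sum_ite_eq, if_pos (hU x hx)]
  rw [key S w f (S.image f ∪ T.image f') fun x hx =>
      Finset.mem_union_left _ (Finset.mem_image_of_mem f hx),
    key T w' f' (S.image f ∪ T.image f') fun x hx =>
      Finset.mem_union_right _ (Finset.mem_image_of_mem f' hx)]
  exact Finset.sum_congr rfl fun u _ => by rw [H u]

/-- The number of exponents of the orbifold of `W` congruent to `r` modulo `h`. -/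
noncomputable def dres (W : WeightSystem) (r : ℤ) : ℤ :=
  ∑ k ∈ Finset.Ico 1 W.h, if (W.h : ℤ) ∣ W.pos k - r then W.sectorMult k else 0

theorem res_univ_eq_sum (W : WeightSystem) (r : ℤ) : W.res Finset.univ r =
    ∑ n ∈ (W.jac Finset.univ).support,
      if (W.h : ℤ) ∣ ((n : ℤ) + W.eps) - r then (W.jac Finset.univ).coeff n else 0 := by
  rw [res]
  refine Finset.sum_congr rfl fun n _ => if_congr ?_ rfl rfl
  rw [sum_a_eq, show (n : ℤ) + (W.eps + W.h) - r = (n + W.eps - r) + W.h by ring]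
  exact (dvd_add_left dvd_rfl)

theorem res_eq_dres {W W' : WeightSystem} (hh : W'.h = W.h)
    (H : ∀ m, W.spec m = W'.dspec m) (r : ℤ) : W.res Finset.univ r = W'.dres r := by
  rw [res_univ_eq_sum, dres, hh]
  refine sum_mul_comp_eq _ _ _ _ _ _ (fun u => ?_) (fun x => (W.h : ℤ) ∣ x - r)
  rw [← spec_eq_sum, H u, dspec, hh]

/-- As `ε` is a unit modulo `h`, the positions `-ε * k` are pairwise incongruent, so a residue class
contains a single sector. -/
theorem dres_neg_eps_mul {W : WeightSystem} (hg : Int.gcd W.eps W.h = 1) {k : ℕ} (h0 : k ≠ 0)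
    (hk : k < W.h) : W.dres (-(W.eps * k)) = W.sectorMult k := by
  have h1 : ∀ l ∈ Finset.Ico 1 W.h,
      (if (W.h : ℤ) ∣ W.pos l - -(W.eps * k) then W.sectorMult l else 0) =
      if l = k then W.sectorMult l else 0 := by
    intro l hl
    rw [Finset.mem_Ico] at hl
    refine if_congr ?_ rfl rfl
    have h2 := W.h_dvd_pos_add l
    constructor
    · intro h3
      have h4 : (W.h : ℤ) ∣ W.eps * (l - k) := by
        have := dvd_sub h2 h3
        rwa [show W.pos l + W.eps * l - (W.pos l - -(W.eps * k)) = W.eps * (l - k) by ring] at this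
      have h5 := Int.dvd_of_dvd_mul_right_of_gcd_one h4 (by rwa [Int.gcd_comm])
      have h6 := Int.eq_zero_of_abs_lt_dvd h5 (by rw [abs_lt]; omega)
      omega
    · rintro rfl
      rwa [sub_neg_eq_add]
  rw [dres, Finset.sum_congr rfl h1, Finset.sum_ite_eq', if_pos]
  rw [Finset.mem_Ico]
  omega

theorem dvd_h_div_iff {h i j : ℕ} (hh : 0 < h) (hi : i ∣ h) : h ∣ i * j ↔ h / i ∣ j := by
  obtain ⟨c, rfl⟩ := hi
  have hi0 : 0 < i := Nat.pos_of_mul_pos_right hh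
  rw [Nat.mul_div_cancel_left _ hi0, Nat.mul_dvd_mul_iff_left hi0]

theorem CountRegular.res_neg_eps_mul {W : WeightSystem} (hW : W.CountRegular)
    (hg : Int.gcd W.eps W.h = 1) (k : ℕ) :
    (W.res Finset.univ (-(W.eps * k)) : ℚ) =
      ∑ j ∈ W.h.divisors, if j ∣ k then W.cyc (W.h / j) else 0 := by
  rw [hW.res_univ_eq, ← Nat.sum_div_divisors]
  refine Finset.sum_congr rfl fun j hj => if_congr ?_ rfl rfl
  have hjd := Nat.dvd_of_mem_divisors hj
  rw [mul_neg, dvd_neg, mul_left_comm]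
  have h1 : (W.h : ℤ) ∣ W.eps * (((W.h / j : ℕ) : ℤ) * k) ↔ (W.h : ℤ) ∣ ((W.h / j : ℕ) : ℤ) * k :=
    ⟨fun h => Int.dvd_of_dvd_mul_right_of_gcd_one h (by rwa [Int.gcd_comm]),
      fun h => h.mul_left _⟩
  rw [h1, ← Nat.cast_mul, Int.natCast_dvd_natCast,
    dvd_h_div_iff W.h_pos (Nat.div_dvd_of_dvd hjd), Nat.div_div_self hjd W.h_pos.ne']

/-- Both numbers are divisor sums at `k`, of `j ↦ cyc (h / j)` for `W` and of `-cyc` for `W'`, and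
divisor sums can be inverted. -/
theorem cycDual_iff {W W' : WeightSystem} (hW : W.CountRegular) (hW' : W'.CountRegular)
    (hh : W'.h = W.h) (hg : Int.gcd W.eps W.h = 1) :
    CycDual W' W ↔ ∀ k : ℕ, W.res Finset.univ (-(W.eps * k)) = W'.sectorMult k := by
  have h1 : (∀ k : ℕ, W.res Finset.univ (-(W.eps * k)) = W'.sectorMult k) ↔
      ∀ k : ℕ, ∑ j ∈ W.h.divisors, (if j ∣ k then W'.cyc j else 0) =
        ∑ j ∈ W.h.divisors, if j ∣ k then -W.cyc (W.h / j) else 0 := by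
    refine forall_congr' fun k => ?_
    rw [← Int.cast_inj (α := ℚ), hW.res_neg_eps_mul hg, hW'.sectorMult_eq, hh]
    rw [show ∑ j ∈ W.h.divisors, (if j ∣ k then -W.cyc (W.h / j) else 0) =
      -∑ j ∈ W.h.divisors, (if j ∣ k then W.cyc (W.h / j) else 0) by
        rw [← Finset.sum_neg_distrib]
        exact Finset.sum_congr rfl fun j _ => by split_ifs <;> simp]
    constructor <;> intro h <;> linarith
  rw [h1]
  constructor
  · intro H k
    refine Finset.sum_congr rfl fun j hj => ?_
    rw [H j, if_pos (Nat.dvd_of_mem_divisors hj)]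
  · intro H i
    split_ifs with hi
    · exact eq_of_sum_divisors_eq W.h_pos.ne' _ (fun j => -W.cyc (W.h / j)) (fun k _ => H k) hi
    · exact cyc_eq_zero_of_not_dvd (by rwa [hh])

theorem CycDual.sum_cyc {W W' : WeightSystem} (H : CycDual W' W) (hh : W'.h = W.h) :
    ∑ j ∈ W'.h.divisors, W'.cyc j = -∑ j ∈ W.h.divisors, W.cyc j := by
  rw [hh, ← Nat.sum_div_divisors W.h W.cyc, ← Finset.sum_neg_distrib]
  refine Finset.sum_congr rfl fun j hj => ?_
  rw [H j, if_pos (Nat.dvd_of_mem_divisors hj)]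

theorem CountRegular.sum_cyc_eq {W : WeightSystem} (hW : W.CountRegular) :
    ∑ j ∈ W.h.divisors, W.cyc j = 2 * W.spec 0 := by
  have h1 := hW.res_univ_eq 0
  rw [hW.hasJac_univ.res_univ_zero] at h1
  simpa using h1.symm

/-- The total of `cyc` is twice `spec 0`, because the exponents divisible by `h` are `0` and `h`;
duality negates the total. -/
theorem CycDual.spec_zero {W W' : WeightSystem} (H : CycDual W' W) (hh : W'.h = W.h)
    (hW : W.CountRegular) (hW' : W'.CountRegular) : W'.spec 0 = -W.spec 0 := by
  have h1 := H.sum_cyc hh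
  rw [hW.sum_cyc_eq, hW'.sum_cyc_eq] at h1
  have h2 : (W'.spec 0 : ℚ) = -W.spec 0 := by linarith
  exact_mod_cast h2

theorem CycDual.symm {W W' : WeightSystem} (H : CycDual W' W) (hh : W'.h = W.h) :
    CycDual W W' := by
  intro i
  split_ifs with hi
  · rw [hh] at hi ⊢
    rw [H, if_pos (Nat.div_dvd_of_dvd hi), Nat.div_div_self hi W.h_pos.ne', neg_neg]
  · exact cyc_eq_zero_of_not_dvd (by rwa [← hh])

theorem CountRegular.sectorMult_of_dvd {W : WeightSystem} (hW : W.CountRegular) {k : ℕ}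
    (hk : W.h ∣ k) : W.sectorMult k = -(2 * W.spec 0) := by
  rw [sectorMult, fixed_of_dvd hk, hW.hasJac_univ.res_univ_zero]
  simp

theorem fixed_mod (W : WeightSystem) (k : ℕ) : W.fixed (k % W.h) = W.fixed k := by
  ext i
  rw [mem_fixed, mem_fixed, Nat.dvd_iff_mod_eq_zero, Nat.dvd_iff_mod_eq_zero, Nat.mul_mod_mod]

theorem sectorMult_mod (W : WeightSystem) (k : ℕ) : W.sectorMult (k % W.h) = W.sectorMult k := by
  rw [sectorMult, fixed_mod, sectorMult]

/-- For `h ∤ k` the claim is equality of spectra reduced modulo `h`. The class of `0` is outside the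
range of the sectors, and there both sides vanish with `spec 0`. -/
theorem SpecDual.cycDual {W W' : WeightSystem} (H : SpecDual W W') (H' : SpecDual W' W)
    (hred : W.IsReduced) (hW : W.CountRegular) (hred' : W'.IsReduced) (hW' : W'.CountRegular) :
    CycDual W' W := by
  obtain ⟨hh, hε⟩ := H.h_eq H' hred hW hred' hW'
  have hg := H.gcd_eps_h H' hred hW hred' hW'
  have hg' := H'.gcd_eps_h H hred' hW' hred hW
  have hs := ((specDual_iff hh hε).mp H).2
  rw [cycDual_iff hW hW' hh hg]
  intro k
  by_cases hk : W.h ∣ k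
  · rw [hW'.sectorMult_of_dvd (hh.symm ▸ hk), H.1]
    have h1 := hW.res_neg_eps_mul hg k
    have h2 : ∀ j ∈ W.h.divisors, (if j ∣ k then W.cyc (W.h / j) else 0) = W.cyc (W.h / j) :=
      fun j hj => if_pos ((Nat.dvd_of_mem_divisors hj).trans hk)
    rw [Finset.sum_congr rfl h2, Nat.sum_div_divisors, hW.sum_cyc_eq, H'.1] at h1
    have h3 : (W.res Finset.univ (-(W.eps * k)) : ℚ) = (-(2 * 0) : ℤ) := by rw [h1]; simp
    exact_mod_cast h3
  · rw [← sectorMult_mod, res_eq_dres hh hs, ← dres_neg_eps_mul hg']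
    · rw [dres, dres]
      refine Finset.sum_congr rfl fun l _ => if_congr ?_ rfl rfl
      rw [← hε]
      have h4 : (W'.h : ℤ) ∣ (k : ℤ) - ((k % W'.h : ℕ) : ℤ) := by
        rw [Int.natCast_mod]
        exact Int.dvd_self_sub_emod
      have h5 : W'.pos l - -(W'.eps * k) = W'.pos l - -(W'.eps * ((k % W'.h : ℕ) : ℤ)) +
          W'.eps * ((k : ℤ) - ((k % W'.h : ℕ) : ℤ)) := by ring
      rw [h5]
      exact dvd_add_left (h4.mul_left _)
    · rw [← hh, Nat.dvd_iff_mod_eq_zero] at hk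
      exact hk
    · exact Nat.mod_lt _ W'.h_pos

end WeightSystem

/-! ### Lifting congruences of exponents to equalities -/

namespace WeightSystem
open Polynomial

theorem CountRegular.dspec_symm {W : WeightSystem} (hred : W.IsReduced) (hW : W.CountRegular)
    (m : ℤ) : W.dspec (W.h - m) = W.dspec m := by
  rw [dspec, dspec]
  refine Finset.sum_nbij' (W.h - ·) (W.h - ·) ?_ ?_ ?_ ?_ ?_
  · intro k hk
    rw [Finset.mem_Ico] at hk ⊢
    omega
  · intro k hk
    rw [Finset.mem_Ico] at hk ⊢
    omega
  · intro k hk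
    rw [Finset.mem_Ico] at hk
    omega
  · intro k hk
    rw [Finset.mem_Ico] at hk
    omega
  · intro k hk
    rw [Finset.mem_Ico] at hk
    rw [sectorMult_sub hk.2.le]
    by_cases h : W.sectorMult k = 0
    · rw [h]
      simp
    · rw [hW.pos_sub hred (by omega) hk.2 h]
      exact if_congr (by omega) rfl rfl

/-- Some variable is moved and contributes a positive residue, which gives the upper bound; the
inverse sector gives the lower one. -/
theorem CountRegular.pos_mem {W : WeightSystem} (hred : W.IsReduced) (hW : W.CountRegular) {k : ℕ}
    (h0 : k ≠ 0) (hk : k < W.h) (hm : W.sectorMult k ≠ 0) :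
    -(W.h : ℤ) < W.pos k ∧ W.pos k < 2 * W.h := by
  have h1 : ∀ l < W.h, l ≠ 0 → W.sectorMult l ≠ 0 → W.pos l < 2 * W.h := by
    intro l hl hl0 hlm
    have h2 : ∃ i, i ∉ W.fixed l := by
      by_contra! h
      exact hred.fixed_ne_univ hl0 hl (Finset.eq_univ_iff_forall.mpr h)
    obtain ⟨i, hi⟩ := h2
    rw [mem_fixed, Nat.dvd_iff_mod_eq_zero] at hi
    have h3 : ((W.a i * l % W.h : ℕ) : ℤ) ≤ ∑ i, ((W.a i * l % W.h : ℕ) : ℤ) :=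
      Finset.single_le_sum (f := fun i => ((W.a i * l % W.h : ℕ) : ℤ))
        (fun i _ => Int.natCast_nonneg _) (Finset.mem_univ i)
    have h4 : 0 ≤ (((W.fixed l).card / 2 : ℕ) : ℤ) * W.h := by positivity
    rw [pos]
    omega
  refine ⟨?_, h1 k hk h0 hm⟩
  have h2 := h1 (W.h - k) (by omega) (by omega) (by rwa [sectorMult_sub hk.le])
  rw [hW.pos_sub hred h0 hk hm] at h2
  omega

theorem dspec_zero {W : WeightSystem} (hg : Int.gcd W.eps W.h = 1) : W.dspec 0 = 0 := by
  refine Finset.sum_eq_zero fun k hk => if_neg fun h => ?_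
  rw [Finset.mem_Ico] at hk
  have h1 := W.h_dvd_pos_add k
  rw [h, zero_add] at h1
  have h2 := Int.dvd_of_dvd_mul_right_of_gcd_one h1 (by rwa [Int.gcd_comm])
  have := Nat.le_of_dvd (by omega) (Int.natCast_dvd_natCast.mp h2)
  omega

theorem CountRegular.dspec_eq_zero {W : WeightSystem} (hred : W.IsReduced) (hW : W.CountRegular)
    {m : ℤ} (hm : m ≤ -W.h ∨ 2 * W.h ≤ m) : W.dspec m = 0 := by
  refine Finset.sum_eq_zero fun k hk => ?_
  rw [Finset.mem_Ico] at hk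
  by_cases h : W.sectorMult k = 0
  · rw [h, ite_self]
  · have := hW.pos_mem hred (by omega) hk.2 h
    exact if_neg (by omega)

theorem neg_h_lt_eps (W : WeightSystem) : -(W.h : ℤ) < W.eps := by
  have h1 := W.sum_a_eq
  have h2 : 0 < ∑ i, (W.a i : ℤ) :=
    Finset.sum_pos (fun i _ => by exact_mod_cast W.a_pos i) Finset.univ_nonempty
  omega

theorem HasJac.add_eps_mem {W : WeightSystem} (hJ : W.HasJac Finset.univ) {n : ℕ}
    (hn : n ∈ (W.jac Finset.univ).support) :
    -(W.h : ℤ) < n + W.eps ∧ n + W.eps < 2 * W.h := by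
  have h1 := le_natDegree_of_mem_supp _ hn
  have h2 := natDegree_jac_univ hJ
  have h3 := W.neg_h_lt_eps
  omega

theorem HasJac.spec_eq_zero {W : WeightSystem} (hJ : W.HasJac Finset.univ) {m : ℤ}
    (hm : m ≤ -W.h ∨ 2 * W.h ≤ m) : W.spec m = 0 := by
  rw [spec_eq_sum]
  refine Finset.sum_eq_zero fun n hn => if_neg ?_
  have := hJ.add_eps_mem hn
  omega

theorem ite_dvd_sub {h x r : ℤ} (v : ℤ) (hx : -h < x) (hx2 : x < 2 * h) (hr : 0 < r)
    (hrh : r < h) : (if h ∣ x - r then v else 0) =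
      (if x = r - h then v else 0) + (if x = r then v else 0) + (if x = r + h then v else 0) := by
  have h1 : h ∣ x - r ↔ x = r - h ∨ x = r ∨ x = r + h := by
    constructor
    · rintro ⟨c, hc⟩
      have h2 : -2 < c := by
        by_contra! h
        nlinarith
      have h3 : c < 2 := by
        by_contra! h
        nlinarith
      obtain rfl | rfl | rfl : c = -1 ∨ c = 0 ∨ c = 1 := by omega
      · left; linarith
      · right; left; linarith
      · right; right; linarith
    · rintro (rfl | rfl | rfl)
      · exact ⟨-1, by ring⟩
      · exact ⟨0, by ring⟩
      · exact ⟨1, by ring⟩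
  rw [if_congr h1 rfl rfl]
  split_ifs <;> omega

theorem HasJac.res_univ_eq_add {W : WeightSystem} (hJ : W.HasJac Finset.univ) {r : ℤ} (hr : 0 < r)
    (hrh : r < W.h) :
    W.res Finset.univ r = W.spec (r - W.h) + W.spec r + W.spec (r + W.h) := by
  rw [res_univ_eq_sum, spec_eq_sum, spec_eq_sum, spec_eq_sum, ← Finset.sum_add_distrib,
    ← Finset.sum_add_distrib]
  refine Finset.sum_congr rfl fun n hn => ?_
  have := hJ.add_eps_mem hn
  exact ite_dvd_sub _ this.1 this.2 hr hrh

theorem CountRegular.dres_eq_add {W : WeightSystem} (hred : W.IsReduced) (hW : W.CountRegular)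
    {r : ℤ} (hr : 0 < r) (hrh : r < W.h) :
    W.dres r = W.dspec (r - W.h) + W.dspec r + W.dspec (r + W.h) := by
  rw [dres, dspec, dspec, dspec, ← Finset.sum_add_distrib, ← Finset.sum_add_distrib]
  refine Finset.sum_congr rfl fun k hk => ?_
  rw [Finset.mem_Ico] at hk
  by_cases h : W.sectorMult k = 0
  · simp [h]
  · have := hW.pos_mem hred (by omega) hk.2 h
    exact ite_dvd_sub _ this.1 this.2 hr hrh

/-- The number of ways to write `s` as a combination of the weights of `W` with positive
coefficients. -/
def repCount (W : WeightSystem) (s : ℕ) : ℕ :=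
  ((Fintype.piFinset fun _ : Fin 3 => Finset.range W.h).filter
    fun l => ∑ i, W.a i * (l i + 1) = s).card

/-- The number of elements of the principal group fixing only the origin with age `s / h`. -/
def ageCount (W : WeightSystem) (s : ℕ) : ℕ :=
  ((Finset.Ico 1 W.h).filter
    fun k => (∀ i, W.a i * k % W.h ≠ 0) ∧ ∑ i, W.a i * k % W.h = s).card

/-- With the volume form a monomial with exponents `l i` has weight `∑ a i * (l i + 1)`, and in this
range no relation of the Jacobi ring interferes. -/
theorem HasJac.spec_eq_repCount {W : WeightSystem} (hJ : W.HasJac Finset.univ) {s : ℕ}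
    (hs : s < W.h) : W.spec ((s : ℤ) - W.h) = W.repCount s := by
  have hsum := W.sum_a_eq
  rw [spec, repCount]
  split_ifs with h
  · rw [hJ.coeff_univ]
    · congr 2
      refine Finset.filter_congr fun l _ => ?_
      have h1 : ∑ i, W.a i * (l i + 1) = ∑ i, W.a i * l i + ∑ i, W.a i := by
        rw [← Finset.sum_add_distrib]
        exact Finset.sum_congr rfl fun i _ => by ring
      rw [h1]
      have h2 : ((∑ i, W.a i : ℕ) : ℤ) = W.eps + W.h := by rw [← hsum]; push_cast; rfl
      omega
    · intro i
      have h1 : (W.a i : ℤ) ≤ ∑ i, (W.a i : ℤ) :=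
        Finset.single_le_sum (f := fun i => (W.a i : ℤ)) (fun i _ => Int.natCast_nonneg _)
          (Finset.mem_univ i)
      have := W.a_lt_h i
      omega
  · symm
    rw [Nat.cast_eq_zero, Finset.card_eq_zero, Finset.filter_eq_empty_iff]
    intro l _ h1
    have h2 : ∑ i, W.a i ≤ ∑ i, W.a i * (l i + 1) :=
      Finset.sum_le_sum fun i _ => Nat.le_mul_of_pos_right _ (by omega)
    have h3 : ((∑ i, W.a i : ℕ) : ℤ) = W.eps + W.h := by rw [← hsum]; push_cast; rfl
    omega

theorem fixed_eq_empty_iff {W : WeightSystem} {k : ℕ} :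
    W.fixed k = ∅ ↔ ∀ i, W.a i * k % W.h ≠ 0 := by
  simp [Finset.eq_empty_iff_forall_notMem, mem_fixed, Nat.dvd_iff_mod_eq_zero]

/-- By symmetry one looks at position `2 * h - s`, greater than `h`. Sectors with two fixed
variables are at most at `h`, so only elements fixing just the origin remain. -/
theorem CountRegular.dspec_eq_ageCount {W : WeightSystem} (hred : W.IsReduced)
    (hW : W.CountRegular) {s : ℕ} (hs : s < W.h) :
    W.dspec ((s : ℤ) - W.h) = W.ageCount s := by
  have h1 := hW.dspec_symm hred ((s : ℤ) - W.h)
  rw [← h1, dspec, ageCount, Finset.card_filter, Nat.cast_sum]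
  refine Finset.sum_congr rfl fun k hk => ?_
  rw [Finset.mem_Ico] at hk
  rw [Nat.cast_ite, Nat.cast_one, Nat.cast_zero]
  simp only [← fixed_eq_empty_iff]
  rcases hW.sectorMult_cases hred (by omega) hk.2 with ⟨h2, h3⟩ | ⟨h2, h3⟩ | ⟨i, j, hij, h2, h3, -⟩
  · rw [h3]
    refine if_congr ?_ rfl rfl
    rw [pos, h2, ← Nat.cast_sum]
    simp only [Finset.card_empty, true_and]
    omega
  · rw [h3, ite_self, if_neg]
    rintro ⟨h4, -⟩
    rw [h4] at h2
    simp at h2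
  · rw [if_neg, if_neg]
    · rintro ⟨h4, -⟩
      rw [h4] at h2
      exact absurd h2.symm (Finset.insert_ne_empty _ _)
    · rw [pos, h2, Finset.card_pair hij]
      have : 0 ≤ ∑ i, ((W.a i * k % W.h : ℕ) : ℤ) := Finset.sum_nonneg fun i _ => by positivity
      omega

/-- If the exponents of `W` and of the orbifold of `W'` agree modulo `h` and in the negative
degrees then they agree. -/
theorem CycDual.spec_eq_dspec {W W' : WeightSystem} (H : CycDual W' W) (hW : W.CountRegular)
    (hred' : W'.IsReduced) (hW' : W'.CountRegular)
    (hh : W'.h = W.h) (hε : W'.eps = W.eps) (hg : Int.gcd W.eps W.h = 1) (h0 : W.spec 0 = 0)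
    (hcount : ∀ s, 0 < s → s < W.h → W.repCount s = W'.ageCount s) (m : ℤ) :
    W.spec m = W'.dspec m := by
  have hJ := hW.hasJac_univ
  have hg' : Int.gcd W'.eps W'.h = 1 := by rwa [hh, hε]
  have hneg : ∀ m : ℤ, m < 0 → W.spec m = W'.dspec m := by
    intro m hm
    rcases le_or_gt m (-(W.h : ℤ)) with h | h
    · rw [hJ.spec_eq_zero (Or.inl h), hW'.dspec_eq_zero hred' (Or.inl (by rwa [hh]))]
    · obtain ⟨s, hs⟩ : ∃ s : ℕ, m = (s : ℤ) - W.h := ⟨(m + W.h).toNat, by omega⟩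
      rw [hs, hJ.spec_eq_repCount (by omega), hcount s (by omega) (by omega), ← hh,
        hW'.dspec_eq_ageCount hred' (by omega)]
  have hbig : ∀ m : ℤ, (W.h : ℤ) < m → W.spec m = W'.dspec m := by
    intro m hm
    rw [← spec_symm hJ, ← hW'.dspec_symm hred', hh]
    exact hneg _ (by omega)
  have hzero : W.spec 0 = W'.dspec 0 := by rw [h0, dspec_zero hg']
  rcases lt_trichotomy m 0 with h | rfl | h
  · exact hneg m h
  · exact hzero
  rcases lt_trichotomy m W.h with h2 | rfl | h2
  -- The class of `m` only contains `m - h`, `m` and `m + h`. The outer two multiplicities are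
  -- known, and duality gives the total.
  · have e1 := hJ.res_univ_eq_add h h2
    have e2 := hW'.dres_eq_add hred' h (by rwa [hh])
    -- Inverting `ε` modulo `h` writes `m` as `-ε * k`, with `k` the reduction of `-x`; the total of
    -- the class is then the multiplicity of sector `k`.
    obtain ⟨x, hx⟩ : ∃ x : ℤ, (W.h : ℤ) ∣ m - W.eps * x := by
      obtain ⟨u, v, huv⟩ := Int.isCoprime_iff_gcd_eq_one.mpr hg
      exact ⟨u * m, v * m, by linear_combination (-m) * huv⟩
    obtain ⟨k, hk0, hk⟩ : ∃ k : ℕ, (W.h : ℤ) ∣ m + W.eps * k ∧ k < W.h := by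
      have hpos : (0 : ℤ) < W.h := by exact_mod_cast W.h_pos
      refine ⟨((-x) % W.h).toNat, ?_, ?_⟩
      · have h3 := Int.emod_nonneg (-x) hpos.ne'
        rw [Int.toNat_of_nonneg h3]
        have h4 : (W.h : ℤ) ∣ -x - -x % W.h := Int.dvd_self_sub_emod
        have h5 : m + W.eps * (-x % W.h) = (m - W.eps * x) - W.eps * (-x - -x % W.h) := by ring
        rw [h5]
        exact dvd_sub hx (h4.mul_left _)
      · have := Int.emod_lt_of_pos (-x) hpos
        omega
    have hk1 : k ≠ 0 := by
      rintro rfl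
      rw [Nat.cast_zero, mul_zero, add_zero] at hk0
      have := Int.le_of_dvd h hk0
      omega
    have e3 : W.res Finset.univ m = W.res Finset.univ (-(W.eps * k)) := by
      rw [res_univ_eq_sum, res_univ_eq_sum]
      refine Finset.sum_congr rfl fun n _ => if_congr ?_ rfl rfl
      rw [show (n : ℤ) + W.eps - -(W.eps * k) = (n + W.eps - m) + (m + W.eps * k) by ring]
      exact (dvd_add_left hk0).symm
    have e4 : W'.dres m = W'.dres (-(W'.eps * k)) := by
      rw [dres, dres]
      refine Finset.sum_congr rfl fun n _ => if_congr ?_ rfl rfl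
      rw [show W'.pos n - -(W'.eps * k) = (W'.pos n - m) + (m + W'.eps * k) by ring, hh, hε]
      exact (dvd_add_left hk0).symm
    rw [e3, (cycDual_iff hW hW' hh hg).mp H] at e1
    rw [e4, dres_neg_eps_mul hg' hk1 (by omega), hh] at e2
    have e5 := hneg (m - W.h) (by omega)
    have e6 := hbig (m + W.h) (by omega)
    omega
  · have e1 := spec_symm hJ 0
    have e2 := hW'.dspec_symm hred' 0
    rw [sub_zero] at e1 e2
    rw [e1, ← hh, e2, hzero]
  · exact hbig m h2

end WeightSystem

/-! ### Monomials and group elements of an invertible polynomial and its transpose -/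

namespace WeightSystem
open Polynomial

/-- The expression is a combination of coordinates of the cross product of `adjugate M * 1` and
`adjugate M * k`, and the cofactor matrix of `adjugate M` is `det M` times the transpose of `M`. -/
theorem det_dvd_adjugate_minor (M : Matrix (Fin 3) (Fin 3) ℤ) (k : Fin 3 → ℤ) (i : Fin 3) :
    M.det ∣ (∑ i, ∑ j, M.adjugate i j) * (∑ j, M.adjugate i j * k j) -
      (∑ j, M.adjugate i j) * (∑ i, ∑ j, M.adjugate i j * k j) := by
  -- The cross product of `k` with the all-ones vector.
  set y : Fin 3 → ℤ := ![k 1 - k 2, k 2 - k 0, k 0 - k 1] with hy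
  set z : Fin 3 → ℤ := fun j => ∑ l, M l j * y l with hz
  set c : Fin 3 → ℤ := ![z 2 - z 1, z 0 - z 2, z 1 - z 0] with hc
  have key : (∑ i, ∑ j, M.adjugate i j) * (∑ j, M.adjugate i j * k j) -
      (∑ j, M.adjugate i j) * (∑ i, ∑ j, M.adjugate i j * k j) = M.det * c i := by
    rw [Matrix.adjugate_fin_three, Matrix.det_fin_three]
    simp only [hc, hz, hy]
    fin_cases i <;> simp [Fin.sum_univ_three] <;> ring
  exact ⟨_, key⟩

/-- The weight systems `W` and `W'` are those of an invertible polynomial with exponent matrix `M`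
and of its transpose, the order of the variables being given by `σ` and `τ`. -/
structure IsTransposeBy (W W' : WeightSystem) (σ τ : Equiv.Perm (Fin 3))
    (M : Matrix (Fin 3) (Fin 3) ℤ) : Prop where
  nonneg : ∀ i j, 0 ≤ M i j
  det_eq : M.det = W.h
  h_eq : W'.h = W.h
  row : ∀ i, ∑ j, M.adjugate i j = W'.a (τ i)
  col : ∀ j, ∑ i, M.adjugate i j = W.a (σ j)
  pos : ∀ k : Fin 3 → ℤ, (∀ i, 1 ≤ k i) → ∑ j, (W.a (σ j) : ℤ) * k j < W.h →
    ∀ i, 0 < ∑ j, M.adjugate i j * k j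

namespace IsTransposeBy

variable {W W' : WeightSystem} {σ τ : Equiv.Perm (Fin 3)} {M : Matrix (Fin 3) (Fin 3) ℤ}

theorem sum_adjugate (H : IsTransposeBy W W' σ τ M) :
    ∑ i, ∑ j, M.adjugate i j = W.eps + W.h := by
  have h1 : ∑ i, ∑ j, M.adjugate i j = ∑ j, ∑ i, M.adjugate i j := Finset.sum_comm
  rw [h1, Finset.sum_congr rfl fun j _ => H.col j,
    Equiv.sum_comp σ fun j => (W.a j : ℤ), sum_a_eq]

theorem eps_eq (H : IsTransposeBy W W' σ τ M) : W'.eps = W.eps := by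
  have h1 : ∑ i, ∑ j, M.adjugate i j = W'.eps + W'.h := by
    rw [Finset.sum_congr rfl fun j _ => H.row j, Equiv.sum_comp τ fun j => (W'.a j : ℤ), sum_a_eq]
  have h2 := H.sum_adjugate
  have h3 := H.h_eq
  rw [h1, h3] at h2
  linarith

theorem sum_adjugate_mul (H : IsTransposeBy W W' σ τ M) (k : Fin 3 → ℤ) :
    ∑ i, ∑ j, M.adjugate i j * k j = ∑ j, (W.a (σ j) : ℤ) * k j := by
  rw [Finset.sum_comm]
  refine Finset.sum_congr rfl fun j _ => ?_
  rw [← Finset.sum_mul, H.col]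

/-- With `s` the weight of the monomial `k`, this says that `adjugate M * k` is congruent to `s / ε`
times the weights of `W'`: it lists the residues of a group element. -/
theorem dvd_sub (H : IsTransposeBy W W' σ τ M) (k : Fin 3 → ℤ) (i : Fin 3) :
    (W.h : ℤ) ∣ W.eps * (∑ j, M.adjugate i j * k j) -
      W'.a (τ i) * ∑ j, (W.a (σ j) : ℤ) * k j := by
  have h1 := det_dvd_adjugate_minor M k i
  rw [H.sum_adjugate_mul, H.sum_adjugate, H.det_eq, H.row] at h1
  have h2 : W.eps * (∑ j, M.adjugate i j * k j) - W'.a (τ i) * ∑ j, (W.a (σ j) : ℤ) * k j =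
      ((W.eps + W.h) * (∑ j, M.adjugate i j * k j) - W'.a (τ i) * ∑ j, (W.a (σ j) : ℤ) * k j) -
        W.h * (∑ j, M.adjugate i j * k j) := by ring
  rw [h2]
  exact Int.dvd_sub h1 (dvd_mul_right _ _)

/-- By `dvd_sub` for unit vectors, a prime dividing `ε` and `h` divides every product of a weight of
`W'` with one of `W`, hence all weights of one of the two. -/
theorem gcd_eps_h (H : IsTransposeBy W W' σ τ M) (hred : W.IsReduced) (hred' : W'.IsReduced) :
    Int.gcd W.eps W.h = 1 := by
  by_contra hne
  obtain ⟨q, hq, hqg⟩ := Nat.exists_prime_and_dvd hne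
  have hqε : (q : ℤ) ∣ W.eps := (Int.natCast_dvd_natCast.mpr hqg).trans (Int.gcd_dvd_left _ _)
  have hqh : (q : ℤ) ∣ W.h := (Int.natCast_dvd_natCast.mpr hqg).trans (Int.gcd_dvd_right _ _)
  have hprod : ∀ i j, q ∣ W'.a i * W.a j := by
    intro i j
    have h1 := hqh.trans (H.dvd_sub (Pi.single (σ.symm j) 1) (τ.symm i))
    simp only [Pi.single_apply, mul_ite, mul_one, mul_zero, Finset.sum_ite_eq', Finset.mem_univ,
      if_true, Equiv.apply_symm_apply] at h1
    have h2 := (Int.dvd_iff_dvd_of_dvd_sub h1).mp (hqε.mul_right _)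
    exact_mod_cast h2
  by_cases hall : ∀ i, q ∣ W'.a i
  · exact hq.one_lt.ne' (hred'.eq_one_of_dvd hall
      (by rw [H.h_eq]; exact Int.natCast_dvd_natCast.mp hqh))
  · push Not at hall
    obtain ⟨i, hi⟩ := hall
    refine hq.one_lt.ne' (hred.eq_one_of_dvd (fun j => ?_) (Int.natCast_dvd_natCast.mp hqh))
    exact (hq.dvd_mul.mp (hprod i j)).resolve_left hi

theorem mul_adjugate_mul (H : IsTransposeBy W W' σ τ M) (k : Fin 3 → ℤ) (i : Fin 3) :
    ∑ l, M i l * ∑ j, M.adjugate l j * k j = W.h * k i := by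
  have h1 := congrFun (congrArg (fun N => Matrix.mulVec N k) M.mul_adjugate) i
  simp only [← Matrix.mulVec_mulVec, Matrix.smul_mulVec, Matrix.one_mulVec, Pi.smul_apply,
    smul_eq_mul, H.det_eq] at h1
  exact h1

theorem adjugate_mul_mul (H : IsTransposeBy W W' σ τ M) (x : Fin 3 → ℤ) (i : Fin 3) :
    ∑ l, M.adjugate i l * ∑ j, M l j * x j = W.h * x i := by
  have h1 := congrFun (congrArg (fun N => Matrix.mulVec N x) M.adjugate_mul) i
  simp only [← Matrix.mulVec_mulVec, Matrix.smul_mulVec, Matrix.one_mulVec, Pi.smul_apply,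
    smul_eq_mul, H.det_eq] at h1
  exact h1

theorem sum_mul_a (H : IsTransposeBy W W' σ τ M) (i : Fin 3) :
    ∑ l, M i l * W'.a (τ l) = W.h := by
  have h1 := H.mul_adjugate_mul (fun _ => 1) i
  simp only [mul_one] at h1
  rw [← h1]
  exact Finset.sum_congr rfl fun l _ => by rw [H.row]

/-- The entries of `x = adjugate M * k` are positive with sum less than `h`, and modulo `h` they
only depend on the weight. So the weight determines `x`, and `M * x = h • k` recovers `k`. -/
theorem eq_of_lt (H : IsTransposeBy W W' σ τ M) (hg : Int.gcd W.eps W.h = 1) {k k' : Fin 3 → ℤ}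
    (hk : ∀ i, 1 ≤ k i) (hk' : ∀ i, 1 ≤ k' i) (hs : ∑ j, (W.a (σ j) : ℤ) * k j < W.h)
    (he : ∑ j, (W.a (σ j) : ℤ) * k j = ∑ j, (W.a (σ j) : ℤ) * k' j) : k = k' := by
  have hlt : ∀ k : Fin 3 → ℤ, (∀ i, 1 ≤ k i) → ∑ j, (W.a (σ j) : ℤ) * k j < W.h → ∀ i,
      ∑ j, M.adjugate i j * k j < W.h := by
    intro k hk hs i
    refine lt_of_le_of_lt ?_ hs
    rw [← H.sum_adjugate_mul]
    exact Finset.single_le_sum (f := fun i => ∑ j, M.adjugate i j * k j)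
      (fun i _ => (H.pos k hk hs i).le) (Finset.mem_univ i)
  have hx : ∀ i, ∑ j, M.adjugate i j * k j = ∑ j, M.adjugate i j * k' j := by
    intro i
    have h1 := Int.dvd_sub (H.dvd_sub k i) (H.dvd_sub k' i)
    rw [← he, show ∀ a b c d : ℤ, a * b - c - (a * d - c) = a * (b - d) by intros; ring] at h1
    have h2 := Int.dvd_of_dvd_mul_right_of_gcd_one h1 (by rwa [Int.gcd_comm])
    have p1 := H.pos k hk hs i
    have p2 := H.pos k' hk' (he ▸ hs) i
    have p3 := hlt k hk hs i
    have p4 := hlt k' hk' (he ▸ hs) i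
    have h3 := Int.eq_zero_of_abs_lt_dvd h2 (by rw [abs_lt]; omega)
    linarith
  funext i
  have h1 := H.mul_adjugate_mul k i
  rw [Finset.sum_congr rfl fun l _ => by rw [hx l], H.mul_adjugate_mul] at h1
  exact (mul_left_cancel₀ (by exact_mod_cast W.h_pos.ne') h1).symm

/-- From a monomial `k` one gets the element `α ≡ s / ε`, whose residues are exactly `adjugate M *
k`. Conversely, the residue vector `x` of `α` satisfies `h ∣ M * x`, since `M` maps the weights of
`W'` to the constant vector `h`; then `k = M * x / h`. -/
theorem exists_rep_iff (H : IsTransposeBy W W' σ τ M) (hg : Int.gcd W.eps W.h = 1) {s : ℕ}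
    (hs : s < W.h) :
    (∃ k : Fin 3 → ℤ, (∀ i, 1 ≤ k i) ∧ ∑ j, (W.a (σ j) : ℤ) * k j = s) ↔
    ∃ α ∈ Finset.Ico 1 W'.h, (∀ i, W'.a i * α % W'.h ≠ 0) ∧ ∑ i, W'.a i * α % W'.h = s := by
  rw [H.h_eq]
  have hpos : (0 : ℤ) < W.h := by exact_mod_cast W.h_pos
  constructor
  · rintro ⟨k, hk, hks⟩
    have hxpos := H.pos k hk (by rw [hks]; exact_mod_cast hs)
    have hxsum := H.sum_adjugate_mul k
    rw [hks] at hxsum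
    have hxlt : ∀ i, ∑ j, M.adjugate i j * k j < W.h := by
      intro i
      have : ∑ j, M.adjugate i j * k j ≤ ∑ i, ∑ j, M.adjugate i j * k j :=
        Finset.single_le_sum (f := fun i => ∑ j, M.adjugate i j * k j)
          (fun i _ => (hxpos i).le) (Finset.mem_univ i)
      omega
    -- The Bézout coefficient `u` is the inverse of `ε` modulo `h`.
    obtain ⟨u, v, huv⟩ := Int.isCoprime_iff_gcd_eq_one.mpr hg
    have h0 := Int.emod_nonneg (u * s) hpos.ne'
    have h1 := Int.emod_lt_of_pos (u * s) hpos
    obtain ⟨α, hα⟩ : ∃ α : ℕ, (α : ℤ) = u * s % W.h := ⟨_, Int.toNat_of_nonneg h0⟩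
    have hmod : ∀ i, ((W'.a (τ i) * α % W.h : ℕ) : ℤ) = ∑ j, M.adjugate i j * k j := by
      intro i
      rw [Int.natCast_mod, Nat.cast_mul, ← Int.emod_eq_of_lt (hxpos i).le (hxlt i)]
      refine Int.ModEq.symm ?_
      rw [Int.modEq_iff_dvd]
      have h2 : (W.h : ℤ) ∣ u * s - α := by
        rw [hα]
        exact Int.dvd_self_sub_emod
      have h3 := H.dvd_sub k i
      rw [hks] at h3
      have h4 : (W'.a (τ i) : ℤ) * α - ∑ j, M.adjugate i j * k j =
          -(W'.a (τ i) * (u * s - α)) -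
          u * (W.eps * (∑ j, M.adjugate i j * k j) - W'.a (τ i) * s) -
          W.h * (v * ∑ j, M.adjugate i j * k j) := by
        linear_combination (∑ j, M.adjugate i j * k j) * huv
      rw [h4]
      exact Int.dvd_sub (Int.dvd_sub ((h2.mul_left _).neg_right) (h3.mul_left _)) (dvd_mul_right _ _)
    have hne : ∀ i, W'.a i * α % W.h ≠ 0 := by
      intro i h
      have h2 := hmod (τ.symm i)
      rw [Equiv.apply_symm_apply, h] at h2
      have := hxpos (τ.symm i)
      rw [← h2] at this
      simp at this
    refine ⟨α, ?_, hne, ?_⟩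
    · rw [Finset.mem_Ico]
      have : α ≠ 0 := by
        rintro rfl
        exact hne 0 (by simp)
      omega
    · have : ((∑ i, W'.a i * α % W.h : ℕ) : ℤ) = s := by
        rw [← Equiv.sum_comp τ, Nat.cast_sum, Finset.sum_congr rfl fun i _ => hmod i, hxsum]
      exact_mod_cast this
  · rintro ⟨α, -, hne, hsum⟩
    set x : Fin 3 → ℤ := fun i => ((W'.a (τ i) * α % W.h : ℕ) : ℤ) with hx
    have hx1 : ∀ i, 1 ≤ x i := fun i => by
      have := hne (τ i)
      simp only [hx]
      omega
    have hdvd : ∀ i, (W.h : ℤ) ∣ ∑ j, M i j * x j := by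
      intro i
      have h1 : (W.h : ℤ) ∣ ∑ j, (M i j * W'.a (τ j) * α - M i j * x j) := by
        refine Finset.dvd_sum fun j _ => ?_
        rw [mul_assoc, ← mul_sub]
        refine Dvd.dvd.mul_left ?_ _
        simp only [hx, Int.natCast_mod, Nat.cast_mul]
        exact Int.dvd_self_sub_emod
      rw [Finset.sum_sub_distrib, ← Finset.sum_mul, H.sum_mul_a] at h1
      exact (Int.dvd_iff_dvd_of_dvd_sub h1).mp (dvd_mul_right _ _)
    choose k hk using hdvd
    have hk1 : ∀ i, 1 ≤ k i := by
      intro i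
      have h1 : 0 < ∑ j, M i j * x j := by
        refine Finset.sum_pos' (fun j _ => mul_nonneg (H.nonneg i j) (by linarith [hx1 j])) ?_
        have h2 : ∑ l, M i l * W'.a (τ l) ≠ 0 := by rw [H.sum_mul_a]; exact hpos.ne'
        obtain ⟨j, hj, hj2⟩ := Finset.exists_ne_zero_of_sum_ne_zero h2
        refine ⟨j, hj, mul_pos (lt_of_le_of_ne (H.nonneg i j) ?_) (by linarith [hx1 j])⟩
        exact (left_ne_zero_of_mul hj2).symm
      rw [hk] at h1
      exact (mul_pos_iff_of_pos_left hpos).mp h1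
    refine ⟨k, hk1, ?_⟩
    have h1 : ∀ i, ∑ l, M.adjugate i l * k l = x i := by
      intro i
      have h2 := H.adjugate_mul_mul x i
      rw [Finset.sum_congr rfl fun l _ => by rw [hk l]] at h2
      have h3 : (W.h : ℤ) * ∑ l, M.adjugate i l * k l = W.h * x i := by
        rw [← h2, Finset.mul_sum]
        exact Finset.sum_congr rfl fun l _ => by ring
      exact mul_left_cancel₀ hpos.ne' h3
    rw [← H.sum_adjugate_mul, Finset.sum_congr rfl fun i _ => h1 i, ← hsum, Nat.cast_sum,
      ← Equiv.sum_comp τ fun i => ((W'.a i * α % W.h : ℕ) : ℤ)]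

/-- Both counts are at most `1`, because `ε` is invertible modulo `h`, and they are nonzero
together. -/
theorem repCount_eq (H : IsTransposeBy W W' σ τ M) (hg : Int.gcd W.eps W.h = 1) {s : ℕ}
    (hs : s < W.h) : W.repCount s = W'.ageCount s := by
  have hrep : ∀ l : Fin 3 → ℕ, ∑ i, W.a i * (l i + 1) = s →
      (∀ i, 1 ≤ ((l (σ i) : ℤ) + 1)) ∧ ∑ j, (W.a (σ j) : ℤ) * ((l (σ j) : ℤ) + 1) = s := by
    intro l hl
    refine ⟨fun i => by omega, ?_⟩
    rw [Equiv.sum_comp σ fun j => (W.a j : ℤ) * ((l j : ℤ) + 1), ← hl]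
    push_cast
    rfl
  have h1 : W.repCount s ≤ 1 := by
    rw [repCount, Finset.card_le_one]
    intro l hl l' hl'
    obtain ⟨e1, e2⟩ := hrep l (Finset.mem_filter.mp hl).2
    obtain ⟨e3, e4⟩ := hrep l' (Finset.mem_filter.mp hl').2
    have h2 := H.eq_of_lt hg e1 e3 (by rw [e2]; exact_mod_cast hs) (e2.trans e4.symm)
    funext i
    have := congrFun h2 (σ.symm i)
    simp only [Equiv.apply_symm_apply] at this
    omega
  have h2 : W'.ageCount s ≤ 1 := by
    rw [ageCount, Finset.card_le_one]
    have h3 : ∀ α, ∑ i, W'.a i * α % W'.h = s → (W'.h : ℤ) ∣ W'.eps * α - s := by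
      intro α hα
      have h4 : (W'.h : ℤ) ∣ ∑ i, ((W'.a i : ℤ) * α - ((W'.a i * α % W'.h : ℕ) : ℤ)) := by
        refine Finset.dvd_sum fun i _ => ?_
        rw [Int.natCast_mod, Nat.cast_mul]
        exact Int.dvd_self_sub_emod
      rw [Finset.sum_sub_distrib, ← Finset.sum_mul, sum_a_eq, ← Nat.cast_sum, hα] at h4
      rw [show W'.eps * α - s = ((W'.eps + W'.h) * α - s) - W'.h * α by ring]
      exact Int.dvd_sub h4 (dvd_mul_right _ _)
    intro α hα β hβ
    rw [Finset.mem_filter, Finset.mem_Ico] at hα hβ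
    have h5 := Int.dvd_sub (h3 α hα.2.2) (h3 β hβ.2.2)
    rw [show W'.eps * (α : ℤ) - s - (W'.eps * β - s) = W'.eps * (α - β) by ring] at h5
    have h6 := Int.dvd_of_dvd_mul_right_of_gcd_one h5
      (by rw [Int.gcd_comm, H.eps_eq, H.h_eq]; exact hg)
    have h7 := Int.eq_zero_of_abs_lt_dvd h6 (by rw [abs_lt]; omega)
    omega
  have h3 : 0 < W.repCount s ↔ 0 < W'.ageCount s := by
    rw [repCount, ageCount, Finset.card_pos, Finset.card_pos]
    have h4 := H.exists_rep_iff hg hs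
    constructor
    · rintro ⟨l, hl⟩
      obtain ⟨α, e1, e2⟩ := h4.mp ⟨_, hrep l (Finset.mem_filter.mp hl).2⟩
      exact ⟨α, Finset.mem_filter.mpr ⟨e1, e2⟩⟩
    · rintro ⟨α, hα⟩
      rw [Finset.mem_filter] at hα
      obtain ⟨k, hk, hks⟩ := h4.mpr ⟨α, hα⟩
      have h5 : ∀ i, k i ≤ s := by
        intro i
        rw [← hks]
        refine le_trans ?_ (Finset.single_le_sum (f := fun j => (W.a (σ j) : ℤ) * k j)
          (fun j _ => mul_nonneg (Int.natCast_nonneg _) (by linarith [hk j])) (Finset.mem_univ i))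
        have : (1 : ℤ) ≤ W.a (σ i) := by exact_mod_cast W.a_pos _
        nlinarith [hk i]
      refine ⟨fun i => (k (σ.symm i) - 1).toNat, Finset.mem_filter.mpr ⟨?_, ?_⟩⟩
      · rw [Fintype.mem_piFinset]
        intro i
        rw [Finset.mem_range]
        have := h5 (σ.symm i)
        have := hk (σ.symm i)
        omega
      · have h6 : ((∑ i, W.a i * ((k (σ.symm i) - 1).toNat + 1) : ℕ) : ℤ) = s := by
          rw [← hks, ← Equiv.sum_comp σ, Nat.cast_sum]
          refine Finset.sum_congr rfl fun i _ => ?_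
          have := hk i
          rw [Equiv.symm_apply_apply, Nat.cast_mul]
          congr 1
          omega
        exact_mod_cast h6
  omega

end IsTransposeBy

end WeightSystem

/-! ### The function `cyc` in terms of the reduced fractions `a i / h = v i / p i` -/

namespace WeightSystem
open Polynomial

/-- The numerator of `aᵢ / h` in lowest terms. -/
def v (W : WeightSystem) (i : Fin 3) : ℕ := W.a i / Nat.gcd W.h (W.a i)

theorem gcd_h_a_pos (W : WeightSystem) (i : Fin 3) : 0 < Nat.gcd W.h (W.a i) :=
  Nat.gcd_pos_of_pos_left _ W.h_pos

theorem p_mul_gcd (W : WeightSystem) (i : Fin 3) : W.p i * Nat.gcd W.h (W.a i) = W.h :=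
  Nat.div_mul_cancel (Nat.gcd_dvd_left _ _)

theorem v_mul_gcd (W : WeightSystem) (i : Fin 3) : W.v i * Nat.gcd W.h (W.a i) = W.a i :=
  Nat.div_mul_cancel (Nat.gcd_dvd_right _ _)

theorem v_mul_h (W : WeightSystem) (i : Fin 3) : W.v i * W.h = W.p i * W.a i := by
  have h1 := W.p_mul_gcd i
  have h2 := W.v_mul_gcd i
  calc W.v i * W.h = W.v i * (W.p i * Nat.gcd W.h (W.a i)) := by rw [h1]
    _ = W.p i * (W.v i * Nat.gcd W.h (W.a i)) := by ring
    _ = W.p i * W.a i := by rw [h2]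

theorem v_pos (W : WeightSystem) (i : Fin 3) : 0 < W.v i := by
  have h1 := W.v_mul_gcd i
  have h2 := W.a_pos i
  by_contra h
  rw [show W.v i = 0 by omega] at h1
  omega

theorem two_mul_v_le (W : WeightSystem) (i : Fin 3) : 2 * W.v i ≤ W.p i := by
  have h1 := W.v_mul_gcd i
  have h2 := W.p_mul_gcd i
  have h3 := W.two_mul_a_le i
  refine Nat.le_of_mul_le_mul_right (c := Nat.gcd W.h (W.a i)) ?_ (W.gcd_h_a_pos i)
  rw [mul_assoc, h1, h2]
  exact h3

theorem two_le_p (W : WeightSystem) (i : Fin 3) : 2 ≤ W.p i := by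
  have := W.two_mul_v_le i
  have := W.v_pos i
  omega

theorem v_eq_one_of_dvd {W : WeightSystem} {i : Fin 3} (h : W.a i ∣ W.h) : W.v i = 1 := by
  rw [v, Nat.gcd_eq_right h, Nat.div_self (W.a_pos i)]

theorem a_eq_of_v_eq_one {W : WeightSystem} {i : Fin 3} (h : W.v i = 1) : W.p i * W.a i = W.h := by
  rw [← v_mul_h, h, one_mul]

/-- The `p i`-th power of the generator then fixes variable `i` alone, and one-variable regularity
gives `a i ∣ h`. -/
theorem CountRegular.v_eq_one {W : WeightSystem} (hW : W.CountRegular) {i : Fin 3}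
    (h : ∀ j, j ≠ i → ¬ W.p j ∣ W.p i) : W.v i = 1 := by
  refine v_eq_one_of_dvd (hW.dvd_h_of_fixed_eq (k := W.p i) ?_)
  ext j
  rw [mem_fixed_iff_p_dvd, Finset.mem_singleton]
  refine ⟨fun hj => ?_, fun hj => hj ▸ dvd_rfl⟩
  by_contra hne
  exact h j hne hj

theorem div_a_eq (W : WeightSystem) (i : Fin 3) : (W.h : ℚ) / W.a i = W.p i / W.v i := by
  have h1 : (W.v i : ℚ) * W.h = W.p i * W.a i := by exact_mod_cast W.v_mul_h i
  have h2 : (W.v i : ℚ) ≠ 0 := by exact_mod_cast (W.v_pos i).ne'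
  have h3 : (W.a i : ℚ) ≠ 0 := by exact_mod_cast (W.a_pos i).ne'
  rw [div_eq_div_iff h3 h2]
  linarith

theorem cyc_single_term (W : WeightSystem) (i : Fin 3) (n : ℕ) :
    (if W.p i = n then (W.h : ℚ) / W.a i / n else 0) =
      if W.p i = n then 1 / (W.v i : ℚ) else 0 := by
  split_ifs with h
  · rw [← h, div_a_eq]
    have h2 : (W.v i : ℚ) ≠ 0 := by exact_mod_cast (W.v_pos i).ne'
    have h3 : (W.p i : ℚ) ≠ 0 := by exact_mod_cast (W.p_pos i).ne'
    field_simp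
  · rfl

theorem cyc_pair_term (W : WeightSystem) (i j : Fin 3) (n : ℕ) :
    (if Nat.lcm (W.p i) (W.p j) = n then (W.h : ℚ) / W.a i * (W.h / W.a j) / n else 0) =
      if Nat.lcm (W.p i) (W.p j) = n then (Nat.gcd (W.p i) (W.p j) : ℚ) / (W.v i * W.v j)
        else 0 := by
  split_ifs with h
  · rw [← h, div_a_eq, div_a_eq]
    have h2 : (W.v i : ℚ) ≠ 0 := by exact_mod_cast (W.v_pos i).ne'
    have h3 : (W.v j : ℚ) ≠ 0 := by exact_mod_cast (W.v_pos j).ne'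
    have h4 : ((Nat.lcm (W.p i) (W.p j) : ℕ) : ℚ) ≠ 0 := by
      exact_mod_cast (Nat.lcm_pos (W.p_pos i) (W.p_pos j)).ne'
    have h5 : (Nat.gcd (W.p i) (W.p j) : ℚ) * Nat.lcm (W.p i) (W.p j) = W.p i * W.p j := by
      exact_mod_cast Nat.gcd_mul_lcm _ _
    field_simp
    linarith
  · rfl

theorem IsReduced.cyc_eq_of {W : WeightSystem} (hW : W.IsReduced) {i j k : Fin 3} (hij : i ≠ j)
    (hik : i ≠ k) (hjk : j ≠ k) (n : ℕ) : W.cyc n = (if n = 1 then -1 else 0) +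
      (if W.p i = n then 1 / (W.v i : ℚ) else 0) + (if W.p j = n then 1 / (W.v j : ℚ) else 0) +
      (if W.p k = n then 1 / (W.v k : ℚ) else 0) -
      (if Nat.lcm (W.p i) (W.p j) = n then
        (Nat.gcd (W.p i) (W.p j) : ℚ) / (W.v i * W.v j) else 0) -
      (if Nat.lcm (W.p i) (W.p k) = n then
        (Nat.gcd (W.p i) (W.p k) : ℚ) / (W.v i * W.v k) else 0) -
      (if Nat.lcm (W.p j) (W.p k) = n then
        (Nat.gcd (W.p j) (W.p k) : ℚ) / (W.v j * W.v k) else 0) +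
      (if W.h = n then (W.p i * W.p j * W.p k : ℚ) / (W.v i * W.v j * W.v k * W.h) else 0) := by
  have hlast : ∀ n, (if W.h = n then (W.h : ℚ) / W.a 0 * (W.h / W.a 1) * (W.h / W.a 2) / n else 0) =
      if W.h = n then (W.p 0 * W.p 1 * W.p 2 : ℚ) / (W.v 0 * W.v 1 * W.v 2 * W.h) else 0 := by
    intro n
    split_ifs with h
    · rw [← h, div_a_eq, div_a_eq, div_a_eq, div_mul_div_comm, div_mul_div_comm, div_div]
    · rfl
  have hT : ∀ a b, (if Nat.lcm (W.p a) (W.p b) = n then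
      (Nat.gcd (W.p a) (W.p b) : ℚ) / (W.v a * W.v b) else 0) =
      if Nat.lcm (W.p b) (W.p a) = n then
      (Nat.gcd (W.p b) (W.p a) : ℚ) / (W.v b * W.v a) else 0 := fun a b => by
    rw [Nat.lcm_comm, Nat.gcd_comm, mul_comm (W.v a : ℚ)]
  rw [hW.cyc_eq, cyc_single_term, cyc_single_term, cyc_single_term, cyc_pair_term, cyc_pair_term,
    cyc_pair_term, hlast]
  obtain ⟨h1, h2, h3⟩ | ⟨h1, h2, h3⟩ | ⟨h1, h2, h3⟩ | ⟨h1, h2, h3⟩ | ⟨h1, h2, h3⟩ | ⟨h1, h2, h3⟩ :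
      (i = 0 ∧ j = 1 ∧ k = 2) ∨ (i = 0 ∧ j = 2 ∧ k = 1) ∨ (i = 1 ∧ j = 0 ∧ k = 2) ∨
      (i = 1 ∧ j = 2 ∧ k = 0) ∨ (i = 2 ∧ j = 0 ∧ k = 1) ∨ (i = 2 ∧ j = 1 ∧ k = 0) := by
    revert hij hik hjk
    revert i j k
    decide
  all_goals
    have hL : (if W.h = n then (W.p i * W.p j * W.p k : ℚ) / (W.v i * W.v j * W.v k * W.h) else 0) =
        if W.h = n then (W.p 0 * W.p 1 * W.p 2 : ℚ) / (W.v 0 * W.v 1 * W.v 2 * W.h) else 0 := by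
      subst h1 h2 h3
      split_ifs
      · ring
      · rfl
    rw [hL]
    subst h1 h2 h3
  · rw [hT 2 0]; ring
  · rw [hT 2 0, hT 2 1]; ring
  · rw [hT 2 0, hT 1 0]; ring
  · rw [hT 1 0]; ring
  · rw [hT 2 1]; ring
  · rw [hT 2 1, hT 1 0]; ring

theorem IsReduced.lcm_eq {W : WeightSystem} (hW : W.IsReduced) {i j k : Fin 3} (hij : i ≠ j)
    (hik : i ≠ k) (hjk : j ≠ k) : Nat.lcm (W.p i) (Nat.lcm (W.p j) (W.p k)) = W.h := by
  have h1 : ∀ l, l = i ∨ l = j ∨ l = k := by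
    revert hij hik hjk
    revert i j k
    decide
  refine Nat.dvd_antisymm
    (Nat.lcm_dvd (W.p_dvd_h i) (Nat.lcm_dvd (W.p_dvd_h j) (W.p_dvd_h k))) ?_
  rw [← hW.lcm_p_univ]
  refine Finset.lcm_dvd fun l _ => ?_
  rcases h1 l with rfl | rfl | rfl
  · exact Nat.dvd_lcm_left _ _
  · exact (Nat.dvd_lcm_left _ _).trans (Nat.dvd_lcm_right _ _)
  · exact (Nat.dvd_lcm_right _ _).trans (Nat.dvd_lcm_right _ _)

theorem sum_divisors_ite {h n : ℕ} (hh : h ≠ 0) (hn : n ∣ h) (x : ℚ) :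
    ∑ j ∈ h.divisors, (if n = j then x else 0) = x := by
  rw [Finset.sum_ite_eq, if_pos (Nat.mem_divisors.mpr ⟨hn, hh⟩)]

theorem IsReduced.sum_cyc_eq_of {W : WeightSystem} (hW : W.IsReduced) {i j k : Fin 3} (hij : i ≠ j)
    (hik : i ≠ k) (hjk : j ≠ k) : ∑ n ∈ W.h.divisors, W.cyc n = -1 +
      1 / (W.v i : ℚ) + 1 / (W.v j : ℚ) + 1 / (W.v k : ℚ) -
      (Nat.gcd (W.p i) (W.p j) : ℚ) / (W.v i * W.v j) -
      (Nat.gcd (W.p i) (W.p k) : ℚ) / (W.v i * W.v k) -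
      (Nat.gcd (W.p j) (W.p k) : ℚ) / (W.v j * W.v k) +
      (W.p i * W.p j * W.p k : ℚ) / (W.v i * W.v j * W.v k * W.h) := by
  have hh := W.h_pos.ne'
  simp only [hW.cyc_eq_of hij hik hjk, Finset.sum_add_distrib, Finset.sum_sub_distrib]
  have h1 : ∑ n ∈ W.h.divisors, (if n = 1 then (-1 : ℚ) else 0) = -1 := by
    rw [Finset.sum_ite_eq', if_pos (Nat.mem_divisors.mpr ⟨one_dvd _, hh⟩)]
  rw [h1, sum_divisors_ite hh (W.p_dvd_h _), sum_divisors_ite hh (W.p_dvd_h _),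
    sum_divisors_ite hh (W.p_dvd_h _),
    sum_divisors_ite hh (Nat.lcm_dvd (W.p_dvd_h _) (W.p_dvd_h _)),
    sum_divisors_ite hh (Nat.lcm_dvd (W.p_dvd_h _) (W.p_dvd_h _)),
    sum_divisors_ite hh (Nat.lcm_dvd (W.p_dvd_h _) (W.p_dvd_h _)), sum_divisors_ite hh dvd_rfl]

theorem two_le_h (W : WeightSystem) : 2 ≤ W.h := by
  have := W.two_mul_a_le 0
  have := W.a_pos 0
  omega

theorem IsReduced.cyc_one {W : WeightSystem} (hW : W.IsReduced) : W.cyc 1 = -1 := by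
  have h1 : ∀ i, W.p i ≠ 1 := fun i => by have := W.two_le_p i; omega
  have h2 : ∀ i j, Nat.lcm (W.p i) (W.p j) ≠ 1 := fun i j h =>
    h1 i (Nat.eq_one_of_dvd_one (h ▸ Nat.dvd_lcm_left _ _))
  have h3 : W.h ≠ 1 := by have := W.two_le_h; omega
  rw [hW.cyc_eq_of (i := 0) (j := 1) (k := 2) (by decide) (by decide) (by decide)]
  simp [h1, h2, h3]

/-- The numerical properties of the function `cyc` shared by the members of a dual pair. -/
structure Balanced (W : WeightSystem) : Prop where
  red : W.IsReduced
  reg : W.CountRegular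
  cyc_h : W.cyc W.h = 1
  sum_cyc : ∑ n ∈ W.h.divisors, W.cyc n = 0

/-- The value at `h` is dual to `cyc 1 = -1`, which comes from the empty subset. -/
theorem CycDual.balanced {W W' : WeightSystem} (H : CycDual W' W) (hh : W'.h = W.h)
    (hred : W.IsReduced) (hred' : W'.IsReduced) (hW' : W'.CountRegular)
    (h0 : W'.spec 0 = 0) : W'.Balanced := by
  refine ⟨hred', hW', ?_, ?_⟩
  · rw [H, hh, if_pos dvd_rfl, Nat.div_self W.h_pos, hred.cyc_one, neg_neg]
  · rw [hW'.sum_cyc_eq, h0]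
    simp

end WeightSystem

/-! ### Balance equations when the `p i` form a chain or two of them coincide -/

namespace WeightSystem
open Polynomial

/-- The function `cyc` is the difference of the indicator functions of `P` and `N`. -/
def HasCyc (W : WeightSystem) (P N : Finset ℕ) : Prop :=
  ∀ n, W.cyc n = (if n ∈ P then 1 else 0) - (if n ∈ N then 1 else 0)

theorem p_ne_one (W : WeightSystem) (i : Fin 3) : W.p i ≠ 1 := by
  have := W.two_le_p i
  omega

theorem h_ne_one (W : WeightSystem) : W.h ≠ 1 := by
  have := W.two_le_h
  omega

theorem CountRegular.v_eq_one_of {W : WeightSystem} (hW : W.CountRegular) {i j k : Fin 3}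
    (hij : i ≠ j) (hik : i ≠ k) (hjk : j ≠ k) (h1 : ¬ W.p j ∣ W.p i) (h2 : ¬ W.p k ∣ W.p i) :
    W.v i = 1 := by
  refine hW.v_eq_one fun l hl => ?_
  have h3 : l = j ∨ l = k := by
    revert hij hik hjk hl
    clear h1 h2
    revert i j k l
    decide
  rcases h3 with rfl | rfl <;> assumption

theorem not_dvd_of_dvd_of_ne {a b : ℕ} (h : a ∣ b) (hne : a ≠ b) : ¬ b ∣ a :=
  fun h' => hne (Nat.dvd_antisymm h h')

/-- The values at `1`, `p i` and `h` are `-1`, `1` and `1`, so total zero forces the value at `p j`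
to be `-1`. This is `p i = v j + 1`; the value at `h` gives the second relation. -/
theorem Balanced.chain {W : WeightSystem} (B : W.Balanced) {i j k : Fin 3} (hij : i ≠ j)
    (hik : i ≠ k) (hjk : j ≠ k) (h1 : W.p i ∣ W.p j) (h2 : W.p j ∣ W.p k) (n1 : W.p i ≠ W.p j)
    (n2 : W.p j ≠ W.p k) : W.v i = 1 ∧ W.p i = W.v j + 1 ∧ W.v k + W.p i = W.p j + 1 ∧
      W.h = W.p k ∧ W.HasCyc {W.h, W.p i} {1, W.p j} := by
  have h3 := h1.trans h2
  have hk : W.h = W.p k := by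
    rw [← B.red.lcm_eq hij hik hjk, Nat.lcm_eq_right h2, Nat.lcm_eq_right h3]
  have n3 : W.p i ≠ W.p k := fun h =>
    n2 (Nat.dvd_antisymm h2 (h ▸ h1))
  have hvi : W.v i = 1 := B.reg.v_eq_one_of hij hik hjk (not_dvd_of_dvd_of_ne h1 n1)
    (not_dvd_of_dvd_of_ne h3 n3)
  have e1 := B.cyc_h
  have e2 := B.sum_cyc
  rw [B.red.cyc_eq_of hij hik hjk, Nat.lcm_eq_right h1, Nat.lcm_eq_right h2, Nat.lcm_eq_right h3,
    Nat.gcd_eq_left h1, Nat.gcd_eq_left h2, Nat.gcd_eq_left h3, hvi, hk, if_neg (W.p_ne_one k),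
    if_neg n3, if_neg n2, if_neg n2, if_pos rfl, if_pos rfl, if_pos rfl, if_pos rfl] at e1
  rw [B.red.sum_cyc_eq_of hij hik hjk, Nat.gcd_eq_left h1, Nat.gcd_eq_left h2, Nat.gcd_eq_left h3,
    hvi, hk] at e2
  have hj0 : (W.v j : ℚ) ≠ 0 := by exact_mod_cast (W.v_pos j).ne'
  have hk0 : (W.v k : ℚ) ≠ 0 := by exact_mod_cast (W.v_pos k).ne'
  have hp0 : (W.p k : ℚ) ≠ 0 := by exact_mod_cast (W.p_pos k).ne'
  have e3 : 1 / (W.v j : ℚ) - W.p i / W.v j = -1 := by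
    push_cast at e1 e2
    simp only [one_mul] at e1 e2
    linarith
  have e4 : (W.p i : ℚ) = W.v j + 1 := by
    field_simp at e3
    linarith
  have hvj : W.p i = W.v j + 1 := by exact_mod_cast e4
  have e5 : (W.v k : ℚ) + W.p i = W.p j + 1 := by
    push_cast at e1
    rw [e4] at e1 ⊢
    field_simp at e1
    have e6 : (W.v j : ℚ) * (W.v k + (W.v j + 1) - (W.p j + 1)) = 0 := by linarith
    have := (mul_eq_zero.mp e6).resolve_left hj0
    linarith
  refine ⟨hvi, hvj, by exact_mod_cast e5, hk, fun n => ?_⟩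
  have t1 := W.p_ne_one i
  have t2 := W.p_ne_one j
  have t3 := W.p_ne_one k
  by_cases c1 : n = 1
  · rw [c1, B.red.cyc_one, hk]
    simp [t1.symm, t2.symm, t3.symm]
  by_cases c2 : n = W.h
  · rw [c2, B.cyc_h, hk]
    simp [t3, n2.symm]
  rw [B.red.cyc_eq_of hij hik hjk, Nat.lcm_eq_right h1, Nat.lcm_eq_right h2, Nat.lcm_eq_right h3,
    Nat.gcd_eq_left h1, hvi, if_neg c1, ← hk, if_neg (Ne.symm c2)]
  by_cases c3 : n = W.p i
  · rw [c3]
    simp [n1, n1.symm, t1, hk.trans_ne n3.symm]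
  by_cases c4 : n = W.p j
  · rw [c4]
    simp only [n1, if_true, if_false, Finset.mem_insert, Finset.mem_singleton, t2, hk, n2,
      n1.symm, n2.symm]
    push_cast
    simp only [one_mul]
    norm_num
    rw [one_div] at e3
    linarith
  · simp [c1, c2, c3, c4, Ne.symm c3, Ne.symm c4, Ne.symm c2]

/-- Otherwise the support is `1`, `p i`, `h` with values `-1`, `1`, `1`, whose sum is not zero. -/
theorem Balanced.not_dvd_of_eq {W : WeightSystem} (B : W.Balanced) {i j k : Fin 3} (hij : i ≠ j)
    (hik : i ≠ k) (hjk : j ≠ k) (h1 : W.p i ∣ W.p j) (h2 : W.p j = W.p k) : W.p i = W.p j := by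
  by_contra n1
  have hk : W.h = W.p j := by
    rw [← B.red.lcm_eq hij hik hjk, ← h2, Nat.lcm_self, Nat.lcm_eq_right h1]
  have hvi : W.v i = 1 := B.reg.v_eq_one_of hij hik hjk (not_dvd_of_dvd_of_ne h1 n1)
    (h2 ▸ not_dvd_of_dvd_of_ne h1 n1)
  have e1 := B.cyc_h
  have e2 := B.sum_cyc
  rw [B.red.cyc_eq_of hij hik hjk, ← h2, Nat.lcm_eq_right h1, Nat.lcm_self,
    Nat.gcd_eq_left h1, Nat.gcd_self, hvi, hk, if_neg (W.p_ne_one j),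
    if_neg n1, if_pos rfl, if_pos rfl, if_pos rfl, if_pos rfl, if_pos rfl] at e1
  rw [B.red.sum_cyc_eq_of hij hik hjk, ← h2, Nat.gcd_eq_left h1, Nat.gcd_self, hvi, hk] at e2
  simp only [if_true] at e1
  push_cast at e1 e2
  linarith

theorem coprime_p_v (W : WeightSystem) (i : Fin 3) : Nat.Coprime (W.p i) (W.v i) :=
  Nat.coprime_div_gcd_div_gcd (W.gcd_h_a_pos i)

/-- The value at the common `p` must vanish, so `v i + v j = p`. As each `v` is at most `p / 2`,
both equal `p / 2`, and coprimality to `p` leaves `p = 2`. -/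
theorem Balanced.of_eq_of_dvd {W : WeightSystem} (B : W.Balanced) {i j k : Fin 3} (hij : i ≠ j)
    (hik : i ≠ k) (hjk : j ≠ k) (h1 : W.p i = W.p j) (h2 : W.p j ∣ W.p k) (n2 : W.p j ≠ W.p k) :
    W.p i = 2 ∧ W.v i = 1 ∧ W.v j = 1 ∧ W.v k = 1 ∧ W.h = W.p k ∧ W.HasCyc {W.h} {1} := by
  have hk : W.h = W.p k := by
    rw [← B.red.lcm_eq hij hik hjk, h1, Nat.lcm_eq_right h2, Nat.lcm_eq_right h2]
  have e1 := B.cyc_h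
  have e2 := B.sum_cyc
  rw [B.red.cyc_eq_of hij hik hjk, h1, Nat.lcm_eq_right h2, Nat.lcm_self,
    Nat.gcd_eq_left h2, Nat.gcd_self, hk, if_neg (W.p_ne_one k),
    if_neg n2, if_neg n2, if_neg n2, if_pos rfl, if_pos rfl, if_pos rfl, if_pos rfl] at e1
  rw [B.red.sum_cyc_eq_of hij hik hjk, h1, Nat.gcd_eq_left h2, Nat.gcd_self, hk] at e2
  have hi0 : (W.v i : ℚ) ≠ 0 := by exact_mod_cast (W.v_pos i).ne'
  have hj0 : (W.v j : ℚ) ≠ 0 := by exact_mod_cast (W.v_pos j).ne'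
  have hk0 : (W.v k : ℚ) ≠ 0 := by exact_mod_cast (W.v_pos k).ne'
  have hp0 : (W.p k : ℚ) ≠ 0 := by exact_mod_cast (W.p_pos k).ne'
  have e3 : 1 / (W.v i : ℚ) + 1 / W.v j - W.p j / (W.v i * W.v j) = 0 := by linarith
  have e4 : W.v i + W.v j = W.p j := by
    have e5 := e3
    field_simp at e5
    have : (W.v i : ℚ) + W.v j = W.p j := by linarith
    exact_mod_cast this
  have e5 := W.two_mul_v_le i
  have e6 := W.two_mul_v_le j
  have e7 : W.v i = 1 := by
    have := W.coprime_p_v i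
    rw [h1, show W.p j = W.v i * 2 by omega] at this
    exact this.symm.eq_one_of_dvd (dvd_mul_right _ _)
  have e8 : W.v j = 1 := by omega
  have e9 : W.p j = 2 := by omega
  have e10 : W.v k = 1 := by
    rw [e7, e8, e9] at e1
    push_cast at e1
    field_simp at e1
    norm_num at e1
    exact_mod_cast e1.symm
  refine ⟨by omega, e7, e8, e10, hk, fun n => ?_⟩
  by_cases c1 : n = 1
  · rw [c1, B.red.cyc_one]
    simp [W.h_ne_one.symm]
  by_cases c2 : n = W.h
  · rw [c2, B.cyc_h]
    simp [W.h_ne_one]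
  rw [B.red.cyc_eq_of hij hik hjk, h1, Nat.lcm_eq_right h2, Nat.lcm_self, Nat.gcd_eq_left h2,
    Nat.gcd_self, ← hk, if_neg (Ne.symm c2), if_neg (Ne.symm c2), if_neg (Ne.symm c2),
    if_neg (Ne.symm c2), if_neg c1, e7, e8, e9]
  simp only [Finset.mem_singleton, c1, c2, if_false]
  split_ifs <;> norm_num

theorem Balanced.hasCyc_of_eq {W : WeightSystem} (B : W.Balanced) (h1 : W.p 0 = W.p 1)
    (h2 : W.p 1 = W.p 2) : W.HasCyc {W.h} {1} := by
  intro n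
  have d1 : (0 : Fin 3) ≠ 1 := by decide
  have d2 : (0 : Fin 3) ≠ 2 := by decide
  have d3 : (1 : Fin 3) ≠ 2 := by decide
  have hk : W.h = W.p 2 := by
    rw [← B.red.lcm_eq d1 d2 d3, h1, h2, Nat.lcm_self, Nat.lcm_self]
  by_cases c1 : n = 1
  · rw [c1, B.red.cyc_one]
    simp [W.h_ne_one.symm]
  by_cases c2 : n = W.h
  · rw [c2, B.cyc_h]
    simp [W.h_ne_one]
  rw [B.red.cyc_eq_of d1 d2 d3, h1, h2, Nat.lcm_self, ← hk]
  simp [c1, c2, Ne.symm c2]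

theorem gcd_div_eq (W : WeightSystem) {i j : Fin 3} (h : Nat.lcm (W.p i) (W.p j) = W.h) :
    (W.p i * W.p j : ℚ) = Nat.gcd (W.p i) (W.p j) * W.h := by
  rw [← h]
  exact_mod_cast (Nat.gcd_mul_lcm _ _).symm

/-- Total zero makes the value at `p j` equal to `-1`, which is the product relation for `v j`, `v
k`; inserted into the value at `h` it gives `gcd(p i, p j) = 1`. -/
theorem Balanced.eq_pair {W : WeightSystem} (B : W.Balanced) {i j k : Fin 3} (hij : i ≠ j)
    (hik : i ≠ k) (hjk : j ≠ k) (h1 : ¬ W.p i ∣ W.p j) (h2 : ¬ W.p j ∣ W.p i)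
    (h3 : W.p j = W.p k) : W.v i = 1 ∧ Nat.Coprime (W.p i) (W.p j) ∧
      (W.v j + 1) * (W.v k + 1) = W.p j + 1 ∧ W.h = W.p i * W.p j ∧
      W.HasCyc {W.h, W.p i} {1, W.p j} := by
  have hl : Nat.lcm (W.p i) (W.p j) = W.h := by
    have := B.red.lcm_eq hij hik hjk
    rwa [← h3, Nat.lcm_self] at this
  have hvi : W.v i = 1 := B.reg.v_eq_one_of hij hik hjk h2 (h3 ▸ h2)
  have n1 : W.p i ≠ W.h := fun h => h2 (h ▸ W.p_dvd_h j)
  have n2 : W.p j ≠ W.h := fun h => h1 (h ▸ W.p_dvd_h i)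
  have n3 : W.p i ≠ W.p j := fun h => h1 (h ▸ dvd_rfl)
  have e1 := B.cyc_h
  have e2 := B.sum_cyc
  rw [B.red.cyc_eq_of hij hik hjk, ← h3, Nat.lcm_self, Nat.gcd_self, hvi, hl,
    if_neg W.h_ne_one, if_neg n1, if_neg n2, if_neg n2, if_neg n2, if_pos rfl, if_pos rfl,
    if_pos rfl, W.gcd_div_eq hl] at e1
  rw [B.red.sum_cyc_eq_of hij hik hjk, ← h3, Nat.gcd_self, hvi, W.gcd_div_eq hl] at e2
  have hj0 : (W.v j : ℚ) ≠ 0 := by exact_mod_cast (W.v_pos j).ne'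
  have hk0 : (W.v k : ℚ) ≠ 0 := by exact_mod_cast (W.v_pos k).ne'
  have hh0 : (W.h : ℚ) ≠ 0 := by exact_mod_cast W.h_pos.ne'
  push_cast at e1 e2
  set g : ℚ := (Nat.gcd (W.p i) (W.p j) : ℚ) with hg
  have e3 : 1 / (W.v j : ℚ) + 1 / W.v k - W.p j / (W.v j * W.v k) = -1 := by linarith
  have e4 : (W.v j : ℚ) + W.v k - W.p j = -(W.v j * W.v k) := by
    field_simp at e3
    linarith
  have e5 : g = 1 := by
    field_simp at e1
    have : (W.v j * W.v k : ℚ) * (g - 1) = 0 := by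
      linear_combination e1 + g * e4
    have h := (mul_eq_zero.mp this).resolve_left (mul_ne_zero hj0 hk0)
    linarith
  have e6 : Nat.Coprime (W.p i) (W.p j) := by
    rw [hg] at e5
    exact_mod_cast e5
  have e7 : W.h = W.p i * W.p j := by rw [← hl, e6.lcm_eq_mul]
  refine ⟨hvi, e6, ?_, e7, fun n => ?_⟩
  · have : ((W.v j : ℚ) + 1) * (W.v k + 1) = W.p j + 1 := by linarith
    exact_mod_cast this
  have t1 := W.p_ne_one i
  have t2 := W.p_ne_one j
  have t3 := W.h_ne_one
  by_cases c1 : n = 1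
  · rw [c1, B.red.cyc_one]
    simp [t1.symm, t3.symm]
  by_cases c2 : n = W.h
  · rw [c2, B.cyc_h]
    simp [t3, n2.symm]
  rw [B.red.cyc_eq_of hij hik hjk, ← h3, Nat.lcm_self, Nat.gcd_self, hvi, hl, if_neg c1,
    if_neg (Ne.symm c2), if_neg (Ne.symm c2), if_neg (Ne.symm c2)]
  simp only [Finset.mem_insert, Finset.mem_singleton, c1, c2, false_or]
  by_cases c3 : n = W.p i
  · rw [c3]
    simp [n3, n3.symm]
  by_cases c4 : n = W.p j
  · rw [c4]
    simp only [if_true, if_neg n3, if_neg n3.symm]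
    linarith
  · simp [c3, c4, Ne.symm c3, Ne.symm c4]

end WeightSystem

/-! ### Balance equations when some `p i` are incomparable -/

namespace WeightSystem
open Polynomial

/-- If `p j` and `p k` were incomparable, the values there would be negative integers `(1 - p i) /
v` with sum `-1`. -/
theorem Balanced.dvd_of_dvd_of_dvd {W : WeightSystem} (B : W.Balanced) {i j k : Fin 3}
    (hij : i ≠ j) (hik : i ≠ k) (hjk : j ≠ k) (h1 : W.p i ∣ W.p j) (h2 : W.p i ∣ W.p k)
    (n1 : W.p i ≠ W.p j) (n2 : W.p i ≠ W.p k) (h3 : ¬ W.p j ∣ W.p k) : W.p k ∣ W.p j := by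
  by_contra h4
  have hl : Nat.lcm (W.p j) (W.p k) = W.h := by
    have := B.red.lcm_eq hij hik hjk
    rwa [Nat.lcm_eq_right (h1.trans (Nat.dvd_lcm_left _ _))] at this
  have hvi : W.v i = 1 := B.reg.v_eq_one_of hij hik hjk (not_dvd_of_dvd_of_ne h1 n1)
    (not_dvd_of_dvd_of_ne h2 n2)
  have m1 : W.p i ≠ W.h := fun h => n1 (Nat.dvd_antisymm h1 (h ▸ W.p_dvd_h j))
  have m2 : W.p j ≠ W.h := fun h => h4 (h ▸ W.p_dvd_h k)
  have m3 : W.p k ≠ W.h := fun h => h3 (h ▸ W.p_dvd_h j)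
  have m4 : W.p j ≠ W.p k := fun h => h3 (h ▸ dvd_rfl)
  have e1 := B.cyc_h
  have e2 := B.sum_cyc
  rw [B.red.cyc_eq_of hij hik hjk, Nat.lcm_eq_right h1, Nat.lcm_eq_right h2, hl,
    Nat.gcd_eq_left h1, Nat.gcd_eq_left h2, hvi, if_neg W.h_ne_one, if_neg m1, if_neg m2,
    if_neg m2, if_neg m3, if_neg m3, if_pos rfl, if_pos rfl] at e1
  rw [B.red.sum_cyc_eq_of hij hik hjk, Nat.gcd_eq_left h1, Nat.gcd_eq_left h2, hvi] at e2
  obtain ⟨e, he⟩ := B.reg.exists_cyc_eq_int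
  have c1 : W.cyc (W.p j) = 1 / W.v j - W.p i / W.v j := by
    rw [B.red.cyc_eq_of hij hik hjk, Nat.lcm_eq_right h1, Nat.lcm_eq_right h2, hl,
      Nat.gcd_eq_left h1, Nat.gcd_eq_left h2, hvi, if_neg (W.p_ne_one j), if_neg n1, if_neg m4.symm,
      if_neg m4.symm, if_neg m2.symm, if_neg m2.symm, if_pos rfl, if_pos rfl]
    push_cast
    ring
  have c2 : W.cyc (W.p k) = 1 / W.v k - W.p i / W.v k := by
    rw [B.red.cyc_eq_of hij hik hjk, Nat.lcm_eq_right h1, Nat.lcm_eq_right h2, hl,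
      Nat.gcd_eq_left h1, Nat.gcd_eq_left h2, hvi, if_neg (W.p_ne_one k), if_neg n2, if_neg m4,
      if_neg m4, if_neg m3.symm, if_neg m3.symm, if_pos rfl, if_pos rfl]
    push_cast
    ring
  have hneg : ∀ l, 1 / (W.v l : ℚ) - W.p i / W.v l < 0 := by
    intro l
    have hl0 : (0 : ℚ) < W.v l := by exact_mod_cast W.v_pos l
    have : (2 : ℚ) ≤ W.p i := by exact_mod_cast W.two_le_p i
    rw [← sub_div]
    exact div_neg_of_neg_of_pos (by linarith) hl0
  have d1 := hneg j
  have d2 := hneg k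
  rw [← c1, ← he] at d1
  rw [← c2, ← he] at d2
  have d3 : e (W.p j) < 0 := by exact_mod_cast d1
  have d4 : e (W.p k) < 0 := by exact_mod_cast d2
  have d5 : (e (W.p j) : ℚ) + e (W.p k) = -1 := by
    rw [he, he, c1, c2]
    push_cast at e1 e2
    simp only [one_mul] at e1 e2
    linarith
  have d6 : e (W.p j) + e (W.p k) = -1 := by exact_mod_cast d5
  omega

/-- Balance forces `gcd(p i, p j) = 2`, so the lcm carries the value `-2`. A dual system would need
the value `2`, which never occurs. -/
theorem Balanced.below_pair {W : WeightSystem} (B : W.Balanced) {i j k : Fin 3}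
    (hij : i ≠ j) (hik : i ≠ k) (hjk : j ≠ k) (h1 : W.p i ∣ W.p k) (h2 : W.p j ∣ W.p k)
    (n1 : W.p i ≠ W.p k) (n2 : W.p j ≠ W.p k) (h3 : ¬ W.p i ∣ W.p j) (h4 : ¬ W.p j ∣ W.p i) :
    (∃ n, W.cyc n = -2) ∧ ∀ n, W.cyc n ≤ 1 := by
  have hk : W.h = W.p k := by
    rw [← B.red.lcm_eq hij hik hjk, Nat.lcm_eq_right h2, Nat.lcm_eq_right h1]
  have hvi : W.v i = 1 := B.reg.v_eq_one_of hij hik hjk h4 (not_dvd_of_dvd_of_ne h1 n1)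
  have hvj : W.v j = 1 := B.reg.v_eq_one_of hij.symm hjk hik h3 (not_dvd_of_dvd_of_ne h2 n2)
  have m1 : W.p i ≠ W.h := hk ▸ n1
  have m2 : W.p j ≠ W.h := hk ▸ n2
  have m4 : W.p i ≠ W.p j := fun h => h3 (h ▸ dvd_rfl)
  have l1 : Nat.lcm (W.p i) (W.p j) ≠ W.p i := fun h => h4 (h ▸ Nat.dvd_lcm_right _ _)
  have l2 : Nat.lcm (W.p i) (W.p j) ≠ W.p j := fun h => h3 (h ▸ Nat.dvd_lcm_left _ _)
  have l3 : Nat.lcm (W.p i) (W.p j) ≠ 1 := fun h =>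
    W.p_ne_one i (Nat.eq_one_of_dvd_one (h ▸ Nat.dvd_lcm_left _ _))
  have e1 := B.cyc_h
  have e2 := B.sum_cyc
  rw [B.red.cyc_eq_of hij hik hjk, Nat.lcm_eq_right h1, Nat.lcm_eq_right h2,
    Nat.gcd_eq_left h1, Nat.gcd_eq_left h2, hvi, hvj, if_neg W.h_ne_one, if_neg m1, if_neg m2,
    if_pos hk.symm, if_pos hk.symm, if_pos hk.symm, if_pos rfl] at e1
  rw [B.red.sum_cyc_eq_of hij hik hjk, Nat.gcd_eq_left h1, Nat.gcd_eq_left h2, hvi, hvj] at e2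
  push_cast at e1 e2
  by_cases hl : Nat.lcm (W.p i) (W.p j) = W.h
  · rw [if_pos hl] at e1
    exfalso
    linarith
  rw [if_neg hl] at e1
  have e3 : (Nat.gcd (W.p i) (W.p j) : ℚ) = 2 := by linarith
  have key : ∀ n, n ≠ 1 → n ≠ W.h → W.cyc n = (if W.p i = n then 1 else 0) +
      (if W.p j = n then 1 else 0) - if Nat.lcm (W.p i) (W.p j) = n then 2 else 0 := by
    intro n c1 c2
    rw [B.red.cyc_eq_of hij hik hjk, Nat.lcm_eq_right h1, Nat.lcm_eq_right h2, hvi, hvj, ← hk,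
      if_neg c1, if_neg (Ne.symm c2), if_neg (Ne.symm c2), if_neg (Ne.symm c2),
      if_neg (Ne.symm c2), e3]
    push_cast
    simp
  refine ⟨⟨Nat.lcm (W.p i) (W.p j), ?_⟩, fun n => ?_⟩
  · rw [key _ l3 hl, if_neg l1.symm, if_neg l2.symm, if_pos rfl]
    norm_num
  · by_cases c1 : n = 1
    · rw [c1, B.red.cyc_one]
      norm_num
    by_cases c2 : n = W.h
    · rw [c2, B.cyc_h]
    rw [key n c1 c2]
    by_cases c3 : W.p i = n
    · rw [← c3, if_neg m4.symm]
      split_ifs <;> norm_num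
    · rw [if_neg c3]
      split_ifs <;> norm_num

/-- With `c = (p i - 1) / v j`, `g = gcd(p i, p k)` and `G = gcd(p j, p k)`, total zero reads `1 - c
- g + c * G = 0`. If `lcm(p i, p k) ≠ h`, the value at `h` gives `c * G = 1`, so `c + g = 2`; as `g
≥ 1` and `c > 0`, all three are `1`. If the lcm is `h`, then `c = 2` and `2 * G = 1 + g`, against `G
≥ 2 * g`. -/
theorem Balanced.dvd_and_incomparable {W : WeightSystem} (B : W.Balanced) {i j k : Fin 3}
    (hij : i ≠ j) (hik : i ≠ k) (hjk : j ≠ k) (h1 : W.p i ∣ W.p j) (n1 : W.p i ≠ W.p j)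
    (h2 : ¬ W.p i ∣ W.p k) (h3 : ¬ W.p k ∣ W.p j) :
    W.v i = 1 ∧ W.v k = 1 ∧ W.p i = W.v j + 1 ∧ Nat.Coprime (W.p j) (W.p k) ∧
      W.h = W.p j * W.p k ∧ W.HasCyc {W.h, W.p i, W.p k} {1, W.p j, W.p i * W.p k} := by
  have h4 : ¬ W.p k ∣ W.p i := fun h => h3 (h.trans h1)
  have h5 : ¬ W.p j ∣ W.p k := fun h => h2 (h1.trans h)
  have hl : Nat.lcm (W.p j) (W.p k) = W.h := by
    have := B.red.lcm_eq hij hik hjk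
    rwa [Nat.lcm_eq_right (h1.trans (Nat.dvd_lcm_left _ _))] at this
  have hvi : W.v i = 1 := B.reg.v_eq_one_of hij hik hjk (not_dvd_of_dvd_of_ne h1 n1) h4
  have hvk : W.v k = 1 := B.reg.v_eq_one_of hik.symm hjk.symm hij h2 h5
  have m1 : W.p i ≠ W.h := fun h => n1 (Nat.dvd_antisymm h1 (h ▸ W.p_dvd_h j))
  have m2 : W.p j ≠ W.h := fun h => h3 (h ▸ W.p_dvd_h k)
  have m3 : W.p k ≠ W.h := fun h => h2 (h ▸ W.p_dvd_h i)
  have m4 : W.p j ≠ W.p k := fun h => h5 (h ▸ dvd_rfl)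
  have m5 : W.p i ≠ W.p k := fun h => h2 (h ▸ dvd_rfl)
  have e1 := B.cyc_h
  have e2 := B.sum_cyc
  rw [B.red.cyc_eq_of hij hik hjk, Nat.lcm_eq_right h1, hl,
    Nat.gcd_eq_left h1, hvi, hvk, if_neg W.h_ne_one, if_neg m1, if_neg m2, if_neg m2,
    if_neg m3, if_pos rfl, if_pos rfl, mul_assoc (W.p i : ℚ), W.gcd_div_eq hl] at e1
  rw [B.red.sum_cyc_eq_of hij hik hjk, Nat.gcd_eq_left h1, hvi, hvk, mul_assoc (W.p i : ℚ),
    W.gcd_div_eq hl] at e2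
  push_cast at e1 e2
  simp only [one_mul, mul_one] at e1 e2
  have hj0 : (0 : ℚ) < W.v j := by exact_mod_cast W.v_pos j
  have hh0 : (W.h : ℚ) ≠ 0 := by exact_mod_cast W.h_pos.ne'
  have hp2 : (2 : ℚ) ≤ W.p i := by exact_mod_cast W.two_le_p i
  have hglast : (W.p i : ℚ) * (Nat.gcd (W.p j) (W.p k) * W.h) / (W.v j * W.h) =
      W.p i / W.v j * Nat.gcd (W.p j) (W.p k) := by
    field_simp
  rw [hglast] at e1 e2
  -- Minus the value of `cyc` at `p j`.
  obtain ⟨c, hc⟩ : ∃ c : ℚ, c = W.p i / W.v j - 1 / W.v j := ⟨_, rfl⟩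
  have hcpos : 0 < c := by
    rw [hc, ← sub_div]
    exact div_pos (by linarith) hj0
  have e3 : 1 - c - Nat.gcd (W.p i) (W.p k) + c * Nat.gcd (W.p j) (W.p k) = 0 := by
    rw [hc]
    linear_combination e2
  have hg1 : (1 : ℚ) ≤ Nat.gcd (W.p i) (W.p k) := by
    exact_mod_cast Nat.gcd_pos_of_pos_left _ (W.p_pos i)
  have hg2 : (1 : ℚ) ≤ Nat.gcd (W.p j) (W.p k) := by
    exact_mod_cast Nat.gcd_pos_of_pos_left _ (W.p_pos j)
  have hl2 : Nat.lcm (W.p i) (W.p k) ≠ W.h := by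
    intro hl2
    rw [if_pos hl2] at e1
    have e4 : c * Nat.gcd (W.p j) (W.p k) = 1 + Nat.gcd (W.p i) (W.p k) := by
      rw [hc]
      linear_combination e1
    have e5 : c = 2 := by linarith
    rw [e5] at e4
    have e6 := W.gcd_div_eq hl
    have e7 := W.gcd_div_eq hl2
    have e8 : (2 : ℚ) * W.p i ≤ W.p j := by
      obtain ⟨b, hb⟩ := h1
      have : 2 ≤ b := by
        rcases b with _ | _ | b
        · have := W.p_pos j
          omega
        · exact absurd (by rw [hb, zero_add, mul_one]) n1
        · omega
      have : W.p i * 2 ≤ W.p j := by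
        rw [hb]
        exact Nat.mul_le_mul_left _ this
      have : (W.p i : ℚ) * 2 ≤ W.p j := by exact_mod_cast this
      linarith
    have e9 : (Nat.gcd (W.p i) (W.p k) : ℚ) * 2 ≤ Nat.gcd (W.p j) (W.p k) := by
      have hhpos : (0 : ℚ) < W.h := by exact_mod_cast W.h_pos
      have hkpos : (0 : ℚ) < W.p k := by exact_mod_cast W.p_pos k
      have : (Nat.gcd (W.p i) (W.p k) : ℚ) * 2 * W.h ≤ Nat.gcd (W.p j) (W.p k) * W.h := by
        rw [← e6, mul_right_comm, ← e7]
        nlinarith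
      exact le_of_mul_le_mul_right this hhpos
    linarith
  rw [if_neg hl2] at e1
  have e4 : c * Nat.gcd (W.p j) (W.p k) = 1 := by
    rw [hc]
    linear_combination e1
  have e5 : Nat.gcd (W.p i) (W.p k) = 1 := by
    have : (Nat.gcd (W.p i) (W.p k) : ℚ) < 2 := by linarith
    have : Nat.gcd (W.p i) (W.p k) < 2 := by exact_mod_cast this
    have : 1 ≤ Nat.gcd (W.p i) (W.p k) := by exact_mod_cast hg1
    omega
  have e6 : c = 1 := by
    rw [e5] at e3
    push_cast at e3
    linarith
  have e7 : Nat.gcd (W.p j) (W.p k) = 1 := by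
    rw [e6, one_mul] at e4
    exact_mod_cast e4
  have e8 : W.p i = W.v j + 1 := by
    have : (W.p i : ℚ) = W.v j + 1 := by
      have := hj0.ne'
      rw [e6] at hc
      field_simp at hc
      linarith
    exact_mod_cast this
  have e9 : Nat.lcm (W.p i) (W.p k) = W.p i * W.p k := Nat.Coprime.lcm_eq_mul e5
  have e10 : W.h = W.p j * W.p k := by rw [← hl, Nat.Coprime.lcm_eq_mul e7]
  refine ⟨hvi, hvk, e8, e7, e10, fun n => ?_⟩
  have t1 := W.p_ne_one i
  have t2 := W.p_ne_one j
  have t4 := W.p_ne_one k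
  have t3 := W.h_ne_one
  have l1 : W.p i * W.p k ≠ W.p i := by
    rw [← e9]
    exact fun h => h4 (h ▸ Nat.dvd_lcm_right _ _)
  have l2 : W.p i * W.p k ≠ W.p k := by
    rw [← e9]
    exact fun h => h2 (h ▸ Nat.dvd_lcm_left _ _)
  have l3 : W.p i * W.p k ≠ W.p j := by
    rw [← e9]
    exact fun h => h3 (h ▸ Nat.dvd_lcm_right _ _)
  have l4 : W.p i * W.p k ≠ 1 := by
    rw [← e9]
    exact fun h => t1 (Nat.eq_one_of_dvd_one (h ▸ Nat.dvd_lcm_left _ _))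
  have l5 : W.p i * W.p k ≠ W.h := e9 ▸ hl2
  by_cases c1 : n = 1
  · rw [c1, B.red.cyc_one]
    simp [t1.symm, t4.symm, t3.symm]
  by_cases c2 : n = W.h
  · rw [c2, B.cyc_h]
    simp [t3, m2.symm, l5.symm]
  rw [B.red.cyc_eq_of hij hik hjk, Nat.lcm_eq_right h1, hl, e9, Nat.gcd_eq_left h1, e5, hvi, hvk,
    if_neg c1, if_neg (Ne.symm c2), if_neg (Ne.symm c2)]
  simp only [Finset.mem_insert, Finset.mem_singleton, c1, c2, false_or]
  by_cases c3 : n = W.p i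
  · rw [c3]
    simp [n1, n1.symm, m5, m5.symm, l1, l1.symm]
  by_cases c4 : n = W.p k
  · rw [c4]
    simp [m4, m4.symm, m5, m5.symm, l2, l2.symm]
  by_cases c5 : n = W.p j
  · rw [c5]
    rw [if_pos rfl, if_pos rfl, if_neg n1, if_neg m4.symm, if_neg l3,
      if_neg (show ¬(W.p j = W.p i ∨ W.p j = W.p k) by tauto), if_pos (Or.inl rfl)]
    push_cast
    rw [e6] at hc
    rw [one_mul]
    linarith
  · rw [if_neg (Ne.symm c3), if_neg (Ne.symm c4), if_neg (Ne.symm c5), if_neg (Ne.symm c5),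
      if_neg (show ¬(n = W.p i ∨ n = W.p k) by tauto)]
    by_cases c6 : W.p i * W.p k = n
    · rw [if_pos c6, if_pos (Or.inr c6.symm)]
      norm_num
    · rw [if_neg c6, if_neg (show ¬(n = W.p j ∨ n = W.p i * W.p k) by tauto)]
      norm_num

theorem p_ne_h (W : WeightSystem) (H : ∀ i j, i ≠ j → ¬ W.p i ∣ W.p j) (l : Fin 3) :
    W.p l ≠ W.h := by
  intro h
  obtain ⟨j, -, hj, -⟩ := exists_compl_pair l
  exact H j l hj (h ▸ W.p_dvd_h j)

/-- With two of the lcms equal to `h`, balance gives `gcd(p j, p k) = 3`, so `p j` and `p k` are at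
least `3`. The remaining equation then makes the other gcds `1` and `p j = p k`. Three lcms equal to
`h` contradict balance outright. -/
theorem Balanced.lcm_ne_h {W : WeightSystem} (B : W.Balanced)
    (H : ∀ i j, i ≠ j → ¬ W.p i ∣ W.p j) {i j k : Fin 3} (hij : i ≠ j) (hik : i ≠ k)
    (hjk : j ≠ k) (hl : Nat.lcm (W.p i) (W.p j) = W.h) :
    Nat.lcm (W.p i) (W.p k) ≠ W.h := by
  intro hl2
  have hv : ∀ l, W.v l = 1 := fun l => B.reg.v_eq_one fun m hm => H m l hm
  have m := W.p_ne_h H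
  have e1 := B.cyc_h
  have e2 := B.sum_cyc
  rw [B.red.cyc_eq_of hij hik hjk, hv, hv, hv, hl, hl2, if_neg W.h_ne_one, if_neg (m _),
    if_neg (m _), if_neg (m _), if_pos rfl, if_pos rfl, W.gcd_div_eq hl] at e1
  rw [B.red.sum_cyc_eq_of hij hik hjk, hv, hv, hv, W.gcd_div_eq hl] at e2
  have hh0 : (W.h : ℚ) ≠ 0 := by exact_mod_cast W.h_pos.ne'
  have hlast : (Nat.gcd (W.p i) (W.p j) : ℚ) * W.h * W.p k / (1 * 1 * 1 * W.h) =
      Nat.gcd (W.p i) (W.p j) * W.p k := by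
    field_simp
  push_cast at e1 e2
  rw [hlast] at e1 e2
  simp only [mul_one, div_one, if_true] at e1 e2
  by_cases hl3 : Nat.lcm (W.p j) (W.p k) = W.h
  · rw [if_pos hl3] at e1
    linarith
  rw [if_neg hl3] at e1
  have e3 : Nat.gcd (W.p j) (W.p k) = 3 := by
    have : (Nat.gcd (W.p j) (W.p k) : ℚ) = 3 := by linarith
    exact_mod_cast this
  have e4 : Nat.gcd (W.p i) (W.p j) * W.p k =
      1 + Nat.gcd (W.p i) (W.p j) + Nat.gcd (W.p i) (W.p k) := by
    have : (Nat.gcd (W.p i) (W.p j) : ℚ) * W.p k =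
        1 + Nat.gcd (W.p i) (W.p j) + Nat.gcd (W.p i) (W.p k) := by linarith
    exact_mod_cast this
  have e5 : Nat.gcd (W.p i) (W.p j) * W.p k = Nat.gcd (W.p i) (W.p k) * W.p j := by
    have h1 := W.gcd_div_eq hl
    have h2 := W.gcd_div_eq hl2
    have : (Nat.gcd (W.p i) (W.p j) * W.p k : ℚ) * W.h = Nat.gcd (W.p i) (W.p k) * W.p j * W.h := by
      linear_combination (W.p j : ℚ) * h2 - (W.p k : ℚ) * h1
    exact_mod_cast mul_right_cancel₀ hh0 this
  have e6 : 3 ≤ W.p j := Nat.le_of_dvd (W.p_pos j) (e3 ▸ Nat.gcd_dvd_left _ _)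
  have e7 : 3 ≤ W.p k := Nat.le_of_dvd (W.p_pos k) (e3 ▸ Nat.gcd_dvd_right _ _)
  have g1 : 0 < Nat.gcd (W.p i) (W.p j) := Nat.gcd_pos_of_pos_left _ (W.p_pos i)
  have g2 : 0 < Nat.gcd (W.p i) (W.p k) := Nat.gcd_pos_of_pos_left _ (W.p_pos i)
  have f1 := Nat.mul_le_mul_left (Nat.gcd (W.p i) (W.p j)) e7
  have f2 := Nat.mul_le_mul_left (Nat.gcd (W.p i) (W.p k)) e6
  have f3 : Nat.gcd (W.p i) (W.p j) = 1 := by omega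
  have f4 : Nat.gcd (W.p i) (W.p k) = 1 := by omega
  rw [f3, f4] at e5
  refine H j k hjk ?_
  rw [show W.p j = W.p k by omega]

/-- If only this lcm is `h`, then `p k = 2` and the gcds of `p k` with `p i` and `p j` add up to
`3`, so `p k` divides one of them. -/
theorem Balanced.lcm_ne_h' {W : WeightSystem} (B : W.Balanced)
    (H : ∀ i j, i ≠ j → ¬ W.p i ∣ W.p j) {i j k : Fin 3} (hij : i ≠ j) (hik : i ≠ k)
    (hjk : j ≠ k) : Nat.lcm (W.p i) (W.p j) ≠ W.h := by
  intro hl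
  have hl2 := B.lcm_ne_h H hij hik hjk hl
  have hl3 := B.lcm_ne_h H hij.symm hjk hik (by rwa [Nat.lcm_comm])
  have hv : ∀ l, W.v l = 1 := fun l => B.reg.v_eq_one fun m hm => H m l hm
  have m := W.p_ne_h H
  have e1 := B.cyc_h
  have e2 := B.sum_cyc
  rw [B.red.cyc_eq_of hij hik hjk, hv, hv, hv, hl, if_neg W.h_ne_one, if_neg (m _),
    if_neg (m _), if_neg (m _), if_pos rfl, if_neg hl2, if_neg hl3, if_pos rfl,
    W.gcd_div_eq hl] at e1
  rw [B.red.sum_cyc_eq_of hij hik hjk, hv, hv, hv, W.gcd_div_eq hl] at e2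
  have hh0 : (W.h : ℚ) ≠ 0 := by exact_mod_cast W.h_pos.ne'
  have hlast : (Nat.gcd (W.p i) (W.p j) : ℚ) * W.h * W.p k / (1 * 1 * 1 * W.h) =
      Nat.gcd (W.p i) (W.p j) * W.p k := by
    field_simp
  push_cast at e1 e2
  rw [hlast] at e1 e2
  simp only [mul_one, div_one] at e1 e2
  have e4 : Nat.gcd (W.p i) (W.p j) * W.p k = 1 + Nat.gcd (W.p i) (W.p j) := by
    have : (Nat.gcd (W.p i) (W.p j) : ℚ) * W.p k = 1 + Nat.gcd (W.p i) (W.p j) := by linarith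
    exact_mod_cast this
  have e3 : Nat.gcd (W.p i) (W.p k) + Nat.gcd (W.p j) (W.p k) = 3 := by
    have : (Nat.gcd (W.p i) (W.p k) : ℚ) + Nat.gcd (W.p j) (W.p k) = 3 := by linarith
    exact_mod_cast this
  have g1 : 0 < Nat.gcd (W.p i) (W.p j) := Nat.gcd_pos_of_pos_left _ (W.p_pos i)
  have g2 : 0 < Nat.gcd (W.p i) (W.p k) := Nat.gcd_pos_of_pos_left _ (W.p_pos i)
  have g3 : 0 < Nat.gcd (W.p j) (W.p k) := Nat.gcd_pos_of_pos_left _ (W.p_pos j)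
  have e5 := W.two_le_p k
  have f1 := Nat.mul_le_mul_left (Nat.gcd (W.p i) (W.p j)) e5
  have f2 : Nat.gcd (W.p i) (W.p j) = 1 := by omega
  have f3 : W.p k = 2 := by
    rw [f2] at e4
    omega
  rcases (show Nat.gcd (W.p i) (W.p k) = 2 ∨ Nat.gcd (W.p j) (W.p k) = 2 by omega) with h | h
  · exact H k i hik.symm (by rw [f3, ← h]; exact Nat.gcd_dvd_left _ _)
  · exact H k j hjk.symm (by rw [f3, ← h]; exact Nat.gcd_dvd_left _ _)

/-- No lcm of two equals `h`, so `cyc h = 1` says that `h` is the product of the `p i`, and total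
zero says that the three gcds add up to `3`. -/
theorem Balanced.antichain {W : WeightSystem} (B : W.Balanced)
    (H : ∀ i j, i ≠ j → ¬ W.p i ∣ W.p j) : (∀ i, W.v i = 1) ∧
      (∀ i j, i ≠ j → Nat.Coprime (W.p i) (W.p j)) ∧ W.h = W.p 0 * W.p 1 * W.p 2 ∧
      W.HasCyc {W.h, W.p 0, W.p 1, W.p 2} {1, W.p 0 * W.p 1, W.p 0 * W.p 2, W.p 1 * W.p 2} := by
  have d1 : (0 : Fin 3) ≠ 1 := by decide
  have d2 : (0 : Fin 3) ≠ 2 := by decide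
  have d3 : (1 : Fin 3) ≠ 2 := by decide
  have l1 := B.lcm_ne_h' H d1 d2 d3
  have l2 := B.lcm_ne_h' H d2 d1 d3.symm
  have l3 := B.lcm_ne_h' H d3 d1.symm d2.symm
  have hv : ∀ l, W.v l = 1 := fun l => B.reg.v_eq_one fun m hm => H m l hm
  have m := W.p_ne_h H
  have e1 := B.cyc_h
  have e2 := B.sum_cyc
  rw [B.red.cyc_eq_of d1 d2 d3, hv, hv, hv, if_neg W.h_ne_one, if_neg (m _),
    if_neg (m _), if_neg (m _), if_neg l1, if_neg l2, if_neg l3, if_pos rfl] at e1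
  rw [B.red.sum_cyc_eq_of d1 d2 d3, hv, hv, hv] at e2
  have hh0 : (W.h : ℚ) ≠ 0 := by exact_mod_cast W.h_pos.ne'
  push_cast at e1 e2
  simp only [mul_one, div_one, one_mul] at e1 e2
  have hh : W.h = W.p 0 * W.p 1 * W.p 2 := by
    have e3 : (W.p 0 * W.p 1 * W.p 2 : ℚ) / W.h = 1 := by linarith
    rw [div_eq_one_iff_eq hh0] at e3
    exact_mod_cast e3.symm
  have e3 : Nat.gcd (W.p 0) (W.p 1) + Nat.gcd (W.p 0) (W.p 2) + Nat.gcd (W.p 1) (W.p 2) = 3 := by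
    have : (Nat.gcd (W.p 0) (W.p 1) : ℚ) + Nat.gcd (W.p 0) (W.p 2) + Nat.gcd (W.p 1) (W.p 2) = 3 := by
      linarith
    exact_mod_cast this
  have g1 : 0 < Nat.gcd (W.p 0) (W.p 1) := Nat.gcd_pos_of_pos_left _ (W.p_pos 0)
  have g2 : 0 < Nat.gcd (W.p 0) (W.p 2) := Nat.gcd_pos_of_pos_left _ (W.p_pos 0)
  have g3 : 0 < Nat.gcd (W.p 1) (W.p 2) := Nat.gcd_pos_of_pos_left _ (W.p_pos 1)
  have c1 : Nat.gcd (W.p 0) (W.p 1) = 1 := by omega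
  have c2 : Nat.gcd (W.p 0) (W.p 2) = 1 := by omega
  have c3 : Nat.gcd (W.p 1) (W.p 2) = 1 := by omega
  refine ⟨hv, ?_, hh, fun n => ?_⟩
  · intro i j hij
    fin_cases i <;> fin_cases j <;> first | exact absurd rfl hij | assumption | skip
    · exact Nat.Coprime.symm c1
    · exact Nat.Coprime.symm c2
    · exact Nat.Coprime.symm c3
  rw [Nat.Coprime.lcm_eq_mul c1] at l1
  rw [Nat.Coprime.lcm_eq_mul c2] at l2
  rw [Nat.Coprime.lcm_eq_mul c3] at l3
  have t0 := W.two_le_p 0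
  have t1 := W.two_le_p 1
  have t2 := W.two_le_p 2
  have th := W.two_le_h
  have p01 := Nat.mul_le_mul t0 t1
  have p02 := Nat.mul_le_mul t0 t2
  have p12 := Nat.mul_le_mul t1 t2
  by_cases k1 : n = 1
  · rw [k1, B.red.cyc_one, if_neg, if_pos (by simp)]
    · norm_num
    · simp only [Finset.mem_insert, Finset.mem_singleton]
      omega
  by_cases k2 : n = W.h
  · rw [k2, B.cyc_h, if_pos (by simp), if_neg]
    · norm_num
    · simp only [Finset.mem_insert, Finset.mem_singleton]
      have := l1.symm
      have := l2.symm
      have := l3.symm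
      have := W.h_ne_one
      tauto
  rw [B.red.cyc_eq_of d1 d2 d3, Nat.Coprime.lcm_eq_mul c1, Nat.Coprime.lcm_eq_mul c2,
    Nat.Coprime.lcm_eq_mul c3, c1, c2, c3, hv, hv, hv, if_neg k1, if_neg (Ne.symm k2)]
  have ne : ∀ i j, i ≠ j → W.p i ≠ W.p j := fun i j hij h => H i j hij (h ▸ dvd_rfl)
  have ne01 := ne 0 1 d1
  have ne02 := ne 0 2 d2
  have ne12 := ne 1 2 d3
  have q1 : W.p 0 * W.p 1 ≠ W.p 0 * W.p 2 := fun h =>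
    ne12 (Nat.eq_of_mul_eq_mul_left (by omega) h)
  have q2 : W.p 0 * W.p 1 ≠ W.p 1 * W.p 2 := fun h =>
    ne02 (Nat.eq_of_mul_eq_mul_left (show 0 < W.p 1 by omega) (by rwa [mul_comm] at h))
  have q3 : W.p 0 * W.p 2 ≠ W.p 1 * W.p 2 := fun h =>
    ne01 (Nat.eq_of_mul_eq_mul_right (by omega) h)
  simp only [Finset.mem_insert, Finset.mem_singleton, k1, k2, false_or]
  have P : ∀ a b c : ℕ, a ≠ b → a ≠ c → b ≠ c → (if a = n then (1 : ℚ) else 0) +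
      (if b = n then 1 else 0) + (if c = n then 1 else 0) =
      if n = a ∨ n = b ∨ n = c then 1 else 0 := by
    intro a b c hab hac hbc
    by_cases ha : n = a
    · simp [← ha, show ¬ b = n by omega, show ¬ c = n by omega]
    by_cases hb : n = b
    · simp [← hb, show ¬ a = n by omega, show ¬ c = n by omega]
    simp [ha, hb, Ne.symm ha, Ne.symm hb, @eq_comm _ c n]
  rw [← P _ _ _ ne01 ne02 ne12, ← P _ _ _ q1 q2 q3]
  push_cast
  simp only [mul_one, div_one]
  ring

end WeightSystem

/-! ### Exponent matrices of the invertible polynomials -/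

namespace WeightSystem
open Polynomial

/-- For `x = adjugate M * k` one has `M * x = h • k`, so positivity becomes a system of linear
inequalities in `x`. -/
theorem isTransposeBy_of_pos {W W' : WeightSystem} {σ τ : Equiv.Perm (Fin 3)}
    {M : Matrix (Fin 3) (Fin 3) ℤ} (nonneg : ∀ i j, 0 ≤ M i j) (det_eq : M.det = W.h)
    (h_eq : W'.h = W.h) (row : ∀ i, ∑ j, M.adjugate i j = W'.a (τ i))
    (col : ∀ j, ∑ i, M.adjugate i j = W.a (σ j))
    (pos : ∀ x : Fin 3 → ℤ, (∀ i, (W.h : ℤ) ≤ ∑ j, M i j * x j) → ∑ i, x i < W.h → ∀ i, 0 < x i) :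
    IsTransposeBy W W' σ τ M := by
  refine ⟨nonneg, det_eq, h_eq, row, col, fun k hk hs => ?_⟩
  refine pos _ (fun i => ?_) ?_
  · have h1 := congrFun (congrArg (fun N => Matrix.mulVec N k) M.mul_adjugate) i
    simp only [← Matrix.mulVec_mulVec, Matrix.smul_mulVec, Matrix.one_mulVec, Pi.smul_apply,
      smul_eq_mul, det_eq] at h1
    have h2 : ∑ l, M i l * ∑ j, M.adjugate l j * k j = W.h * k i := h1
    rw [h2]
    exact le_mul_of_one_le_right (Int.natCast_nonneg _) (hk i)
  · have h1 : ∑ i, ∑ j, M.adjugate i j * k j = ∑ j, (W.a (σ j) : ℤ) * k j := by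
      rw [Finset.sum_comm]
      refine Finset.sum_congr rfl fun j _ => ?_
      rw [← Finset.sum_mul, col]
    rwa [h1]

theorem isTransposeBy_fermat {W W' : WeightSystem} {σ τ : Equiv.Perm (Fin 3)} {A B C : ℤ}
    (hA : 0 < A) (hB : 0 < B) (hC : 0 < C) (hh : W'.h = W.h) (h0 : (W.h : ℤ) = A * B * C)
    (a0 : (W.a (σ 0) : ℤ) = B * C) (a1 : (W.a (σ 1) : ℤ) = A * C) (a2 : (W.a (σ 2) : ℤ) = A * B)
    (b0 : (W'.a (τ 0) : ℤ) = B * C) (b1 : (W'.a (τ 1) : ℤ) = A * C)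
    (b2 : (W'.a (τ 2) : ℤ) = A * B) :
    IsTransposeBy W W' σ τ !![A, 0, 0; 0, B, 0; 0, 0, C] := by
  have hpos : (0 : ℤ) < W.h := by exact_mod_cast W.h_pos
  refine isTransposeBy_of_pos ?_ ?_ hh ?_ ?_ ?_
  · simp [Fin.forall_fin_succ, hA.le, hB.le, hC.le]
  · simp [Matrix.det_fin_three, h0]
  · simp [Fin.forall_fin_succ, Matrix.adjugate_fin_three, Fin.sum_univ_three, b0, b1, b2]
  · simp [Fin.forall_fin_succ, Matrix.adjugate_fin_three, Fin.sum_univ_three, a0, a1, a2]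
  · intro x hx _
    have h1 := hx 0
    have h2 := hx 1
    have h3 := hx 2
    simp [Fin.sum_univ_three] at h1 h2 h3
    have e1 : 0 < x 0 := (mul_pos_iff_of_pos_left hA).mp (hpos.trans_le h1)
    have e2 : 0 < x 1 := (mul_pos_iff_of_pos_left hB).mp (hpos.trans_le h2)
    have e3 : 0 < x 2 := (mul_pos_iff_of_pos_left hC).mp (hpos.trans_le h3)
    simp [Fin.forall_fin_succ, e1, e2, e3]

/-- The last two rows give `x 1, x 2 > 0`. If `x 0 ≤ 0`, the first row makes `x 0 + x 1` at least
`h`, against the bound on the sum. -/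
theorem isTransposeBy_fermatChain {W W' : WeightSystem} {σ τ : Equiv.Perm (Fin 3)} {A B C : ℤ}
    (hA : 0 < A) (hB : 0 < B) (hC : 0 < C) (hh : W'.h = W.h) (h0 : (W.h : ℤ) = A * B * C)
    (a0 : (W.a (σ 0) : ℤ) = B * C) (a1 : (W.a (σ 1) : ℤ) = (A - 1) * C)
    (a2 : (W.a (σ 2) : ℤ) = A * B)
    (b0 : (W'.a (τ 0) : ℤ) = (B - 1) * C) (b1 : (W'.a (τ 1) : ℤ) = A * C)
    (b2 : (W'.a (τ 2) : ℤ) = A * B) :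
    IsTransposeBy W W' σ τ !![A, 1, 0; 0, B, 0; 0, 0, C] := by
  have hpos : (0 : ℤ) < W.h := by exact_mod_cast W.h_pos
  refine isTransposeBy_of_pos ?_ ?_ hh ?_ ?_ ?_
  · simp [Fin.forall_fin_succ, hA.le, hB.le, hC.le]
  · simp [Matrix.det_fin_three, h0]
  · simp [Fin.forall_fin_succ, Matrix.adjugate_fin_three, Fin.sum_univ_three, b0, b1, b2]
    ring
  · simp [Fin.forall_fin_succ, Matrix.adjugate_fin_three, Fin.sum_univ_three, a0, a1, a2]
    ring
  · intro x hx hs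
    have h1 := hx 0
    have h2 := hx 1
    have h3 := hx 2
    simp [Fin.sum_univ_three] at h1 h2 h3 hs
    have e2 : 0 < x 1 := (mul_pos_iff_of_pos_left hB).mp (hpos.trans_le h2)
    have e3 : 0 < x 2 := (mul_pos_iff_of_pos_left hC).mp (hpos.trans_le h3)
    have e1 : 0 < x 0 := by
      by_contra! h
      nlinarith
    simp [Fin.forall_fin_succ, e1, e2, e3]

theorem isTransposeBy_chain {W W' : WeightSystem} {σ τ : Equiv.Perm (Fin 3)} {A B C : ℤ}
    (hA : 0 < A) (hB : 0 < B) (hC : 0 < C) (hh : W'.h = W.h) (h0 : (W.h : ℤ) = A * B * C)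
    (a0 : (W.a (σ 0) : ℤ) = B * C) (a1 : (W.a (σ 1) : ℤ) = (A - 1) * C)
    (a2 : (W.a (σ 2) : ℤ) = A * B - A + 1)
    (b0 : (W'.a (τ 0) : ℤ) = B * C - C + 1) (b1 : (W'.a (τ 1) : ℤ) = (C - 1) * A)
    (b2 : (W'.a (τ 2) : ℤ) = A * B) :
    IsTransposeBy W W' σ τ !![A, 1, 0; 0, B, 1; 0, 0, C] := by
  have hpos : (0 : ℤ) < W.h := by exact_mod_cast W.h_pos
  refine isTransposeBy_of_pos ?_ ?_ hh ?_ ?_ ?_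
  · simp [Fin.forall_fin_succ, hA.le, hB.le, hC.le]
  · simp [Matrix.det_fin_three, h0]
  · simp [Fin.forall_fin_succ, Matrix.adjugate_fin_three, Fin.sum_univ_three, b0, b1, b2]
    constructor <;> ring
  · simp [Fin.forall_fin_succ, Matrix.adjugate_fin_three, Fin.sum_univ_three, a0, a1, a2]
    constructor <;> ring
  · intro x hx hs
    have h1 := hx 0
    have h2 := hx 1
    have h3 := hx 2
    simp [Fin.sum_univ_three] at h1 h2 h3 hs
    have e3 : 0 < x 2 := (mul_pos_iff_of_pos_left hC).mp (hpos.trans_le h3)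
    have e2 : 0 < x 1 := by
      by_contra! h
      have e0 : 0 < x 0 := by
        by_contra! h'
        nlinarith
      nlinarith
    have e1 : 0 < x 0 := by
      by_contra! h
      nlinarith
    simp [Fin.forall_fin_succ, e1, e2, e3]

theorem isTransposeBy_fermatLoop {W W' : WeightSystem} {σ τ : Equiv.Perm (Fin 3)} {A B C : ℤ}
    (hA : 0 < A) (hB : 0 < B) (hC : 0 < C) (hh : W'.h = W.h) (h0 : (W.h : ℤ) = (A * B - 1) * C)
    (a0 : (W.a (σ 0) : ℤ) = (B - 1) * C) (a1 : (W.a (σ 1) : ℤ) = (A - 1) * C)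
    (a2 : (W.a (σ 2) : ℤ) = A * B - 1)
    (b0 : (W'.a (τ 0) : ℤ) = (B - 1) * C) (b1 : (W'.a (τ 1) : ℤ) = (A - 1) * C)
    (b2 : (W'.a (τ 2) : ℤ) = A * B - 1) :
    IsTransposeBy W W' σ τ !![A, 1, 0; 1, B, 0; 0, 0, C] := by
  have hpos : (0 : ℤ) < W.h := by exact_mod_cast W.h_pos
  refine isTransposeBy_of_pos ?_ ?_ hh ?_ ?_ ?_
  · simp [Fin.forall_fin_succ, hA.le, hB.le, hC.le]
  · simp [Matrix.det_fin_three, h0]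
    ring
  · simp [Fin.forall_fin_succ, Matrix.adjugate_fin_three, Fin.sum_univ_three, b0, b1, b2]
    constructor <;> ring
  · simp [Fin.forall_fin_succ, Matrix.adjugate_fin_three, Fin.sum_univ_three, a0, a1, a2]
    constructor <;> ring
  · intro x hx hs
    have h1 := hx 0
    have h2 := hx 1
    have h3 := hx 2
    simp [Fin.sum_univ_three] at h1 h2 h3 hs
    have e3 : 0 < x 2 := (mul_pos_iff_of_pos_left hC).mp (hpos.trans_le h3)
    have e1 : 0 < x 0 := by
      by_contra! h
      nlinarith
    have e2 : 0 < x 1 := by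
      by_contra! h
      nlinarith
    simp [Fin.forall_fin_succ, e1, e2, e3]

theorem isTransposeBy_loop {W W' : WeightSystem} {σ τ : Equiv.Perm (Fin 3)} {k l m : ℤ}
    (hk : 0 < k) (hl : 0 < l) (hm : 0 < m) (hh : W'.h = W.h) (h0 : (W.h : ℤ) = k * l * m + 1)
    (a0 : (W.a (σ 0) : ℤ) = l * m - l + 1) (a1 : (W.a (σ 1) : ℤ) = m * k - m + 1)
    (a2 : (W.a (σ 2) : ℤ) = k * l - k + 1)
    (b0 : (W'.a (τ 0) : ℤ) = l * m - m + 1) (b1 : (W'.a (τ 1) : ℤ) = m * k - k + 1)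
    (b2 : (W'.a (τ 2) : ℤ) = k * l - l + 1) :
    IsTransposeBy W W' σ τ !![k, 1, 0; 0, l, 1; 1, 0, m] := by
  have hpos : (0 : ℤ) < W.h := by exact_mod_cast W.h_pos
  refine isTransposeBy_of_pos ?_ ?_ hh ?_ ?_ ?_
  · simp [Fin.forall_fin_succ, hk.le, hl.le, hm.le]
  · simp [Matrix.det_fin_three, h0]
  · simp [Fin.forall_fin_succ, Matrix.adjugate_fin_three, Fin.sum_univ_three, b0, b1, b2]
    refine ⟨?_, ?_, ?_⟩ <;> ring
  · simp [Fin.forall_fin_succ, Matrix.adjugate_fin_three, Fin.sum_univ_three, a0, a1, a2]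
    refine ⟨?_, ?_, ?_⟩ <;> ring
  · intro x hx hs
    have h1 := hx 0
    have h2 := hx 1
    have h3 := hx 2
    simp [Fin.sum_univ_three] at h1 h2 h3 hs
    -- If `y0 ≤ 0`, the first row and the bound on the sum give `y2 < (q - 1) * y0 ≤ 0`, and then
    -- `y0 + r * y2` is negative. The loop is cyclically symmetric, so this serves all three
    -- coordinates.
    have key : ∀ y0 y1 y2 q r : ℤ, 0 < q → 0 < r → (W.h : ℤ) ≤ q * y0 + y1 →
        (W.h : ℤ) ≤ y0 + r * y2 → y0 + y1 + y2 < W.h → 0 < y0 := by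
      intro y0 y1 y2 q r hq hr g1 g2 g3
      by_contra! h
      have g4 : y2 < 0 := by nlinarith
      nlinarith
    have e1 := key (x 0) (x 1) (x 2) k m hk hm h1 h3 hs
    have e2 := key (x 1) (x 2) (x 0) l k hl hk h2 (by linarith) (by linarith)
    have e3 := key (x 2) (x 0) (x 1) m l hm hl (by linarith) (by linarith) (by linarith)
    simp [Fin.forall_fin_succ, e1, e2, e3]

end WeightSystem

/-! ### Classification of balanced weight systems -/

namespace WeightSystem
open Polynomial

/-- The weights of a Fermat polynomial with pairwise coprime exponents. -/
structure IsFermat (W : WeightSystem) : Prop where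
  antichain : ∀ i j, i ≠ j → ¬ W.p i ∣ W.p j
  p_mul_a : ∀ i, W.p i * W.a i = W.h
  h_eq : W.h = W.p 0 * W.p 1 * W.p 2
  cyc : W.HasCyc {W.h, W.p 0, W.p 1, W.p 2} {1, W.p 0 * W.p 1, W.p 0 * W.p 2, W.p 1 * W.p 2}

/-- The weights of `x ^ A + x y ^ B + z ^ C`. -/
structure IsFermatChain (W : WeightSystem) (i j k : Fin 3) (A B C : ℕ) : Prop where
  hij : i ≠ j
  hik : i ≠ k
  hjk : j ≠ k
  hA : 2 ≤ A
  hB : 2 ≤ B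
  hC : 2 ≤ C
  hAC : ¬ A ∣ C
  hCA : ¬ C ∣ A * B
  pi_eq : W.p i = A
  pj_eq : W.p j = A * B
  pk_eq : W.p k = C
  h_eq : W.h = A * B * C
  ai_eq : W.a i = B * C
  aj_eq : W.a j + C = A * C
  ak_eq : W.a k = A * B
  cyc : W.HasCyc {W.h, A, C} {1, A * B, A * C}

/-- The weights of `x ^ A + x y ^ B + y z ^ C`. -/
structure IsChain (W : WeightSystem) (i j k : Fin 3) (A B C : ℕ) : Prop where
  hij : i ≠ j
  hik : i ≠ k
  hjk : j ≠ k
  hA : 2 ≤ A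
  hB : 2 ≤ B
  hC : 2 ≤ C
  pi_eq : W.p i = A
  pj_eq : W.p j = A * B
  pk_eq : W.p k = A * B * C
  h_eq : W.h = A * B * C
  ai_eq : W.a i = B * C
  aj_eq : W.a j + C = A * C
  ak_eq : W.a k + A = A * B + 1
  cyc : W.HasCyc {W.h, A} {1, A * B}

/-- The weights of `x ^ A + y ^ (s + 1) z + y z ^ (t + 1)`. -/
structure IsFermatLoop (W : WeightSystem) (i j k : Fin 3) (A B s t : ℕ) : Prop where
  hij : i ≠ j
  hik : i ≠ k
  hjk : j ≠ k
  hA : 2 ≤ A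
  hB : 2 ≤ B
  hs : 1 ≤ s
  ht : 1 ≤ t
  hAB : ¬ A ∣ B
  hBA : ¬ B ∣ A
  pi_eq : W.p i = A
  pj_eq : W.p j = B
  pk_eq : W.p k = B
  h_eq : W.h = A * B
  ai_eq : W.a i = B
  aj_eq : W.a j = s * A
  ak_eq : W.a k = t * A
  st_eq : (s + 1) * (t + 1) = B + 1
  cyc : W.HasCyc {W.h, A} {1, B}

/-- The weight systems `(h / 2, h / 2, 1; h)` with `h > 2`. -/
structure IsHalfHalfOne (W : WeightSystem) (i j k : Fin 3) : Prop where
  hij : i ≠ j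
  hik : i ≠ k
  hjk : j ≠ k
  hh : W.h ≠ 2
  pi_eq : W.p i = 2
  pj_eq : W.p j = 2
  pk_eq : W.p k = W.h
  ai_eq : 2 * W.a i = W.h
  aj_eq : 2 * W.a j = W.h
  ak_eq : W.a k = 1
  cyc : W.HasCyc {W.h} {1}

theorem two_le_of_ne_mul {a b : ℕ} (h0 : 0 < a * b) (h : a ≠ a * b) : 2 ≤ b := by
  rcases b with _ | _ | b
  · simp at h0
  · simp at h
  · omega

theorem Balanced.exists_isChain {W : WeightSystem} (B : W.Balanced) {i j k : Fin 3} (hij : i ≠ j)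
    (hik : i ≠ k) (hjk : j ≠ k) (h1 : W.p i ∣ W.p j) (h2 : W.p j ∣ W.p k) (n1 : W.p i ≠ W.p j)
    (n2 : W.p j ≠ W.p k) : ∃ A B C, W.IsChain i j k A B C := by
  obtain ⟨e1, e2, e3, e4, e5⟩ := B.chain hij hik hjk h1 h2 n1 n2
  obtain ⟨b, hb⟩ := h1
  obtain ⟨c, hc⟩ := h2
  have hp0 := W.two_le_p i
  have hb2 : 2 ≤ b := two_le_of_ne_mul (hb ▸ W.p_pos j) (hb ▸ n1)
  have hc2 : 2 ≤ c := two_le_of_ne_mul (hc ▸ W.p_pos k) (hc ▸ n2)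
  have hh : W.h = W.p i * b * c := by rw [e4, hc, hb]
  have ai := W.v_mul_h i
  have aj := W.v_mul_h j
  have ak := W.v_mul_h k
  refine ⟨W.p i, b, c, hij, hik, hjk, hp0, hb2, hc2, rfl, hb, by rw [hc, hb], hh, ?_, ?_, ?_,
    by rwa [← hb]⟩
  · rw [e1, one_mul, hh, mul_assoc] at ai
    exact (Nat.eq_of_mul_eq_mul_left (by omega) ai).symm
  · rw [hh, hb] at aj
    have : W.p i * b * (W.v j * c) = W.p i * b * W.a j := by
      rw [← aj]
      ring
    have := Nat.eq_of_mul_eq_mul_left (Nat.mul_pos (by omega) (by omega)) this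
    rw [← this, e2]
    ring
  · rw [e4, mul_comm] at ak
    have := Nat.eq_of_mul_eq_mul_left (W.p_pos k) ak
    rw [← this, ← hb]
    exact e3

theorem Balanced.exists_isFermatChain {W : WeightSystem} (B : W.Balanced) {i j k : Fin 3}
    (hij : i ≠ j) (hik : i ≠ k) (hjk : j ≠ k) (h1 : W.p i ∣ W.p j) (n1 : W.p i ≠ W.p j)
    (h2 : ¬ W.p i ∣ W.p k) (h3 : ¬ W.p k ∣ W.p j) : ∃ A B C, W.IsFermatChain i j k A B C := by
  obtain ⟨e1, e2, e3, -, e4, e5⟩ := B.dvd_and_incomparable hij hik hjk h1 n1 h2 h3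
  obtain ⟨b, hb⟩ := h1
  have hp0 := W.two_le_p i
  have hp2 := W.two_le_p k
  have hb2 : 2 ≤ b := two_le_of_ne_mul (hb ▸ W.p_pos j) (hb ▸ n1)
  have hh : W.h = W.p i * b * W.p k := by rw [e4, hb]
  have ai := W.v_mul_h i
  have aj := W.v_mul_h j
  have ak := W.v_mul_h k
  refine ⟨W.p i, b, W.p k, hij, hik, hjk, hp0, hb2, hp2, h2, by rwa [← hb], rfl, hb, rfl, hh,
    ?_, ?_, ?_, by rwa [← hb]⟩
  · rw [e1, one_mul, hh, mul_assoc] at ai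
    exact (Nat.eq_of_mul_eq_mul_left (by omega) ai).symm
  · rw [hh, hb] at aj
    have : W.p i * b * (W.v j * W.p k) = W.p i * b * W.a j := by
      rw [← aj]
      ring
    have := Nat.eq_of_mul_eq_mul_left (Nat.mul_pos (by omega) (by omega)) this
    rw [← this]
    rw [e3]
    ring
  · rw [e2, one_mul, hh, mul_comm] at ak
    exact (Nat.eq_of_mul_eq_mul_left (by omega) ak).symm

theorem Balanced.exists_isFermatLoop {W : WeightSystem} (B : W.Balanced) {i j k : Fin 3}
    (hij : i ≠ j) (hik : i ≠ k) (hjk : j ≠ k) (h1 : ¬ W.p i ∣ W.p j) (h2 : ¬ W.p j ∣ W.p i)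
    (h3 : W.p j = W.p k) : ∃ A B s t, W.IsFermatLoop i j k A B s t := by
  obtain ⟨e1, -, e3, e4, e5⟩ := B.eq_pair hij hik hjk h1 h2 h3
  have ai := W.v_mul_h i
  have aj := W.v_mul_h j
  have ak := W.v_mul_h k
  refine ⟨W.p i, W.p j, W.v j, W.v k, hij, hik, hjk, W.two_le_p i, W.two_le_p j, W.v_pos j,
    W.v_pos k, h1, h2, rfl, rfl, h3.symm, e4, ?_, ?_, ?_, e3, e5⟩
  · rw [e1, one_mul, e4] at ai
    exact (Nat.eq_of_mul_eq_mul_left (W.p_pos i) ai).symm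
  · rw [e4, ← mul_assoc, mul_comm] at aj
    exact (Nat.eq_of_mul_eq_mul_left (W.p_pos j) aj).symm
  · rw [e4, ← mul_assoc, mul_comm, ← h3] at ak
    exact (Nat.eq_of_mul_eq_mul_left (W.p_pos j) ak).symm

theorem Balanced.isHalfHalfOne {W : WeightSystem} (B : W.Balanced) {i j k : Fin 3} (hij : i ≠ j)
    (hik : i ≠ k) (hjk : j ≠ k) (h1 : W.p i = W.p j) (h2 : W.p j ∣ W.p k) (n2 : W.p j ≠ W.p k) :
    W.IsHalfHalfOne i j k := by
  obtain ⟨e1, e2, e3, e4, e5, e6⟩ := B.of_eq_of_dvd hij hik hjk h1 h2 n2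
  refine ⟨hij, hik, hjk, ?_, e1, h1 ▸ e1, e5.symm, ?_, ?_, ?_, e6⟩
  · rw [e5, ← e1, h1]
    exact n2.symm
  · rw [← a_eq_of_v_eq_one e2, e1]
  · rw [← a_eq_of_v_eq_one e3, ← h1, e1]
  · have := a_eq_of_v_eq_one e4
    rw [e5] at this
    exact Nat.eq_of_mul_eq_mul_left (W.p_pos k) (by rw [this, mul_one])

theorem Balanced.isFermat {W : WeightSystem} (B : W.Balanced)
    (H : ∀ i j, i ≠ j → ¬ W.p i ∣ W.p j) : W.IsFermat := by
  obtain ⟨e1, -, e2, e3⟩ := B.antichain H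
  exact ⟨H, fun i => a_eq_of_v_eq_one (e1 i), e2, e3⟩

/-- The divisibility patterns of `p 0, p 1, p 2` are exhausted, first by coincidences and then by
comparabilities; the last alternative is two incomparable elements below a third. -/
theorem Balanced.cases {W : WeightSystem} (B : W.Balanced) :
    W.IsFermat ∨ (∃ i j k A B C, W.IsFermatChain i j k A B C) ∨
    (∃ i j k A B C, W.IsChain i j k A B C) ∨ (∃ i j k A B s t, W.IsFermatLoop i j k A B s t) ∨
    (∃ i j k, W.IsHalfHalfOne i j k) ∨ (W.IsTypeV ∧ W.HasCyc {W.h} {1}) ∨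
    ((∃ n, W.cyc n = -2) ∧ ∀ n, W.cyc n ≤ 1) := by
  by_cases H : ∃ i j, i ≠ j ∧ W.p i = W.p j
  · obtain ⟨i, j, hij, h⟩ := H
    obtain ⟨k, hik, hjk, huniv⟩ : ∃ k, i ≠ k ∧ j ≠ k ∧ ∀ l, l = i ∨ l = j ∨ l = k := by
      clear h
      revert i j
      decide
    by_cases h1 : W.p j = W.p k
    · have h2 : ∀ l, W.p l = W.p k := by
        intro l
        rcases huniv l with rfl | rfl | rfl
        · rw [h, h1]
        · exact h1
        · rfl
      have hV : W.IsTypeV := ⟨by rw [h2 0, h2 1], by rw [h2 1, h2 2]⟩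
      exact .inr (.inr (.inr (.inr (.inr (.inl ⟨hV, B.hasCyc_of_eq hV.1 hV.2⟩)))))
    by_cases h2 : W.p j ∣ W.p k
    · exact .inr (.inr (.inr (.inr (.inl ⟨i, j, k, B.isHalfHalfOne hij hik hjk h h2 h1⟩))))
    by_cases h3 : W.p k ∣ W.p j
    · exact absurd (B.not_dvd_of_eq hjk.symm hik.symm hij.symm h3 h.symm) (Ne.symm h1)
    exact .inr (.inr (.inr (.inl ⟨k, j, i, B.exists_isFermatLoop hjk.symm hik.symm hij.symm h3 h2
      h.symm⟩)))
  push Not at H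
  by_cases H2 : ∃ i j, i ≠ j ∧ W.p i ∣ W.p j
  · obtain ⟨i, j, hij, h⟩ := H2
    obtain ⟨k, hik, hjk⟩ : ∃ k, i ≠ k ∧ j ≠ k := by
      clear h H
      revert i j
      decide
    by_cases h1 : W.p k ∣ W.p i
    · exact .inr (.inr (.inl ⟨k, i, j, B.exists_isChain hik.symm hjk.symm hij h1 h
        (H _ _ hik.symm) (H _ _ hij)⟩))
    by_cases h2 : W.p j ∣ W.p k
    · exact .inr (.inr (.inl ⟨i, j, k, B.exists_isChain hij hik hjk h h2 (H _ _ hij) (H _ _ hjk)⟩))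
    by_cases h3 : W.p i ∣ W.p k
    · have h4 := B.dvd_of_dvd_of_dvd hij hik hjk h h3 (H _ _ hij) (H _ _ hik) h2
      exact .inr (.inr (.inl ⟨i, k, j, B.exists_isChain hik hij hjk.symm h3 h4 (H _ _ hik)
        (H _ _ hjk.symm)⟩))
    by_cases h4 : W.p k ∣ W.p j
    · exact .inr (.inr (.inr (.inr (.inr (.inr (B.below_pair hik hij hjk.symm h h4 (H _ _ hij)
        (H _ _ hjk.symm) h3 h1))))))
    exact .inr (.inl ⟨i, j, k, B.exists_isFermatChain hij hik hjk h (H _ _ hij) h3 h4⟩)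
  · push Not at H2
    exact .inl (B.isFermat H2)

theorem HasCyc.cyc_ne_two {W : WeightSystem} {P N : Finset ℕ} (H : W.HasCyc P N) (n : ℕ) :
    W.cyc n ≠ 2 := by
  rw [H n]
  split_ifs <;> norm_num

/-- The sign in the duality exchanges positive and negative values, and the index is complemented in
`h`. -/
theorem HasCyc.pos_eq_image {W W' : WeightSystem} {P N P' N' : Finset ℕ} (H : W.HasCyc P N)
    (H' : W'.HasCyc P' N') (hd' : Disjoint P' N') (hd : Disjoint P N) (D : CycDual W' W) :
    P' = N.image (W.h / ·) := by
  ext n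
  rw [Finset.mem_image]
  constructor
  · intro hn
    have h1 := H' n
    rw [if_pos hn, if_neg (Finset.disjoint_left.mp hd' hn), D n] at h1
    split_ifs at h1 with h2
    · rw [H] at h1
      refine ⟨W.h / n, ?_, Nat.div_div_self h2 W.h_pos.ne'⟩
      split_ifs at h1 <;> first | assumption | norm_num at h1
    · norm_num at h1
  · rintro ⟨m, hm, rfl⟩
    have h1 := H m
    rw [if_pos hm, if_neg (Finset.disjoint_right.mp hd hm)] at h1
    have h2 : m ∣ W.h := by
      by_contra h2
      rw [cyc_eq_zero_of_not_dvd h2] at h1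
      norm_num at h1
    have h3 := D (W.h / m)
    rw [if_pos (Nat.div_dvd_of_dvd h2), Nat.div_div_self h2 W.h_pos.ne', h1, H'] at h3
    split_ifs at h3 <;> first | assumption | norm_num at h3

theorem HasCyc.card_pos_eq {W W' : WeightSystem} {P N P' N' : Finset ℕ} (H : W.HasCyc P N)
    (H' : W'.HasCyc P' N') (hd' : Disjoint P' N') (hd : Disjoint P N) (D : CycDual W' W) :
    P'.card = N.card := by
  rw [H.pos_eq_image H' hd' hd D]
  refine Finset.card_image_of_injOn ?_
  have hdvd : ∀ m ∈ N, m ∣ W.h := by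
    intro m hm
    by_contra h2
    have h1 := H m
    rw [if_pos hm, if_neg (Finset.disjoint_right.mp hd hm), cyc_eq_zero_of_not_dvd h2] at h1
    norm_num at h1
  intro m hm n hn hmn
  simp only at hmn
  rw [← Nat.div_div_self (hdvd m hm) W.h_pos.ne', hmn, Nat.div_div_self (hdvd n hn) W.h_pos.ne']

end WeightSystem

/-! ### Members of a dual pair have the same number of cyclotomic factors -/

namespace WeightSystem
open Polynomial

theorem IsFermat.ne {W : WeightSystem} (F : W.IsFermat) {i j : Fin 3} (h : i ≠ j) :
    W.p i ≠ W.p j := fun h' => F.antichain i j h (h' ▸ dvd_rfl)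

theorem IsFermat.mul_ne {W : WeightSystem} (F : W.IsFermat) {i j l : Fin 3} (h : j ≠ l) :
    W.p i * W.p j ≠ W.p l := fun h' => F.antichain j l h (h' ▸ dvd_mul_left _ _)

theorem IsFermat.card {W : WeightSystem} (F : W.IsFermat) :
    Disjoint ({W.h, W.p 0, W.p 1, W.p 2} : Finset ℕ)
      {1, W.p 0 * W.p 1, W.p 0 * W.p 2, W.p 1 * W.p 2} ∧
    ({W.h, W.p 0, W.p 1, W.p 2} : Finset ℕ).card = 4 ∧
    ({1, W.p 0 * W.p 1, W.p 0 * W.p 2, W.p 1 * W.p 2} : Finset ℕ).card = 4 := by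
  have e0 := W.two_le_p 0
  have e1 := W.two_le_p 1
  have e2 := W.two_le_p 2
  have n01 := F.ne (i := 0) (j := 1) (by decide)
  have n02 := F.ne (i := 0) (j := 2) (by decide)
  have n12 := F.ne (i := 1) (j := 2) (by decide)
  have q01 : W.p 0 * W.p 1 ≠ W.p 2 := F.mul_ne (by decide)
  have q02 : W.p 0 * W.p 2 ≠ W.p 1 := F.mul_ne (by decide)
  have q12 : W.p 1 * W.p 2 ≠ W.p 0 := F.mul_ne (by decide)
  have s1 := Nat.mul_le_mul_left (W.p 0) e1
  have s2 := Nat.mul_le_mul_right (W.p 1) e0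
  have s3 := Nat.mul_le_mul_left (W.p 0) e2
  have s4 := Nat.mul_le_mul_right (W.p 2) e0
  have s5 := Nat.mul_le_mul_left (W.p 1) e2
  have s6 := Nat.mul_le_mul_right (W.p 2) e1
  have h1 := Nat.mul_le_mul_left (W.p 0 * W.p 1) e2
  have h2 : W.h = W.p 0 * W.p 2 * W.p 1 := by rw [F.h_eq]; ring
  have h3 : W.h = W.p 1 * W.p 2 * W.p 0 := by rw [F.h_eq]; ring
  have h4 := Nat.mul_le_mul_left (W.p 0 * W.p 2) e1
  have h5 := Nat.mul_le_mul_left (W.p 1 * W.p 2) e0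
  have t1 : W.p 0 * W.p 1 ≠ W.p 0 * W.p 2 := fun h =>
    n12 (Nat.eq_of_mul_eq_mul_left (by omega) h)
  have t2 : W.p 0 * W.p 1 ≠ W.p 1 * W.p 2 := fun h =>
    n02 (Nat.eq_of_mul_eq_mul_left (show 0 < W.p 1 by omega) (by rwa [mul_comm] at h))
  have t3 : W.p 0 * W.p 2 ≠ W.p 1 * W.p 2 := fun h =>
    n01 (Nat.eq_of_mul_eq_mul_right (by omega) h)
  rw [← F.h_eq] at h1
  rw [← h2] at h4
  rw [← h3] at h5
  refine ⟨?_, ?_, ?_⟩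
  · rw [Finset.disjoint_left]
    simp only [Finset.mem_insert, Finset.mem_singleton]
    omega
  · repeat rw [Finset.card_insert_of_notMem]
    · simp
    all_goals
      simp only [Finset.mem_insert, Finset.mem_singleton]
      omega
  · repeat rw [Finset.card_insert_of_notMem]
    · simp
    all_goals
      simp only [Finset.mem_insert, Finset.mem_singleton]
      omega

theorem IsFermatChain.card {W : WeightSystem} {i j k : Fin 3} {A B C : ℕ}
    (F : W.IsFermatChain i j k A B C) :
    Disjoint ({W.h, A, C} : Finset ℕ) {1, A * B, A * C} ∧
    ({W.h, A, C} : Finset ℕ).card = 3 ∧ ({1, A * B, A * C} : Finset ℕ).card = 3 := by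
  have hA := F.hA
  have hB := F.hB
  have hC := F.hC
  have n1 : A ≠ C := fun h => F.hAC (h ▸ dvd_rfl)
  have n2 : A * B ≠ C := fun h => F.hCA (h ▸ dvd_rfl)
  have n3 : B ≠ C := fun h => F.hCA (h ▸ dvd_mul_left _ _)
  have n4 : A * B ≠ A * C := fun h => n3 (Nat.eq_of_mul_eq_mul_left (by omega) h)
  have s1 := Nat.mul_le_mul_left A hB
  have s2 := Nat.mul_le_mul_left A hC
  have s3 := Nat.mul_le_mul_right C hA
  have h1 := Nat.mul_le_mul_left (A * B) hC
  have h2 : A * B * C = A * C * B := by ring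
  have h3 := Nat.mul_le_mul_left (A * C) hB
  rw [← F.h_eq] at h1
  rw [← h2, ← F.h_eq] at h3
  have s4 := Nat.mul_le_mul_left (A * B) hC
  have h4 : C * (A * B) = A * B * C := by ring
  have s5 := Nat.mul_le_mul_left C (show 4 ≤ A * B by omega)
  rw [h4, ← F.h_eq] at s5
  refine ⟨?_, ?_, ?_⟩
  · rw [Finset.disjoint_left]
    simp only [Finset.mem_insert, Finset.mem_singleton]
    omega
  · repeat rw [Finset.card_insert_of_notMem]
    · simp
    all_goals
      simp only [Finset.mem_insert, Finset.mem_singleton]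
      omega
  · repeat rw [Finset.card_insert_of_notMem]
    · simp
    all_goals
      simp only [Finset.mem_insert, Finset.mem_singleton]
      omega

theorem card_pair_of_lt {h A N : ℕ} (hA : 2 ≤ A) (hN : 2 ≤ N) (hAN : A ≠ N) (hAh : A < h)
    (hNh : N < h) : Disjoint ({h, A} : Finset ℕ) {1, N} ∧ ({h, A} : Finset ℕ).card = 2 ∧
    ({1, N} : Finset ℕ).card = 2 := by
  refine ⟨?_, ?_, ?_⟩
  · rw [Finset.disjoint_left]
    simp only [Finset.mem_insert, Finset.mem_singleton]
    omega
  · rw [Finset.card_pair (by omega)]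
  · rw [Finset.card_pair (by omega)]

theorem IsChain.card {W : WeightSystem} {i j k : Fin 3} {A B C : ℕ} (F : W.IsChain i j k A B C) :
    Disjoint ({W.h, A} : Finset ℕ) {1, A * B} ∧
    ({W.h, A} : Finset ℕ).card = 2 ∧ ({1, A * B} : Finset ℕ).card = 2 := by
  have hA := F.hA
  have s1 := Nat.mul_le_mul_left A F.hB
  have s2 := Nat.mul_le_mul_left (A * B) F.hC
  rw [← F.h_eq] at s2
  exact card_pair_of_lt (by omega) (by omega) (by omega) (by omega) (by omega)

theorem IsFermatLoop.card {W : WeightSystem} {i j k : Fin 3} {A B s t : ℕ}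
    (F : W.IsFermatLoop i j k A B s t) : Disjoint ({W.h, A} : Finset ℕ) {1, B} ∧
    ({W.h, A} : Finset ℕ).card = 2 ∧ ({1, B} : Finset ℕ).card = 2 := by
  have hA := F.hA
  have hB := F.hB
  have n1 : A ≠ B := fun h => F.hAB (h ▸ dvd_rfl)
  have s1 := Nat.mul_le_mul_left A F.hB
  have s2 := Nat.mul_le_mul_right B F.hA
  rw [← F.h_eq] at s1 s2
  exact card_pair_of_lt (by omega) (by omega) (by omega) (by omega) (by omega)

theorem card_singleton_of_h (W : WeightSystem) : Disjoint ({W.h} : Finset ℕ) {1} ∧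
    ({W.h} : Finset ℕ).card = 1 ∧ ({1} : Finset ℕ).card = 1 := by
  have := W.h_ne_one
  simp [this]

/-- The common size of the sets of `n` with `cyc n = 1` and of `n` with `cyc n = -1`. -/
def HasCycCard (W : WeightSystem) (c : ℕ) : Prop :=
  ∃ P N : Finset ℕ, W.HasCyc P N ∧ Disjoint P N ∧ P.card = c ∧ N.card = c

theorem HasCycCard.unique {W W' : WeightSystem} {c c' : ℕ} (H : W.HasCycCard c)
    (H' : W'.HasCycCard c') (D : CycDual W' W) : c = c' := by
  obtain ⟨P, N, h1, h2, -, h4⟩ := H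
  obtain ⟨P', N', h1', h2', h3', -⟩ := H'
  rw [← h4, ← h3', h1.card_pos_eq h1' h2' h2 D]

theorem Balanced.cases_card {W : WeightSystem} (B : W.Balanced) :
    (W.HasCycCard 4 ∧ W.IsFermat) ∨
    (W.HasCycCard 3 ∧ ∃ i j k A B C, W.IsFermatChain i j k A B C) ∨
    (W.HasCycCard 2 ∧ ((∃ i j k A B C, W.IsChain i j k A B C) ∨
      ∃ i j k A B s t, W.IsFermatLoop i j k A B s t)) ∨
    (W.HasCycCard 1 ∧ ((∃ i j k, W.IsHalfHalfOne i j k) ∨ W.IsTypeV)) ∨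
    ((∃ n, W.cyc n = -2) ∧ ∀ n, W.cyc n ≤ 1) := by
  rcases B.cases with h | ⟨i, j, k, b, c, d, h⟩ | ⟨i, j, k, b, c, d, h⟩ |
    ⟨i, j, k, b, c, d, e, h⟩ | ⟨i, j, k, h⟩ | ⟨h1, h2⟩ | h
  · exact .inl ⟨⟨_, _, h.cyc, h.card⟩, h⟩
  · exact .inr (.inl ⟨⟨_, _, h.cyc, h.card⟩, i, j, k, b, c, d, h⟩)
  · exact .inr (.inr (.inl ⟨⟨_, _, h.cyc, h.card⟩, .inl ⟨i, j, k, b, c, d, h⟩⟩))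
  · exact .inr (.inr (.inl ⟨⟨_, _, h.cyc, h.card⟩, .inr ⟨i, j, k, b, c, d, e, h⟩⟩))
  · exact .inr (.inr (.inr (.inl ⟨⟨_, _, h.cyc, W.card_singleton_of_h⟩, .inl ⟨i, j, k, h⟩⟩)))
  · exact .inr (.inr (.inr (.inl ⟨⟨_, _, h2, W.card_singleton_of_h⟩, .inr h1⟩)))
  · exact .inr (.inr (.inr (.inr h)))

theorem HasCycCard.cyc_ne {W : WeightSystem} {c : ℕ} (H : W.HasCycCard c) (n : ℕ) :
    W.cyc n ≠ 2 := by
  obtain ⟨P, N, h, -⟩ := H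
  exact h.cyc_ne_two n

theorem exists_cyc_eq_two {W W' : WeightSystem} (D : CycDual W' W) (H : ∃ n, W.cyc n = -2) :
    ∃ n, W'.cyc n = 2 := by
  obtain ⟨n, hn⟩ := H
  have h2 : n ∣ W.h := by
    by_contra h2
    rw [cyc_eq_zero_of_not_dvd h2] at hn
    norm_num at hn
  refine ⟨W.h / n, ?_⟩
  rw [D, if_pos (Nat.div_dvd_of_dvd h2), Nat.div_div_self h2 W.h_pos.ne', hn]
  norm_num

/-- The number of positive values, `4`, `3`, `2` or `1`, is invariant under duality and separates
these groups of types. A value `-2` is excluded because its dual would be `2`. -/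
theorem Balanced.cases_of_cycDual {W W' : WeightSystem} (B : W.Balanced) (B' : W'.Balanced)
    (D : CycDual W' W) (hh : W'.h = W.h) :
    (W.IsFermat ∧ W'.IsFermat) ∨
    ((∃ i j k A B C, W.IsFermatChain i j k A B C) ∧
      ∃ i j k A B C, W'.IsFermatChain i j k A B C) ∨
    (((∃ i j k A B C, W.IsChain i j k A B C) ∨ ∃ i j k A B s t, W.IsFermatLoop i j k A B s t) ∧
      ((∃ i j k A B C, W'.IsChain i j k A B C) ∨
        ∃ i j k A B s t, W'.IsFermatLoop i j k A B s t)) ∨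
    (((∃ i j k, W.IsHalfHalfOne i j k) ∨ W.IsTypeV) ∧
      ((∃ i j k, W'.IsHalfHalfOne i j k) ∨ W'.IsTypeV)) := by
  have D' := D.symm hh
  have hle : ∀ V : WeightSystem, V.Balanced → ∀ n, V.cyc n ≠ 2 := by
    intro V hV n
    rcases hV.cases_card with ⟨h, -⟩ | ⟨h, -⟩ | ⟨h, -⟩ | ⟨h, -⟩ | ⟨-, h⟩
    · exact h.cyc_ne n
    · exact h.cyc_ne n
    · exact h.cyc_ne n
    · exact h.cyc_ne n
    · intro h2
      have := h n
      rw [h2] at this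
      norm_num at this
  have hnot : ¬ ∃ n, W.cyc n = -2 := fun h => by
    obtain ⟨n, hn⟩ := exists_cyc_eq_two D h
    exact hle W' B' n hn
  have hnot' : ¬ ∃ n, W'.cyc n = -2 := fun h => by
    obtain ⟨n, hn⟩ := exists_cyc_eq_two D' h
    exact hle W B n hn
  rcases B.cases_card with ⟨h1, h2⟩ | ⟨h1, h2⟩ | ⟨h1, h2⟩ | ⟨h1, h2⟩ | ⟨h1, -⟩ <;>
  rcases B'.cases_card with ⟨h3, h4⟩ | ⟨h3, h4⟩ | ⟨h3, h4⟩ | ⟨h3, h4⟩ | ⟨h3, -⟩ <;>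
  first
  | exact absurd h1 hnot
  | exact absurd h3 hnot'
  | exact absurd (h1.unique h3 D) (by decide)
  | skip
  · exact .inl ⟨h2, h4⟩
  · exact .inr (.inl ⟨h2, h4⟩)
  · exact .inr (.inr (.inl ⟨h2, h4⟩))
  · exact .inr (.inr (.inr ⟨h2, h4⟩))

end WeightSystem

/-! ### Dual pairs outside type V and the half-half-one family are transposes -/

namespace WeightSystem
open Polynomial

theorem exists_perm_of_ne {i j k : Fin 3} (hij : i ≠ j) (hik : i ≠ k) (hjk : j ≠ k) :
    ∃ σ : Equiv.Perm (Fin 3), σ 0 = i ∧ σ 1 = j ∧ σ 2 = k := by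
  revert hij hik hjk
  revert i j k
  decide

/-- `W` and `W'` are the weight systems of an invertible polynomial and of its transpose. -/
def IsTransposePair (W W' : WeightSystem) : Prop :=
  ∃ σ τ M, IsTransposeBy W W' σ τ M

theorem IsFermat.isTransposePair {W W' : WeightSystem} (F : W.IsFermat) (F' : W'.IsFermat)
    (D : CycDual W' W) (hh : W'.h = W.h) : IsTransposePair W W' := by
  have h1 := F.cyc.pos_eq_image F'.cyc F'.card.1 F.card.1 D
  have e0 := W.p_pos 0
  have e1 := W.p_pos 1
  have e2 := W.p_pos 2
  have d01 : W.h / (W.p 0 * W.p 1) = W.p 2 :=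
    Nat.div_eq_of_eq_mul_right (Nat.mul_pos e0 e1) (by rw [F.h_eq])
  have d02 : W.h / (W.p 0 * W.p 2) = W.p 1 :=
    Nat.div_eq_of_eq_mul_right (Nat.mul_pos e0 e2) (by rw [F.h_eq]; ring)
  have d12 : W.h / (W.p 1 * W.p 2) = W.p 0 :=
    Nat.div_eq_of_eq_mul_right (Nat.mul_pos e1 e2) (by rw [F.h_eq]; ring)
  simp only [Finset.image_insert, Finset.image_singleton, Nat.div_one, d01, d02, d12] at h1
  have hne := W.p_ne_h F.antichain
  have hex : ∀ i, ∃ j, W'.p j = W.p i := by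
    intro i
    have h2 : W.p i ∈ ({W'.h, W'.p 0, W'.p 1, W'.p 2} : Finset ℕ) := by
      rw [h1]
      fin_cases i <;> simp
    simp only [Finset.mem_insert, Finset.mem_singleton] at h2
    rcases h2 with h2 | h2 | h2 | h2
    · exact absurd (h2.trans hh) (hne i)
    · exact ⟨0, h2.symm⟩
    · exact ⟨1, h2.symm⟩
    · exact ⟨2, h2.symm⟩
  choose f hf using hex
  have hinj : Function.Injective f := fun i j hij => by
    by_contra hne
    exact F.ne hne (by rw [← hf, hij, hf])
  have ha : ∀ i, W'.a (f i) = W.a i := by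
    intro i
    have h3 := F'.p_mul_a (f i)
    rw [hf, hh, ← F.p_mul_a i] at h3
    exact Nat.eq_of_mul_eq_mul_left (W.p_pos i) h3
  have a0 : W.a 0 = W.p 1 * W.p 2 := by
    have := F.p_mul_a 0
    rw [F.h_eq, mul_assoc] at this
    exact Nat.eq_of_mul_eq_mul_left e0 this
  have a1 : W.a 1 = W.p 0 * W.p 2 := by
    have := F.p_mul_a 1
    rw [F.h_eq, mul_comm (W.p 0), mul_assoc] at this
    exact Nat.eq_of_mul_eq_mul_left e1 this
  have a2 : W.a 2 = W.p 0 * W.p 1 := by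
    have := F.p_mul_a 2
    rw [F.h_eq, mul_comm _ (W.p 2)] at this
    exact Nat.eq_of_mul_eq_mul_left e2 this
  refine ⟨1, Equiv.ofBijective f (Finite.injective_iff_bijective.mp hinj), _,
    isTransposeBy_fermat (A := W.p 0) (B := W.p 1) (C := W.p 2) (by exact_mod_cast e0)
      (by exact_mod_cast e1) (by exact_mod_cast e2) hh (by exact_mod_cast F.h_eq)
      (by exact_mod_cast a0) (by exact_mod_cast a1) (by exact_mod_cast a2) ?_ ?_ ?_⟩
  · rw [Equiv.ofBijective_apply, ha]
    exact_mod_cast a0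
  · rw [Equiv.ofBijective_apply, ha]
    exact_mod_cast a1
  · rw [Equiv.ofBijective_apply, ha]
    exact_mod_cast a2

/-- Duality gives `{A', C'} = {B, C}` and `{A, C} = {B', C'}`. The consistent solution is `A' = B`,
`B' = A`, `C' = C`, the transposed chain. -/
theorem IsFermatChain.isTransposePair {W W' : WeightSystem} {i j k i' j' k' : Fin 3}
    {A B C A' B' C' : ℕ} (F : W.IsFermatChain i j k A B C)
    (F' : W'.IsFermatChain i' j' k' A' B' C') (D : CycDual W' W) (hh : W'.h = W.h) :
    IsTransposePair W W' := by
  have h1 := F.cyc.pos_eq_image F'.cyc F'.card.1 F.card.1 D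
  have h2 := F'.cyc.pos_eq_image F.cyc F.card.1 F'.card.1 (D.symm hh)
  have hA := F.hA
  have hB := F.hB
  have hC := F.hC
  have hA' := F'.hA
  have hB' := F'.hB
  have hC' := F'.hC
  have d1 : W.h / (A * B) = C := Nat.div_eq_of_eq_mul_right (by positivity) F.h_eq
  have d2 : W.h / (A * C) = B :=
    Nat.div_eq_of_eq_mul_right (by positivity) (by rw [F.h_eq]; ring)
  have d1' : W.h / (A' * B') = C' :=
    Nat.div_eq_of_eq_mul_right (by positivity) (by rw [← hh, F'.h_eq])
  have d2' : W.h / (A' * C') = B' :=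
    Nat.div_eq_of_eq_mul_right (by positivity) (by rw [← hh, F'.h_eq]; ring)
  simp only [Finset.image_insert, Finset.image_singleton, Nat.div_one, hh, d1, d2, d1', d2']
    at h1 h2
  have hprod : A' * B' * C' = A * B * C := by rw [← F.h_eq, ← F'.h_eq, hh]
  have n3 : B ≠ C := fun h => F.hCA (h ▸ dvd_mul_left _ _)
  have n3' : B' ≠ C' := fun h => F'.hCA (h ▸ dvd_mul_left _ _)
  have n1' : A' ≠ C' := fun h => F'.hAC (h ▸ dvd_rfl)
  have s1 := Nat.mul_le_mul_left A hB
  have hlt : ∀ x, x * 4 ≤ W.h → 0 < x → x ≠ W.h := by omega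
  have hA'h : A' ≠ W.h := by
    have := Nat.mul_le_mul_left A' (Nat.mul_le_mul hB' hC')
    rw [← mul_assoc A' B' C', ← F'.h_eq, hh] at this
    exact hlt _ this (by omega)
  have hC'h : C' ≠ W.h := by
    have := Nat.mul_le_mul_left C' (Nat.mul_le_mul hA' hB')
    rw [mul_comm C' (A' * B'), ← F'.h_eq, hh] at this
    exact hlt _ this (by omega)
  have mA' : A' ∈ ({W.h, A', C'} : Finset ℕ) := by simp
  have mC' : C' ∈ ({W.h, A', C'} : Finset ℕ) := by simp
  have mC2 : C' ∈ ({W.h, C', B'} : Finset ℕ) := by simp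
  rw [h1] at mA' mC'
  rw [← h2] at mC2
  simp only [Finset.mem_insert, Finset.mem_singleton] at mA' mC' mC2
  have key : A' = B ∧ C' = C ∧ B' = A := by
    rcases mA'.resolve_left hA'h with e1 | e1 <;> rcases mC'.resolve_left hC'h with e2 | e2
    · omega
    · exfalso
      -- The crossed assignment would lead to `B' = C'`, which is excluded.
      have e3 : C' = A := by omega
      subst e1 e2
      have : A' * C' * B' = A' * C' * A := by rw [mul_right_comm, hprod]; ring
      have := Nat.eq_of_mul_eq_mul_left (by positivity) this
      omega
    · subst e1 e2
      refine ⟨rfl, rfl, ?_⟩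
      have : A' * C' * B' = A' * C' * A := by rw [mul_right_comm, hprod]; ring
      exact Nat.eq_of_mul_eq_mul_left (by positivity) this
    · omega
  obtain ⟨rfl, rfl, rfl⟩ := key
  obtain ⟨σ, s0, s1, s2⟩ := exists_perm_of_ne F.hij F.hik F.hjk
  obtain ⟨τ, t0, t1, t2⟩ := exists_perm_of_ne F'.hij.symm F'.hjk F'.hik
  have aj : (W.a j : ℤ) + C' = B' * C' := by exact_mod_cast F.aj_eq
  have aj' : (W'.a j' : ℤ) + C' = A' * C' := by exact_mod_cast F'.aj_eq
  refine ⟨σ, τ, _, isTransposeBy_fermatChain (A := B') (B := A') (C := C') (by positivity)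
    (by positivity) (by positivity) hh (by exact_mod_cast F.h_eq) ?_ ?_ ?_ ?_ ?_ ?_⟩
  · rw [s0]
    exact_mod_cast F.ai_eq
  · rw [s1]
    linear_combination aj
  · rw [s2]
    exact_mod_cast F.ak_eq
  · rw [t0]
    linear_combination aj'
  · rw [t1]
    exact_mod_cast F'.ai_eq
  · rw [t2, mul_comm]
    exact_mod_cast F'.ak_eq

theorem eq_of_hasCyc_pair {W W' : WeightSystem} {A N A' N' : ℕ} (H : W.HasCyc {W.h, A} {1, N})
    (H' : W'.HasCyc {W'.h, A'} {1, N'}) (hd : Disjoint ({W.h, A} : Finset ℕ) {1, N})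
    (hd' : Disjoint ({W'.h, A'} : Finset ℕ) {1, N'}) (hc' : ({W'.h, A'} : Finset ℕ).card = 2)
    (D : CycDual W' W) (hh : W'.h = W.h) (hN : N ∣ W.h) : A' * N = W.h := by
  have h1 := H.pos_eq_image H' hd' hd D
  simp only [Finset.image_insert, Finset.image_singleton, Nat.div_one] at h1
  have h2 : A' ∈ ({W'.h, A'} : Finset ℕ) := by simp
  have h3 : A' ≠ W.h := by
    rintro h
    rw [hh, h] at hc'
    simp at hc'
  rw [h1] at h2
  simp only [Finset.mem_insert, Finset.mem_singleton] at h2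
  rw [h2.resolve_left h3, Nat.div_mul_cancel hN]

theorem IsChain.isTransposePair {W W' : WeightSystem} {i j k i' j' k' : Fin 3}
    {A B C A' B' C' : ℕ} (F : W.IsChain i j k A B C)
    (F' : W'.IsChain i' j' k' A' B' C') (D : CycDual W' W) (hh : W'.h = W.h) :
    IsTransposePair W W' := by
  have hA := F.hA
  have hB := F.hB
  have hC := F.hC
  have h1 := eq_of_hasCyc_pair F.cyc F'.cyc F.card.1 F'.card.1 F'.card.2.1 D hh
    (Dvd.intro _ F.h_eq.symm)
  have h2 := eq_of_hasCyc_pair F'.cyc F.cyc F'.card.1 F.card.1 F.card.2.1 (D.symm hh) hh.symm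
    (Dvd.intro _ F'.h_eq.symm)
  rw [F.h_eq, mul_comm] at h1
  rw [F'.h_eq, mul_comm] at h2
  have e1 : A' = C := Nat.eq_of_mul_eq_mul_left (by positivity) h1
  have e2 : A = C' := Nat.eq_of_mul_eq_mul_left
    (Nat.mul_pos (by have := F'.hA; omega) (by have := F'.hB; omega)) h2
  subst e1 e2
  have e3 : B' = B := by
    have h3 := F'.h_eq
    rw [hh, F.h_eq] at h3
    have : A * A' * B' = A * A' * B := by linarith [h3, mul_right_comm A B A']
    exact Nat.eq_of_mul_eq_mul_left (by positivity) this
  subst e3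
  obtain ⟨σ, s0, s1, s2⟩ := exists_perm_of_ne F.hij F.hik F.hjk
  obtain ⟨τ, t0, t1, t2⟩ := exists_perm_of_ne F'.hjk.symm F'.hik.symm F'.hij.symm
  have aj : (W.a j : ℤ) + A' = A * A' := by exact_mod_cast F.aj_eq
  have aj' : (W'.a j' : ℤ) + A = A' * A := by exact_mod_cast F'.aj_eq
  have ak : (W.a k : ℤ) + A = A * B' + 1 := by exact_mod_cast F.ak_eq
  have ak' : (W'.a k' : ℤ) + A' = A' * B' + 1 := by exact_mod_cast F'.ak_eq
  refine ⟨σ, τ, _, isTransposeBy_chain (A := A) (B := B') (C := A') (by positivity)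
    (by positivity) (by positivity) hh (by exact_mod_cast F.h_eq) ?_ ?_ ?_ ?_ ?_ ?_⟩
  · rw [s0]
    exact_mod_cast F.ai_eq
  · rw [s1]
    linear_combination aj
  · rw [s2]
    linear_combination ak
  · rw [t0]
    linear_combination ak'
  · rw [t1]
    linear_combination aj'
  · rw [t2, mul_comm]
    exact_mod_cast F'.ai_eq

/-- Duality in both directions gives `B' = A * B` and `A = A'`, so `A' ∣ B'`, against
incomparability. -/
theorem IsChain.not_isFermatLoop {W W' : WeightSystem} {i j k i' j' k' : Fin 3}
    {A B C A' B' s t : ℕ} (F : W.IsChain i j k A B C) (F' : W'.IsFermatLoop i' j' k' A' B' s t)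
    (D : CycDual W' W) (hh : W'.h = W.h) : False := by
  have hA := F.hA
  have hB := F.hB
  have h1 := eq_of_hasCyc_pair F.cyc F'.cyc F.card.1 F'.card.1 F'.card.2.1 D hh
    (Dvd.intro _ F.h_eq.symm)
  have h2 := F'.h_eq
  rw [hh, ← h1] at h2
  have h3 := eq_of_hasCyc_pair F'.cyc F.cyc F'.card.1 F.card.1 F.card.2.1 (D.symm hh) hh.symm
    (Dvd.intro_left _ F'.h_eq.symm)
  have hA' := F'.hA
  have h4 := Nat.eq_of_mul_eq_mul_left (show 0 < A' by omega) h2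
  rw [F'.h_eq] at h3
  have hB' := F'.hB
  have h5 := Nat.eq_of_mul_eq_mul_right (show 0 < B' by omega) h3
  exact F'.hAB (h5 ▸ h4 ▸ dvd_mul_right _ _)

theorem IsFermatLoop.isTypeIII {W : WeightSystem} {i j k : Fin 3} {A B s t : ℕ}
    (F : W.IsFermatLoop i j k A B s t) : W.IsTypeIII := by
  obtain ⟨σ, s0, s1, s2⟩ := exists_perm_of_ne F.hij F.hik F.hjk
  refine ⟨σ, ?_, ?_, ?_⟩
  · rw [s1, s2, F.pj_eq, F.pk_eq]
  · rw [s0, s1, F.pi_eq, F.pj_eq]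
    exact F.hAB
  · rw [s0, s1, F.pi_eq, F.pj_eq]
    exact F.hBA

theorem sum_eq_of_ne {i j k : Fin 3} (hij : i ≠ j) (hik : i ≠ k) (hjk : j ≠ k) (f : Fin 3 → ℤ) :
    ∑ l, f l = f i + f j + f k := by
  obtain ⟨σ, s0, s1, s2⟩ := exists_perm_of_ne hij hik hjk
  rw [← Equiv.sum_comp σ, Fin.sum_univ_three, s0, s1, s2]

theorem IsFermatLoop.swap {W : WeightSystem} {i j k : Fin 3} {A B s t : ℕ}
    (F : W.IsFermatLoop i j k A B s t) : W.IsFermatLoop i k j A B t s :=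
  ⟨F.hik, F.hij, F.hjk.symm, F.hA, F.hB, F.ht, F.hs, F.hAB, F.hBA, F.pi_eq, F.pk_eq, F.pj_eq,
    F.h_eq, F.ai_eq, F.ak_eq, F.aj_eq, by rw [mul_comm]; exact F.st_eq, F.cyc⟩

theorem IsFermatLoop.isTransposePair_of_eq {W W' : WeightSystem} {i j k i' j' k' : Fin 3}
    {A B s t : ℕ} (F : W.IsFermatLoop i j k A B s t)
    (F' : W'.IsFermatLoop i' j' k' A B s t) (hh : W'.h = W.h) :
    IsTransposePair W W' ∧ IsSame W' W := by
  have hA := F.hA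
  obtain ⟨σ, s0, s1, s2⟩ := exists_perm_of_ne F.hjk F.hij.symm F.hik.symm
  obtain ⟨τ, t0, t1, t2⟩ := exists_perm_of_ne F'.hjk F'.hij.symm F'.hik.symm
  have hB : ((s : ℤ) + 1) * (t + 1) = B + 1 := by exact_mod_cast F.st_eq
  have hh2 : (W.h : ℤ) = A * B := by exact_mod_cast F.h_eq
  have ai : (W.a i : ℤ) = B := by exact_mod_cast F.ai_eq
  have aj : (W.a j : ℤ) = s * A := by exact_mod_cast F.aj_eq
  have ak : (W.a k : ℤ) = t * A := by exact_mod_cast F.ak_eq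
  have ai' : (W'.a i' : ℤ) = B := by exact_mod_cast F'.ai_eq
  have aj' : (W'.a j' : ℤ) = s * A := by exact_mod_cast F'.aj_eq
  have ak' : (W'.a k' : ℤ) = t * A := by exact_mod_cast F'.ak_eq
  refine ⟨⟨σ, τ, _, isTransposeBy_fermatLoop (A := (t : ℤ) + 1) (B := s + 1) (C := A)
    (by positivity) (by positivity) (by positivity) hh ?_ ?_ ?_ ?_ ?_ ?_ ?_⟩, hh, σ.symm.trans τ,
    fun l => ?_⟩
  · rw [hh2]
    linear_combination (-(A : ℤ)) * hB
  · rw [s0, aj]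
    ring
  · rw [s1, ak]
    ring
  · rw [s2, ai]
    linear_combination (-1 : ℤ) * hB
  · rw [t0, aj']
    ring
  · rw [t1, ak']
    ring
  · rw [t2, ai']
    linear_combination (-1 : ℤ) * hB
  · obtain ⟨l, rfl⟩ := σ.surjective l
    rw [Equiv.trans_apply, Equiv.symm_apply_apply]
    fin_cases l
    · change W'.a (τ 0) = W.a (σ 0)
      rw [s0, t0, F.aj_eq, F'.aj_eq]
    · change W'.a (τ 1) = W.a (σ 1)
      rw [s1, t1, F.ak_eq, F'.ak_eq]
    · change W'.a (τ 2) = W.a (σ 2)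
      rw [s2, t2, F.ai_eq, F'.ai_eq]

/-- The function `cyc` only determines `A` and `B`, hence `(s + 1) * (t + 1)`. Equality of `ε` adds
the sum `s + t`, so the unordered pair is determined, and the loop is its own transpose. -/
theorem IsFermatLoop.isTransposePair {W W' : WeightSystem} {i j k i' j' k' : Fin 3}
    {A B s t A' B' s' t' : ℕ} (F : W.IsFermatLoop i j k A B s t)
    (F' : W'.IsFermatLoop i' j' k' A' B' s' t') (D : CycDual W' W) (hh : W'.h = W.h)
    (hε : W'.eps = W.eps) : IsTransposePair W W' ∧ IsSame W' W := by
  have hA := F.hA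
  have hB := F.hB
  have h1 := eq_of_hasCyc_pair F.cyc F'.cyc F.card.1 F'.card.1 F'.card.2.1 D hh
    (Dvd.intro_left _ F.h_eq.symm)
  have h2 := eq_of_hasCyc_pair F'.cyc F.cyc F'.card.1 F.card.1 F.card.2.1 (D.symm hh) hh.symm
    (Dvd.intro_left _ F'.h_eq.symm)
  rw [F.h_eq] at h1
  have e1 : A' = A := Nat.eq_of_mul_eq_mul_right (by omega) h1
  subst e1
  rw [hh, F.h_eq] at h2
  have e2 : B' = B := Nat.eq_of_mul_eq_mul_left (by omega) h2
  subst e2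
  have e3 : (s' : ℤ) + t' = s + t := by
    rw [eps, eps, sum_eq_of_ne F'.hij F'.hik F'.hjk, sum_eq_of_ne F.hij F.hik F.hjk, F.ai_eq,
      F.aj_eq, F.ak_eq, F'.ai_eq, F'.aj_eq, F'.ak_eq, hh] at hε
    push_cast at hε
    have h3 : (A' : ℤ) * (s' + t') = A' * (s + t) := by linear_combination hε
    exact mul_left_cancel₀ (by positivity) h3
  have e4 : ((s : ℤ) + 1) * (t + 1) = (s' + 1) * (t' + 1) := by
    have := F.st_eq.trans F'.st_eq.symm
    exact_mod_cast this
  have e5 : ((s : ℤ) - s') * (s - t') = 0 := by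
    linear_combination (-(s : ℤ)) * e3 - (e4 + e3)
  rcases mul_eq_zero.mp e5 with h | h
  · have es : s' = s := by omega
    have et : t' = t := by omega
    subst es et
    exact F.isTransposePair_of_eq F' hh
  · have es : t' = s := by omega
    have et : s' = t := by omega
    subst es et
    exact F.isTransposePair_of_eq F'.swap hh

theorem not_isTypeIII_of_injective {W : WeightSystem} (H : ∀ i j, i ≠ j → W.p i ≠ W.p j) :
    ¬ W.IsTypeIII ∧ ¬ W.IsTypeV := by
  refine ⟨?_, fun h => H 0 1 (by decide) h.1⟩
  rintro ⟨σ, h, -⟩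
  exact H (σ 1) (σ 2) (by simp) h

theorem p_injective_of_ne {W : WeightSystem} {i j k : Fin 3} (hij : i ≠ j) (hik : i ≠ k)
    (hjk : j ≠ k) (h1 : W.p i ≠ W.p j) (h2 : W.p i ≠ W.p k) (h3 : W.p j ≠ W.p k) :
    ∀ a b, a ≠ b → W.p a ≠ W.p b := by
  have huniv : ∀ l, l = i ∨ l = j ∨ l = k := by
    clear h1 h2 h3
    revert hij hik hjk
    revert i j k
    decide
  intro a b hab
  rcases huniv a with rfl | rfl | rfl <;> rcases huniv b with rfl | rfl | rfl <;>
  first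
  | exact absurd rfl hab
  | assumption
  | exact Ne.symm (by assumption)

theorem IsFermatChain.not_isTypeIII {W : WeightSystem} {i j k : Fin 3} {A B C : ℕ}
    (F : W.IsFermatChain i j k A B C) : ¬ W.IsTypeIII ∧ ¬ W.IsTypeV := by
  have hA := F.hA
  have s1 := Nat.mul_le_mul_left A F.hB
  refine not_isTypeIII_of_injective (p_injective_of_ne F.hij F.hik F.hjk ?_ ?_ ?_)
  · rw [F.pi_eq, F.pj_eq]
    omega
  · rw [F.pi_eq, F.pk_eq]
    exact fun h => F.hAC (h ▸ dvd_rfl)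
  · rw [F.pj_eq, F.pk_eq]
    exact fun h => F.hCA (h ▸ dvd_rfl)

theorem IsChain.not_isTypeIII {W : WeightSystem} {i j k : Fin 3} {A B C : ℕ}
    (F : W.IsChain i j k A B C) : ¬ W.IsTypeIII ∧ ¬ W.IsTypeV := by
  have hA := F.hA
  have s1 := Nat.mul_le_mul_left A F.hB
  have s2 := Nat.mul_le_mul_left (A * B) F.hC
  refine not_isTypeIII_of_injective (p_injective_of_ne F.hij F.hik F.hjk ?_ ?_ ?_)
  · rw [F.pi_eq, F.pj_eq]
    omega
  · rw [F.pi_eq, F.pk_eq]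
    omega
  · rw [F.pj_eq, F.pk_eq]
    omega

theorem IsTypeV.p_eq {W : WeightSystem} (h : W.IsTypeV) (a b : Fin 3) : W.p a = W.p b := by
  have h3 : ∀ a, W.p a = W.p 0 := by
    intro a
    fin_cases a
    · rfl
    · exact h.1.symm
    · exact (h.1.trans h.2).symm
  rw [h3 a, h3 b]

theorem IsFermatLoop.not_isTypeV {W : WeightSystem} {i j k : Fin 3} {A B s t : ℕ}
    (F : W.IsFermatLoop i j k A B s t) : ¬ W.IsTypeV := by
  intro h
  have h3 := h.p_eq i j
  rw [F.pi_eq, F.pj_eq] at h3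
  exact F.hAB (h3 ▸ dvd_rfl)

/-- The hypothesis on `ε` is confined to type III so that it can be met from either duality: from
equality of spectra, or from the identity clause of M-duality. -/
theorem Balanced.classify {W W' : WeightSystem} (B : W.Balanced) (B' : W'.Balanced)
    (D : CycDual W' W) (hh : W'.h = W.h)
    (hε : W.IsTypeIII → W'.eps = W.eps) :
    (IsTransposePair W W' ∧ IsTransposePair W' W ∧ (W.IsTypeIII ∨ W'.IsTypeIII →
      IsSame W' W) ∧ ¬ W.IsTypeV ∧ ¬ W'.IsTypeV) ∨
    (((∃ i j k, W.IsHalfHalfOne i j k) ∨ W.IsTypeV) ∧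
      ((∃ i j k, W'.IsHalfHalfOne i j k) ∨ W'.IsTypeV)) := by
  rcases B.cases_of_cycDual B' D hh with ⟨F, F'⟩ | ⟨⟨_, _, _, _, _, _, F⟩, _, _, _, _, _, _, F'⟩ |
    ⟨⟨_, _, _, _, _, _, F⟩ | ⟨_, _, _, _, _, _, _, F⟩,
      ⟨_, _, _, _, _, _, F'⟩ | ⟨_, _, _, _, _, _, _, F'⟩⟩ | h
  · have h1 := not_isTypeIII_of_injective fun i j h => F.ne h
    have h2 := not_isTypeIII_of_injective fun i j h => F'.ne h
    exact .inl ⟨F.isTransposePair F' D hh, F'.isTransposePair F (D.symm hh) hh.symm,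
      fun h => absurd h (not_or.mpr ⟨h1.1, h2.1⟩), h1.2, h2.2⟩
  · have h1 := F.not_isTypeIII
    have h2 := F'.not_isTypeIII
    exact .inl ⟨F.isTransposePair F' D hh, F'.isTransposePair F (D.symm hh) hh.symm,
      fun h => absurd h (not_or.mpr ⟨h1.1, h2.1⟩), h1.2, h2.2⟩
  · have h1 := F.not_isTypeIII
    have h2 := F'.not_isTypeIII
    exact .inl ⟨F.isTransposePair F' D hh, F'.isTransposePair F (D.symm hh) hh.symm,
      fun h => absurd h (not_or.mpr ⟨h1.1, h2.1⟩), h1.2, h2.2⟩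
  · exact (F.not_isFermatLoop F' D hh).elim
  · exact (F'.not_isFermatLoop F (D.symm hh) hh.symm).elim
  · obtain ⟨h1, h2⟩ := F.isTransposePair F' D hh (hε F.isTypeIII)
    exact .inl ⟨h1, (F'.isTransposePair F (D.symm hh) hh.symm (hε F.isTypeIII).symm).1,
      fun _ => h2, F.not_isTypeV, F'.not_isTypeV⟩
  · exact .inr h

end WeightSystem

/-! ### Type V systems are loops -/

namespace WeightSystem
open Polynomial

theorem IsReduced.p_eq_h {W : WeightSystem} (hW : W.IsReduced) (hV : W.IsTypeV) (i : Fin 3) :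
    W.p i = W.h := by
  have h := hW.lcm_eq (show (0 : Fin 3) ≠ 1 by decide) (show (0 : Fin 3) ≠ 2 by decide)
    (by decide)
  rw [hV.1, ← hV.2, Nat.lcm_self, Nat.lcm_self] at h
  fin_cases i
  · exact hV.1.trans h
  · exact h
  · exact hV.2.symm.trans h

theorem coprime_of_p_eq_h {W : WeightSystem} {i : Fin 3} (h : W.p i = W.h) :
    Nat.Coprime W.h (W.a i) := by
  have h1 := W.coprime_p_v i
  have h2 := W.v_mul_h i
  rw [h, mul_comm] at h2
  rwa [h, Nat.eq_of_mul_eq_mul_left W.h_pos h2] at h1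

theorem p_eq_h_of_coprime {W : WeightSystem} {i : Fin 3} (h : Nat.Coprime W.h (W.a i)) :
    W.p i = W.h := by
  rw [p, h, Nat.div_one]

theorem v_eq_a_of_p_eq_h {W : WeightSystem} {i : Fin 3} (h : W.p i = W.h) : W.v i = W.a i := by
  have h2 := W.v_mul_h i
  rw [h, mul_comm] at h2
  exact Nat.eq_of_mul_eq_mul_left W.h_pos h2

/-- All `p i` equal `h`, so `v i = a i` and every gcd is `h`; clearing denominators says that `∏ (h
- a i) / a i`, the number of exponents, is `h - 1`. -/
theorem IsReduced.sum_cyc_eq_zero_iff {W : WeightSystem} (hW : W.IsReduced)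
    (hp : ∀ i, W.p i = W.h) : ∑ n ∈ W.h.divisors, W.cyc n = 0 ↔
    ((W.h : ℤ) - W.a 0) * (W.h - W.a 1) * (W.h - W.a 2) =
      (W.h - 1) * (W.a 0 * W.a 1 * W.a 2) := by
  have a0 : (W.a 0 : ℚ) ≠ 0 := by exact_mod_cast (W.a_pos 0).ne'
  have a1 : (W.a 1 : ℚ) ≠ 0 := by exact_mod_cast (W.a_pos 1).ne'
  have a2 : (W.a 2 : ℚ) ≠ 0 := by exact_mod_cast (W.a_pos 2).ne'
  have hh : (W.h : ℚ) ≠ 0 := by exact_mod_cast W.h_pos.ne'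
  have key : (∑ n ∈ W.h.divisors, W.cyc n) * (W.a 0 * W.a 1 * W.a 2 * W.h) =
      ((W.h : ℚ) - W.a 0) * (W.h - W.a 1) * (W.h - W.a 2) -
      (W.h - 1) * (W.a 0 * W.a 1 * W.a 2) := by
    rw [hW.sum_cyc_eq_of (show (0 : Fin 3) ≠ 1 by decide) (show (0 : Fin 3) ≠ 2 by decide)
      (by decide)]
    simp only [v_eq_a_of_p_eq_h (hp _), hp, Nat.gcd_self]
    field_simp
    ring
  have hne : (W.a 0 * W.a 1 * W.a 2 * W.h : ℚ) ≠ 0 := by positivity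
  rw [← mul_left_inj' hne, key, zero_mul, sub_eq_zero]
  exact_mod_cast Iff.rfl

theorem IsReduced.hasCyc_of_sum_eq_zero {W : WeightSystem} (hW : W.IsReduced)
    (hp : ∀ i, W.p i = W.h) (h0 : ∑ n ∈ W.h.divisors, W.cyc n = 0) : W.HasCyc {W.h} {1} := by
  intro n
  have e1 := hW.cyc_eq_of (show (0 : Fin 3) ≠ 1 by decide) (show (0 : Fin 3) ≠ 2 by decide)
      (by decide) n
  rw [hW.sum_cyc_eq_of (show (0 : Fin 3) ≠ 1 by decide) (show (0 : Fin 3) ≠ 2 by decide)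
      (by decide)] at h0
  simp only [hp, Nat.lcm_self] at e1 h0
  rw [e1]
  simp only [Finset.mem_singleton, eq_comm (a := n)]
  split_ifs <;> linarith

/-- Regularity at `d = a i` supplies a `j` with `a i ∣ h - a j`, and coprimality to `h` excludes `j
= i` when `a i > 1`. -/
theorem CountRegular.exists_dvd {W : WeightSystem} (hW : W.CountRegular)
    (hc : ∀ i, Nat.Coprime W.h (W.a i)) (i : Fin 3) :
    ∃ j, j ≠ i ∧ ∃ k : ℕ, W.h = W.a i * k + W.a j := by
  obtain ⟨j, hj, h⟩ : ∃ j, j ≠ i ∧ W.a i ∣ W.h - W.a j := by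
    rcases Nat.lt_or_ge 1 (W.a i) with h1 | h1
    · have h2 : 0 < (Finset.univ.filter fun l => W.a i ∣ W.a l).card :=
        Finset.card_pos.mpr ⟨i, by simp⟩
      obtain ⟨j, hj⟩ := Finset.card_pos.mp (h2.trans_le (hW _ h1))
      simp only [Finset.mem_filter, Finset.mem_univ, true_and] at hj
      refine ⟨j, ?_, hj⟩
      rintro rfl
      have h6 := (Nat.dvd_sub_iff_left (W.a_lt_h j).le dvd_rfl).mp hj
      exact h1.ne' (Nat.eq_one_of_dvd_coprimes (hc j) h6 dvd_rfl)
    · have h2 := W.a_pos i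
      obtain ⟨j, _, hj, -⟩ := exists_compl_pair i
      exact ⟨j, hj, by rw [show W.a i = 1 by omega]; exact one_dvd _⟩
  obtain ⟨k, hk⟩ := h
  have := W.a_lt_h j
  exact ⟨j, hj, k, by omega⟩

/-- The weights of `x ^ k z + x y ^ l + y z ^ m`. -/
def IsLoop (W : WeightSystem) (k l m : ℕ) : Prop :=
  ∃ σ : Equiv.Perm (Fin 3), ∀ i, (W.a (σ i) : ℤ) =
    ![(l : ℤ) * m - l + 1, (m : ℤ) * k - m + 1, (k : ℤ) * l - k + 1] i

/-- Inserting the three equations into the product identity gives `k * l * m = h - 1`, the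
determinant of the linear system less one; the weights are then its solution. -/
theorem isLoop_of_eq {W : WeightSystem} {i0 i1 i2 : Fin 3} (h01 : i0 ≠ i1) (h02 : i0 ≠ i2)
    (h12 : i1 ≠ i2) {k l m : ℕ} (e0 : W.h = W.a i0 * k + W.a i2)
    (e1 : W.h = W.a i1 * l + W.a i0) (e2 : W.h = W.a i2 * m + W.a i1)
    (hprod : ((W.h : ℤ) - W.a 0) * (W.h - W.a 1) * (W.h - W.a 2) =
      (W.h - 1) * (W.a 0 * W.a 1 * W.a 2)) : W.h = k * l * m + 1 ∧ W.IsLoop k l m := by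
  obtain ⟨σ, rfl, rfl, rfl⟩ := exists_perm_of_ne h01 h02 h12
  have hp1 : ∏ l, ((W.h : ℤ) - W.a (σ l)) = (W.h - 1) * ∏ l, (W.a (σ l) : ℤ) := by
    rw [Equiv.prod_comp σ fun l => (W.h : ℤ) - W.a l, Equiv.prod_comp σ fun l => (W.a l : ℤ),
      Fin.prod_univ_three, Fin.prod_univ_three, hprod]
  rw [Fin.prod_univ_three, Fin.prod_univ_three] at hp1
  have f0 : (W.h : ℤ) = W.a (σ 0) * k + W.a (σ 2) := by exact_mod_cast e0
  have f1 : (W.h : ℤ) = W.a (σ 1) * l + W.a (σ 0) := by exact_mod_cast e1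
  have f2 : (W.h : ℤ) = W.a (σ 2) * m + W.a (σ 1) := by exact_mod_cast e2
  have a0 : (W.a (σ 0) : ℤ) ≠ 0 := by exact_mod_cast (W.a_pos _).ne'
  have a1 : (W.a (σ 1) : ℤ) ≠ 0 := by exact_mod_cast (W.a_pos _).ne'
  have a2 : (W.a (σ 2) : ℤ) ≠ 0 := by exact_mod_cast (W.a_pos _).ne'
  have hh0 : (W.h : ℤ) ≠ 0 := by exact_mod_cast W.h_pos.ne'
  rw [show (W.h : ℤ) - W.a (σ 0) = W.a (σ 1) * l by linarith,
    show (W.h : ℤ) - W.a (σ 1) = W.a (σ 2) * m by linarith,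
    show (W.h : ℤ) - W.a (σ 2) = W.a (σ 0) * k by linarith] at hp1
  have hh : (W.h : ℤ) = k * l * m + 1 := by
    have h3 : ((W.a (σ 0) : ℤ) * W.a (σ 1) * W.a (σ 2)) * (k * l * m) =
        (W.a (σ 0) * W.a (σ 1) * W.a (σ 2)) * (W.h - 1) := by linear_combination hp1
    have := mul_left_cancel₀ (by positivity) h3
    linarith
  refine ⟨by exact_mod_cast hh, σ, fun i => ?_⟩
  fin_cases i
  · change (W.a (σ 0) : ℤ) = l * m - l + 1
    refine mul_left_cancel₀ hh0 ?_
    linear_combination (W.a (σ 0) : ℤ) * hh - l * m * f0 - f1 + l * f2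
  · change (W.a (σ 1) : ℤ) = m * k - m + 1
    refine mul_left_cancel₀ hh0 ?_
    linear_combination (W.a (σ 1) : ℤ) * hh - m * k * f1 - f2 + m * f0
  · change (W.a (σ 2) : ℤ) = k * l - k + 1
    refine mul_left_cancel₀ hh0 ?_
    linear_combination (W.a (σ 2) : ℤ) * hh - k * l * f2 - f0 + k * f1

/-- For a two-cycle the product identity reduces to `s * t * (h - a) = (h - 1) * a` with `a` the
third weight. Coprimality gives `h - a ∣ h - 1`, and `h - a ≥ h / 2` leaves `a = 1` and `s = t = 1`.
Then `h` is twice a weight coprime to it. -/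
theorem h_eq_two_of_tail {W : WeightSystem} (hc : ∀ i, Nat.Coprime W.h (W.a i)) {i j l : Fin 3}
    (hij : i ≠ j) (hil : i ≠ l) (hjl : j ≠ l) {s t : ℕ} (e0 : W.h = W.a i * s + W.a j)
    (e1 : W.h = W.a j * t + W.a i)
    (hprod : ((W.h : ℤ) - W.a 0) * (W.h - W.a 1) * (W.h - W.a 2) =
      (W.h - 1) * (W.a 0 * W.a 1 * W.a 2)) : W.h = 2 := by
  obtain ⟨σ, rfl, rfl, rfl⟩ := exists_perm_of_ne hij hil hjl
  have hp1 : ∏ l, ((W.h : ℤ) - W.a (σ l)) = (W.h - 1) * ∏ l, (W.a (σ l) : ℤ) := by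
    rw [Equiv.prod_comp σ fun l => (W.h : ℤ) - W.a l, Equiv.prod_comp σ fun l => (W.a l : ℤ),
      Fin.prod_univ_three, Fin.prod_univ_three, hprod]
  rw [Fin.prod_univ_three, Fin.prod_univ_three] at hp1
  have f0 : (W.h : ℤ) = W.a (σ 0) * s + W.a (σ 1) := by exact_mod_cast e0
  have f1 : (W.h : ℤ) = W.a (σ 1) * t + W.a (σ 0) := by exact_mod_cast e1
  have a0 : (W.a (σ 0) : ℤ) ≠ 0 := by exact_mod_cast (W.a_pos _).ne'
  have a1 : (W.a (σ 1) : ℤ) ≠ 0 := by exact_mod_cast (W.a_pos _).ne'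
  have c2 := W.two_mul_a_le (σ 2)
  have c1 := W.two_mul_a_le (σ 1)
  have c0 := W.two_mul_a_le (σ 0)
  have p2 := W.a_pos (σ 2)
  have p1 := W.a_pos (σ 1)
  have hge := W.two_le_h
  rw [show (W.h : ℤ) - W.a (σ 0) = W.a (σ 1) * t by linarith,
    show (W.h : ℤ) - W.a (σ 1) = W.a (σ 0) * s by linarith] at hp1
  have h3 : (s : ℤ) * t * (W.h - W.a (σ 2)) = (W.h - 1) * W.a (σ 2) := by
    have h3 : ((W.a (σ 0) : ℤ) * W.a (σ 1)) * (s * t * (W.h - W.a (σ 2))) =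
        (W.a (σ 0) * W.a (σ 1)) * ((W.h - 1) * W.a (σ 2)) := by linear_combination hp1
    exact mul_left_cancel₀ (by positivity) h3
  obtain ⟨b, hb⟩ := Nat.exists_eq_add_of_le (W.a_lt_h (σ 2)).le
  have h4 : s * t * b = (W.h - 1) * W.a (σ 2) := by
    zify [W.h_pos]
    rw [← h3, hb]
    push_cast
    ring
  have h5 : Nat.Coprime b (W.a (σ 2)) := by
    have := hc (σ 2)
    rw [hb] at this
    simpa using this
  have h6 : b ∣ W.h - 1 := h5.dvd_of_dvd_mul_right ⟨s * t, by rw [← h4]; ring⟩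
  obtain ⟨q, hq⟩ := h6
  have hq1 : q = 1 := by
    have : q < 2 := by
      by_contra! h
      have := Nat.mul_le_mul_left b h
      omega
    have : q ≠ 0 := by
      rintro rfl
      omega
    omega
  rw [hq1, mul_one] at hq
  have ha2 : W.a (σ 2) = 1 := by omega
  have hst : s * t = 1 := by
    rw [ha2, hq, mul_comm] at h4
    exact Nat.eq_of_mul_eq_mul_left (by omega) h4
  have hs := Nat.eq_one_of_mul_eq_one_right hst
  rw [hs, mul_one] at e0
  have h7 := hc (σ 0)
  rw [show W.h = W.a (σ 0) * 2 by omega, Nat.Coprime, Nat.gcd_comm, Nat.gcd_mul_right_right] at h7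
  omega

theorem isLoop_of_h_eq_two {W : WeightSystem} (h : W.h = 2) : W.h = 1 * 1 * 1 + 1 ∧
    W.IsLoop 1 1 1 := by
  refine ⟨h, 1, fun i => ?_⟩
  have h1 := W.two_mul_a_le i
  have h2 := W.a_pos i
  have h3 : W.a i = 1 := by omega
  fin_cases i <;> simpa using h3

/-- A self-map of three points without fixed points is a three-cycle or contains a two-cycle. -/
theorem Balanced.exists_isLoop {W : WeightSystem} (B : W.Balanced) (hV : W.IsTypeV) :
    ∃ k l m : ℕ, W.h = k * l * m + 1 ∧ W.IsLoop k l m := by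
  have hp := B.red.p_eq_h hV
  have hc := fun i => coprime_of_p_eq_h (hp i)
  have hprod := (B.red.sum_cyc_eq_zero_iff hp).mp B.sum_cyc
  choose τ hτ k hk using B.reg.exists_dvd hc
  have e0 := hk 0
  have e1 := hk 1
  have e2 := hk 2
  have t0 := hτ 0
  have t1 := hτ 1
  have t2 := hτ 2
  generalize τ 0 = x at *
  generalize τ 1 = y at *
  generalize τ 2 = z at *
  have h01 : (0 : Fin 3) ≠ 1 := by decide
  have h02 : (0 : Fin 3) ≠ 2 := by decide
  have h12 : (1 : Fin 3) ≠ 2 := by decide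
  fin_cases x <;> fin_cases y <;> fin_cases z <;> first
  | exact absurd rfl t0
  | exact absurd rfl t1
  | exact absurd rfl t2
  | exact ⟨_, _, _, isLoop_of_eq h01 h02 h12 e0 e1 e2 hprod⟩
  | exact ⟨_, _, _, isLoop_of_eq h02 h01 h12.symm e0 e2 e1 hprod⟩
  | exact ⟨_, _, _, isLoop_of_h_eq_two (h_eq_two_of_tail hc h01 h02 h12 e0 e1 hprod)⟩
  | exact ⟨_, _, _, isLoop_of_h_eq_two (h_eq_two_of_tail hc h02 h01 h12.symm e0 e2 hprod)⟩
  | exact ⟨_, _, _, isLoop_of_h_eq_two (h_eq_two_of_tail hc h12 h01.symm h02.symm e1 e2 hprod)⟩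

end WeightSystem

/-! ### Transposed loops, and recovery of the weights from the spectrum -/

namespace WeightSystem
open Polynomial

theorem isLoop_swap {W : WeightSystem} {k l m : ℕ} (H : W.IsLoop k l m) :
    ∃ σ : Equiv.Perm (Fin 3), ∀ i, (W.a (σ i) : ℤ) =
      ![(m : ℤ) * l - l + 1, (l : ℤ) * k - k + 1, (k : ℤ) * m - m + 1] i := by
  obtain ⟨σ, hσ⟩ := H
  refine ⟨(Equiv.swap 1 2).trans σ, fun i => ?_⟩
  rw [Equiv.trans_apply, hσ]
  fin_cases i
  · change (l : ℤ) * m - l + 1 = m * l - l + 1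
    ring
  · change (k : ℤ) * l - k + 1 = l * k - k + 1
    ring
  · change (m : ℤ) * k - m + 1 = k * m - m + 1
    ring

theorem isLoop_of_swap {W : WeightSystem} {k l m : ℕ}
    (H : ∃ σ : Equiv.Perm (Fin 3), ∀ i, (W.a (σ i) : ℤ) =
      ![(l : ℤ) * m - m + 1, (m : ℤ) * k - k + 1, (k : ℤ) * l - l + 1] i) :
    W.IsLoop k m l := by
  obtain ⟨σ, hσ⟩ := H
  refine ⟨(Equiv.swap 1 2).trans σ, fun i => ?_⟩
  rw [Equiv.trans_apply, hσ]
  fin_cases i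
  · change (l : ℤ) * m - m + 1 = m * l - m + 1
    ring
  · change (k : ℤ) * l - l + 1 = l * k - l + 1
    ring
  · change (m : ℤ) * k - k + 1 = k * m - k + 1
    ring

theorem isLoopPair_iff {W W' : WeightSystem} : IsLoopPair W' W ↔ ∃ k l m : ℕ,
    W.h = k * l * m + 1 ∧ W'.h = k * l * m + 1 ∧ W.IsLoop k m l ∧ W'.IsLoop k l m :=
  ⟨fun ⟨k, l, m, h1, h2, h3, h4⟩ => ⟨k, l, m, h1, h2, isLoop_of_swap h3, h4⟩,
    fun ⟨k, l, m, h1, h2, h3, h4⟩ => ⟨k, l, m, h1, h2, isLoop_swap h3, h4⟩⟩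

theorem IsLoop.isTransposePair {W W' : WeightSystem} {k l m : ℕ} (L : W.IsLoop k m l)
    (L' : W'.IsLoop k l m) (h : W.h = k * l * m + 1) (h' : W'.h = k * l * m + 1) :
    IsTransposePair W W' := by
  have h0 : k * l * m ≠ 0 := by
    have := W.two_le_h
    omega
  obtain ⟨hkl, hm⟩ := Nat.mul_ne_zero_iff.mp h0
  obtain ⟨hk, hl⟩ := Nat.mul_ne_zero_iff.mp hkl
  obtain ⟨σ, hσ⟩ := L
  obtain ⟨τ, hτ⟩ := isLoop_swap L'
  exact ⟨σ, τ, _, isTransposeBy_loop (k := k) (l := m) (m := l) (by positivity) (by positivity)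
    (by positivity) (h'.trans h.symm) (by rw [h]; push_cast; ring) (hσ 0) (hσ 1) (hσ 2) (hτ 0)
    (hτ 1) (hτ 2)⟩

theorem IsLoopPair.isTransposePair {W W' : WeightSystem} (H : IsLoopPair W' W) :
    IsTransposePair W W' ∧ IsTransposePair W' W := by
  obtain ⟨k, l, m, h1, h2, h3, h4⟩ := isLoopPair_iff.mp H
  rw [mul_right_comm] at h1 h2
  refine ⟨IsLoop.isTransposePair h3 h4 ?_ ?_, IsLoop.isTransposePair h4 h3 h2 h1⟩ <;>
  rwa [mul_right_comm]

theorem IsLoop.exists_perm {W : WeightSystem} {k l m : ℕ} (L : W.IsLoop k l m)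
    (h : W.h = k * l * m + 1) : ∃ σ : Equiv.Perm (Fin 3), W.h = W.a (σ 0) * k + W.a (σ 2) ∧
      W.h = W.a (σ 1) * l + W.a (σ 0) ∧ W.h = W.a (σ 2) * m + W.a (σ 1) := by
  obtain ⟨σ, hσ⟩ := L
  have h0 : (W.a (σ 0) : ℤ) = (l : ℤ) * m - l + 1 := hσ 0
  have h1 : (W.a (σ 1) : ℤ) = (m : ℤ) * k - m + 1 := hσ 1
  have h2 : (W.a (σ 2) : ℤ) = (k : ℤ) * l - k + 1 := hσ 2
  have hh : (W.h : ℤ) = k * l * m + 1 := by exact_mod_cast h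
  refine ⟨σ, ?_, ?_, ?_⟩
  · zify
    rw [hh, h0, h2]
    ring
  · zify
    rw [hh, h0, h1]
    ring
  · zify
    rw [hh, h1, h2]
    ring

theorem countRegular_of_perm {W : WeightSystem} (π : Equiv.Perm (Fin 3))
    (H : ∀ i, W.a i ∣ W.h - W.a (π i)) : W.CountRegular := by
  intro d _
  refine Finset.card_le_card_of_injOn π ?_ π.injective.injOn
  intro i hi
  simp only [Finset.coe_filter, Finset.mem_univ, true_and, Set.mem_ofPred_eq] at hi ⊢
  exact hi.trans (H i)

theorem IsLoop.countRegular {W : WeightSystem} {k l m : ℕ} (L : W.IsLoop k l m)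
    (h : W.h = k * l * m + 1) : W.CountRegular := by
  obtain ⟨σ, h0, h1, h2⟩ := L.exists_perm h
  refine countRegular_of_perm (σ.symm.trans ((finRotate 3).symm.trans σ)) fun i => ?_
  obtain ⟨i, rfl⟩ := σ.surjective i
  rw [Equiv.trans_apply, Equiv.symm_apply_apply, Equiv.trans_apply]
  fin_cases i
  · exact ⟨k, Nat.sub_eq_of_eq_add h0⟩
  · exact ⟨l, Nat.sub_eq_of_eq_add h1⟩
  · exact ⟨m, Nat.sub_eq_of_eq_add h2⟩

/-- A common divisor of `h` and one weight passes around the loop to all weights. -/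
theorem IsLoop.coprime {W : WeightSystem} {k l m : ℕ} (L : W.IsLoop k l m)
    (h : W.h = k * l * m + 1) (hred : W.IsReduced) (i : Fin 3) : Nat.Coprime W.h (W.a i) := by
  obtain ⟨σ, h0, h1, h2⟩ := L.exists_perm h
  obtain ⟨i, rfl⟩ := σ.surjective i
  refine hred.eq_one_of_dvd (fun j => ?_) (Nat.gcd_dvd_left _ _)
  obtain ⟨j, rfl⟩ := σ.surjective j
  have d0 : ∀ q, q ∣ W.h → q ∣ W.a (σ 0) → q ∣ W.a (σ 2) := fun q g1 g2 =>
    (Nat.dvd_add_right (g2.mul_right k)).mp (h0 ▸ g1)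
  have d1 : ∀ q, q ∣ W.h → q ∣ W.a (σ 1) → q ∣ W.a (σ 0) := fun q g1 g2 =>
    (Nat.dvd_add_right (g2.mul_right l)).mp (h1 ▸ g1)
  have d2 : ∀ q, q ∣ W.h → q ∣ W.a (σ 2) → q ∣ W.a (σ 1) := fun q g1 g2 =>
    (Nat.dvd_add_right (g2.mul_right m)).mp (h2 ▸ g1)
  have g1 := Nat.gcd_dvd_left W.h (W.a (σ i))
  have g2 := Nat.gcd_dvd_right W.h (W.a (σ i))
  generalize Nat.gcd W.h (W.a (σ i)) = q at *
  have a0 : q ∣ W.a (σ 0) := by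
    fin_cases i
    · exact g2
    · exact d1 q g1 g2
    · exact d1 q g1 (d2 q g1 g2)
  fin_cases j
  · exact a0
  · exact d2 q g1 (d0 q g1 a0)
  · exact d0 q g1 a0

theorem IsLoop.sum_cyc {W : WeightSystem} {k l m : ℕ} (L : W.IsLoop k l m)
    (h : W.h = k * l * m + 1) (hred : W.IsReduced) : ∑ n ∈ W.h.divisors, W.cyc n = 0 := by
  rw [hred.sum_cyc_eq_zero_iff fun i => p_eq_h_of_coprime (L.coprime h hred i)]
  obtain ⟨σ, h0, h1, h2⟩ := L.exists_perm h
  have hp1 : ∏ l, ((W.h : ℤ) - W.a (σ l)) = (W.h - 1) * ∏ l, (W.a (σ l) : ℤ) := by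
    rw [Fin.prod_univ_three, Fin.prod_univ_three]
    have f0 : (W.h : ℤ) = W.a (σ 0) * k + W.a (σ 2) := by exact_mod_cast h0
    have f1 : (W.h : ℤ) = W.a (σ 1) * l + W.a (σ 0) := by exact_mod_cast h1
    have f2 : (W.h : ℤ) = W.a (σ 2) * m + W.a (σ 1) := by exact_mod_cast h2
    have hh : (W.h : ℤ) = k * l * m + 1 := by exact_mod_cast h
    rw [show (W.h : ℤ) - W.a (σ 0) = W.a (σ 1) * l by linarith,
      show (W.h : ℤ) - W.a (σ 1) = W.a (σ 2) * m by linarith,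
      show (W.h : ℤ) - W.a (σ 2) = W.a (σ 0) * k by linarith, hh]
    ring
  rw [Equiv.prod_comp σ fun l => (W.h : ℤ) - W.a l, Equiv.prod_comp σ fun l => (W.a l : ℤ),
    Fin.prod_univ_three, Fin.prod_univ_three] at hp1
  exact hp1

theorem IsLoop.eps_eq {W : WeightSystem} {k l m : ℕ} (L : W.IsLoop k l m)
    (h : W.h = k * l * m + 1) : W.eps = 1 - ((k : ℤ) - 1) * (l - 1) * (m - 1) := by
  obtain ⟨σ, hσ⟩ := L
  have h0 : (W.a (σ 0) : ℤ) = (l : ℤ) * m - l + 1 := hσ 0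
  have h1 : (W.a (σ 1) : ℤ) = (m : ℤ) * k - m + 1 := hσ 1
  have h2 : (W.a (σ 2) : ℤ) = (k : ℤ) * l - k + 1 := hσ 2
  rw [eps, ← Equiv.sum_comp σ, Fin.sum_univ_three, h0, h1, h2, h]
  push_cast
  ring

/-- The weight system of `x ^ k z + x y ^ l + y z ^ m`. -/
def loop (k l m : ℕ) (hk : 2 ≤ k) (hl : 2 ≤ l) (hm : 2 ≤ m) : WeightSystem where
  a := ![l * (m - 1) + 1, m * (k - 1) + 1, k * (l - 1) + 1]
  h := k * l * m + 1
  a_pos i := by fin_cases i <;> exact Nat.succ_pos _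
  h_pos := Nat.succ_pos _
  two_mul_a_le i := by
    have key : ∀ k l m : ℕ, 2 ≤ k → 2 ≤ l → 2 ≤ m → 2 * (l * (m - 1) + 1) ≤ k * l * m + 1 := by
      intro k l m hk hl hm
      obtain ⟨m, rfl⟩ := Nat.exists_eq_add_of_le' (show 1 ≤ m by omega)
      rw [Nat.add_sub_cancel]
      nlinarith [Nat.mul_le_mul_right (l * (m + 1)) hk]
    fin_cases i
    · exact key k l m hk hl hm
    · exact (key l m k hl hm hk).trans_eq (by ring)
    · exact (key m k l hm hk hl).trans_eq (by ring)

theorem isLoop_loop (k l m : ℕ) (hk : 2 ≤ k) (hl : 2 ≤ l) (hm : 2 ≤ m) :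
    (loop k l m hk hl hm).IsLoop k l m := by
  have key : ∀ l m : ℕ, 2 ≤ m → ((l * (m - 1) + 1 : ℕ) : ℤ) = l * m - l + 1 := by
    intro l m hm
    rw [Nat.cast_add, Nat.cast_mul, Nat.cast_sub (by omega)]
    push_cast
    ring
  refine ⟨1, fun i => ?_⟩
  fin_cases i
  · exact key l m hm
  · exact key m k hk
  · exact key k l hl

theorem card_fiber_eq_of_prod_eq {ι : Type*} [Fintype ι] {n n' : ι → ℕ} (hn : ∀ i, n i ≠ 0)
    (hn' : ∀ i, n' i ≠ 0) (H : ∏ i, (X ^ n i - 1 : ℤ[X]) = ∏ i, (X ^ n' i - 1)) (j : ℕ) :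
    (Finset.univ.filter fun i => n i = j).card = (Finset.univ.filter fun i => n' i = j).card := by
  classical
  have hz : ∀ n : ι → ℕ, ∏ i, ((RatFunc.X : RatFunc ℂ) ^ n i - 1) =
      ∏ b ∈ Finset.univ.image n, ((RatFunc.X : RatFunc ℂ) ^ b - 1) ^
        ((Finset.univ.filter fun i => n i = b).card : ℤ) := by
    intro n
    rw [Finset.prod_comp (fun b => (RatFunc.X : RatFunc ℂ) ^ b - 1) n]
    simp only [zpow_natCast]
  have hm : ∀ n : ι → ℕ, algebraMap ℂ[X] (RatFunc ℂ)
      ((∏ i, (X ^ n i - 1 : ℤ[X])).map (Int.castRingHom ℂ)) =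
        ∏ i, ((RatFunc.X : RatFunc ℂ) ^ n i - 1) := by
    intro n
    rw [Polynomial.map_prod, map_prod]
    simp
  have h1 : ∏ i, ((RatFunc.X : RatFunc ℂ) ^ n i - 1) = ∏ i, (RatFunc.X ^ n' i - 1) := by
    rw [← hm, ← hm, H]
  rw [hz, hz, prod_zpow_eq_iff (by simpa using hn) (by simpa using hn')] at h1
  have h2 := h1 j
  have h3 : ∀ n : ι → ℕ, (if j ∈ Finset.univ.image n then
      ((Finset.univ.filter fun i => n i = j).card : ℤ) else 0) =
        (Finset.univ.filter fun i => n i = j).card := by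
    intro n
    split_ifs with h
    · rfl
    · symm
      rw [Nat.cast_eq_zero, Finset.card_eq_zero, Finset.filter_eq_empty_iff]
      exact fun i _ hi => h (Finset.mem_image.mpr ⟨i, Finset.mem_univ _, hi⟩)
  rw [h3, h3] at h2
  exact_mod_cast h2

theorem card_filter_sumElim {ι κ : Type*} [Fintype ι] [Fintype κ] (f : ι → ℕ) (g : κ → ℕ) (j : ℕ) :
    (Finset.univ.filter fun i => Sum.elim f g i = j).card =
      (Finset.univ.filter fun i => f i = j).card + (Finset.univ.filter fun i => g i = j).card := by
  rw [Finset.card_filter, Fintype.sum_sum_type, Finset.card_filter, Finset.card_filter]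
  rfl

/-- Cross-multiplying the two expressions for `jac` shows that the `a i` with the `h - a' i` form
the same multiset as the `a' i` with the `h - a i`. The parts below `h / 2` are the weights. -/
theorem exists_perm_of_spec_eq {W W' : WeightSystem} (hW : W.CountRegular) (hW' : W'.CountRegular)
    (hh : W'.h = W.h) (hε : W'.eps = W.eps) (hs : ∀ m, W.spec m = W'.spec m)
    (h2 : ∀ i, 2 * W.a i ≠ W.h) (h2' : ∀ i, 2 * W'.a i ≠ W.h) :
    ∃ σ : Equiv.Perm (Fin 3), ∀ i, W'.a (σ i) = W.a i := by
  have hjac : W.jac Finset.univ = W'.jac Finset.univ := by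
    ext n
    have h3 := hs (n + W.eps)
    rw [spec, spec, hε, if_pos (by omega), if_pos (by omega)] at h3
    simpa using h3
  have e1 := hW.hasJac_univ.mul_jac
  have e2 := hW'.hasJac_univ.mul_jac
  have hprod : ∏ i : Fin 3 ⊕ Fin 3, (X ^ Sum.elim W.a (fun i => W'.h - W'.a i) i - 1 : ℤ[X]) =
      ∏ i : Fin 3 ⊕ Fin 3, (X ^ Sum.elim W'.a (fun i => W.h - W.a i) i - 1) := by
    rw [Fintype.prod_sum_type, Fintype.prod_sum_type]
    simp only [Sum.elim_inl, Sum.elim_inr]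
    rw [← e1, ← e2, hjac]
    ring
  have hcard := card_fiber_eq_of_prod_eq
    (by
      rintro (i | i)
      · exact (W.a_pos i).ne'
      · have := W'.a_lt_h i
        simp only [Sum.elim_inr]
        omega)
    (by
      rintro (i | i)
      · exact (W'.a_pos i).ne'
      · have := W.a_lt_h i
        simp only [Sum.elim_inr]
        omega) hprod
  have key : ∀ j, (Finset.univ.filter fun i => W.a i = j).card =
      (Finset.univ.filter fun i => W'.a i = j).card := by
    intro j
    have b1 := fun i => W.two_mul_a_le i
    have b2 := fun i => W'.two_mul_a_le i
    by_cases hj : 2 * j < W.h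
    · have h3 := hcard j
      rw [card_filter_sumElim, card_filter_sumElim,
        Finset.filter_false_of_mem (p := fun i => W'.h - W'.a i = j)
          (fun i _ => by have := b2 i; omega),
        Finset.filter_false_of_mem (p := fun i => W.h - W.a i = j)
          (fun i _ => by have := b1 i; omega)] at h3
      simpa using h3
    · rw [Finset.filter_false_of_mem (fun i _ => by have := b1 i; have := h2 i; omega),
        Finset.filter_false_of_mem (fun i _ => by have := b2 i; have := h2' i; omega)]
  have e : ∀ c, {i // W.a i = c} ≃ {i // W'.a i = c} := fun c =>
    Fintype.equivOfCardEq (by rw [Fintype.card_subtype, Fintype.card_subtype, key])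
  exact ⟨Equiv.ofFiberEquiv e, fun i => Equiv.ofFiberEquiv_map e i⟩

theorem two_le_of_h_eq {W : WeightSystem} {i j : Fin 3} {k : ℕ} (hc : Nat.Coprime W.h (W.a i))
    (h : W.h = W.a i * k + W.a j) (h2 : W.h ≠ 2) : 2 ≤ k := by
  have h3 := W.two_mul_a_le i
  have h4 := W.two_mul_a_le j
  have h5 := W.h_pos
  by_contra! hk
  obtain rfl | rfl : k = 0 ∨ k = 1 := by omega
  · omega
  · rw [show W.h = W.a i * 2 by omega, Nat.Coprime, Nat.gcd_comm, Nat.gcd_mul_right_right] at hc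
    omega

theorem two_mul_a_ne_h {W : WeightSystem} {i : Fin 3} (hc : Nat.Coprime W.h (W.a i))
    (h2 : W.h ≠ 2) : 2 * W.a i ≠ W.h := by
  intro h
  rw [show W.h = W.a i * 2 by omega, Nat.Coprime, Nat.gcd_comm, Nat.gcd_mul_right_right] at hc
  omega

theorem cycDual_of_hasCyc {W W' : WeightSystem} (H : W.HasCyc {W.h} {1})
    (H' : W'.HasCyc {W'.h} {1}) (hh : W'.h = W.h) : CycDual W' W := by
  intro n
  rw [H', H, hh]
  simp only [Finset.mem_singleton]
  by_cases hn : n ∣ W.h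
  · have h1 : W.h / n = W.h ↔ n = 1 := by
      rw [Nat.div_eq_self]
      simp [W.h_pos.ne']
    have h2 : W.h / n = 1 ↔ n = W.h := by
      rw [Nat.div_eq_iff_eq_mul_left (Nat.pos_of_dvd_of_pos hn W.h_pos) hn, one_mul, eq_comm]
    rw [if_pos hn]
    simp only [h1, h2]
    ring
  · rw [if_neg hn, if_neg fun h : n = W.h => hn (h ▸ dvd_rfl), if_neg fun h : n = 1 => hn (h ▸ one_dvd _),
      sub_zero]

/-- Let `T` be the loop transposed to `W'`. The transpose argument gives `T` the spectrum of the
orbifold of `W'`, which is also that of `W`, so `T` and `W` have the same weights. -/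
theorem Balanced.isLoopPair {W W' : WeightSystem} (B : W.Balanced) (B' : W'.Balanced)
    (hV : W.IsTypeV) (hV' : W'.IsTypeV) (hh : W'.h = W.h) (hε : W'.eps = W.eps)
    (hg : Int.gcd W.eps W.h = 1) (hs : ∀ m, W.spec m = W'.dspec m) : IsLoopPair W' W := by
  obtain ⟨k, l, m, h, L⟩ := B'.exists_isLoop hV'
  rw [isLoopPair_iff]
  -- For `h = 2` all weights equal `h / 2` and do not separate; the parameters are `1`.
  by_cases h2 : W.h = 2
  · obtain ⟨e1, e2⟩ := isLoop_of_h_eq_two h2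
    obtain ⟨e3, e4⟩ := isLoop_of_h_eq_two (hh.trans h2)
    exact ⟨1, 1, 1, e1, e3, e2, e4⟩
  have h2' : W'.h ≠ 2 := hh ▸ h2
  refine ⟨k, l, m, hh ▸ h, h, ?_, L⟩
  have hc := fun i => coprime_of_p_eq_h (B.red.p_eq_h hV i)
  have hc' := fun i => coprime_of_p_eq_h (B'.red.p_eq_h hV' i)
  obtain ⟨σ, e0, e1, e2⟩ := L.exists_perm h
  have hT := isLoop_loop k m l (two_le_of_h_eq (hc' _) e0 h2') (two_le_of_h_eq (hc' _) e2 h2')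
    (two_le_of_h_eq (hc' _) e1 h2')
  have hTh : (loop k m l (two_le_of_h_eq (hc' _) e0 h2') (two_le_of_h_eq (hc' _) e2 h2')
    (two_le_of_h_eq (hc' _) e1 h2')).h = k * m * l + 1 := rfl
  generalize loop k m l (two_le_of_h_eq (hc' _) e0 h2') (two_le_of_h_eq (hc' _) e2 h2')
    (two_le_of_h_eq (hc' _) e1 h2') = T at hT hTh
  have hhT : W'.h = T.h := by rw [h, hTh, mul_right_comm]
  have hεT : W'.eps = T.eps := by
    rw [L.eps_eq h, hT.eps_eq hTh]
    ring
  have hgT : Int.gcd T.eps T.h = 1 := by rw [← hhT, ← hεT, hh, hε, hg]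
  -- A common divisor of the weights and `h` divides `ε`, which is coprime to `h`.
  have hTred : T.IsReduced := by
    have h3 : ((Nat.gcd (Finset.univ.gcd T.a) T.h : ℕ) : ℤ) ∣ Int.gcd T.eps T.h := by
      have h4 : ((Nat.gcd (Finset.univ.gcd T.a) T.h : ℕ) : ℤ) ∣ T.h :=
        Int.natCast_dvd_natCast.mpr (Nat.gcd_dvd_right _ _)
      refine Int.dvd_coe_gcd (dvd_sub (Finset.dvd_sum fun i hi => ?_) h4) h4
      exact Int.natCast_dvd_natCast.mpr ((Nat.gcd_dvd_left _ _).trans (Finset.gcd_dvd hi))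
    rw [hgT] at h3
    exact Nat.eq_one_of_dvd_one (by exact_mod_cast h3)
  have hTreg := hT.countRegular hTh
  have hTc := hT.coprime hTh hTred
  have hTsum := hT.sum_cyc hTh hTred
  have hTcyc := hTred.hasCyc_of_sum_eq_zero (fun i => p_eq_h_of_coprime (hTc i)) hTsum
  have h0 : T.spec 0 = 0 := by
    rw [hTreg.sum_cyc_eq] at hTsum
    have : (T.spec 0 : ℚ) = 0 := by linarith
    exact_mod_cast this
  obtain ⟨σ', τ', M', hM⟩ := hT.isTransposePair L (by rw [hTh, mul_right_comm]) h
  have hsT := (cycDual_of_hasCyc hTcyc (B'.hasCyc_of_eq hV'.1 hV'.2) hhT).spec_eq_dspec hTreg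
    B'.red B'.reg hhT hεT hgT h0 fun s _ hs => hM.repCount_eq hgT hs
  have hTW : T.h = W.h := hhT.symm.trans hh
  obtain ⟨ρ, hρ⟩ := exists_perm_of_spec_eq hTreg B.reg hTW.symm (hε.symm.trans hεT)
    (fun m => (hsT m).trans (hs m).symm) (fun i => two_mul_a_ne_h (hTc i) (hTW ▸ h2))
    (fun i => hTW ▸ two_mul_a_ne_h (hc i) h2)
  obtain ⟨υ, hυ⟩ := hT
  exact ⟨υ.trans ρ, fun i => by rw [Equiv.trans_apply, hρ, hυ]⟩

end WeightSystem

/-! ### The two implications -/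

namespace WeightSystem
open Polynomial

theorem IsSame.eps_eq {W W' : WeightSystem} (H : IsSame W' W) : W'.eps = W.eps := by
  obtain ⟨h, σ, hσ⟩ := H
  rw [eps, eps, h, ← Equiv.sum_comp σ]
  simp only [hσ]

theorem IsHalfHalfOne.eps_eq {W : WeightSystem} {i j k : Fin 3} (F : W.IsHalfHalfOne i j k) :
    W.eps = 1 := by
  have h1 := F.ai_eq
  have h2 := F.aj_eq
  have h3 := F.ak_eq
  rw [eps, sum_eq_of_ne F.hij F.hik F.hjk]
  omega

theorem IsHalfHalfOne.univ_eq {W : WeightSystem} {i j k : Fin 3} (F : W.IsHalfHalfOne i j k)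
    (l : Fin 3) : l = i ∨ l = j ∨ l = k := by
  have hij := F.hij
  have hik := F.hik
  have hjk := F.hjk
  clear F
  revert hij hik hjk
  revert i j k l
  decide

theorem IsHalfHalfOne.not_isTypeIII {W : WeightSystem} {i j k : Fin 3}
    (F : W.IsHalfHalfOne i j k) : ¬ W.IsTypeIII := by
  rintro ⟨σ, -, h1, h2⟩
  have h3 : ∀ l, W.p l = 2 ∨ W.p l = W.h := by
    intro l
    rcases F.univ_eq l with rfl | rfl | rfl
    · exact .inl F.pi_eq
    · exact .inl F.pj_eq
    · exact .inr F.pk_eq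
  have h4 : 2 ∣ W.h := ⟨_, F.ai_eq.symm⟩
  rcases h3 (σ 0) with e0 | e0 <;> rcases h3 (σ 1) with e1 | e1 <;> rw [e0, e1] at h1 h2
  · exact h1 dvd_rfl
  · exact h1 h4
  · exact h2 h4
  · exact h1 dvd_rfl

theorem IsTypeV.not_isTypeIII {W : WeightSystem} (h : W.IsTypeV) : ¬ W.IsTypeIII := by
  rintro ⟨σ, -, h1, -⟩
  exact h1 (h.p_eq (σ 0) (σ 1) ▸ dvd_rfl)

theorem IsHalfHalfOne.not_isTypeV {W : WeightSystem} {i j k : Fin 3}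
    (F : W.IsHalfHalfOne i j k) : ¬ W.IsTypeV := by
  intro h
  have h1 := h.p_eq i k
  rw [F.pi_eq, F.pk_eq] at h1
  exact F.hh h1.symm

theorem repCount_eq_zero {W : WeightSystem} (hε : 0 ≤ W.eps) {s : ℕ} (hs : s < W.h) :
    W.repCount s = 0 := by
  rw [repCount, Finset.card_eq_zero, Finset.filter_eq_empty_iff]
  rintro l - rfl
  have h1 := W.sum_a_eq
  have h2 : ∑ i, W.a i ≤ ∑ i, W.a i * (l i + 1) :=
    Finset.sum_le_sum fun i _ => Nat.le_mul_of_pos_right _ (Nat.succ_pos _)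
  zify at h2 hs
  linarith

/-- A moved variable of weight `h / 2` has residue `h / 2`, so two of them already give `h`. -/
theorem IsHalfHalfOne.ageCount_eq_zero {W : WeightSystem} {i j k : Fin 3}
    (F : W.IsHalfHalfOne i j k) {s : ℕ} (hs : s < W.h) : W.ageCount s = 0 := by
  rw [ageCount, Finset.card_eq_zero, Finset.filter_eq_empty_iff]
  rintro l - ⟨h1, h2⟩
  have key : ∀ x, 2 * W.a x = W.h → W.a x ≤ W.a x * l % W.h := by
    intro x hx
    have h3 := h1 x
    rw [← hx, mul_comm 2, Nat.mul_mod_mul_left] at h3 ⊢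
    exact Nat.le_mul_of_pos_right _ (Nat.pos_of_ne_zero fun h => h3 (by rw [h, mul_zero]))
  have e1 := key i F.ai_eq
  have e2 := key j F.aj_eq
  have e3 := F.ai_eq
  have e4 := F.aj_eq
  have h3 : W.a i * l % W.h + W.a j * l % W.h ≤ ∑ x, W.a x * l % W.h := by
    rw [← Finset.sum_pair (f := fun x => W.a x * l % W.h) F.hij]
    exact Finset.sum_le_sum_of_subset (Finset.subset_univ _)
  omega

theorem CycDual.isPDual {W W' : WeightSystem} (D : CycDual W' W) (hred : W.IsReduced)
    (hW : W.CountRegular) (hred' : W'.IsReduced) (hW' : W'.CountRegular) (hh : W'.h = W.h)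
    (hε : W'.eps = W.eps) (hg : Int.gcd W.eps W.h = 1) (h0 : W.spec 0 = 0)
    (h0' : W'.spec 0 = 0) (hc : ∀ s, s < W.h → W.repCount s = W'.ageCount s)
    (hc' : ∀ s, s < W.h → W'.repCount s = W.ageCount s) : IsPDual W' W := by
  rw [isPDual_iff hred hW hred' hW', specDual_iff hh hε, specDual_iff hh.symm hε.symm]
  refine ⟨⟨h0', D.spec_eq_dspec hW hred' hW' hh hε hg h0 fun s _ hs => hc s hs⟩, h0,
    (D.symm hh).spec_eq_dspec hW' hred hW hh.symm hε.symm (by rwa [hh, hε]) h0'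
      fun s _ hs => hc' s (by rwa [← hh])⟩

theorem CycDual.isPDual_of_isTransposePair {W W' : WeightSystem} (D : CycDual W' W)
    (hred : W.IsReduced) (hW : W.CountRegular) (hred' : W'.IsReduced) (hW' : W'.CountRegular)
    (hh : W'.h = W.h) (h0 : W.spec 0 = 0) (h0' : W'.spec 0 = 0) (T : IsTransposePair W W')
    (T' : IsTransposePair W' W) : IsPDual W' W := by
  obtain ⟨_, _, _, H⟩ := T
  obtain ⟨_, _, _, H'⟩ := T'
  exact D.isPDual hred hW hred' hW' hh H.eps_eq (H.gcd_eps_h hred hred') h0 h0'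
    (fun s hs => H.repCount_eq (H.gcd_eps_h hred hred') hs)
    fun s hs => H'.repCount_eq (H'.gcd_eps_h hred' hred) (by rwa [hh])

theorem IsDoubledA.isTypeIII {W : WeightSystem} {d : ℕ} (H : W.IsDoubledA d) : W.IsTypeIII := by
  obtain ⟨hh, hd, hd3, i, hi, hj⟩ := H
  obtain ⟨j, k, hji, hki, hjk, -⟩ := exists_compl_pair i
  obtain ⟨σ, rfl, rfl, rfl⟩ := exists_perm_of_ne hji.symm hki.symm hjk
  have p0 : W.p (σ 0) = d := by
    rw [p, hi, hh, Nat.gcd_mul_right_left]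
    omega
  have pd : ∀ x, x ≠ σ 0 → W.p x = 2 := by
    intro x hx
    rw [p, hj x hx, hh, Nat.gcd_mul_left_left, Nat.mul_div_cancel _ (by omega)]
  have hodd : ¬ 2 ∣ d := fun h => Nat.not_even_iff_odd.mpr hd (even_iff_two_dvd.mpr h)
  refine ⟨σ, by rw [pd _ hji, pd _ hki], ?_, ?_⟩
  · rw [p0, pd _ hji]
    exact fun h => absurd (Nat.le_of_dvd (by norm_num) h) (by omega)
  · rw [p0, pd _ hji]
    exact hodd

/-- The value dual to `cyc 1 = -1` is nonzero, so `h ∣ h'`; and `cyc` of `W'` is supported on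
divisors of `h`, so `prod_one_sub_eq` at `h` and at `h'` agree. The exception `(2, d, d; 2d)` is of
type III. -/
theorem CycDual.h_eq_or_isTypeIII {W W' : WeightSystem} (D : CycDual W' W) (hred : W.IsReduced)
    (hred' : W'.IsReduced) (hW' : W'.CountRegular) : W'.h = W.h ∨ W'.IsTypeIII := by
  have h1 : W.h ∣ W'.h := by
    by_contra h
    have h2 := D W.h
    rw [cyc_eq_zero_of_not_dvd h, if_pos dvd_rfl, Nat.div_self W.h_pos, hred.cyc_one] at h2
    norm_num at h2
  have h2 : ∏ i ∈ W'.fixed W.h, (1 - (W'.h : ℚ) / W'.a i) = ∏ i, (1 - (W'.h : ℚ) / W'.a i) := by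
    have e1 := W'.prod_one_sub_eq W.h
    have e2 := W'.prod_one_sub_eq W'.h
    rw [fixed_of_dvd dvd_rfl] at e2
    rw [← neg_inj, e1, e2]
    refine Finset.sum_congr rfl fun j hj => ?_
    rw [if_pos (Nat.dvd_of_mem_divisors hj)]
    split_ifs with h
    · rfl
    · rw [D j, if_neg h, mul_zero]
  exact (hW'.eq_h_or_isDoubledA hred' h1 h2).imp Eq.symm IsDoubledA.isTypeIII

theorem IsPDual.isMDual {W W' : WeightSystem} (hred : W.IsReduced) (hW : W.CountRegular)
    (hred' : W'.IsReduced) (hW' : W'.CountRegular) (H : IsPDual W' W) : IsMDual W' W := by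
  obtain ⟨S, S'⟩ := (isPDual_iff hred hW hred' hW').mp H
  obtain ⟨hh, hε⟩ := S.h_eq S' hred hW hred' hW'
  have hg := S.gcd_eps_h S' hred hW hred' hW'
  have D := S.cycDual S' hred hW hred' hW'
  obtain ⟨h0', hs⟩ := (specDual_iff hh hε).mp S
  obtain ⟨h0, hs'⟩ := (specDual_iff hh.symm hε.symm).mp S'
  have hnn : ∀ {W : WeightSystem}, W.IsReduced → W.CountRegular → ∀ m, 0 ≤ W.dspec m := by
    intro W hred hW m
    refine Finset.sum_nonneg fun k hk => ?_
    rw [Finset.mem_Ico] at hk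
    split_ifs
    · exact hW.sectorMult_nonneg hred (by omega) hk.2
    · exact le_rfl
  have B' := D.balanced hh hred hred' hW' h0'
  have B := (D.symm hh).balanced hh.symm hred' hred hW h0
  refine ⟨(isCharPolyDual_iff hred hW hred' hW').mpr ⟨fun m => hs m ▸ hnn hred' hW' m,
    fun m => hs' m ▸ hnn hred hW m, D⟩, ?_⟩
  -- Both families have the same `cyc` for given `h`, but `ε` is `1` for the first, and `1 - (k - 1)
  -- * (l - 1) * (m - 1) < 1` for a loop with `h ≠ 2`.
  have hmix : ∀ {W W' : WeightSystem} {i j k : Fin 3}, W'.Balanced → W.IsHalfHalfOne i j k →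
      W'.IsTypeV → W'.h = W.h → W'.eps = W.eps → False := by
    intro W W' i j k B' F hV hh hε
    obtain ⟨k, l, m, h, L⟩ := B'.exists_isLoop hV
    rw [L.eps_eq h, F.eps_eq] at hε
    have h1 : ((k : ℤ) - 1) * (l - 1) * (m - 1) = 0 := by linarith
    obtain ⟨σ, e0, e1, e2⟩ := L.exists_perm h
    have h2 : W'.h ≠ 2 := hh ▸ F.hh
    have hc := fun i => coprime_of_p_eq_h (B'.red.p_eq_h hV i)
    have g0 := two_le_of_h_eq (hc _) e0 h2
    have g1 := two_le_of_h_eq (hc _) e1 h2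
    have g2 := two_le_of_h_eq (hc _) e2 h2
    have h3 : 0 < ((k : ℤ) - 1) * (l - 1) * (m - 1) :=
      mul_pos (mul_pos (by omega) (by omega)) (by omega)
    omega
  rcases B.classify B' D hh fun _ => hε with ⟨-, -, h1, h2, h3⟩ |
    ⟨⟨i, j, k, F⟩ | hV, ⟨i', j', k', F'⟩ | hV'⟩
  · exact ⟨h1, fun h => absurd h (not_or.mpr ⟨h2, h3⟩)⟩
  · exact ⟨fun h => absurd h (not_or.mpr ⟨F.not_isTypeIII, F'.not_isTypeIII⟩),
      fun h => absurd h (not_or.mpr ⟨F.not_isTypeV, F'.not_isTypeV⟩)⟩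
  · exact (hmix B' F hV' hh hε).elim
  · exact (hmix B F' hV hh.symm hε.symm).elim
  · exact ⟨fun h => absurd h (not_or.mpr ⟨hV.not_isTypeIII, hV'.not_isTypeIII⟩),
      fun _ => ⟨hV, hV', B.isLoopPair B' hV hV' hh hε hg hs⟩⟩

theorem IsMDual.isPDual {W W' : WeightSystem} (hred : W.IsReduced) (hW : W.CountRegular)
    (hred' : W'.IsReduced) (hW' : W'.CountRegular) (H : IsMDual W' W) : IsPDual W' W := by
  obtain ⟨hC, h3, h5⟩ := H
  obtain ⟨hn, hn', D⟩ := (isCharPolyDual_iff hred hW hred' hW').mp hC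
  have hh : W'.h = W.h :=
    (D.h_eq_or_isTypeIII hred hred' hW').elim id fun h => (h3 (.inr h)).1
  -- The two multiplicities of the exponent `0` are opposite and nonnegative, hence zero.
  have hz := D.spec_zero hh hW hW'
  have h0 : W.spec 0 = 0 := by
    have := hn 0
    have := hn' 0
    omega
  have h0' : W'.spec 0 = 0 := by rw [hz, h0, neg_zero]
  have B' := D.balanced hh hred hred' hW' h0'
  have B := (D.symm hh).balanced hh.symm hred' hred hW h0
  by_cases hV : W.IsTypeV ∨ W'.IsTypeV
  · obtain ⟨T, T'⟩ := (h5 hV).2.2.isTransposePair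
    exact D.isPDual_of_isTransposePair hred hW hred' hW' hh h0 h0' T T'
  rw [not_or] at hV
  rcases B.classify B' D hh fun h => (h3 (.inl h)).eps_eq with ⟨T, T', -⟩ |
    ⟨⟨i, j, k, F⟩ | h, ⟨i', j', k', F'⟩ | h'⟩
  · exact D.isPDual_of_isTransposePair hred hW hred' hW' hh h0 h0' T T'
  · have hε : W'.eps = W.eps := by rw [F.eps_eq, F'.eps_eq]
    refine D.isPDual hred hW hred' hW' hh hε (by rw [F.eps_eq, Int.one_gcd]) h0 h0'
      (fun s hs => ?_) fun s hs => ?_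
    · rw [repCount_eq_zero (by rw [F.eps_eq]; norm_num) hs, F'.ageCount_eq_zero (by rwa [hh])]
    · rw [repCount_eq_zero (by rw [F'.eps_eq]; norm_num) (by rwa [hh]), F.ageCount_eq_zero hs]
  · exact absurd h' hV.2
  · exact absurd h hV.1
  · exact absurd h hV.1

end WeightSystem

theorem theorem3p1 (W W' : WeightSystem)
    (hW : W.IsReduced) (hW_reg : W.IsRegular)
    (hW' : W'.IsReduced) (hW'_reg : W'.IsRegular) :
    WeightSystem.IsPDual W' W ↔ WeightSystem.IsMDual W' W :=
  ⟨WeightSystem.IsPDual.isMDual hW hW_reg.countRegular hW' hW'_reg.countRegular,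
    WeightSystem.IsMDual.isPDual hW hW_reg.countRegular hW' hW'_reg.countRegular⟩
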